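/- Conventions. Let $Y$ be a compact Kähler manifold of dimension $k$. A submanifold $V\subset Y$ is a closed complex submanifold (of pure dimension), and $[V]$ is its current of integration. For $m\ge 2$ let $\Delta_m=\{(y,\dots,y)\}\subset Y^m$ be the diagonal and $\pi_m:E_m\to\Delta_m$ its normal bundle in $Y^m$, identified with $(TY)^{\oplus (m-1)}$ via $(v_1,\dots,v_m)\mapsto (v_2-v_1,\dots,v_m-v_1)$; for $\lambda\in\mathbb C^*$ let $A_\lambda:E_m\to E_m$ be the multiplication by $\lambda$ on fibres. An admissible map is a smooth diffeomorphism $\tau$ from an open neighbourhood of $\Delta_m$ in $Y^m$ onto an open neighbourhood of the zero section of $E_m$ that is the identity on $\Delta_m$ and whose differential along $\Delta_m$ induces the identity on the normal bundle $E_m$. A density current associated to currents $T_1,\dots,T_m$ on $Y$ is a current $R$ on $E_m$ for which there are an admissible map $\tau$ and a sequence $\lambda_n\in\mathbb C^*$, $|\lambda_n|\to\infty$, with $(A_{\lambda_n})_*\tau_*(T_1\otimes\cdots\otimes T_m)\to R$ weakly on $E_m$. The Dinh–Sibony product $T_1\curlywedge\cdots\curlywedge T_m$ is well-defined and equal to $S$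 if there is exactly one density current associated to $T_1,\dots,T_m$ and it is $\pi_m^*S$; in particular, $T_1\curlywedge\cdots\curlywedge T_m=0$ means that there is exactly one density current associated to $T_1,\dots,T_m$, and it is $0$. **Lemma.** Let $Y$ be a compact Kähler manifold of dimension $k$, let $T$ be a positive closed current on $Y$ of bidimension $(q,q)$, and let $V_1,V_2\subset Y$ be closed complex submanifolds of dimensions $\ell_1,\ell_2$ that are transverse, i.e. $T_xV_1+T_xV_2=T_xY$ for all $x\in V_1\cap V_2$. If $$T\curlywedge[V_1]\curlywedge[V_2]=0,$$ then $V_1\cap V_2$ is a closed complex submanifold of $Y$ (empty, or of dimension $\ell_1+\ell_2-k$), and $$T\curlywedge[V_1\cap V_2]=0.$$ -/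

import Mathlib

open Set Filter Topology MeasureTheory Bundle
open scoped Manifold ContDiff

noncomputable section

/-! ## Differential forms and currents on smooth manifolds without boundary -/

section Forms

variable {E : Type*} [NormedAddCommGroup E] [NormedSpace ℝ E]
  {H : Type*} [TopologicalSpace H] (I : ModelWithCorners ℝ E H)
  (M : Type*) [TopologicalSpace M] [ChartedSpace H M]

/-- Complex-valued differential forms of degree `n` on `M`, with no regularity. -/
abbrev DForm (n : ℕ) : Type _ := ∀ x : M, TangentSpace I x [⋀^Fin n]→L[ℝ] ℂ

variable {I M}

/-- The expression of a form in the preferred chart at `x₀`, i.e. its pull-back by the inverse of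
that chart. It is meaningful on the target of the chart. -/
def localForm {n : ℕ} (φ : DForm I M n) (x₀ : M) : E → E [⋀^Fin n]→L[ℝ] ℂ := fun z =>
  (φ ((extChartAt I x₀).symm z)).compContinuousLinearMap
    (mfderiv 𝓘(ℝ, E) I (extChartAt I x₀).symm z)

/-- Smoothness of a form: all its local expressions are smooth. -/
def SmoothForm {n : ℕ} (φ : DForm I M n) : Prop :=
  ∀ x₀ : M, ContDiffOn ℝ ∞ (localForm φ x₀) (extChartAt I x₀).target

/-- The exterior derivative, computed at `x` in the preferred chart at `x`. -/
def extDer {n : ℕ} (φ : DForm I M n) : DForm I M (n + 1) := fun x =>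
  (extDeriv (localForm φ x) (extChartAt I x x)).compContinuousLinearMap
    (mfderiv I 𝓘(ℝ, E) (extChartAt I x) x)

variable (I M) in
/-- The space of test forms: smooth forms with compact support. -/
def testForms (n : ℕ) : Submodule ℂ (DForm I M n) where
  carrier := {φ | SmoothForm φ ∧ IsCompact (closure {x | φ x ≠ 0})}
  zero_mem' := by
    refine ⟨fun x₀ => ?_, by simp⟩
    have : localForm (0 : DForm I M n) x₀ = fun _ => 0 := by
      funext z; ext v; rfl
    rw [this]; exact contDiffOn_const
  add_mem' := by
    rintro φ ψ ⟨h₁, k₁⟩ ⟨h₂, k₂⟩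
    refine ⟨fun x₀ => ?_, (k₁.union k₂).of_isClosed_subset isClosed_closure ?_⟩
    · have : localForm (φ + ψ) x₀ = fun z => localForm φ x₀ z + localForm ψ x₀ z := by
        funext z; ext v; rfl
      rw [this]; exact (h₁ x₀).add (h₂ x₀)
    · rw [← closure_union]
      refine closure_mono fun x hx => ?_
      by_contra hcon
      simp only [mem_union, mem_ofPred_eq, not_or, not_not] at hcon
      exact hx (by simp [hcon.1, hcon.2])
  smul_mem' := by
    rintro c φ ⟨h, k⟩
    refine ⟨fun x₀ => ?_, k.of_isClosed_subset isClosed_closure ?_⟩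
    · have : localForm (c • φ) x₀ = fun z => c • localForm φ x₀ z := by
        funext z; ext v; rfl
      rw [this]; exact (h x₀).const_smul c
    · refine closure_mono fun x hx hcon => hx ?_
      simp [hcon]

/-- Convergence to zero in the space of test forms: the supports lie in a common compact set, and
in every preferred chart all derivatives tend to zero uniformly on compact sets. -/
def TendsToZero {n : ℕ} (φ : ℕ → DForm I M n) : Prop :=
  (∃ K : Set M, IsCompact K ∧ ∀ i x, φ i x ≠ 0 → x ∈ K) ∧
  ∀ (x₀ : M) (L : Set E), IsCompact L → L ⊆ (extChartAt I x₀).target → ∀ j : ℕ,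
    TendstoUniformlyOn (fun i z => iteratedFDeriv ℝ j (localForm (φ i) x₀) z)
      (fun _ => 0) atTop L

variable (I M) in
/-- Currents of dimension `n`: (sequentially) continuous linear functionals on test forms of
degree `n`. -/
structure Current (n : ℕ) where
  toLinearMap : testForms I M n →ₗ[ℂ] ℂ
  continuous' : ∀ φ : ℕ → testForms I M n, TendsToZero (fun i => (φ i : DForm I M n)) →
    Tendsto (fun i => toLinearMap (φ i)) atTop (𝓝 0)

instance (n : ℕ) : Zero (Current I M n) := ⟨⟨0, by intro φ _; simp⟩⟩

open Classical in
/-- The value of a current on a form (zero by convention if the form is not a test form). -/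
def Current.eval {n : ℕ} (T : Current I M n) (φ : DForm I M n) : ℂ :=
  if h : φ ∈ testForms I M n then T.toLinearMap ⟨φ, h⟩ else 0

/-- `d T = 0`: the current vanishes on the differentials of test forms. -/
def Current.IsClosed {n : ℕ} (T : Current I M n) : Prop :=
  ∀ (m : ℕ) (h : m + 1 = n), ∀ ψ ∈ testForms I M m, ∀ φ : DForm I M n,
    (∀ x v, φ x v = extDer ψ x (fun i => v (Fin.cast h i))) → T.eval φ = 0

end Forms

/-! ## Tensor products of currents -/

section Tensor

variable {E : Type*} [NormedAddCommGroup E] [NormedSpace ℝ E]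
  {H : Type*} [TopologicalSpace H] {I : ModelWithCorners ℝ E H}
  {M : Type*} [TopologicalSpace M] [ChartedSpace H M]
  {F : Type*} [NormedAddCommGroup F] [NormedSpace ℝ F]
  {G : Type*} [TopologicalSpace G] {J : ModelWithCorners ℝ F G}
  {N : Type*} [TopologicalSpace N] [ChartedSpace G N]

lemma append_update_aux {α β : Type*} [Zero α] [Zero β] {a b : ℕ} [DecidableEq (Fin b)]
    (u : Fin a → α) (v : Fin b → β) (j : Fin b) (x : β) :
    (Fin.append (fun i => (u i, (0 : β)))
        (fun i => ((0 : α), Function.update v j x i)) : Fin (a + b) → α × β) =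
      Function.update (Fin.append (fun i => (u i, (0 : β))) (fun i => ((0 : α), v i)))
        (Fin.natAdd a j) (0, x) := by
  funext t
  refine Fin.addCases (fun i => ?_) (fun i => ?_) t
  · have : Fin.castAdd b i ≠ Fin.natAdd a j := by
      intro h
      have := congrArg Fin.val h
      simp at this
      omega
    simp [Function.update_of_ne this]
  · by_cases h : i = j
    · subst h; simp
    · have h2 : Fin.natAdd a i ≠ Fin.natAdd a j := by
        intro h3; exact h (by simpa using h3)
      simp [Function.update_of_ne h2, Function.update_of_ne h]

/-- The alternating form `v ↦ A ((u₁,0), …, (u_a,0), (0,v₁), …, (0,v_b))` on `F`. -/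
def partialForm {a b : ℕ} (A : (E × F) [⋀^Fin (a + b)]→L[ℝ] ℂ) (u : Fin a → E) :
    F [⋀^Fin b]→L[ℝ] ℂ where
  toFun v := A (Fin.append (fun i => (u i, (0 : F))) (fun j => ((0 : E), v j)))
  map_update_add' := by
    intro _ v j x y
    have h : ((0 : E), x + y) = (0, x) + (0, y) := by simp
    simp only [append_update_aux, h]
    classical
    convert A.map_update_add _ _ _ _
  map_update_smul' := by
    intro _ v j c x
    have h : ((0 : E), c • x) = c • ((0 : E), x) := by simp
    simp only [append_update_aux, h]
    classical
    convert A.map_update_smul _ _ _ _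
  map_eq_zero_of_eq' := by
    intro v i j hv hij
    refine A.map_eq_zero_of_eq _ (i := Fin.natAdd a i) (j := Fin.natAdd a j) ?_ ?_
    · simp [hv]
    · intro h; exact hij (by simpa using h)
  cont := by
    refine A.cont.comp (continuous_pi fun t => ?_)
    refine Fin.addCases (fun i => ?_) (fun i => ?_) t
    · simp only [Fin.append_left]; exact continuous_const
    · simp only [Fin.append_right]
      exact continuous_const.prodMk (continuous_apply i)

/-- For a form `Φ` on `M × N`, a point `x` of `M` and tangent vectors `u₁, …, u_a` at `x`, the
`b`-form `y ↦ Φ (x,y) ((u₁,0), …, (u_a,0), (0,·), …, (0,·))` on `N`. -/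
def sliceForm {a b : ℕ} (Φ : DForm (I.prod J) (M × N) (a + b)) (x : M)
    (u : Fin a → TangentSpace I x) : DForm J N b := fun y =>
  partialForm (E := E) (F := F) (Φ (x, y)) u

/-- The partial pairing `x ↦ ⟨S(y), Φ(x,y)⟩`, an `a`-form on `M`: its value at `x` is the
alternating form sending `(u₁, …, u_a)` to the value of `S` on the corresponding slice of `Φ`
(such an alternating form exists, and is unique, when `S` is linear on test forms and `Φ` is a test
form). -/
def partialPairing {a b : ℕ} (S : DForm J N b → ℂ) (Φ : DForm (I.prod J) (M × N) (a + b)) :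
    DForm I M a := fun x =>
  Classical.epsilon fun A : TangentSpace I x [⋀^Fin a]→L[ℝ] ℂ =>
    ∀ u : Fin a → TangentSpace I x, A u = S (sliceForm Φ x u)

/-- The tensor product `⟨R ⊗ S, Φ⟩ = ⟨R(x), ⟨S(y), Φ(x,y)⟩⟩`. In the cases of interest the
dimensions of the currents are even, and no sign enters. -/
def tensor {a b : ℕ} (R : DForm I M a → ℂ) (S : DForm J N b → ℂ) :
    DForm (I.prod J) (M × N) (a + b) → ℂ := fun Φ => R (partialPairing S Φ)

end Tensor

/-! ## Complex manifolds -/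

/-- The model space `ℂᵏ`. -/
abbrev Cn (k : ℕ) : Type := Fin k → ℂ

/-- A complex manifold is a real analytic manifold. -/
instance isManifold_real_of_complex {k : ℕ} {Y : Type*} [TopologicalSpace Y]
    [ChartedSpace (Cn k) Y] [h : IsManifold 𝓘(ℂ, Cn k) ω Y] : IsManifold 𝓘(ℝ, Cn k) ω Y := by
  refine isManifold_of_contDiffOn _ _ _ fun e e' he he' => ?_
  have h1 := h.compatible he he'
  have h2 := (contDiffGroupoid ω 𝓘(ℂ, Cn k)).compatible he he'
  rw [contDiffGroupoid, mem_groupoid_of_pregroupoid] at h2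
  exact h2.1.restrict_scalars ℝ

/-- The complex vector space structure of the tangent spaces of a complex manifold (the
differentials of holomorphic changes of charts are complex linear). -/
instance complexModuleTangentSpace {k : ℕ} {Y : Type*} [TopologicalSpace Y]
    [ChartedSpace (Cn k) Y] (x : Y) : Module ℂ (TangentSpace 𝓘(ℝ, Cn k) x) :=
  inferInstanceAs (Module ℂ (Cn k))

section Complex

variable {k : ℕ} {Y : Type*} [TopologicalSpace Y] [ChartedSpace (Cn k) Y]

/-- Existence of a Kähler form on `Y`: a smooth closed real form of type `(1,1)` that is
positive definite. -/
def IsKahler (k : ℕ) (Y : Type*) [TopologicalSpace Y] [ChartedSpace (Cn k) Y] : Prop :=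
  ∃ κ : DForm 𝓘(ℝ, Cn k) Y 2, SmoothForm κ ∧ (∀ x, extDer κ x = 0) ∧
    (∀ x v, (κ x v).im = 0) ∧
    (∀ x (u v : TangentSpace 𝓘(ℝ, Cn k) x),
      κ x ![Complex.I • u, Complex.I • v] = κ x ![u, v]) ∧
    ∀ x (u : TangentSpace 𝓘(ℝ, Cn k) x), u ≠ 0 → 0 < (κ x ![u, Complex.I • u]).re

/-- Forms of type `(r,s)`, among the forms of degree `n = r + s`. -/
def HasType {n : ℕ} (φ : DForm 𝓘(ℝ, Cn k) Y n) (r s : ℕ) : Prop :=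
  ∀ (x : Y) (c : ℂ) (v : Fin n → TangentSpace 𝓘(ℝ, Cn k) x),
    φ x (fun i => c • v i) = c ^ r * (starRingEnd ℂ c) ^ s * φ x v

/-- The value at `v` of `(i α₁ ∧ ᾱ₁) ∧ … ∧ (i α_q ∧ ᾱ_q)`, where the `α_j` are complex linear. -/
def decomposablePositive {q : ℕ} {x : Y} (α : Fin q → TangentSpace 𝓘(ℝ, Cn k) x →ₗ[ℂ] ℂ)
    (v : Fin (2 * q) → TangentSpace 𝓘(ℝ, Cn k) x) : ℂ :=
  Complex.I ^ q * Matrix.det (Matrix.of fun a b : Fin (2 * q) =>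
    if a.val % 2 = 0 then α ⟨a.val / 2, by omega⟩ (v b)
    else starRingEnd ℂ (α ⟨a.val / 2, by omega⟩ (v b)))

/-- Strongly positive `(q,q)`-forms: at every point, a combination with non-negative coefficients
of forms `(i α₁ ∧ ᾱ₁) ∧ … ∧ (i α_q ∧ ᾱ_q)`. -/
def StronglyPositive {q : ℕ} (φ : DForm 𝓘(ℝ, Cn k) Y (2 * q)) : Prop :=
  ∀ x : Y, ∃ (N : ℕ) (c : Fin N → ℝ)
    (α : Fin N → Fin q → TangentSpace 𝓘(ℝ, Cn k) x →ₗ[ℂ] ℂ),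
    (∀ s, 0 ≤ c s) ∧ ∀ v, φ x v = ∑ s, (c s : ℂ) * decomposablePositive (α s) v

/-- Positive currents of bidimension `(q,q)`: they vanish on forms of type `(r,s) ≠ (q,q)` and
are non-negative on strongly positive test forms. -/
structure Current.IsPositive {q : ℕ} (T : Current 𝓘(ℝ, Cn k) Y (2 * q)) : Prop where
  bidimension : ∀ r s : ℕ, r + s = 2 * q → r ≠ q → ∀ φ ∈ testForms 𝓘(ℝ, Cn k) Y (2 * q),
    HasType φ r s → T.eval φ = 0
  nonneg : ∀ φ ∈ testForms 𝓘(ℝ, Cn k) Y (2 * q), StronglyPositive φ →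
    0 ≤ (T.eval φ).re ∧ (T.eval φ).im = 0

/-! ## Complex submanifolds and their currents of integration -/

/-- A holomorphic chart in which `V` is the slice `{z : z_j = 0 for j ≥ ℓ}`. -/
structure IsSliceChart (V : Set Y) (ℓ : ℕ) (e : OpenPartialHomeomorph Y (Cn k)) : Prop where
  mem_maximalAtlas : e ∈ IsManifold.maximalAtlas 𝓘(ℂ, Cn k) ω Y
  mem_iff : ∀ x ∈ e.source, x ∈ V ↔ ∀ j : Fin k, ℓ ≤ j.val → e x j = 0

variable (k) in
/-- `V` is a closed complex submanifold of `Y` of dimension `ℓ`. -/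
structure IsComplexSubmanifold (V : Set Y) (ℓ : ℕ) : Prop where
  isClosed : IsClosed V
  dim_le : ℓ ≤ k
  exists_chart : ∀ x ∈ V, ∃ e : OpenPartialHomeomorph Y (Cn k), x ∈ e.source ∧ IsSliceChart V ℓ e

/-- `v` is tangent at `x` to the submanifold that is the slice `{z_j = 0 for j ≥ ℓ}` in the
chart `e`. -/
def TangentIn (ℓ : ℕ) (e : OpenPartialHomeomorph Y (Cn k)) (x : Y)
    (v : TangentSpace 𝓘(ℝ, Cn k) x) : Prop :=
  ∀ j : Fin k, ℓ ≤ j.val → (mfderiv 𝓘(ℝ, Cn k) 𝓘(ℝ, Cn k) e x v : Cn k) j = 0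

/-- Transversality: `T_x V₁ + T_x V₂ = T_x Y` for all `x ∈ V₁ ∩ V₂`. -/
def Transverse (k : ℕ) {Y : Type*} [TopologicalSpace Y] [ChartedSpace (Cn k) Y] (V₁ : Set Y) (ℓ₁ : ℕ) (V₂ : Set Y) (ℓ₂ : ℕ) : Prop :=
  ∀ x ∈ V₁ ∩ V₂, ∀ e₁ e₂ : OpenPartialHomeomorph Y (Cn k),
    IsSliceChart V₁ ℓ₁ e₁ → x ∈ e₁.source → IsSliceChart V₂ ℓ₂ e₂ → x ∈ e₂.source →
    ∀ w : TangentSpace 𝓘(ℝ, Cn k) x, ∃ v₁ v₂ : TangentSpace 𝓘(ℝ, Cn k) x,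
      TangentIn ℓ₁ e₁ x v₁ ∧ TangentIn ℓ₂ e₂ x v₂ ∧ w = v₁ + v₂

/-- The inclusion `ℂ^ℓ → ℂ^k` of the first `ℓ` coordinates (for `ℓ ≤ k`). -/
def sliceIncl (ℓ k : ℕ) (w : Cn ℓ) : Cn k := fun j => if h : j.val < ℓ then w ⟨j.val, h⟩ else 0

/-- The real basis `(e₁, i e₁, …, e_ℓ, i e_ℓ)` of `ℂ^ℓ`, which is positively oriented. -/
def realFrame (ℓ : ℕ) (a : Fin (2 * ℓ)) : Cn ℓ :=
  Pi.single ⟨a.val / 2, by omega⟩ (if a.val % 2 = 0 then 1 else Complex.I)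

/-- The integral over `{z_j = 0 for j ≥ ℓ}`, in the chart `e`, of the product `χ φ`, where `χ` is a
function supported in the source of `e`. -/
def chartIntegral (ℓ : ℕ) (e : OpenPartialHomeomorph Y (Cn k)) (χ : Y → ℝ)
    (φ : DForm 𝓘(ℝ, Cn k) Y (2 * ℓ)) : ℂ :=
  ∫ w in {w : Cn ℓ | sliceIncl ℓ k w ∈ e.target},
    (χ (e.symm (sliceIncl ℓ k w)) : ℂ) *
      φ (e.symm (sliceIncl ℓ k w)) (fun a =>
        mfderiv 𝓘(ℝ, Cn ℓ) 𝓘(ℝ, Cn k) (fun w' => e.symm (sliceIncl ℓ k w')) w (realFrame ℓ a))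

lemma IsComplexSubmanifold.exists_partition [IsManifold 𝓘(ℂ, Cn k) ω Y] [T2Space Y]
    [CompactSpace Y] {V : Set Y} {ℓ : ℕ} (hV : IsComplexSubmanifold k V ℓ) :
    ∃ ρ : SmoothPartitionOfUnity V 𝓘(ℝ, Cn k) Y V,
      ρ.IsSubordinate fun p => (hV.exists_chart p.1 p.2).choose.source := by
  refine SmoothPartitionOfUnity.exists_isSubordinate _ hV.isClosed _
    (fun p => (hV.exists_chart p.1 p.2).choose.open_source) fun x hx => ?_
  exact mem_iUnion_of_mem ⟨x, hx⟩ (hV.exists_chart x hx).choose_spec.1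

/-- The current of integration `[V]`, `φ ↦ ∫_V φ`, defined by means of slice charts and of a
subordinate smooth partition of unity (the result does not depend on these choices). -/
def integrationCurrent [IsManifold 𝓘(ℂ, Cn k) ω Y] [T2Space Y] [CompactSpace Y]
    {V : Set Y} {ℓ : ℕ} (hV : IsComplexSubmanifold k V ℓ) : DForm 𝓘(ℝ, Cn k) Y (2 * ℓ) → ℂ :=
  fun φ => ∑ᶠ p : V, chartIntegral ℓ (hV.exists_chart p.1 p.2).choose
    (hV.exists_partition.choose p) φ

end Complex

/-! ## Tangent currents -/

section TangentCurrents

variable {EY : Type*} [NormedAddCommGroup EY] [NormedSpace ℝ EY]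
  {HY : Type*} [TopologicalSpace HY] {IY : ModelWithCorners ℝ EY HY}
  {Y : Type*} [TopologicalSpace Y] [ChartedSpace HY Y]
  {EX : Type*} [NormedAddCommGroup EX] [NormedSpace ℝ EX]
  {HX : Type*} [TopologicalSpace HX] {IX : ModelWithCorners ℝ EX HX}
  {X : Type*} [TopologicalSpace X] [ChartedSpace HX X]
  (F : Type*) [NormedAddCommGroup F] [NormedSpace ℝ F] {Z : Y → Type*}
  [TopologicalSpace (TotalSpace F Z)] [∀ y, TopologicalSpace (Z y)] [FiberBundle F Z]
  [∀ y, AddCommGroup (Z y)] [∀ y, Module ℝ (Z y)] [∀ y, Module ℂ (Z y)]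

/-- The dilation `A_λ` of the total space of a vector bundle: multiplication by `λ` on fibres. -/
def dilation (c : ℂ) (p : TotalSpace F Z) : TotalSpace F Z := ⟨p.proj, c • p.snd⟩

variable (IY) in
/-- The image of `u ∈ T_y Y` under the differential of the zero section. -/
def horizontalVector (y : Y) (u : TangentSpace IY y) : EY × F :=
  mfderiv IY (IY.prod 𝓘(ℝ, F)) (fun y' => (⟨y', 0⟩ : TotalSpace F Z)) y u

variable (IY) in
/-- The vertical tangent vector at the zero of the fibre `Z_y` that corresponds to `z ∈ Z_y`: the
velocity at `t = 0` of the curve `t ↦ t • z`. -/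
def verticalVector (y : Y) (z : Z y) : EY × F :=
  mfderiv 𝓘(ℝ, ℝ) (IY.prod 𝓘(ℝ, F)) (fun t : ℝ => (⟨y, t • z⟩ : TotalSpace F Z)) 0 (1 : ℝ)

/-- Admissible maps. Here `δ : Y → X` is an embedding and `quot y : T_{δ y} X → Z_y` is surjective
with kernel `dδ (T_y Y)`, so that `Z` is identified with the normal bundle of `δ(Y)` in `X`.
An admissible map is a smooth diffeomorphism `τ` from an open neighbourhood of `δ(Y)` onto an open
neighbourhood of the zero section of `Z`, which is the identity on `Y` and whose differential
along `Y` induces the identity on the normal bundle: `dτ(w)` and the vertical vector `quot y w`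
differ by a vector tangent to the zero section. -/
structure IsAdmissible (δ : Y → X) (quot : ∀ y, TangentSpace IX (δ y) → Z y)
    (τ : PartialDiffeomorph IX (IY.prod 𝓘(ℝ, F)) X (TotalSpace F Z) ∞) : Prop where
  mem_source : ∀ y, δ y ∈ τ.source
  map_base : ∀ y, τ (δ y) = ⟨y, 0⟩
  deriv_normal : ∀ y (w : TangentSpace IX (δ y)), ∃ u : TangentSpace IY y,
    mfderiv IX (IY.prod 𝓘(ℝ, F)) τ (δ y) w =
      horizontalVector IY F (Z := Z) y u + verticalVector IY F y (quot y w)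

open Classical in
/-- The form `τ^* A_λ^* Φ` on `X`, extended by zero outside the domain of `τ`, so that
`⟨(A_λ)_* τ_* T, Φ⟩ = ⟨T, τ^* A_λ^* Φ⟩`. If the support of `Φ` is compact, then for `|λ|` large this
is a smooth form whose support is a compact subset of the domain of `τ`. -/
def dilatedPullback {n : ℕ} (τ : PartialDiffeomorph IX (IY.prod 𝓘(ℝ, F)) X (TotalSpace F Z) ∞)
    (c : ℂ) (Φ : DForm (IY.prod 𝓘(ℝ, F)) (TotalSpace F Z) n) : DForm IX X n := fun x =>
  if x ∈ τ.source then
    (Φ (dilation F c (τ x))).compContinuousLinearMap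
      (mfderiv IX (IY.prod 𝓘(ℝ, F)) (fun x' => dilation F c (τ x')) x)
  else 0

/-- `R` is a tangent current to `T` along `δ(Y)`: a weak limit of `(A_{λ_i})_* τ_* T` on the normal
bundle, for some admissible map `τ` and some sequence `λ_i → ∞` in `ℂ^*`. -/
def IsTangentCurrent {n : ℕ} (δ : Y → X) (quot : ∀ y, TangentSpace IX (δ y) → Z y)
    (T : DForm IX X n → ℂ) (R : Current (IY.prod 𝓘(ℝ, F)) (TotalSpace F Z) n) : Prop :=
  ∃ τ : PartialDiffeomorph IX (IY.prod 𝓘(ℝ, F)) X (TotalSpace F Z) ∞,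
    IsAdmissible F δ quot τ ∧ ∃ c : ℕ → ℂ, (∀ i, c i ≠ 0) ∧
      Tendsto (fun i => ‖c i‖) atTop atTop ∧
      ∀ Φ ∈ testForms (IY.prod 𝓘(ℝ, F)) (TotalSpace F Z) n,
        Tendsto (fun i => T (dilatedPullback F τ (c i) Φ)) atTop (𝓝 (R.eval Φ))

end TangentCurrents

/-! ## Density currents and vanishing of the Dinh-Sibony product -/

section Density

variable {k : ℕ} {Y : Type*} [TopologicalSpace Y] [ChartedSpace (Cn k) Y]
  [IsManifold 𝓘(ℂ, Cn k) ω Y]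

/-- Density currents associated to two currents on `Y`: tangent currents to `T₁ ⊗ T₂` along the
diagonal of `Y²`. The normal bundle of the diagonal is identified with `TY` through
`(v₁, v₂) ↦ v₂ - v₁`. -/
def IsDensityCurrent₂ {a b : ℕ} (T₁ : DForm 𝓘(ℝ, Cn k) Y a → ℂ) (T₂ : DForm 𝓘(ℝ, Cn k) Y b → ℂ)
    (R : Current (𝓘(ℝ, Cn k).prod 𝓘(ℝ, Cn k))
      (TotalSpace (Cn k) (TangentSpace 𝓘(ℝ, Cn k) : Y → Type)) (a + b)) : Prop :=
  IsTangentCurrent (IX := 𝓘(ℝ, Cn k).prod 𝓘(ℝ, Cn k)) (X := Y × Y)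
    (Z := (TangentSpace 𝓘(ℝ, Cn k) : Y → Type)) (Cn k)
    (fun y => (y, y))
    (fun y (w : Cn k × Cn k) => (w.2 - w.1 : TangentSpace 𝓘(ℝ, Cn k) y))
    (tensor T₁ T₂) R

/-- Density currents associated to three currents on `Y`: tangent currents to `T₁ ⊗ T₂ ⊗ T₃` along
the diagonal of `Y³`. The normal bundle of the diagonal is identified with `TY ⊕ TY` through
`(v₁, v₂, v₃) ↦ (v₂ - v₁, v₃ - v₁)`. -/
def IsDensityCurrent₃ {a b c : ℕ} (T₁ : DForm 𝓘(ℝ, Cn k) Y a → ℂ)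
    (T₂ : DForm 𝓘(ℝ, Cn k) Y b → ℂ) (T₃ : DForm 𝓘(ℝ, Cn k) Y c → ℂ)
    (R : Current (𝓘(ℝ, Cn k).prod 𝓘(ℝ, Cn k × Cn k))
      (TotalSpace (Cn k × Cn k) ((TangentSpace 𝓘(ℝ, Cn k) : Y → Type) ×ᵇ
        (TangentSpace 𝓘(ℝ, Cn k) : Y → Type))) (a + (b + c))) : Prop :=
  IsTangentCurrent (IX := 𝓘(ℝ, Cn k).prod (𝓘(ℝ, Cn k).prod 𝓘(ℝ, Cn k))) (X := Y × (Y × Y))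
    (Z := (TangentSpace 𝓘(ℝ, Cn k) : Y → Type) ×ᵇ (TangentSpace 𝓘(ℝ, Cn k) : Y → Type))
    (Cn k × Cn k)
    (fun y => (y, (y, y)))
    (fun y (w : Cn k × (Cn k × Cn k)) =>
      ((w.2.1 - w.1, w.2.2 - w.1) :
        TangentSpace 𝓘(ℝ, Cn k) y × TangentSpace 𝓘(ℝ, Cn k) y))
    (tensor T₁ (tensor T₂ T₃)) R

/-- The product of `T₁` and `T₂` is well-defined and equal to zero: there is one and only one
density current associated to `T₁, T₂`, and it is the pull-back of the zero current on the
diagonal, that is, zero. -/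
def DSProductEqZero₂ {a b : ℕ} (T₁ : DForm 𝓘(ℝ, Cn k) Y a → ℂ)
    (T₂ : DForm 𝓘(ℝ, Cn k) Y b → ℂ) : Prop :=
  ∀ R, IsDensityCurrent₂ T₁ T₂ R ↔ R = 0

/-- The product of `T₁`, `T₂` and `T₃` is well-defined and equal to zero: there is one and only one
density current associated to `T₁, T₂, T₃`, and it is the pull-back of the zero current on the
diagonal, that is, zero. -/
def DSProductEqZero₃ {a b c : ℕ} (T₁ : DForm 𝓘(ℝ, Cn k) Y a → ℂ)
    (T₂ : DForm 𝓘(ℝ, Cn k) Y b → ℂ) (T₃ : DForm 𝓘(ℝ, Cn k) Y c → ℂ) : Prop :=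
  ∀ R, IsDensityCurrent₃ T₁ T₂ T₃ R ↔ R = 0

end Density

end

set_option linter.unusedSectionVars false

noncomputable section

/-! ## Test functions on vector spaces -/

section TestFunctions

variable {E : Type*} [NormedAddCommGroup E] [NormedSpace ℝ E]
  {E' : Type*} [NormedAddCommGroup E'] [NormedSpace ℝ E']
  {V : Type*} [NormedAddCommGroup V] [NormedSpace ℝ V]
  {V' : Type*} [NormedAddCommGroup V'] [NormedSpace ℝ V']

/-- Smooth functions vanishing outside `K`. -/
structure IsTest (K : Set E) (f : E → V) : Prop where
  smooth : ContDiff ℝ ∞ f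
  eq_zero : ∀ x, x ∉ K → f x = 0

/-- Sequences of smooth functions vanishing outside `K`, all of whose derivatives tend uniformly
to zero. -/
structure NullSeq (K : Set E) (f : ℕ → E → V) : Prop where
  test : ∀ᶠ i in atTop, IsTest K (f i)
  small : ∀ (j : ℕ) (ε : ℝ), 0 < ε → ∀ᶠ i in atTop, ∀ x, ‖iteratedFDeriv ℝ j (f i) x‖ ≤ ε

lemma IsTest.mono {K K' : Set E} {f : E → V} (h : IsTest K f) (hK : K ⊆ K') : IsTest K' f :=
  ⟨h.smooth, fun x hx => h.eq_zero x fun h' => hx (hK h')⟩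

lemma IsTest.zero (K : Set E) : IsTest K (fun _ => 0 : E → V) := ⟨contDiff_const, fun _ _ => rfl⟩

lemma IsTest.add {K : Set E} {f g : E → V} (hf : IsTest K f) (hg : IsTest K g) :
    IsTest K (f + g) :=
  ⟨hf.smooth.add hg.smooth, fun x hx => by simp [hf.eq_zero x hx, hg.eq_zero x hx]⟩

lemma IsTest.sub {K : Set E} {f g : E → V} (hf : IsTest K f) (hg : IsTest K g) :
    IsTest K (f - g) :=
  ⟨hf.smooth.sub hg.smooth, fun x hx => by simp [hf.eq_zero x hx, hg.eq_zero x hx]⟩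

lemma IsTest.iteratedFDeriv_eq_zero {K : Set E} {f : E → V} (hf : IsTest K f)
    (hK : _root_.IsClosed K) (j : ℕ) {x : E} (hx : x ∉ K) : iteratedFDeriv ℝ j f x = 0 := by
  have h : f =ᶠ[𝓝 x] fun _ => 0 := by
    filter_upwards [hK.isOpen_compl.mem_nhds hx] with y hy using hf.eq_zero y hy
  rw [(h.iteratedFDeriv ℝ j).eq_of_nhds]
  simp [iteratedFDeriv_fun_zero]

lemma NullSeq.comp_tendsto {K : Set E} {f : ℕ → E → V} (h : NullSeq K f) {φ : ℕ → ℕ}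
    (hφ : Tendsto φ atTop atTop) : NullSeq K (fun i => f (φ i)) :=
  ⟨hφ.eventually h.test, fun j ε hε => hφ.eventually (h.small j ε hε)⟩

lemma NullSeq.congr {K : Set E} {f g : ℕ → E → V} (h : NullSeq K f)
    (hfg : ∀ᶠ i in atTop, f i = g i) : NullSeq K g :=
  ⟨by filter_upwards [h.test, hfg] with i h1 h2 using h2 ▸ h1,
   fun j ε hε => by filter_upwards [h.small j ε hε, hfg] with i h1 h2 using h2 ▸ h1⟩

lemma exists_uniform_iteratedFDeriv_bound {Ω : Set E'} (hΩ : IsOpen Ω) {h : E' → V}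
    (hh : ContDiffOn ℝ ∞ h Ω) {K : Set E'} (hK : IsCompact K) (hKΩ : K ⊆ Ω) (j : ℕ) :
    ∃ B : ℝ, 1 ≤ B ∧ ∀ i ≤ j, ∀ z ∈ K, ‖iteratedFDeriv ℝ i h z‖ ≤ B := by
  have key : ∀ i : ℕ, ∃ B : ℝ, ∀ z ∈ K, ‖iteratedFDeriv ℝ i h z‖ ≤ B := by
    intro i
    refine hK.exists_bound_of_continuousOn fun z hz => ?_
    exact (((hh.contDiffAt (hΩ.mem_nhds (hKΩ hz))).iteratedFDeriv_right (i := i) (m := 0)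
      (by simp only [zero_add]; exact_mod_cast le_top)).continuousAt).continuousWithinAt
  choose B hB using key
  refine ⟨1 + ∑ i ∈ Finset.range (j + 1), |B i|, ?_, fun i hi z hz => ?_⟩
  · have : 0 ≤ ∑ i ∈ Finset.range (j + 1), |B i| := Finset.sum_nonneg fun _ _ => abs_nonneg _
    linarith
  · have h1 : |B i| ≤ ∑ i ∈ Finset.range (j + 1), |B i| :=
      Finset.single_le_sum (f := fun i => |B i|) (fun _ _ => abs_nonneg _)
        (Finset.mem_range.2 (by omega))
    linarith [hB i z hz, le_abs_self (B i)]

/-- A `j`-th derivative of `z ↦ M z (f (g z))` is controlled by the derivatives of `f`. -/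
lemma exists_iteratedFDeriv_bound {Ω : Set E'} (hΩ : IsOpen Ω) {g : E' → E}
    (hg : ContDiffOn ℝ ∞ g Ω) {M : E' → V →L[ℝ] V'} (hM : ContDiffOn ℝ ∞ M Ω)
    {K : Set E'} (hK : IsCompact K) (hKΩ : K ⊆ Ω) (j : ℕ) :
    ∃ C : ℝ, 0 ≤ C ∧ ∀ (f : E → V) (z : E') (ε : ℝ), z ∈ K → ContDiffAt ℝ ∞ f (g z) → 0 ≤ ε →
      (∀ i ≤ j, ‖iteratedFDeriv ℝ i f (g z)‖ ≤ ε) →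
      ‖iteratedFDeriv ℝ j (fun z => M z (f (g z))) z‖ ≤ C * ε := by
  obtain ⟨Bg, hBg1, hBg⟩ := exists_uniform_iteratedFDeriv_bound hΩ hg hK hKΩ j
  obtain ⟨BM, hBM1, hBM⟩ := exists_uniform_iteratedFDeriv_bound hΩ hM hK hKΩ j
  refine ⟨∑ i ∈ Finset.range (j + 1), (j.choose i : ℝ) * BM * ((j - i).factorial * Bg ^ (j - i)),
    ?_, fun f z ε hz hf hε hfe => ?_⟩
  · refine Finset.sum_nonneg fun i _ => ?_
    positivity
  obtain ⟨u, hu, hfu⟩ := (hf.of_le (m := (j : ℕ∞ω)) (by exact_mod_cast le_top)).contDiffOn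
    (m := j) le_rfl (by simp)
  obtain ⟨t, htu, ht, hzt⟩ := mem_nhds_iff.1 hu
  have hft : ContDiffOn ℝ j f t := hfu.mono htu
  have hgc : ContinuousOn g Ω := hg.continuousOn
  set s : Set E' := Ω ∩ g ⁻¹' t with hs
  have hso : IsOpen s := hgc.isOpen_inter_preimage hΩ ht
  have hzs : z ∈ s := ⟨hKΩ hz, hzt⟩
  have hjn : ((j : ℕ) : ℕ∞ω) ≤ ∞ := by exact_mod_cast le_top
  have hgs : ContDiffOn ℝ j g s := (hg.of_le hjn).mono inter_subset_left
  have hMs : ContDiffOn ℝ j M s := (hM.of_le hjn).mono inter_subset_left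
  have hcomp : ContDiffOn ℝ j (f ∘ g) s := hft.comp hgs fun x hx => hx.2
  have key := norm_iteratedFDerivWithin_clm_apply (n := j) hMs hcomp hso.uniqueDiffOn hzs le_rfl
  rw [iteratedFDerivWithin_of_isOpen j hso hzs] at key
  refine key.trans ?_
  rw [Finset.sum_mul]
  refine Finset.sum_le_sum fun i hi => ?_
  have hij : i ≤ j := by simpa [Nat.lt_succ_iff] using hi
  have h1 : ‖iteratedFDerivWithin ℝ i M s z‖ ≤ BM := by
    rw [iteratedFDerivWithin_of_isOpen i hso hzs]; exact hBM i hij z hz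
  have h2 : ‖iteratedFDerivWithin ℝ (j - i) (f ∘ g) s z‖ ≤
      (j - i).factorial * ε * Bg ^ (j - i) := by
    refine norm_iteratedFDerivWithin_comp_le (N := (j : ℕ∞ω)) hft hgs
      (by exact_mod_cast Nat.sub_le _ _) ht.uniqueDiffOn hso.uniqueDiffOn
      (fun x hx => hx.2) hzs (fun m hm => ?_) (fun m hm1 hm => ?_)
    · rw [iteratedFDerivWithin_of_isOpen m ht hzt]
      exact hfe m (by omega)
    · rw [iteratedFDerivWithin_of_isOpen m hso hzs]
      refine (hBg m (by omega) z hz).trans ?_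
      calc Bg = Bg ^ 1 := (pow_one _).symm
        _ ≤ Bg ^ m := pow_le_pow_right₀ hBg1 hm1
  calc _ ≤ (j.choose i : ℝ) * BM * ((j - i).factorial * ε * Bg ^ (j - i)) := by gcongr
    _ = _ := by ring

open Classical in
lemma IsTest.pull {K : Set E} {f : E → V} (hf : IsTest K f) {Ω : Set E'} (hΩ : IsOpen Ω)
    {g : E' → E} (hg : ContDiffOn ℝ ∞ g Ω) {M : E' → V →L[ℝ] V'} (hM : ContDiffOn ℝ ∞ M Ω)
    {K' : Set E'} (hK' : _root_.IsClosed K') (hKΩ : K' ⊆ Ω)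
    (hgK : ∀ z ∈ Ω, g z ∈ K → z ∈ K') :
    IsTest K' (fun z => if z ∈ Ω then M z (f (g z)) else 0) := by
  have hz : ∀ z, z ∉ K' → (if z ∈ Ω then M z (f (g z)) else 0) = 0 := by
    intro z hz
    split_ifs with h
    · rw [hf.eq_zero _ fun h' => hz (hgK z h h'), map_zero]
    · rfl
  refine ⟨contDiff_iff_contDiffAt.2 fun z => ?_, hz⟩
  by_cases h : z ∈ K'
  · have hz : Ω ∈ 𝓝 z := hΩ.mem_nhds (hKΩ h)
    refine ((hM.contDiffAt hz).clm_apply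
      (hf.smooth.contDiffAt.comp z (hg.contDiffAt hz))).congr_of_eventuallyEq ?_
    filter_upwards [hz] with y hy
    simp [hy]
  · refine (contDiffAt_const (c := 0)).congr_of_eventuallyEq ?_
    filter_upwards [hK'.isOpen_compl.mem_nhds h] with y hy using hz y hy

open Classical in
lemma NullSeq.pull {K : Set E} {f : ℕ → E → V} (hf : NullSeq K f) {Ω : Set E'} (hΩ : IsOpen Ω)
    {g : E' → E} (hg : ContDiffOn ℝ ∞ g Ω) {M : E' → V →L[ℝ] V'} (hM : ContDiffOn ℝ ∞ M Ω)
    {K' : Set E'} (hK' : IsCompact K') (hKΩ : K' ⊆ Ω)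
    (hgK : ∀ z ∈ Ω, g z ∈ K → z ∈ K') :
    NullSeq K' (fun i z => if z ∈ Ω then M z (f i (g z)) else 0) := by
  refine ⟨hf.test.mono fun i h => h.pull hΩ hg hM hK'.isClosed hKΩ hgK, fun j ε hε => ?_⟩
  obtain ⟨C, hC, hb⟩ := exists_iteratedFDeriv_bound hΩ hg hM hK' hKΩ j
  have h1 : ∀ᶠ i in atTop, ∀ m ∈ Finset.range (j + 1), ∀ x,
      ‖iteratedFDeriv ℝ m (f i) x‖ ≤ ε / (C + 1) :=
    (Filter.eventually_all_finset _).2 fun m _ => hf.small m _ (by positivity)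
  filter_upwards [h1, hf.test] with i hi ht z
  by_cases h : z ∈ K'
  · have hz : Ω ∈ 𝓝 z := hΩ.mem_nhds (hKΩ h)
    have heq : (fun z => if z ∈ Ω then M z (f i (g z)) else 0) =ᶠ[𝓝 z]
        fun z => M z (f i (g z)) := by
      filter_upwards [hz] with y hy
      simp [hy]
    rw [(heq.iteratedFDeriv ℝ j).eq_of_nhds]
    refine (hb (f i) z (ε / (C + 1)) h ht.smooth.contDiffAt (by positivity)
      fun m hm => hi m (Finset.mem_range.2 (by omega)) _).trans ?_
    rw [mul_div_assoc', div_le_iff₀ (by positivity)]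
    nlinarith
  · rw [(ht.pull hΩ hg hM hK'.isClosed hKΩ hgK).iteratedFDeriv_eq_zero hK'.isClosed j h]
    simpa using hε.le

end TestFunctions

section Families

variable {T : Type*} [NormedAddCommGroup T] [NormedSpace ℝ T]
  {E : Type*} [NormedAddCommGroup E] [NormedSpace ℝ E]
  {V : Type*} [NormedAddCommGroup V] [NormedSpace ℝ V]

lemma continuous_iteratedFDeriv_family {F : T → E → V} (hF : ContDiff ℝ ∞ (Function.uncurry F))
    (j : ℕ) : Continuous (fun p : T × E => iteratedFDeriv ℝ j (F p.1) p.2) := by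
  have h : ∀ t x, iteratedFDeriv ℝ j (F t) x =
      (iteratedFDeriv ℝ j (Function.uncurry F) (t, x)).compContinuousLinearMap
        fun _ => ContinuousLinearMap.inr ℝ T E := by
    intro t x
    have h1 : ContDiff ℝ ∞ fun p : T × E => Function.uncurry F (((t, 0) : T × E) + p) :=
      hF.comp (contDiff_const.add contDiff_id)
    have h2 : F t = (fun p : T × E => Function.uncurry F (((t, 0) : T × E) + p)) ∘
        ContinuousLinearMap.inr ℝ T E := by
      funext y; simp
    rw [h2, ContinuousLinearMap.iteratedFDeriv_comp_right _ h1 x (by exact_mod_cast le_top),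
      iteratedFDeriv_comp_add_left]
    simp
  simp only [h]
  exact (ContinuousMultilinearMap.compContinuousLinearMapL
    fun _ => ContinuousLinearMap.inr ℝ T E).continuous.comp
    (hF.continuous_iteratedFDeriv (by exact_mod_cast le_top))

/-- In a smooth family, all derivatives converge uniformly on compact sets. -/
lemma eventually_iteratedFDeriv_sub_le {F : T → E → V}
    (hF : ContDiff ℝ ∞ (Function.uncurry F)) {ι : Type*} {l : Filter ι} {θ : ι → T} {θ₀ : T}
    (hθ : Tendsto θ l (𝓝 θ₀)) {K : Set E} (hK : IsCompact K) (j : ℕ) {ε : ℝ} (hε : 0 < ε) :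
    ∀ᶠ n in l, ∀ x ∈ K, ‖iteratedFDeriv ℝ j (F (θ n) - F θ₀) x‖ ≤ ε := by
  have hc := continuous_iteratedFDeriv_family hF j
  have hFs : ∀ t, ContDiff ℝ ∞ (F t) := fun t => hF.comp (contDiff_const.prodMk contDiff_id)
  have h : ∀ᶠ t in 𝓝 θ₀, ∀ x ∈ K,
      ‖iteratedFDeriv ℝ j (F t) x - iteratedFDeriv ℝ j (F θ₀) x‖ < ε := by
    refine hK.eventually_forall_of_forall_eventually fun x _ => ?_
    have hcc : Continuous fun p : T × E =>
        ‖iteratedFDeriv ℝ j (F p.1) p.2 - iteratedFDeriv ℝ j (F θ₀) p.2‖ :=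
      (hc.sub (hc.comp (continuous_const.prodMk continuous_snd))).norm
    refine hcc.continuousAt.eventually_lt continuousAt_const ?_
    simpa using hε
  filter_upwards [hθ.eventually h] with n hn x hx
  rw [iteratedFDeriv_sub_apply ((hFs _).contDiffAt.of_le (by exact_mod_cast le_top))
    ((hFs _).contDiffAt.of_le (by exact_mod_cast le_top))]
  exact (hn x hx).le

end Families

section ParametricIntegrals

variable {X : Type*} [NormedAddCommGroup X] [NormedSpace ℝ X]
  {P : Type*} [NormedAddCommGroup P] [NormedSpace ℝ P] [MeasurableSpace P] [BorelSpace P]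
  {μ : Measure P}
  {V : Type*} [NormedAddCommGroup V] [NormedSpace ℝ V]

open Convolution in
lemma contDiff_integral_weighted {w : P → ℝ} (hw : LocallyIntegrable w μ) {g : X → P → V}
    (hg : ContDiff ℝ ∞ (Function.uncurry g)) {k : Set P} (hk : IsCompact k)
    (hgk : ∀ x u, u ∉ k → g x u = 0) :
    ContDiff ℝ ∞ (fun x => ∫ u, w u • g x u ∂μ) := by
  have h := contDiffOn_convolution_right_with_param_comp (μ := μ) (n := ⊤)
    (ContinuousLinearMap.lsmul ℝ ℝ : ℝ →L[ℝ] V →L[ℝ] V) (s := (univ : Set X))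
    (v := fun _ => (0 : P)) contDiffOn_const (f := w) (g := fun x u => g x (-u)) (k := -k)
    isOpen_univ hk.neg (fun x u _ hu => hgk x _ fun h => hu (by simpa using h)) hw
    ((hg.comp (contDiff_fst.prodMk contDiff_snd.neg)).contDiffOn)
  have h2 := contDiffOn_univ.1 h
  convert h2 using 2 with x
  simp [convolution]

lemma contDiff_integral [IsLocallyFiniteMeasure μ] {g : X → P → V}
    (hg : ContDiff ℝ ∞ (Function.uncurry g)) {k : Set P} (hk : IsCompact k)
    (hgk : ∀ x u, u ∉ k → g x u = 0) :
    ContDiff ℝ ∞ (fun x => ∫ u, g x u ∂μ) := by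
  simpa using contDiff_integral_weighted (w := fun _ => 1)
    (continuous_const.locallyIntegrable (μ := μ)) hg hk hgk

/-- The function `∫₀¹ Df(x + r s y) y dr`. -/
noncomputable def hadamard {W : Type*} [NormedAddCommGroup W] [NormedSpace ℝ W]
    (f : W → V) (q : ℝ × W × W) : V :=
  ∫ r in Icc (0 : ℝ) 1, fderiv ℝ f (q.2.1 + (r * q.1) • q.2.2) q.2.2

lemma contDiff_hadamard {W : Type*} [NormedAddCommGroup W] [NormedSpace ℝ W]
    {f : W → V} (hf : ContDiff ℝ ∞ f) : ContDiff ℝ ∞ (hadamard f) := by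
  let χ : ContDiffBump (0 : ℝ) := ⟨2, 3, by norm_num, by norm_num⟩
  have hw : LocallyIntegrable (indicator (Icc (0 : ℝ) 1) fun _ => (1 : ℝ)) volume := by
    refine Integrable.locallyIntegrable ?_
    rw [integrable_indicator_iff measurableSet_Icc]
    exact integrableOn_const (by simp)
  have h := contDiff_integral_weighted (X := ℝ × W × W) hw
    (g := fun q r => χ r • fderiv ℝ f (q.2.1 + (r * q.1) • q.2.2) q.2.2)
    (k := Metric.closedBall 0 3) ?_ (isCompact_closedBall _ _) ?_
  · convert h using 2 with q
    rw [hadamard, ← integral_indicator measurableSet_Icc]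
    congr 1
    funext r
    by_cases hr : r ∈ Icc (0 : ℝ) 1
    · have : χ r = 1 := χ.one_of_mem_closedBall (by
        simp [χ, Real.norm_eq_abs, abs_le]; constructor <;> linarith [hr.1, hr.2])
      simp [hr, this]
    · simp [hr]
  · refine ContDiff.smul (χ.contDiff.comp contDiff_snd) ?_
    refine ContDiff.clm_apply ?_ (by fun_prop)
    refine (hf.fderiv_right (m := ∞) (by simp)).comp ?_
    fun_prop
  · intro q r hr
    rw [χ.zero_of_le_dist, zero_smul]
    simpa using (not_le.1 (fun h => hr (by simpa using h))).le

lemma smul_hadamard [CompleteSpace V] {W : Type*} [NormedAddCommGroup W] [NormedSpace ℝ W]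
    {f : W → V} (hf : ContDiff ℝ ∞ f) (s : ℝ) (x y : W) :
    s • hadamard f (s, x, y) = f (x + s • y) - f x := by
  have hd : ∀ r : ℝ, HasDerivAt (fun r : ℝ => f (x + (r * s) • y))
      (s • fderiv ℝ f (x + (r * s) • y) y) r := by
    intro r
    have h1 : HasDerivAt (fun r : ℝ => x + (r * s) • y) (s • y) r := by
      simpa using (((hasDerivAt_id r).mul_const s).smul_const y).const_add x
    have h2 := ((hf.differentiable (by simp)) (x + (r * s) • y)).hasFDerivAt
    simpa [Function.comp_def] using h2.comp_hasDerivAt r h1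
  have hc : Continuous fun r : ℝ => s • fderiv ℝ f (x + (r * s) • y) y := by
    refine Continuous.const_smul (Continuous.clm_apply ?_ continuous_const) s
    exact (hf.continuous_fderiv (by simp)).comp (by fun_prop)
  have h := intervalIntegral.integral_eq_sub_of_hasDerivAt (a := 0) (b := 1)
    (fun r _ => hd r) (hc.intervalIntegrable _ _)
  rw [hadamard, ← integral_smul, MeasureTheory.integral_Icc_eq_integral_Ioc,
    ← intervalIntegral.integral_of_le zero_le_one, h]
  simp

lemma hadamard_zero {W : Type*} [NormedAddCommGroup W] [NormedSpace ℝ W]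
    [CompleteSpace V] (f : W → V) (x y : W) : hadamard f (0, x, y) = fderiv ℝ f x y := by
  simp [hadamard]

end ParametricIntegrals

section FibreIntegrals

universe u

variable {X : Type u} [NormedAddCommGroup X] [NormedSpace ℝ X]
  {P : Type*} [NormedAddCommGroup P] [NormedSpace ℝ P] [MeasurableSpace P] [BorelSpace P]
  {μ : Measure P} [IsLocallyFiniteMeasure μ]

lemma norm_iteratedFDeriv_integral_le {K : Set (X × P)} (hK : IsCompact K) (j : ℕ) {ε : ℝ} :
    ∀ {V : Type u} [NormedAddCommGroup V] [NormedSpace ℝ V] {f : X × P → V},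
    IsTest K f → (∀ x, ‖iteratedFDeriv ℝ j f x‖ ≤ ε) →
    ∀ x, ‖iteratedFDeriv ℝ j (fun x => ∫ u, f (x, u) ∂μ) x‖ ≤ ε * μ.real (Prod.snd '' K) := by
  have hK2 : IsCompact (Prod.snd '' K) := hK.image continuous_snd
  have zero_off : ∀ {V : Type u} [NormedAddCommGroup V] [NormedSpace ℝ V] {f : X × P → V},
      IsTest K f → ∀ x u, u ∉ Prod.snd '' K → f (x, u) = 0 :=
    fun hf x u hu => hf.eq_zero _ fun h => hu ⟨_, h, rfl⟩
  induction j with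
  | zero =>
    intro V _ _ f hf hb x
    simp only [norm_iteratedFDeriv_zero] at hb ⊢
    rw [← setIntegral_eq_integral_of_forall_compl_eq_zero (s := Prod.snd '' K)
      fun u hu => zero_off hf x u hu]
    exact norm_setIntegral_le_of_norm_le_const hK2.measure_lt_top fun u _ => hb _
  | succ j ih =>
    intro V _ _ f hf hb x
    let f' : X × P → X →L[ℝ] V := fun p =>
      ((ContinuousLinearMap.compL ℝ X (X × P) V).flip (ContinuousLinearMap.inl ℝ X P))
        (fderiv ℝ f p)
    have hf' : IsTest K f' := by
      refine ⟨(ContinuousLinearMap.contDiff _).comp (hf.smooth.fderiv_right (by simp)),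
        fun p hp => ?_⟩
      have : fderiv ℝ f p = 0 := by
        have h : f =ᶠ[𝓝 p] fun _ => 0 := by
          filter_upwards [hK.isClosed.isOpen_compl.mem_nhds hp] with y hy using hf.eq_zero y hy
        rw [h.fderiv_eq]; simp
      simp [f', this]
    have hd : ∀ x, HasFDerivAt (fun x => ∫ u, f (x, u) ∂μ) (∫ u, f' (x, u) ∂μ) x := by
      intro x
      obtain ⟨B, hB⟩ := hK.exists_bound_of_continuousOn hf'.smooth.continuous.continuousOn
      have hB' : ∀ p, ‖f' p‖ ≤ indicator (Prod.snd '' K) (fun _ => |B|) p.2 := by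
        intro p
        by_cases hp : p ∈ K
        · rw [indicator_of_mem (mem_image_of_mem _ hp)]
          exact (hB p hp).trans (le_abs_self B)
        · rw [hf'.eq_zero p hp, norm_zero]
          exact indicator_nonneg (fun _ _ => abs_nonneg _) _
      have hint : ∀ x, Integrable (fun u => f (x, u)) μ := fun x =>
        (hf.smooth.continuous.comp (by fun_prop : Continuous fun u => (x, u))).integrable_of_hasCompactSupport
          (HasCompactSupport.intro hK2 fun u hu => zero_off hf x u hu)
      refine hasFDerivAt_integral_of_dominated_of_fderiv_le (𝕜 := ℝ) (s := univ)
        (F' := fun x u => f' (x, u))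
        (bound := indicator (Prod.snd '' K) fun _ => |B|) univ_mem
        (Eventually.of_forall fun x => (hint x).aestronglyMeasurable) (hint x) ?_
        (Eventually.of_forall fun u x _ => hB' (x, u)) ?_ (Eventually.of_forall fun u x _ => ?_)
      · exact ((hf'.smooth.continuous.comp
          (by fun_prop : Continuous fun u => (x, u))).integrable_of_hasCompactSupport
          (HasCompactSupport.intro hK2 fun u hu => zero_off hf' x u hu)).aestronglyMeasurable
      · rw [integrable_indicator_iff hK2.measurableSet]
        exact integrableOn_const hK2.measure_lt_top.ne
      · have h1 := ((hf.smooth.differentiable (by simp)) (x, u)).hasFDerivAt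
        have h2 : HasFDerivAt (fun x : X => (x, u)) (ContinuousLinearMap.inl ℝ X P) x :=
          hasFDerivAt_prodMk_left x u
        exact h1.comp x h2
    have hfd : fderiv ℝ (fun x => ∫ u, f (x, u) ∂μ) = fun x => ∫ u, f' (x, u) ∂μ :=
      funext fun x => (hd x).fderiv
    rw [← norm_iteratedFDeriv_fderiv, hfd]
    refine ih hf' (fun p => ?_) x
    refine (ContinuousLinearMap.norm_iteratedFDeriv_comp_left _
      ((hf.smooth.fderiv_right (m := ∞) (by simp)).contDiffAt)
      (by exact_mod_cast le_top)).trans ?_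
    rw [norm_iteratedFDeriv_fderiv]
    refine (mul_le_of_le_one_left (norm_nonneg _) ?_).trans (hb p)
    refine ContinuousLinearMap.opNorm_le_bound _ zero_le_one fun A => ?_
    rw [one_mul]
    refine (ContinuousLinearMap.opNorm_comp_le A _).trans ?_
    exact mul_le_of_le_one_right (norm_nonneg _) (ContinuousLinearMap.norm_inl_le_one ℝ X P)

variable {V : Type u} [NormedAddCommGroup V] [NormedSpace ℝ V]

lemma IsTest.integral {K : Set (X × P)} (hK : IsCompact K) {f : X × P → V} (hf : IsTest K f) :
    IsTest (Prod.fst '' K) (fun x => ∫ u, f (x, u) ∂μ) := by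
  refine ⟨contDiff_integral (g := fun x u => f (x, u)) hf.smooth (hK.image continuous_snd)
    fun x u hu => hf.eq_zero _ fun h => hu ⟨_, h, rfl⟩, fun x hx => ?_⟩
  rw [← integral_zero P V (μ := μ)]
  congr 1
  funext u
  exact hf.eq_zero _ fun h => hx ⟨_, h, rfl⟩

lemma NullSeq.integral {K : Set (X × P)} (hK : IsCompact K) {f : ℕ → X × P → V}
    (hf : NullSeq K f) : NullSeq (Prod.fst '' K) (fun i x => ∫ u, f i (x, u) ∂μ) := by
  refine ⟨hf.test.mono fun i h => h.integral hK, fun j ε hε => ?_⟩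
  have hm : 0 ≤ μ.real (Prod.snd '' K) := measureReal_nonneg
  filter_upwards [hf.test, hf.small j (ε / (μ.real (Prod.snd '' K) + 1)) (by positivity)]
    with i h1 h2 x
  refine (norm_iteratedFDeriv_integral_le hK j h1 h2 x).trans ?_
  rw [div_mul_eq_mul_div, div_le_iff₀ (by positivity)]
  nlinarith

end FibreIntegrals

/-! ## The uniform boundedness principle for test functions -/

section UniformBoundedness

variable {E : Type*} [NormedAddCommGroup E] [NormedSpace ℝ E]
  {V : Type*} [NormedAddCommGroup V] [NormedSpace ℝ V] [CompleteSpace V] [SMul ℂ V]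

/-- A functional that is complex linear and continuous on test functions supported in `K`. -/
structure IsTestFunctional (K : Set E) (L : (E → V) → ℂ) : Prop where
  map_add : ∀ f g, IsTest K f → IsTest K g → L (f + g) = L f + L g
  map_smul : ∀ (c : ℂ) (f : E → V), IsTest K f → L (fun x => c • f x) = c * L f
  tendsto : ∀ x : ℕ → E → V, NullSeq K x → Tendsto (fun i => L (x i)) atTop (𝓝 0)

omit [CompleteSpace V] in
lemma IsTestFunctional.map_zero {K : Set E} {L : (E → V) → ℂ} (h : IsTestFunctional K L) :
    L 0 = 0 := by
  have := h.map_add 0 0 (IsTest.zero K) (IsTest.zero K)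
  simpa using this

omit [CompleteSpace V] in
lemma IsTestFunctional.map_sub {K : Set E} {L : (E → V) → ℂ} (h : IsTestFunctional K L)
    {f g : E → V} (hf : IsTest K f) (hg : IsTest K g) : L (f - g) = L f - L g := by
  have := h.map_add (f - g) g (hf.sub hg) hg
  rw [sub_add_cancel] at this
  rw [this]; ring

omit [CompleteSpace V] [SMul ℂ V] in
lemma IsTest.sum {K : Set E} {ι : Type*} (s : Finset ι) {z : ι → E → V}
    (hz : ∀ i ∈ s, IsTest K (z i)) : IsTest K (fun x => ∑ i ∈ s, z i x) :=
  ⟨ContDiff.sum fun i hi => (hz i hi).smooth,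
    fun x hx => Finset.sum_eq_zero fun i hi => (hz i hi).eq_zero x hx⟩

omit [CompleteSpace V] in
lemma IsTestFunctional.map_sum {K : Set E} {L : (E → V) → ℂ} (h : IsTestFunctional K L)
    {ι : Type*} (s : Finset ι) {z : ι → E → V} (hz : ∀ i ∈ s, IsTest K (z i)) :
    L (fun x => ∑ i ∈ s, z i x) = ∑ i ∈ s, L (z i) := by
  classical
  induction s using Finset.induction_on with
  | empty => simpa [Pi.zero_def] using h.map_zero
  | insert a s ha ih =>
    have h1 : (fun x => ∑ i ∈ insert a s, z i x) = z a + fun x => ∑ i ∈ s, z i x := by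
      funext x; simp [Finset.sum_insert ha]
    rw [h1, h.map_add _ _ (hz a (by simp)) (IsTest.sum s fun i hi => hz i (by simp [hi])),
      ih fun i hi => hz i (by simp [hi]), Finset.sum_insert ha]

omit [SMul ℂ V] in
/-- A rapidly converging series of test functions converges in the space of test functions. -/
lemma exists_sum_of_rapid_decay {K : Set E} {z : ℕ → E → V} (hz : ∀ i, IsTest K (z i))
    (hb : ∀ i, ∀ m ≤ i, ∀ x, ‖iteratedFDeriv ℝ m (z i) x‖ ≤ (1 / 2 : ℝ) ^ i) :
    ∃ f : E → V, IsTest K f ∧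
      NullSeq K (fun N => f - fun x => ∑ i ∈ Finset.range N, z i x) := by
  have hs : Summable fun i : ℕ => (1 / 2 : ℝ) ^ i := summable_geometric_two
  have hsmooth : ContDiff ℝ ∞ fun x => ∑' i, z i x :=
    contDiff_tsum_of_eventually (N := ⊤) (v := fun _ i => (1 / 2 : ℝ) ^ i)
      (fun i => (hz i).smooth) (fun _ _ => hs) fun k _ => by
        rw [Nat.cofinite_eq_atTop]
        filter_upwards [eventually_ge_atTop k] with i hi x using hb i k hi x
  have hf : IsTest K fun x => ∑' i, z i x :=
    ⟨hsmooth, fun x hx => by simp [fun i => (hz i).eq_zero x hx]⟩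
  refine ⟨_, hf, Eventually.of_forall fun N => hf.sub (IsTest.sum _ fun i _ => hz i),
    fun k ε hε => ?_⟩
  have hx : ∀ x, Summable fun i => z i x := fun x =>
    Summable.of_norm_bounded hs fun i => by simpa using hb i 0 (Nat.zero_le _) x
  have htail : ∀ N, ((fun x => ∑' i, z i x) - fun x => ∑ i ∈ Finset.range N, z i x) =
      fun x => ∑' i, z (i + N) x := by
    intro N
    funext x
    rw [Pi.sub_apply, ← (hx x).sum_add_tsum_nat_add N, add_sub_cancel_left]
  have hlim : Tendsto (fun N : ℕ => (1 / 2 : ℝ) ^ N * 2) atTop (𝓝 0) := by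
    simpa using (tendsto_pow_atTop_nhds_zero_of_lt_one (r := (1 / 2 : ℝ))
      (by norm_num) (by norm_num)).mul_const 2
  filter_upwards [eventually_ge_atTop k, hlim.eventually_lt_const hε] with N hN hNε x
  rw [htail]
  have hsN : Summable fun i : ℕ => (1 / 2 : ℝ) ^ (i + N) := (summable_nat_add_iff N).2 hs
  rw [iteratedFDeriv_tsum (N := (k : ℕ∞)) (v := fun _ i => (1 / 2 : ℝ) ^ (i + N))
    (fun i => (hz _).smooth.of_le (by exact_mod_cast le_top)) (fun _ _ => hsN)
    (fun m i x hm => hb _ m (by have : m ≤ k := by exact_mod_cast hm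
                                omega) x) le_rfl]
  refine (tsum_of_norm_bounded hsN.hasSum fun i => hb _ k (by omega) x).trans (le_trans ?_ hNε.le)
  simp only [pow_add]
  rw [tsum_mul_right, tsum_geometric_two]
  linarith

lemma tendsto_apply_nullSeq_of_tendsto_zero {K : Set E} {L : ℕ → (E → V) → ℂ}
    (hL : ∀ᶠ n in atTop, IsTestFunctional K (L n))
    (hlim : ∀ f, IsTest K f → Tendsto (fun n => L n f) atTop (𝓝 0))
    {x : ℕ → E → V} (hx : NullSeq K x) : Tendsto (fun n => L n (x n)) atTop (𝓝 0) := by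
  by_contra hcon
  rw [Metric.tendsto_atTop] at hcon
  push Not at hcon
  obtain ⟨δ, hδ, hcon⟩ := hcon
  simp only [dist_zero_right] at hcon
  let P : ℕ × ℕ → Prop := fun p => IsTestFunctional K (L p.2) ∧ IsTest K (x p.2) ∧
    δ ≤ ‖L p.2 (x p.2)‖ ∧ ∀ m ≤ p.1, ∀ y, ‖iteratedFDeriv ℝ m (x p.2) y‖ ≤ (1 / 2 : ℝ) ^ p.1
  let r : ℕ × ℕ → ℕ × ℕ → Prop := fun p q => p.1 < q.1 ∧ p.2 < q.2 ∧
    ‖L q.2 (x p.2)‖ ≤ δ / 8 * (1 / 2 : ℝ) ^ p.1 ∧ ‖L p.2 (x q.2)‖ ≤ δ / 8 * (1 / 2 : ℝ) ^ q.1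
  obtain ⟨φ, hP, hr⟩ := exists_seq_of_forall_finset_exists P r (by
    intro s hs
    let j := s.sup Prod.fst + 1
    have hj : ∀ p ∈ s, p.1 < j := fun p hp => Nat.lt_succ_of_le (Finset.le_sup (f := Prod.fst) hp)
    have e1 : ∀ᶠ n in atTop, ∀ m ∈ Finset.range (j + 1), ∀ y,
        ‖iteratedFDeriv ℝ m (x n) y‖ ≤ (1 / 2 : ℝ) ^ j :=
      (Filter.eventually_all_finset _).2 fun m _ => hx.small m _ (by positivity)
    have e2 : ∀ᶠ n in atTop, ∀ p ∈ s, p.2 < n ∧ ‖L n (x p.2)‖ ≤ δ / 8 * (1 / 2 : ℝ) ^ p.1 ∧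
        ‖L p.2 (x n)‖ ≤ δ / 8 * (1 / 2 : ℝ) ^ j := by
      refine (Filter.eventually_all_finset _).2 fun p hp => ?_
      have h1 := (hlim _ (hs p hp).2.1).norm.eventually_le_const
        (show ‖(0 : ℂ)‖ < δ / 8 * (1 / 2 : ℝ) ^ p.1 by simpa using hδ)
      have h2 := ((hs p hp).1.tendsto _ hx).norm.eventually_le_const
        (show ‖(0 : ℂ)‖ < δ / 8 * (1 / 2 : ℝ) ^ j by simpa using hδ)
      filter_upwards [h1, h2, eventually_gt_atTop p.2] with n h1 h2 h3 using ⟨h3, h1, h2⟩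
    obtain ⟨N, hN⟩ := eventually_atTop.1 (((e1.and e2).and hL).and hx.test)
    obtain ⟨n, hn, hnδ⟩ := hcon N
    obtain ⟨⟨⟨h1, h2⟩, h3⟩, h4⟩ := hN n hn
    exact ⟨(j, n), ⟨h3, h4, hnδ, fun m hm y => h1 m (Finset.mem_range.2 (by
      have : m ≤ j := hm
      omega)) y⟩, fun p hp => ⟨hj p hp, (h2 p hp).1, (h2 p hp).2.1, (h2 p hp).2.2⟩⟩)
  have hmono1 : StrictMono fun i => (φ i).1 := fun a b hab => (hr a b hab).1
  have hmono2 : StrictMono fun i => (φ i).2 := fun a b hab => (hr a b hab).2.1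
  have hle : ∀ i, i ≤ (φ i).1 := fun i => hmono1.le_apply
  have hpow : ∀ i, (1 / 2 : ℝ) ^ (φ i).1 ≤ (1 / 2 : ℝ) ^ i := fun i =>
    pow_le_pow_of_le_one (by norm_num) (by norm_num) (hle i)
  obtain ⟨f, hf, hnull⟩ := exists_sum_of_rapid_decay (K := K) (z := fun i => x (φ i).2)
    (fun i => (hP i).2.1)
    fun i m hm y => ((hP i).2.2.2 m (hm.trans (hle i)) y).trans (hpow i)
  have hlow : ∀ m, δ / 2 ≤ ‖L (φ m).2 f‖ := by
    intro m
    have hLm := (hP m).1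
    have hpart : ∀ N, IsTest K fun y => ∑ i ∈ Finset.range N, x (φ i).2 y :=
      fun N => IsTest.sum _ fun i _ => (hP i).2.1
    have hN : ∀ N, m < N →
        3 / 4 * δ ≤ ‖L (φ m).2 fun y => ∑ i ∈ Finset.range N, x (φ i).2 y‖ := by
      intro N hmN
      rw [hLm.map_sum _ fun i _ => (hP i).2.1,
        ← Finset.add_sum_erase _ _ (Finset.mem_range.2 hmN)]
      have hsum : ‖∑ i ∈ (Finset.range N).erase m, L (φ m).2 (x (φ i).2)‖ ≤ δ / 4 := by
        calc _ ≤ ∑ i ∈ (Finset.range N).erase m, δ / 8 * (1 / 2 : ℝ) ^ i := by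
              refine norm_sum_le_of_le _ fun i hi => ?_
              have him : i ≠ m := (Finset.mem_erase.1 hi).1
              refine le_trans ?_ (mul_le_mul_of_nonneg_left (hpow i) (by positivity))
              rcases lt_or_gt_of_ne him with h | h
              · exact (hr i m h).2.2.1
              · exact (hr m i h).2.2.2
          _ ≤ ∑' i, δ / 8 * (1 / 2 : ℝ) ^ i :=
              (summable_geometric_two.mul_left _).sum_le_tsum _ fun i _ => by positivity
          _ = δ / 4 := by rw [tsum_mul_left, tsum_geometric_two]; ring
      have h1 := (hP m).2.2.1
      have h2 := norm_sub_norm_le (L (φ m).2 (x (φ m).2))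
        (-∑ i ∈ (Finset.range N).erase m, L (φ m).2 (x (φ i).2))
      rw [sub_neg_eq_add, norm_neg] at h2
      linarith
    have ht := (hLm.tendsto _ hnull).norm.eventually_le_const
      (show ‖(0 : ℂ)‖ < δ / 4 by simpa using hδ)
    obtain ⟨N, hN1, hN2⟩ := (ht.and (eventually_gt_atTop m)).exists
    rw [hLm.map_sub hf (hpart N)] at hN1
    have h1 := hN N hN2
    have h2 := norm_sub_norm_le (L (φ m).2 fun y => ∑ i ∈ Finset.range N, x (φ i).2 y)
      (L (φ m).2 f)
    rw [norm_sub_rev] at h2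
    linarith
  have h0 := ((hlim f hf).comp hmono2.tendsto_atTop).norm.eventually_lt_const
    (show ‖(0 : ℂ)‖ < δ / 2 by simpa using hδ)
  obtain ⟨m, hm⟩ := h0.exists
  exact absurd (hlow m) (not_le.2 hm)

/-- If the functionals `L n` converge pointwise to the continuous functional `L₀` and the test
functions `y n` converge to `y₀`, then `L n (y n)` converges to `L₀ y₀`. -/
lemma tendsto_apply_of_tendsto {K : Set E} {L : ℕ → (E → V) → ℂ} {L₀ : (E → V) → ℂ}
    (hL : ∀ᶠ n in atTop, IsTestFunctional K (L n)) (hL₀ : IsTestFunctional K L₀)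
    (hlim : ∀ f, IsTest K f → Tendsto (fun n => L n f) atTop (𝓝 (L₀ f)))
    {y : ℕ → E → V} {y₀ : E → V} (hy₀ : IsTest K y₀) (hy : NullSeq K (fun n => y n - y₀)) :
    Tendsto (fun n => L n (y n)) atTop (𝓝 (L₀ y₀)) := by
  have h1 : Tendsto (fun n => (L n (y n - y₀) - L₀ (y n - y₀))) atTop (𝓝 0) := by
    refine tendsto_apply_nullSeq_of_tendsto_zero (K := K)
      (L := fun n f => L n f - L₀ f) ?_ ?_ hy
    · filter_upwards [hL] with n hn
      refine ⟨fun f g hf hg => ?_, fun c f hf => ?_, fun x hx => ?_⟩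
      · rw [hn.map_add f g hf hg, hL₀.map_add f g hf hg]; ring
      · rw [hn.map_smul c f hf, hL₀.map_smul c f hf]; ring
      · simpa using (hn.tendsto x hx).sub (hL₀.tendsto x hx)
    · intro f hf
      simpa using (hlim f hf).sub_const (L₀ f)
  have h2 := hL₀.tendsto _ hy
  have h3 := (h1.add h2).add (hlim y₀ hy₀)
  simp only [add_zero, zero_add] at h3
  refine h3.congr' ?_
  filter_upwards [hL, hy.test] with n hn ht
  have : L n (y n) = L n (y n - y₀) + L n y₀ := by
    rw [← hn.map_add _ _ ht hy₀, sub_add_cancel]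
  rw [this]; ring

end UniformBoundedness

/-! ## Alternating forms on finite-dimensional spaces -/

section AlternatingForms

variable {E : Type*} [NormedAddCommGroup E] [NormedSpace ℝ E] [FiniteDimensional ℝ E]
  {E' : Type*} [NormedAddCommGroup E'] [NormedSpace ℝ E'] [FiniteDimensional ℝ E']
  {X : Type*} [NormedAddCommGroup X] [NormedSpace ℝ X] {n : ℕ}

variable (E n) in
/-- The values of an alternating form on the tuples of vectors of a basis. -/
noncomputable def altEval : (E [⋀^Fin n]→L[ℝ] ℂ) →ₗ[ℝ]
    ((Fin n → Fin (Module.finrank ℝ E)) → ℂ) where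
  toFun A r := A fun i => Module.finBasis ℝ E (r i)
  map_add' _ _ := rfl
  map_smul' _ _ := rfl

lemma alt_apply_eq_sum (A : E [⋀^Fin n]→L[ℝ] ℂ) (w : Fin n → E) :
    A w = ∑ r : Fin n → Fin (Module.finrank ℝ E),
      (∏ i, (Module.finBasis ℝ E).repr (w i) (r i)) • altEval E n A r := by
  classical
  conv_lhs => rw [show w = fun i => ∑ j, (Module.finBasis ℝ E).repr (w i) j •
    Module.finBasis ℝ E j from funext fun i => ((Module.finBasis ℝ E).sum_repr (w i)).symm]
  have := A.toContinuousMultilinearMap.toMultilinearMap.map_sum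
    (fun i j => (Module.finBasis ℝ E).repr (w i) j • Module.finBasis ℝ E j)
  refine this.trans (Finset.sum_congr rfl fun r _ => ?_)
  exact A.toContinuousMultilinearMap.toMultilinearMap.map_smul_univ _ _

lemma altEval_injective : Function.Injective (altEval E n) := fun A A' h => by
  ext w
  rw [alt_apply_eq_sum, alt_apply_eq_sum, h]

instance finiteDimensional_continuousAlternatingMap :
    FiniteDimensional ℝ (E [⋀^Fin n]→L[ℝ] ℂ) :=
  Module.Finite.of_injective (altEval E n) altEval_injective

lemma contDiffOn_alt_of_apply {f : X → E [⋀^Fin n]→L[ℝ] ℂ} {s : Set X}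
    (h : ∀ v, ContDiffOn ℝ ∞ (fun x => f x v) s) : ContDiffOn ℝ ∞ f s := by
  obtain ⟨g, hg⟩ := (altEval E n).exists_leftInverse_of_injective
    (LinearMap.ker_eq_bot.2 altEval_injective)
  have hc : ContDiffOn ℝ ∞ (fun x => altEval E n (f x)) s := contDiffOn_pi.2 fun r => h _
  have := (LinearMap.toContinuousLinearMap g).contDiff.comp_contDiffOn hc
  refine this.congr fun x _ => ?_
  exact (LinearMap.congr_fun hg (f x)).symm

lemma ContDiffOn.alt_apply {f : X → E [⋀^Fin n]→L[ℝ] ℂ} {w : X → Fin n → E} {s : Set X}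
    (hf : ContDiffOn ℝ ∞ f s) (hw : ∀ i, ContDiffOn ℝ ∞ (fun x => w x i) s) :
    ContDiffOn ℝ ∞ (fun x => f x (w x)) s := by
  simp only [fun x => alt_apply_eq_sum (f x) (w x)]
  refine ContDiffOn.sum fun r _ => ?_
  have h1 : ContDiffOn ℝ ∞ (fun x => ∏ i, (Module.finBasis ℝ E).repr (w x i) (r i)) s := by
    refine contDiffOn_prod fun i _ => ?_
    have : ContDiff ℝ ∞ fun e : E => (Module.finBasis ℝ E).repr e (r i) :=
      (LinearMap.toContinuousLinearMap ((Module.finBasis ℝ E).coord (r i))).contDiff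
    exact this.comp_contDiffOn (hw i)
  have h2 : ContDiff ℝ ∞ fun A : E [⋀^Fin n]→L[ℝ] ℂ => altEval E n A :=
    (LinearMap.toContinuousLinearMap (altEval E n)).contDiff
  exact h1.smul (contDiffOn_pi.1 (h2.comp_contDiffOn hf) r)

lemma ContDiffOn.alt_comp {f : X → E [⋀^Fin n]→L[ℝ] ℂ} {g : X → E' →L[ℝ] E} {s : Set X}
    (hf : ContDiffOn ℝ ∞ f s) (hg : ContDiffOn ℝ ∞ g s) :
    ContDiffOn ℝ ∞ (fun x => (f x).compContinuousLinearMap (g x)) s :=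
  contDiffOn_alt_of_apply fun _ => hf.alt_apply fun _ => hg.clm_apply contDiffOn_const

lemma ContDiffOn.altPullCLM {g : X → E' →L[ℝ] E} {s : Set X} (hg : ContDiffOn ℝ ∞ g s) :
    ContDiffOn ℝ ∞ (fun x => (ContinuousAlternatingMap.compContinuousLinearMapCLM (g x) :
      (E [⋀^Fin n]→L[ℝ] ℂ) →L[ℝ] (E' [⋀^Fin n]→L[ℝ] ℂ))) s :=
  contDiffOn_clm_apply.2 fun A => (contDiffOn_const (c := A)).alt_comp hg

end AlternatingForms

section Slices

variable {B : Type*} [NormedAddCommGroup B] [NormedSpace ℝ B]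
  {P : Type*} [NormedAddCommGroup P] [NormedSpace ℝ P] {a b : ℕ}

lemma append_update_left {α : Type*} [DecidableEq (Fin a)] (u : Fin a → α) (v : Fin b → α) (i : Fin a) (x : α) :
    Fin.append (Function.update u i x) v =
      Function.update (Fin.append u v) (Fin.castAdd b i) x := by
  funext t
  refine Fin.addCases (fun j => ?_) (fun j => ?_) t
  · by_cases h : j = i
    · subst h; simp
    · have : Fin.castAdd b j ≠ Fin.castAdd b i := fun h' => h (by simpa using h')
      simp [Function.update_of_ne h, Function.update_of_ne this]
  · have : Fin.natAdd a j ≠ Fin.castAdd b i := by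
      intro h
      have := congrArg Fin.val h
      simp at this
      omega
    simp [Function.update_of_ne this]

lemma update_inl {B P : Type*} [Zero P] [DecidableEq (Fin a)] (u : Fin a → B) (i : Fin a)
    (x : B) : (fun j => ((Function.update u i x j, 0) : B × P)) =
      Function.update (fun j => ((u j, 0) : B × P)) i (x, 0) := by
  funext j
  by_cases h : j = i
  · subst h; simp
  · simp [Function.update_of_ne h]

/-- The alternating form `h ↦ A ((h₁,0), …, (h_a,0), (0,f₁), …, (0,f_b))`. -/
noncomputable def sliceForm₁ (f : Fin b → P) (A : (B × P) [⋀^Fin (a + b)]→L[ℝ] ℂ) : B [⋀^Fin a]→L[ℝ] ℂ where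
  toFun h := A (Fin.append (fun i => (h i, (0 : P))) fun j => ((0 : B), f j))
  map_update_add' := by
    intro _ h i x y
    have e : ((x + y, 0) : B × P) = (x, 0) + (y, 0) := by simp
    simp only [update_inl, append_update_left, e]
    classical convert A.map_update_add _ _ _ _
  map_update_smul' := by
    intro _ h i c x
    have e : ((c • x, 0) : B × P) = c • (x, 0) := by simp
    simp only [update_inl, append_update_left, e]
    classical convert A.map_update_smul _ _ _ _
  map_eq_zero_of_eq' := by
    intro h i j hh hij
    refine A.map_eq_zero_of_eq _ (i := Fin.castAdd b i) (j := Fin.castAdd b j) ?_ ?_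
    · simp [hh]
    · intro h; exact hij (by simpa using h)
  cont := by
    refine A.cont.comp (continuous_pi fun t => ?_)
    refine Fin.addCases (fun i => ?_) (fun i => ?_) t
    · simp only [Fin.append_left]
      exact (continuous_apply i).prodMk continuous_const
    · simp only [Fin.append_right]; exact continuous_const

variable [FiniteDimensional ℝ B] [FiniteDimensional ℝ P]

/-- The map `A ↦ A ((·,0), …, (·,0), (0,f₁), …, (0,f_b))` on alternating forms. -/
noncomputable def sliceAlt (f : Fin b → P) :
    ((B × P) [⋀^Fin (a + b)]→L[ℝ] ℂ) →L[ℝ] (B [⋀^Fin a]→L[ℝ] ℂ) :=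
  LinearMap.toContinuousLinearMap
    { toFun := sliceForm₁ f
      map_add' := fun _ _ => rfl
      map_smul' := fun _ _ => rfl }

lemma sliceAlt_apply (f : Fin b → P) (A : (B × P) [⋀^Fin (a + b)]→L[ℝ] ℂ) (h : Fin a → B) :
    sliceAlt f A h = A (Fin.append (fun i => (h i, (0 : P))) fun j => ((0 : B), f j)) := rfl

omit [FiniteDimensional ℝ B] [FiniteDimensional ℝ P] in
/-- Components along the span of the frame do not matter. -/
lemma alt_append_shear (bs : Module.Basis (Fin b) ℝ P) (A : (B × P) [⋀^Fin (a + b)]→L[ℝ] ℂ)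
    (h : Fin a → B) (k : Fin a → P) :
    A (Fin.append (fun i => (h i, k i)) fun j => ((0 : B), bs j)) =
      A (Fin.append (fun i => (h i, 0)) fun j => ((0 : B), bs j)) := by
  classical
  have key : ∀ s : Finset (Fin a),
      A (Fin.append (fun i => (h i, if i ∈ s then k i else 0)) fun j => ((0 : B), bs j)) =
        A (Fin.append (fun i => (h i, 0)) fun j => ((0 : B), bs j)) := by
    intro s
    induction s using Finset.induction_on with
    | empty => simp
    | insert i s hi ih =>
      rw [← ih]
      set u : Fin a → B × P := fun j => (h j, if j ∈ s then k j else 0) with hu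
      have h1 : (fun j => ((h j, if j ∈ insert i s then k j else 0) : B × P)) =
          Function.update u i (u i + ∑ t, (bs.repr (k i) t) • ((0 : B), bs t)) := by
        funext j
        by_cases hj : j = i
        · subst hj
          have : (∑ t, (bs.repr (k j) t) • ((0 : B), bs t)) = (0, k j) := by
            have := congrArg (LinearMap.inr ℝ B P) (bs.sum_repr (k j))
            simp only [map_sum, map_smul, LinearMap.inr_apply] at this
            exact this
          rw [Function.update_self, this]
          simp [hu, hi]
        · rw [Function.update_of_ne hj]
          simp [hu, hj]
      rw [h1, append_update_left, A.map_update_add]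
      have h2 : Function.update (Fin.append u fun j => ((0 : B), bs j)) (Fin.castAdd b i) (u i) =
          Fin.append u fun j => ((0 : B), bs j) := by
        rw [← append_update_left, Function.update_eq_self]
      rw [h2, add_eq_left]
      have hsum := A.toAlternatingMap.map_update_sum Finset.univ (Fin.castAdd b i)
        (fun t => (bs.repr (k i) t) • ((0 : B), bs t)) (Fin.append u fun j => ((0 : B), bs j))
      refine hsum.trans (Finset.sum_eq_zero fun t _ => ?_)
      refine (A.map_update_smul _ _ _ _).trans ?_
      have hne : Fin.castAdd b i ≠ Fin.natAdd a t := by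
        intro h
        have := congrArg Fin.val h
        simp at this
        omega
      rw [A.map_eq_zero_of_eq _ (i := Fin.castAdd b i) (j := Fin.natAdd a t) ?_ hne, smul_zero]
      rw [Function.update_self, Function.update_of_ne hne.symm, Fin.append_right]
  simpa using key Finset.univ

omit [FiniteDimensional ℝ P] in
lemma topForm_comp (bs : Module.Basis (Fin b) ℝ P) (η : P [⋀^Fin b]→L[ℝ] ℂ) (C : P →ₗ[ℝ] P) :
    η (fun j => C (bs j)) = LinearMap.det C • η bs := by
  have key : ∀ η' : P [⋀^Fin b]→ₗ[ℝ] ℝ, η' (C ∘ bs) = LinearMap.det C * η' bs := by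
    intro η'
    have h2 := DFunLike.congr_fun (AlternatingMap.eq_smul_basis_det bs η') (C ∘ bs)
    rw [AlternatingMap.smul_apply, Module.Basis.det_comp, Module.Basis.det_self] at h2
    rw [h2, smul_eq_mul]; ring
  apply Complex.ext
  · simpa [Function.comp_def] using key (Complex.reLm.compAlternatingMap η.toAlternatingMap)
  · simpa [Function.comp_def] using key (Complex.imLm.compAlternatingMap η.toAlternatingMap)

omit [FiniteDimensional ℝ B] [FiniteDimensional ℝ P] in
lemma alt_append_det (bs : Module.Basis (Fin b) ℝ P) (A : (B × P) [⋀^Fin (a + b)]→L[ℝ] ℂ)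
    (h : Fin a → B) (C : P →ₗ[ℝ] P) :
    A (Fin.append (fun i => (h i, 0)) fun j => ((0 : B), C (bs j))) =
      LinearMap.det C • A (Fin.append (fun i => (h i, 0)) fun j => ((0 : B), bs j)) :=
  topForm_comp bs (partialForm A h) C

omit [FiniteDimensional ℝ B] [FiniteDimensional ℝ P] in
lemma alt_append_shear_det (bs : Module.Basis (Fin b) ℝ P)
    (A : (B × P) [⋀^Fin (a + b)]→L[ℝ] ℂ) (h : Fin a → B) (k : Fin a → P) (C : P ≃ₗ[ℝ] P) :
    A (Fin.append (fun i => (h i, k i)) fun j => ((0 : B), C (bs j))) =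
      LinearMap.det (C : P →ₗ[ℝ] P) •
        A (Fin.append (fun i => (h i, 0)) fun j => ((0 : B), bs j)) := by
  rw [← alt_append_det]
  simpa using alt_append_shear (bs.map C) A h k

end Slices

section Extension

variable {W : Type*} [NormedAddCommGroup W] [NormedSpace ℝ W]

lemma exists_alt_extension {a : ℕ} : ∀ {b : ℕ} (f : Fin b → W) (α : Fin b → (W →L[ℝ] ℝ)),
    (∀ i j, α i (f j) = if i = j then 1 else 0) →
    ∃ L : (W [⋀^Fin a]→L[ℝ] ℂ) →ₗ[ℝ] (W [⋀^Fin (a + b)]→L[ℝ] ℂ),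
      ∀ ψ (h : Fin a → W), (∀ i j, α j (h i) = 0) → L ψ (Fin.append h f) = ψ h := by
  intro b
  induction b with
  | zero =>
    intro f α _
    refine ⟨LinearMap.id, fun ψ h _ => ?_⟩
    rw [Fin.append_right_nil h f rfl]
    rfl
  | succ b ih =>
    intro f α hα
    obtain ⟨L, hL⟩ := ih (fun j => f j.castSucc) (fun j => α j.castSucc) fun i j => by
      simpa using hα i.castSucc j.castSucc
    let β := α (Fin.last b)
    refine ⟨(-1 : ℝ) ^ (a + b) •
      ((ContinuousAlternatingMap.alternatizeUncurryFinCLM ℝ W ℂ (n := a + b)).toLinearMap ∘ₗ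
        (ContinuousLinearMap.smulRightL ℝ W (W [⋀^Fin (a + b)]→L[ℝ] ℂ) β).toLinearMap ∘ₗ L),
      fun ψ h hh => ?_⟩
    have hv : ∀ t : Fin (a + b + 1), t ≠ Fin.last (a + b) →
        β ((Fin.append h f : Fin (a + (b + 1)) → W) t) = 0 := by
      intro t ht
      refine Fin.addCases (motive := fun t : Fin (a + (b + 1)) => t ≠ Fin.last (a + b) →
        β ((Fin.append h f : Fin (a + (b + 1)) → W) t) = 0) (fun i _ => ?_) (fun j hj => ?_) t ht
      · rw [Fin.append_left]; exact hh i _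
      · rw [Fin.append_right]
        refine (hα _ _).trans (if_neg fun h' => hj ?_)
        rw [← h']; ext; simp
    have hlast : (Fin.append h f : Fin (a + (b + 1)) → W) (Fin.last (a + b)) =
        f (Fin.last b) := by
      have : (Fin.last (a + b) : Fin (a + (b + 1))) = Fin.natAdd a (Fin.last b) := by ext; simp
      rw [this, Fin.append_right]
    have hrem : (Fin.last (a + b)).removeNth (Fin.append h f : Fin (a + (b + 1)) → W) =
        Fin.append h fun j => f j.castSucc := by
      funext t
      rw [Fin.removeNth_last]
      refine Fin.addCases (fun i => ?_) (fun j => ?_) t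
      · rw [Fin.append_left]
        exact Fin.append_left h f i
      · rw [Fin.append_right]
        exact Fin.append_right h f j.castSucc
    have hsm : ∀ w v, (ContinuousLinearMap.smulRightL ℝ W (W [⋀^Fin (a + b)]→L[ℝ] ℂ) β) (L ψ)
        w v = β w • L ψ v := fun _ _ => rfl
    have hstep : ContinuousAlternatingMap.alternatizeUncurryFin
        ((ContinuousLinearMap.smulRightL ℝ W (W [⋀^Fin (a + b)]→L[ℝ] ℂ) β) (L ψ))
        (Fin.append h f : Fin (a + (b + 1)) → W) = (-1 : ℝ) ^ (a + b) • ψ h := by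
      rw [ContinuousAlternatingMap.alternatizeUncurryFin_apply,
        Finset.sum_eq_single (Fin.last (a + b))]
      · rw [hrem]
        rw [hsm, hlast]
        have : β (f (Fin.last b)) = 1 := by simpa using hα (Fin.last b) (Fin.last b)
        rw [this, one_smul, hL ψ h fun i j => hh i _]
        simp
      · intro t _ ht
        rw [hsm, hv t ht, zero_smul]
        simp
      · simp
    have := congrArg (fun z : ℂ => (-1 : ℝ) ^ (a + b) • z) hstep
    simp only [smul_smul, ← mul_pow] at this
    simpa using this

variable {B : Type*} [NormedAddCommGroup B] [NormedSpace ℝ B] [FiniteDimensional ℝ B]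
  {P : Type*} [NormedAddCommGroup P] [NormedSpace ℝ P] [FiniteDimensional ℝ P] {a b : ℕ}

lemma exists_sliceAlt_rightInverse (bs : Module.Basis (Fin b) ℝ P) :
    ∃ L : (B [⋀^Fin a]→L[ℝ] ℂ) →L[ℝ] ((B × P) [⋀^Fin (a + b)]→L[ℝ] ℂ),
      ∀ ψ, sliceAlt bs (L ψ) = ψ := by
  obtain ⟨L, hL⟩ := exists_alt_extension (W := B × P) (a := a) (fun j => ((0 : B), bs j))
    (fun j => (LinearMap.toContinuousLinearMap (bs.coord j)).comp (ContinuousLinearMap.snd ℝ B P))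
    (fun i j => by simp [Finsupp.single_apply, eq_comm])
  refine ⟨(LinearMap.toContinuousLinearMap L).comp
    (ContinuousAlternatingMap.compContinuousLinearMapCLM (ContinuousLinearMap.fst ℝ B P)),
    fun ψ => ?_⟩
  ext h
  rw [sliceAlt_apply]
  exact hL _ _ fun i j => by simp

end Extension

/-! ## Forms on manifolds in charts -/

section ChartForms

variable {E : Type*} [NormedAddCommGroup E] [NormedSpace ℝ E] [FiniteDimensional ℝ E]
  {H : Type*} [TopologicalSpace H] {I : ModelWithCorners ℝ E H}
  {M : Type*} [TopologicalSpace M] [ChartedSpace H M]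
  {W : Type*} [NormedAddCommGroup W] [NormedSpace ℝ W] [FiniteDimensional ℝ W] {n : ℕ}

open Classical in
/-- The form on `M` that is `f` in the chart `Θ`, extended by zero. -/
def chartPull (Θ : PartialDiffeomorph I 𝓘(ℝ, W) M W ∞) (f : W → W [⋀^Fin n]→L[ℝ] ℂ) :
    DForm I M n := fun x =>
  if x ∈ Θ.source then (f (Θ x)).compContinuousLinearMap (mfderiv I 𝓘(ℝ, W) Θ x) else 0

open Classical in
/-- The expression of a form in the chart `Θ`, extended by zero. -/
def chartPush (Θ : PartialDiffeomorph I 𝓘(ℝ, W) M W ∞) (φ : DForm I M n) :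
    W → W [⋀^Fin n]→L[ℝ] ℂ := fun z =>
  if z ∈ Θ.target then (φ (Θ.symm z)).compContinuousLinearMap (mfderiv 𝓘(ℝ, W) I Θ.symm z) else 0

variable [IsManifold I ∞ M] [I.Boundaryless]

/-- The transition from the preferred chart at `x₀` to `Θ`. -/
def chartTrans (Θ : PartialDiffeomorph I 𝓘(ℝ, W) M W ∞) (x₀ : M) : E → W :=
  fun z => Θ ((extChartAt I x₀).symm z)

/-- The domain of the transition from the preferred chart at `x₀` to `Θ`. -/
def chartTransDom (Θ : PartialDiffeomorph I 𝓘(ℝ, W) M W ∞) (x₀ : M) : Set E :=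
  (extChartAt I x₀).target ∩ (extChartAt I x₀).symm ⁻¹' Θ.source

lemma isOpen_chartTransDom (Θ : PartialDiffeomorph I 𝓘(ℝ, W) M W ∞) (x₀ : M) :
    IsOpen (chartTransDom Θ x₀) :=
  (continuousOn_extChartAt_symm x₀).isOpen_inter_preimage (isOpen_extChartAt_target x₀)
    Θ.open_source

lemma contDiffOn_chartTrans (Θ : PartialDiffeomorph I 𝓘(ℝ, W) M W ∞) (x₀ : M) :
    ContDiffOn ℝ ∞ (chartTrans Θ x₀) (chartTransDom Θ x₀) := by
  rw [← contMDiffOn_iff_contDiffOn]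
  exact Θ.contMDiffOn_toFun.comp ((contMDiffOn_extChartAt_symm x₀).mono inter_subset_left)
    inter_subset_right

lemma localForm_chartPull (Θ : PartialDiffeomorph I 𝓘(ℝ, W) M W ∞)
    (f : W → W [⋀^Fin n]→L[ℝ] ℂ) (x₀ : M) {z : E} (hz : z ∈ chartTransDom Θ x₀) :
    localForm (chartPull Θ f) x₀ z = (f (chartTrans Θ x₀ z)).compContinuousLinearMap
      (fderiv ℝ (chartTrans Θ x₀) z) := by
  have h1 : MDifferentiableAt 𝓘(ℝ, E) I (extChartAt I x₀).symm z :=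
    ((contMDiffOn_extChartAt_symm (n := ∞) x₀).contMDiffAt
      ((isOpen_extChartAt_target x₀).mem_nhds hz.1)).mdifferentiableAt (by simp)
  have h2 : MDifferentiableAt I 𝓘(ℝ, W) Θ ((extChartAt I x₀).symm z) :=
    Θ.mdifferentiableAt (by simp) hz.2
  have h3 : fderiv ℝ (chartTrans Θ x₀) z =
      (mfderiv I 𝓘(ℝ, W) Θ ((extChartAt I x₀).symm z)).comp
        (mfderiv 𝓘(ℝ, E) I (extChartAt I x₀).symm z) := by
    rw [← mfderiv_eq_fderiv]
    exact mfderiv_comp z h2 h1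
  rw [h3]
  have hz2 : (extChartAt I x₀).symm z ∈ Θ.source := hz.2
  simp only [localForm, chartPull, if_pos hz2]
  rfl

lemma chartPull_eq_zero (Θ : PartialDiffeomorph I 𝓘(ℝ, W) M W ∞) {K : Set W}
    {f : W → W [⋀^Fin n]→L[ℝ] ℂ} (hf : ∀ z, z ∉ K → f z = 0) {x : M}
    (hx : x ∉ Θ.symm '' (K ∩ Θ.target)) : chartPull Θ f x = 0 := by
  unfold chartPull
  split_ifs with h
  · rw [hf]
    · rfl
    · intro hK
      exact hx ⟨Θ x, ⟨hK, Θ.map_source h⟩, Θ.left_inv h⟩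
  · rfl

variable [T2Space M]

lemma isCompact_symm_image (Θ : PartialDiffeomorph I 𝓘(ℝ, W) M W ∞) {K : Set W}
    (hK : IsCompact K) (hKΘ : K ⊆ Θ.target) : IsCompact (Θ.symm '' (K ∩ Θ.target)) := by
  rw [inter_eq_left.2 hKΘ]
  exact hK.image_of_continuousOn (Θ.symm.contMDiffOn_toFun.continuousOn.mono hKΘ)

lemma contDiffAt_localForm_chartPull (Θ : PartialDiffeomorph I 𝓘(ℝ, W) M W ∞) {K : Set W}
    (hK : IsCompact K) (hKΘ : K ⊆ Θ.target) {f : W → W [⋀^Fin n]→L[ℝ] ℂ} (hf : IsTest K f)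
    (x₀ : M) {z : E} (hz : z ∈ (extChartAt I x₀).target) :
    ContDiffAt ℝ ∞ (localForm (chartPull Θ f) x₀) z ∧
      ((extChartAt I x₀).symm z ∉ Θ.symm '' (K ∩ Θ.target) →
        localForm (chartPull Θ f) x₀ =ᶠ[𝓝 z] fun _ => 0) := by
  have hcl := (isCompact_symm_image Θ hK hKΘ).isClosed
  have h0 : (extChartAt I x₀).symm z ∉ Θ.symm '' (K ∩ Θ.target) →
        localForm (chartPull Θ f) x₀ =ᶠ[𝓝 z] fun _ => 0 := by
    intro h
    have ho := (continuousOn_extChartAt_symm (I := I) x₀).isOpen_inter_preimage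
      (isOpen_extChartAt_target x₀) hcl.isOpen_compl
    filter_upwards [ho.mem_nhds ⟨hz, h⟩] with y hy
    simp only [localForm]
    rw [chartPull_eq_zero Θ hf.eq_zero hy.2]
    rfl
  refine ⟨?_, h0⟩
  by_cases h : (extChartAt I x₀).symm z ∈ Θ.symm '' (K ∩ Θ.target)
  · have hzd : z ∈ chartTransDom Θ x₀ := by
      refine ⟨hz, ?_⟩
      obtain ⟨w, hw, hwz⟩ := h
      change (extChartAt I x₀).symm z ∈ Θ.source
      rw [← hwz]
      exact Θ.symm.map_source hw.2
    have ho := (isOpen_chartTransDom Θ x₀).mem_nhds hzd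
    have hg := contDiffOn_chartTrans Θ x₀
    have : ContDiffOn ℝ ∞ (fun z => (f (chartTrans Θ x₀ z)).compContinuousLinearMap
      (fderiv ℝ (chartTrans Θ x₀) z)) (chartTransDom Θ x₀) :=
      (hf.smooth.comp_contDiffOn hg).alt_comp
        (hg.fderiv_of_isOpen (isOpen_chartTransDom Θ x₀) (by simp))
    refine (this.contDiffAt ho).congr_of_eventuallyEq ?_
    filter_upwards [ho] with y hy using localForm_chartPull Θ f x₀ hy
  · exact contDiffAt_const.congr_of_eventuallyEq (h0 h)

lemma chartPull_mem_testForms (Θ : PartialDiffeomorph I 𝓘(ℝ, W) M W ∞) {K : Set W}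
    (hK : IsCompact K) (hKΘ : K ⊆ Θ.target) {f : W → W [⋀^Fin n]→L[ℝ] ℂ} (hf : IsTest K f) :
    chartPull Θ f ∈ testForms I M n := by
  refine ⟨fun x₀ z hz =>
    (contDiffAt_localForm_chartPull Θ hK hKΘ hf x₀ hz).1.contDiffWithinAt, ?_⟩
  refine (isCompact_symm_image Θ hK hKΘ).of_isClosed_subset isClosed_closure ?_
  refine closure_minimal (fun x hx => ?_) (isCompact_symm_image Θ hK hKΘ).isClosed
  by_contra h
  exact hx (chartPull_eq_zero Θ hf.eq_zero h)

lemma tendsToZero_chartPull (Θ : PartialDiffeomorph I 𝓘(ℝ, W) M W ∞) {K : Set W}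
    (hK : IsCompact K) (hKΘ : K ⊆ Θ.target) {f : ℕ → W → W [⋀^Fin n]→L[ℝ] ℂ} (hf : NullSeq K f)
    (hf' : ∀ i, IsTest K (f i)) :
    TendsToZero (fun i => chartPull Θ (f i)) := by
  have hc := isCompact_symm_image Θ hK hKΘ
  refine ⟨⟨_, hc, fun i x hx => ?_⟩, fun x₀ L hL hLt j => ?_⟩
  · by_contra h
    exact hx (chartPull_eq_zero Θ (hf' i).eq_zero h)
  have hLK : IsCompact (L ∩ (extChartAt I x₀).symm ⁻¹' (Θ.symm '' (K ∩ Θ.target))) :=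
    ((continuousOn_extChartAt_symm x₀).mono hLt).preimage_isClosed_of_isClosed hL.isClosed
      hc.isClosed |> fun h => hL.of_isClosed_subset h inter_subset_left
  have hsub : L ∩ (extChartAt I x₀).symm ⁻¹' (Θ.symm '' (K ∩ Θ.target)) ⊆ chartTransDom Θ x₀ := by
    rintro z ⟨hz, w, hw, hwz⟩
    refine ⟨hLt hz, ?_⟩
    change (extChartAt I x₀).symm z ∈ Θ.source
    rw [← hwz]
    exact Θ.symm.map_source hw.2
  have hg := contDiffOn_chartTrans Θ x₀
  have ho := isOpen_chartTransDom Θ x₀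
  obtain ⟨C, hC, hb⟩ := exists_iteratedFDeriv_bound ho hg
    ((hg.fderiv_of_isOpen ho (m := ∞) (by simp)).altPullCLM (n := n)) hLK hsub j
  rw [Metric.tendstoUniformlyOn_iff]
  intro ε hε
  have h1 : ∀ᶠ i in atTop, ∀ m ∈ Finset.range (j + 1), ∀ x,
      ‖iteratedFDeriv ℝ m (f i) x‖ ≤ ε / (C + 1) :=
    (Filter.eventually_all_finset _).2 fun m _ => hf.small m _ (by positivity)
  filter_upwards [h1] with i hi z hz
  rw [dist_zero_left]
  by_cases h : (extChartAt I x₀).symm z ∈ Θ.symm '' (K ∩ Θ.target)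
  · have hzd := hsub ⟨hz, h⟩
    have heq : localForm (chartPull Θ (f i)) x₀ =ᶠ[𝓝 z] fun z =>
        (ContinuousAlternatingMap.compContinuousLinearMapCLM (fderiv ℝ (chartTrans Θ x₀) z))
          (f i (chartTrans Θ x₀ z)) := by
      filter_upwards [ho.mem_nhds hzd] with y hy using localForm_chartPull Θ (f i) x₀ hy
    rw [(heq.iteratedFDeriv ℝ j).eq_of_nhds]
    refine (hb (f i) z (ε / (C + 1)) ⟨hz, h⟩ (hf' i).smooth.contDiffAt (by positivity)
      fun m hm => hi m (Finset.mem_range.2 (by omega)) _).trans_lt ?_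
    rw [mul_div_assoc', div_lt_iff₀ (by positivity)]
    nlinarith
  · have h0 := (contDiffAt_localForm_chartPull Θ hK hKΘ (hf' i) x₀ (hLt hz)).2 h
    rw [(h0.iteratedFDeriv ℝ j).eq_of_nhds]
    simpa [iteratedFDeriv_fun_zero] using hε

lemma Current.eval_of_mem (T : Current I M n) {φ : DForm I M n} (h : φ ∈ testForms I M n) :
    T.eval φ = T.toLinearMap ⟨φ, h⟩ := by
  unfold Current.eval
  rw [dif_pos h]

lemma chartPull_add (Θ : PartialDiffeomorph I 𝓘(ℝ, W) M W ∞) (f g : W → W [⋀^Fin n]→L[ℝ] ℂ) :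
    chartPull Θ (f + g) = chartPull Θ f + chartPull Θ g := by
  funext x
  simp only [chartPull, Pi.add_apply]
  split_ifs
  · rfl
  · simp

lemma chartPull_smul (Θ : PartialDiffeomorph I 𝓘(ℝ, W) M W ∞) (c : ℂ)
    (f : W → W [⋀^Fin n]→L[ℝ] ℂ) :
    chartPull Θ (fun x => c • f x) = c • chartPull Θ f := by
  funext x
  simp only [chartPull, Pi.smul_apply]
  split_ifs
  · rfl
  · exact (smul_zero (A := E [⋀^Fin n]→L[ℝ] ℂ) c).symm

/-- A current, in a chart. -/
lemma Current.isTestFunctional (T : Current I M n) (Θ : PartialDiffeomorph I 𝓘(ℝ, W) M W ∞)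
    {K : Set W} (hK : IsCompact K) (hKΘ : K ⊆ Θ.target) :
    IsTestFunctional K (fun f => T.eval (chartPull Θ f)) := by
  have hm : ∀ {f}, IsTest K f → chartPull Θ f ∈ testForms I M n :=
    fun hf => chartPull_mem_testForms Θ hK hKΘ hf
  refine ⟨fun f g hf hg => ?_, fun c f hf => ?_, fun x hx => ?_⟩
  · rw [T.eval_of_mem (hm (hf.add hg)), T.eval_of_mem (hm hf), T.eval_of_mem (hm hg), ← map_add]
    congr 1
    exact Subtype.ext (chartPull_add Θ f g)
  · have h2 : chartPull Θ (fun x => c • f x) ∈ testForms I M n := by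
      rw [chartPull_smul]; exact (testForms I M n).smul_mem c (hm hf)
    rw [T.eval_of_mem h2, T.eval_of_mem (hm hf), ← smul_eq_mul, ← map_smul]
    congr 1
    exact Subtype.ext (chartPull_smul Θ c f)
  · obtain ⟨N, hN⟩ := eventually_atTop.1 hx.test
    have hx' : NullSeq K fun i => x (i + N) := hx.comp_tendsto (tendsto_add_atTop_nat N)
    have ht : ∀ i, IsTest K (x (i + N)) := fun i => hN _ (by omega)
    have := T.continuous' (fun i => ⟨_, hm (ht i)⟩) (tendsToZero_chartPull Θ hK hKΘ hx' ht)
    rw [← tendsto_add_atTop_iff_nat N]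
    refine this.congr fun i => ?_
    rw [T.eval_of_mem (hm (ht i))]

/-- The transition from `Θ` to the preferred chart at `x₀`. -/
def chartTransInv (Θ : PartialDiffeomorph I 𝓘(ℝ, W) M W ∞) (x₀ : M) : W → E :=
  fun z => extChartAt I x₀ (Θ.symm z)

/-- The domain of the transition from `Θ` to the preferred chart at `x₀`. -/
def chartTransInvDom (Θ : PartialDiffeomorph I 𝓘(ℝ, W) M W ∞) (x₀ : M) : Set W :=
  Θ.target ∩ Θ.symm ⁻¹' (extChartAt I x₀).source

lemma isOpen_chartTransInvDom (Θ : PartialDiffeomorph I 𝓘(ℝ, W) M W ∞) (x₀ : M) :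
    IsOpen (chartTransInvDom Θ x₀) :=
  Θ.symm.contMDiffOn_toFun.continuousOn.isOpen_inter_preimage Θ.open_target
    (isOpen_extChartAt_source x₀)

lemma contDiffOn_chartTransInv (Θ : PartialDiffeomorph I 𝓘(ℝ, W) M W ∞) (x₀ : M) :
    ContDiffOn ℝ ∞ (chartTransInv Θ x₀) (chartTransInvDom Θ x₀) := by
  rw [← contMDiffOn_iff_contDiffOn]
  refine (contMDiffOn_extChartAt (I := I) (x := x₀) (n := ∞)).comp
    (Θ.symm.contMDiffOn_toFun.mono inter_subset_left) fun z hz => ?_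
  simpa using hz.2

lemma chartPush_eq_localForm (Θ : PartialDiffeomorph I 𝓘(ℝ, W) M W ∞) (φ : DForm I M n)
    (x₀ : M) {z : W} (hz : z ∈ chartTransInvDom Θ x₀) :
    chartPush Θ φ z = (localForm φ x₀ (chartTransInv Θ x₀ z)).compContinuousLinearMap
      (fderiv ℝ (chartTransInv Θ x₀) z) := by
  have ho := isOpen_chartTransInvDom Θ x₀
  have hz2 : Θ.symm z ∈ (extChartAt I x₀).source := hz.2
  have ht : chartTransInv Θ x₀ z ∈ (extChartAt I x₀).target := (extChartAt I x₀).map_source hz2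
  have hl : (extChartAt I x₀).symm (chartTransInv Θ x₀ z) = Θ.symm z :=
    (extChartAt I x₀).left_inv hz2
  have h1 : MDifferentiableAt 𝓘(ℝ, E) I (extChartAt I x₀).symm (chartTransInv Θ x₀ z) :=
    ((contMDiffOn_extChartAt_symm (n := ∞) x₀).contMDiffAt
      ((isOpen_extChartAt_target x₀).mem_nhds ht)).mdifferentiableAt (by simp)
  have h2 : MDifferentiableAt 𝓘(ℝ, W) 𝓘(ℝ, E) (chartTransInv Θ x₀) z :=
    (((contDiffOn_chartTransInv Θ x₀).contDiffAt (ho.mem_nhds hz)).differentiableAt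
      (by simp)).mdifferentiableAt
  have h3 : mfderiv 𝓘(ℝ, W) I Θ.symm z =
      (mfderiv 𝓘(ℝ, E) I (extChartAt I x₀).symm (chartTransInv Θ x₀ z)).comp
        (mfderiv 𝓘(ℝ, W) 𝓘(ℝ, E) (chartTransInv Θ x₀) z) := by
    have heq : (Θ.symm : W → M) =ᶠ[𝓝 z] (extChartAt I x₀).symm ∘ chartTransInv Θ x₀ := by
      filter_upwards [ho.mem_nhds hz] with y hy
      exact ((extChartAt I x₀).left_inv hy.2).symm
    rw [heq.mfderiv_eq]
    exact mfderiv_comp z h1 h2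
  simp only [chartPush, if_pos hz.1, localForm]
  rw [h3, mfderiv_eq_fderiv, hl]
  rfl

/-- Localized expressions of smooth forms are test functions. -/
lemma isTest_smul_chartPush (Θ : PartialDiffeomorph I 𝓘(ℝ, W) M W ∞) {K : Set W}
    (hK : IsCompact K) (hKΘ : K ⊆ Θ.target) {χ : W → ℝ} (hχ : ContDiffOn ℝ ∞ χ Θ.target)
    {φ : DForm I M n} (hφ : SmoothForm φ) (h0 : ∀ z, z ∉ K → χ z • chartPush Θ φ z = 0) :
    IsTest K (fun z => χ z • chartPush Θ φ z) := by
  refine ⟨contDiff_iff_contDiffAt.2 fun z => ?_, h0⟩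
  by_cases hz : z ∈ K
  · have hzt := hKΘ hz
    have hzd : z ∈ chartTransInvDom Θ (Θ.symm z) := ⟨hzt, mem_extChartAt_source _⟩
    have ho := isOpen_chartTransInvDom Θ (Θ.symm z)
    have hg := contDiffOn_chartTransInv Θ (Θ.symm z)
    have h1 := ((hφ (Θ.symm z)).comp hg fun y hy => (extChartAt I _).map_source hy.2).alt_comp
      (hg.fderiv_of_isOpen ho (m := ∞) (by simp))
    have h2 := (hχ.mono inter_subset_left).smul h1
    refine (h2.contDiffAt (ho.mem_nhds hzd)).congr_of_eventuallyEq ?_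
    filter_upwards [ho.mem_nhds hzd] with y hy
    rw [chartPush_eq_localForm Θ φ _ hy]
    rfl
  · refine contDiffAt_const (c := 0) |>.congr_of_eventuallyEq ?_
    filter_upwards [hK.isClosed.isOpen_compl.mem_nhds hz] with y hy using h0 y hy

lemma nullSeq_smul_chartPush (Θ : PartialDiffeomorph I 𝓘(ℝ, W) M W ∞) {K : Set W}
    (hK : IsCompact K) (hKΘ : K ⊆ Θ.target) {χ : W → ℝ} (hχ : ContDiffOn ℝ ∞ χ Θ.target)
    {φ : ℕ → DForm I M n} (hφ : ∀ i, SmoothForm (φ i)) (hφ0 : TendsToZero φ)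
    (h0 : ∀ i z, z ∉ K → χ z • chartPush Θ (φ i) z = 0) :
    NullSeq K (fun i z => χ z • chartPush Θ (φ i) z) := by
  have ht := fun i => isTest_smul_chartPush Θ hK hKΘ hχ (hφ i) (h0 i)
  refine ⟨Eventually.of_forall ht, fun j ε hε => ?_⟩
  have hloc : ∀ z ∈ K, ∃ U ∈ 𝓝 z, ∀ᶠ i in atTop, ∀ y ∈ U,
      ‖iteratedFDeriv ℝ j (fun z => χ z • chartPush Θ (φ i) z) y‖ ≤ ε := by
    intro z hz
    set x₀ := Θ.symm z with hx₀
    have hzd : z ∈ chartTransInvDom Θ x₀ := ⟨hKΘ hz, mem_extChartAt_source _⟩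
    have ho := isOpen_chartTransInvDom Θ x₀
    have hg := contDiffOn_chartTransInv Θ x₀
    obtain ⟨U, hU, hUz, hUd⟩ := exists_compact_subset ho hzd
    have hM : ContDiffOn ℝ ∞ (fun z => χ z •
        (ContinuousAlternatingMap.compContinuousLinearMapCLM (fderiv ℝ (chartTransInv Θ x₀) z) :
        (E [⋀^Fin n]→L[ℝ] ℂ) →L[ℝ] (W [⋀^Fin n]→L[ℝ] ℂ))) (chartTransInvDom Θ x₀) :=
      contDiffOn_clm_apply.2 fun A => (hχ.mono inter_subset_left).smul
        ((contDiffOn_const (c := A)).alt_comp (hg.fderiv_of_isOpen ho (m := ∞) (by simp)))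
    obtain ⟨C, hC, hb⟩ := exists_iteratedFDeriv_bound ho hg hM hU hUd j
    have hL : IsCompact (chartTransInv Θ x₀ '' U) :=
      hU.image_of_continuousOn (hg.continuousOn.mono hUd)
    have hLt : chartTransInv Θ x₀ '' U ⊆ (extChartAt I x₀).target := by
      rintro _ ⟨y, hy, rfl⟩
      exact (extChartAt I x₀).map_source (hUd hy).2
    have h1 : ∀ᶠ i in atTop, ∀ m ∈ Finset.range (j + 1), ∀ y ∈ chartTransInv Θ x₀ '' U,
        ‖iteratedFDeriv ℝ m (localForm (φ i) x₀) y‖ ≤ ε / (C + 1) := by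
      refine (Filter.eventually_all_finset _).2 fun m _ => ?_
      have := hφ0.2 x₀ _ hL hLt m
      rw [Metric.tendstoUniformlyOn_iff] at this
      filter_upwards [this (ε / (C + 1)) (by positivity)] with i hi y hy
      simpa using (hi y hy).le
    refine ⟨interior U, isOpen_interior.mem_nhds hUz, ?_⟩
    filter_upwards [h1] with i hi y hy
    have hyU := interior_subset hy
    have hyd := hUd hyU
    have heq : (fun z => χ z • chartPush Θ (φ i) z) =ᶠ[𝓝 y] fun z => (χ z •
        (ContinuousAlternatingMap.compContinuousLinearMapCLM (fderiv ℝ (chartTransInv Θ x₀) z) :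
        (E [⋀^Fin n]→L[ℝ] ℂ) →L[ℝ] (W [⋀^Fin n]→L[ℝ] ℂ)))
          (localForm (φ i) x₀ (chartTransInv Θ x₀ z)) := by
      filter_upwards [ho.mem_nhds hyd] with w hw
      rw [chartPush_eq_localForm Θ (φ i) _ hw]
      rfl
    rw [(heq.iteratedFDeriv ℝ j).eq_of_nhds]
    refine (hb _ y (ε / (C + 1)) hyU ?_ (by positivity)
      fun m hm => hi m (Finset.mem_range.2 (by omega)) _ ⟨y, hyU, rfl⟩).trans ?_
    · exact ((hφ i) x₀).contDiffAt ((isOpen_extChartAt_target x₀).mem_nhds (hLt ⟨y, hyU, rfl⟩))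
    rw [mul_div_assoc', div_le_iff₀ (by positivity)]
    nlinarith
  choose! U hU hUe using hloc
  obtain ⟨t, htK, hcov⟩ := hK.elim_nhds_subcover U hU
  filter_upwards [(Filter.eventually_all_finset t).2 fun z hz => hUe z (htK z hz)] with i hi y
  by_cases hy : y ∈ K
  · obtain ⟨z, hz, hyz⟩ := mem_iUnion₂.1 (hcov hy)
    exact hi z hz y hyz
  · rw [(ht i).iteratedFDeriv_eq_zero hK.isClosed j hy]
    simpa using hε.le

lemma chartPull_chartPush (Θ : PartialDiffeomorph I 𝓘(ℝ, W) M W ∞) (φ : DForm I M n) {x : M}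
    (hx : x ∈ Θ.source) : chartPull Θ (chartPush Θ φ) x = φ x := by
  have hz : Θ x ∈ Θ.target := Θ.map_source hx
  have hl : Θ.symm (Θ x) = x := Θ.left_inv hx
  have h1 : MDifferentiableAt 𝓘(ℝ, W) I Θ.symm (Θ x) := Θ.symm.mdifferentiableAt (by simp) hz
  have h2 : MDifferentiableAt I 𝓘(ℝ, W) Θ x := Θ.mdifferentiableAt (by simp) hx
  have h3 : (mfderiv 𝓘(ℝ, W) I Θ.symm (Θ x)).comp (mfderiv I 𝓘(ℝ, W) Θ x) =
      ContinuousLinearMap.id ℝ (TangentSpace I x) := by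
    rw [← mfderiv_comp x h1 h2, ← mfderiv_id]
    refine Filter.EventuallyEq.mfderiv_eq ?_
    filter_upwards [Θ.open_source.mem_nhds hx] with y hy using Θ.left_inv hy
  simp only [chartPull, if_pos hx, chartPush, if_pos hz]
  ext v
  change φ (Θ.symm (Θ x)) (fun i => ((mfderiv 𝓘(ℝ, W) I Θ.symm (Θ x)).comp
    (mfderiv I 𝓘(ℝ, W) Θ x)) (v i)) = _
  rw [h3, hl]
  rfl

end ChartForms

/-! ## Pull-backs in smooth families -/

section FamilyPull

variable {T : Type*} [NormedAddCommGroup T] [NormedSpace ℝ T] [FiniteDimensional ℝ T]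
  {E : Type*} [NormedAddCommGroup E] [NormedSpace ℝ E]
  {E' : Type*} [NormedAddCommGroup E'] [NormedSpace ℝ E']
  {V : Type*} [NormedAddCommGroup V] [NormedSpace ℝ V]
  {V' : Type*} [NormedAddCommGroup V'] [NormedSpace ℝ V']

lemma norm_iteratedFDeriv_slice_le {F : T × E → V} {t : T} {x : E}
    (hF : ContDiff ℝ ∞ F) (j : ℕ) :
    ‖iteratedFDeriv ℝ j (fun y => F (t, y)) x‖ ≤ ‖iteratedFDeriv ℝ j F (t, x)‖ := by
  have h1 : ContDiff ℝ ∞ fun p : T × E => F (((t, 0) : T × E) + p) :=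
    hF.comp (contDiff_const.add contDiff_id)
  have h2 : (fun y => F (t, y)) = (fun p : T × E => F (((t, 0) : T × E) + p)) ∘
      ContinuousLinearMap.inr ℝ T E := by
    funext y; simp
  rw [h2, ContinuousLinearMap.iteratedFDeriv_comp_right _ h1 x (by exact_mod_cast le_top),
    iteratedFDeriv_comp_add_left]
  refine (ContinuousMultilinearMap.norm_compContinuousLinearMap_le _ _).trans ?_
  simp only [ContinuousLinearMap.inr_apply, Prod.mk_add_mk, add_zero, zero_add]
  refine mul_le_of_le_one_right (norm_nonneg _) (Finset.prod_le_one (fun _ _ => norm_nonneg _)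
    fun _ _ => ContinuousLinearMap.norm_inr_le_one ℝ T E)

lemma nullSeq_pull_family {H : T × E → E'} (hH : ContDiff ℝ ∞ H) {M : T × E → V →L[ℝ] V'}
    (hM : ContDiff ℝ ∞ M) {θ : ℕ → T} {θ₀ : T} (hθ : Tendsto θ atTop (𝓝 θ₀)) {K : Set E'}
    {K' : Set E} (hK' : IsCompact K') {f : ℕ → E' → V} {f₀ : E' → V} (hf₀ : IsTest K f₀)
    (hf : NullSeq K (fun n => f n - f₀)) {y : ℕ → E → V'} {y₀ : E → V'} (hy₀ : IsTest K' y₀)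
    (hy : ∀ᶠ n in atTop, IsTest K' (y n)) {U : Set E} (hU : IsOpen U) (hKU : K' ⊆ U)
    (he : ∀ᶠ n in atTop, ∀ x ∈ U, y n x = M (θ n, x) (f n (H (θ n, x))))
    (he₀ : ∀ x ∈ U, y₀ x = M (θ₀, x) (f₀ (H (θ₀, x)))) :
    NullSeq K' (fun n => y n - y₀) := by
  refine ⟨hy.mono fun n h => h.sub hy₀, fun j ε hε => ?_⟩
  have hF : ContDiff ℝ ∞ (Function.uncurry fun (t : T) (x : E) => M (t, x) (f₀ (H (t, x)))) :=
    hM.clm_apply (hf₀.smooth.comp hH)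
  obtain ⟨C, hC, hb⟩ := exists_iteratedFDeriv_bound isOpen_univ hH.contDiffOn hM.contDiffOn
    ((isCompact_closedBall θ₀ 1).prod hK') (subset_univ _) j
  have h1 : ∀ᶠ n in atTop, ∀ m ∈ Finset.range (j + 1), ∀ x,
      ‖iteratedFDeriv ℝ m (f n - f₀) x‖ ≤ ε / 2 / (C + 1) :=
    (Filter.eventually_all_finset _).2 fun m _ => hf.small m _ (by positivity)
  filter_upwards [hy, he, eventually_iteratedFDeriv_sub_le hF hθ hK' j (half_pos hε), h1, hf.test,
    hθ.eventually (Metric.closedBall_mem_nhds θ₀ one_pos)] with n hyn hen hn h1n hfn hθn x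
  by_cases hx : x ∈ K'
  · have heq : y n - y₀ =ᶠ[𝓝 x] ((fun x => M (θ n, x) (f₀ (H (θ n, x)))) -
        fun x => M (θ₀, x) (f₀ (H (θ₀, x)))) +
        fun x => M (θ n, x) ((f n - f₀) (H (θ n, x))) := by
      filter_upwards [hU.mem_nhds (hKU hx)] with z hz
      simp only [Pi.sub_apply, Pi.add_apply, hen z hz, he₀ z hz, map_sub]
      abel
    have hs1 : ContDiff ℝ ∞ fun p : T × E => M p ((f n - f₀) (H p)) :=
      hM.clm_apply (hfn.smooth.comp hH)
    have hs2 : ∀ t, ContDiff ℝ ∞ fun x : E => M (t, x) (f₀ (H (t, x))) := fun t =>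
      hF.comp (contDiff_const.prodMk contDiff_id)
    have hj : ((j : ℕ) : WithTop ℕ∞) ≤ ∞ := by exact_mod_cast le_top
    have hs3 : ContDiff ℝ ∞ fun x : E => M (θ n, x) ((f n - f₀) (H (θ n, x))) :=
      hs1.comp (contDiff_const.prodMk contDiff_id)
    have hs4 : ContDiff ℝ ∞ ((fun x : E => M (θ n, x) (f₀ (H (θ n, x)))) -
        fun x => M (θ₀, x) (f₀ (H (θ₀, x)))) := (hs2 (θ n)).sub (hs2 θ₀)
    rw [(heq.iteratedFDeriv ℝ j).eq_of_nhds, iteratedFDeriv_add_apply (hs4.contDiffAt.of_le hj) (hs3.contDiffAt.of_le hj)]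
    refine (norm_add_le _ _).trans ?_
    have h2 := (norm_iteratedFDeriv_slice_le (t := θ n) (x := x) hs1 j).trans
      (hb (f n - f₀) (θ n, x) (ε / 2 / (C + 1)) ⟨hθn, hx⟩ hfn.smooth.contDiffAt (by positivity)
        fun m hm => h1n m (Finset.mem_range.2 (by omega)) _)
    have h3 : C * (ε / 2 / (C + 1)) ≤ ε / 2 := by
      rw [mul_div_assoc', div_le_iff₀ (by positivity)]
      nlinarith
    have h4 := hn x hx
    linarith
  · rw [(hyn.sub hy₀).iteratedFDeriv_eq_zero hK'.isClosed j hx]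
    simpa using hε.le

lemma exists_cutoff [FiniteDimensional ℝ E] {C U : Set E} (hC : IsCompact C) (hU : IsOpen U)
    (hCU : C ⊆ U) : ∃ (χ : E → ℝ) (L : Set E), IsTest L χ ∧ IsCompact L ∧ L ⊆ U ∧
      ∃ N, IsOpen N ∧ C ⊆ N ∧ N ⊆ L ∧ ∀ x ∈ N, χ x = 1 := by
  obtain ⟨L, hL, hCL, hLU⟩ := exists_compact_between hC hU hCU
  obtain ⟨f, hf1, hf0, -⟩ := exists_contMDiffMap_one_nhds_of_subset_interior 𝓘(ℝ, E)
    (n := (⊤ : ℕ∞)) hC.isClosed hCL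
  obtain ⟨N, hN, hCN, hN1⟩ := eventually_nhdsSet_iff_exists.1 hf1
  exact ⟨f, L, ⟨f.contMDiff.contDiff, hf0⟩, hL, hLU, N ∩ interior L, hN.inter isOpen_interior,
    subset_inter hCN hCL, inter_subset_right.trans interior_subset, fun x hx => hN1 x hx.1⟩

lemma IsTest.smul_left {K : Set E} {f : E → V} (hf : IsTest K f) {χ : E → ℝ}
    (hχ : ContDiff ℝ ∞ χ) : IsTest K (fun x => χ x • f x) :=
  ⟨hχ.smul hf.smooth, fun x hx => by simp [hf.eq_zero x hx]⟩

end FamilyPull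

/-! ## Conjugation by dilations -/

section Conjugation

variable {B : Type*} [NormedAddCommGroup B] [NormedSpace ℝ B] [FiniteDimensional ℝ B]
  {F : Type*} [NormedAddCommGroup F] [NormedSpace ℝ F] [NormedSpace ℂ F] [IsScalarTower ℝ ℂ F]
  [FiniteDimensional ℝ F] {n : ℕ}

variable (B F) in
/-- Multiplication by `c` on the second factor. -/
def fibreDil (c : ℂ) : B × F →L[ℝ] B × F :=
  (ContinuousLinearMap.fst ℝ B F).prod (c • ContinuousLinearMap.snd ℝ B F)

@[simp] lemma fibreDil_apply (c : ℂ) (x : B × F) : fibreDil B F c x = (x.1, c • x.2) := rfl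

lemma fibreDil_inv_cancel {c : ℂ} (hc : c ≠ 0) (x : B × F) :
    fibreDil B F c⁻¹ (fibreDil B F c x) = x := by
  ext <;> simp [smul_smul, hc]

lemma fibreDil_cancel_inv {c : ℂ} (hc : c ≠ 0) (x : B × F) :
    fibreDil B F c (fibreDil B F c⁻¹ x) = x := by
  ext <;> simp [smul_smul, hc]

/-- A local diffeomorphism that is the identity on `Ω × {0}`, with differential inducing the
identity on the normal directions. -/
structure NormalizedAlong (Ω : Set B)
    (g : PartialDiffeomorph 𝓘(ℝ, B × F) 𝓘(ℝ, B × F) (B × F) (B × F) ∞) : Prop where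
  mem_source : ∀ p ∈ Ω, (p, (0 : F)) ∈ g.source
  map_zero : ∀ p ∈ Ω, g (p, 0) = (p, 0)
  deriv : ∀ p ∈ Ω, ∀ w, (fderiv ℝ g (p, 0) (0, w)).2 = w

lemma PartialDiffeomorph.contDiffOn {E E' : Type*} [NormedAddCommGroup E] [NormedSpace ℝ E]
    [NormedAddCommGroup E'] [NormedSpace ℝ E']
    (g : PartialDiffeomorph 𝓘(ℝ, E) 𝓘(ℝ, E') E E' ∞) : ContDiffOn ℝ ∞ g g.source :=
  g.contMDiffOn_toFun.contDiffOn

lemma PartialDiffeomorph.contDiffAt {E E' : Type*} [NormedAddCommGroup E] [NormedSpace ℝ E]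
    [NormedAddCommGroup E'] [NormedSpace ℝ E']
    (g : PartialDiffeomorph 𝓘(ℝ, E) 𝓘(ℝ, E') E E' ∞) {x : E} (hx : x ∈ g.source) :
    ContDiffAt ℝ ∞ g x :=
  g.contDiffOn.contDiffAt (g.open_source.mem_nhds hx)

lemma PartialDiffeomorph.differentiableAt {E E' : Type*} [NormedAddCommGroup E] [NormedSpace ℝ E]
    [NormedAddCommGroup E'] [NormedSpace ℝ E']
    (g : PartialDiffeomorph 𝓘(ℝ, E) 𝓘(ℝ, E') E E' ∞) {x : E} (hx : x ∈ g.source) :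
    DifferentiableAt ℝ g x :=
  (g.contDiffAt hx).differentiableAt (by simp)

lemma PartialDiffeomorph.fderiv_symm_comp {E E' : Type*} [NormedAddCommGroup E] [NormedSpace ℝ E]
    [NormedAddCommGroup E'] [NormedSpace ℝ E']
    (g : PartialDiffeomorph 𝓘(ℝ, E) 𝓘(ℝ, E') E E' ∞) {x : E} (hx : x ∈ g.source) :
    (fderiv ℝ g.symm (g x)).comp (fderiv ℝ g x) = ContinuousLinearMap.id ℝ E := by
  rw [← fderiv_comp x (g.symm.differentiableAt (g.map_source hx)) (g.differentiableAt hx),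
    ← fderiv_id (x := x)]
  refine Filter.EventuallyEq.fderiv_eq ?_
  filter_upwards [g.open_source.mem_nhds hx] with y hy using g.left_inv hy

lemma NormalizedAlong.symm {Ω : Set B} (hΩ : IsOpen Ω)
    {g : PartialDiffeomorph 𝓘(ℝ, B × F) 𝓘(ℝ, B × F) (B × F) (B × F) ∞}
    (hg : NormalizedAlong Ω g) : NormalizedAlong Ω g.symm := by
  have hs : ∀ p ∈ Ω, g.symm (p, (0 : F)) = (p, 0) := fun p hp => by
    have := g.left_inv (hg.mem_source p hp)
    rwa [hg.map_zero p hp] at this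
  refine ⟨fun p hp => ?_, hs, fun p hp w => ?_⟩
  · have := g.map_source (hg.mem_source p hp)
    rwa [hg.map_zero p hp] at this
  · have hms := hg.mem_source p hp
    have h1 := g.symm.fderiv_symm_comp (x := (p, 0)) (by
      have := g.map_source hms
      rwa [hg.map_zero p hp] at this)
    rw [hs p hp] at h1
    have h2 := DFunLike.congr_fun h1 (0, w)
    set v := fderiv ℝ g.symm (p, 0) (0, w) with hv
    have h3 : fderiv ℝ g (p, 0) v = (0, w) := h2
    have h4 : fderiv ℝ g (p, 0) (v.1, 0) = (v.1, 0) := by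
      have hd := g.differentiableAt hms
      have hc : HasFDerivAt (fun q : B => ((q, 0) : B × F)) (ContinuousLinearMap.inl ℝ B F) p :=
        (ContinuousLinearMap.inl ℝ B F).hasFDerivAt
      have h5 := (hd.hasFDerivAt.comp p hc).congr_of_eventuallyEq
        (f₁ := fun q : B => ((q, 0) : B × F)) (by
          filter_upwards [hΩ.mem_nhds hp] with q hq
          exact (hg.map_zero q hq).symm)
      exact DFunLike.congr_fun (h5.unique hc) v.1
    have h6 : v = (v.1, 0) + (0, v.2) := by simp
    rw [h6, map_add, h4] at h3
    have h7 := congrArg Prod.snd h3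
    simpa [hg.deriv p hp] using h7

open Classical in
/-- The pull-back of a form by `A_c ∘ g ∘ A_{1/c}`, extended by zero. -/
def conjPull (g : PartialDiffeomorph 𝓘(ℝ, B × F) 𝓘(ℝ, B × F) (B × F) (B × F) ∞) (c : ℂ)
    (f : B × F → (B × F) [⋀^Fin n]→L[ℝ] ℂ) : B × F → (B × F) [⋀^Fin n]→L[ℝ] ℂ := fun x =>
  if fibreDil B F c⁻¹ x ∈ g.source then
    (f (fibreDil B F c (g (fibreDil B F c⁻¹ x)))).compContinuousLinearMap
      (fderiv ℝ (fun y => fibreDil B F c (g (fibreDil B F c⁻¹ y))) x)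
  else 0

/-- The parameters describing a dilation factor near infinity. -/
def dilParam (c : ℂ) : ℝ × ℂ × ℂ := (‖c‖⁻¹, c / ‖c‖, (c / ‖c‖)⁻¹)

lemma exists_conj_family {Ω : Set B}
    {g : PartialDiffeomorph 𝓘(ℝ, B × F) 𝓘(ℝ, B × F) (B × F) (B × F) ∞}
    (hg : NormalizedAlong Ω g) {c : ℕ → ℂ} (hc : Tendsto (fun i => ‖c i‖) atTop atTop) {ξ : ℂ} (hξ0 : ξ ≠ 0)
    {L : Set (B × F)} (hL : IsCompact L) (hLΩ : L ⊆ Ω ×ˢ univ) :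
    ∃ H : (ℝ × ℂ × ℂ) × (B × F) → B × F, ContDiff ℝ ∞ H ∧
      (∀ x ∈ L, H ((0, ξ, ξ⁻¹), x) = x) ∧
      ∀ᶠ i in atTop, ∀ x ∈ L, fibreDil B F (c i)⁻¹ x ∈ g.source ∧
        fibreDil B F (c i) (g (fibreDil B F (c i)⁻¹ x)) = H (dilParam (c i), x) := by
  have hC : IsCompact ((fun x : B × F => (x.1, (0 : F))) '' L) :=
    hL.image (by fun_prop)
  have hCg : (fun x : B × F => (x.1, (0 : F))) '' L ⊆ g.source := by
    rintro _ ⟨x, hx, rfl⟩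
    exact hg.mem_source _ (hLΩ hx).1
  obtain ⟨χ, L', hχ, hL', hL'g, N, hN, hCN, hNL, hN1⟩ := exists_cutoff hC g.open_source hCg
  have hG : ContDiff ℝ ∞ (fun x => χ x • g x) := by
    rw [contDiff_iff_contDiffAt]
    intro x
    by_cases hx : x ∈ L'
    · exact hχ.smooth.contDiffAt.smul (g.contDiffAt (hL'g hx))
    · refine (contDiffAt_const (c := 0)).congr_of_eventuallyEq ?_
      filter_upwards [hL'.isClosed.isOpen_compl.mem_nhds hx] with y hy
      rw [hχ.eq_zero y hy, zero_smul]
  set G : B × F → B × F := fun x => χ x • g x with hGdef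
  have hG2 : ContDiff ℝ ∞ fun x => (G x).2 := contDiff_snd.comp hG
  have hGN : ∀ x ∈ N, G x = g x := fun x hx => by simp [hGdef, hN1 x hx]
  have hxN : ∀ x ∈ L, ((x.1, 0) : B × F) ∈ N := fun x hx => hCN ⟨x, hx, rfl⟩
  have hG0 : ∀ x ∈ L, G (x.1, 0) = (x.1, 0) := fun x hx => by
    rw [hGN _ (hxN x hx), hg.map_zero _ (hLΩ hx).1]
  refine ⟨fun p => ((G (p.2.1, p.1.1 • p.1.2.2 • p.2.2)).1,
    p.1.2.1 • hadamard (fun x => (G x).2) (p.1.1, (p.2.1, 0), (0, p.1.2.2 • p.2.2))), ?_, ?_, ?_⟩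
  · have h2 : ContDiff ℝ ∞ fun p : (ℝ × ℂ × ℂ) × (B × F) => p.1.2.2 • p.2.2 :=
      (by fun_prop : ContDiff ℝ ∞ fun p : (ℝ × ℂ × ℂ) × (B × F) => p.1.2.2).smul
        (by fun_prop : ContDiff ℝ ∞ fun p : (ℝ × ℂ × ℂ) × (B × F) => p.2.2)
    have h1 : ContDiff ℝ ∞ fun p : (ℝ × ℂ × ℂ) × (B × F) => p.1.1 • p.1.2.2 • p.2.2 :=
      (by fun_prop : ContDiff ℝ ∞ fun p : (ℝ × ℂ × ℂ) × (B × F) => p.1.1).smul h2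
    have h3 : ContDiff ℝ ∞ fun p : (ℝ × ℂ × ℂ) × (B × F) => p.2.1 := by fun_prop
    have h4 : ContDiff ℝ ∞ fun p : (ℝ × ℂ × ℂ) × (B × F) => p.1.1 := by fun_prop
    refine (contDiff_fst.comp (hG.comp (h3.prodMk h1))).prodMk ?_
    exact (by fun_prop : ContDiff ℝ ∞ fun p : (ℝ × ℂ × ℂ) × (B × F) => p.1.2.1).smul
      ((contDiff_hadamard hG2).comp
        (h4.prodMk ((h3.prodMk contDiff_const).prodMk (contDiff_const.prodMk h2))))
  · intro x hx
    have hxΩ := (hLΩ hx).1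
    have hd : fderiv ℝ (fun x => (G x).2) (x.1, 0) (0, ξ⁻¹ • x.2) = ξ⁻¹ • x.2 := by
      have h1 : (fun x => (G x).2) =ᶠ[𝓝 (x.1, (0 : F))] Prod.snd ∘ g := by
        filter_upwards [hN.mem_nhds (hxN x hx)] with y hy
        simp [hGN y hy]
      rw [h1.fderiv_eq, fderiv_comp _ differentiableAt_snd
        (g.differentiableAt (hg.mem_source _ hxΩ)), fderiv_snd]
      exact hg.deriv _ hxΩ _
    simp only [zero_smul, hG0 x hx, hadamard_zero, hd, smul_smul, mul_inv_cancel₀ hξ0, one_smul]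
  · have hct : Tendsto (fun i => (c i)⁻¹) atTop (𝓝 0) :=
      tendsto_inv₀_cobounded.comp (tendsto_norm_atTop_iff_cobounded.1 hc)
    have h1 : ∀ᶠ z in 𝓝 (0 : ℂ), ∀ x ∈ L, fibreDil B F z x ∈ N := by
      refine hL.eventually_forall_of_forall_eventually fun x hx => ?_
      have hcont : Continuous fun z : ℂ × (B × F) => fibreDil B F z.1 z.2 := by
        simp only [fibreDil_apply]; fun_prop
      refine hcont.continuousAt.eventually_mem (hN.mem_nhds ?_)
      simpa using hxN x hx
    filter_upwards [hct.eventually h1, hc.eventually_gt_atTop 0] with i hi hci x hx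
    have hxi := hi x hx
    refine ⟨hL'g (hNL hxi), ?_⟩
    have hc0 : c i ≠ 0 := norm_pos_iff.1 hci
    have hn0 : (‖c i‖ : ℂ) ≠ 0 := by exact_mod_cast hci.ne'
    have hsc : ‖c i‖⁻¹ • (c i / ‖c i‖)⁻¹ • x.2 = (c i)⁻¹ • x.2 := by
      rw [← smul_assoc, Complex.real_smul]
      congr 1
      push_cast
      field_simp
    have hsm := smul_hadamard hG2 ‖c i‖⁻¹ (x.1, 0) (0, (c i / ‖c i‖)⁻¹ • x.2)
    simp only [Prod.smul_mk, Prod.mk_add_mk, smul_zero, add_zero, zero_add, hG0 x hx, sub_zero,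
      hsc] at hsm
    have hg' : G (x.1, (c i)⁻¹ • x.2) = g (fibreDil B F (c i)⁻¹ x) := hGN _ hxi
    simp only [dilParam, hsc]
    rw [hg'] at hsm ⊢
    refine Prod.ext rfl ?_
    simp only [fibreDil_apply] at hsm ⊢
    have hcc : c i / ‖c i‖ = ‖c i‖⁻¹ • c i := by
      rw [Complex.real_smul]
      push_cast
      ring
    rw [← hsm, hcc, smul_assoc, smul_comm]

end Conjugation

section ConjugationLimits

variable {B : Type*} [NormedAddCommGroup B] [NormedSpace ℝ B] [FiniteDimensional ℝ B]
  {F : Type*} [NormedAddCommGroup F] [NormedSpace ℝ F] [NormedSpace ℂ F] [IsScalarTower ℝ ℂ F]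
  [FiniteDimensional ℝ F] {n : ℕ} {Ω : Set B}
  {g : PartialDiffeomorph 𝓘(ℝ, B × F) 𝓘(ℝ, B × F) (B × F) (B × F) ∞}
  {c : ℕ → ℂ} {ξ : ℂ}

lemma tendsto_dilParam (hc : Tendsto (fun i => ‖c i‖) atTop atTop)
    (hξ : Tendsto (fun i => c i / ‖c i‖) atTop (𝓝 ξ)) (hξ0 : ξ ≠ 0) :
    Tendsto (fun i => dilParam (c i)) atTop (𝓝 (0, ξ, ξ⁻¹)) :=
  (tendsto_inv_atTop_zero.comp hc).prodMk_nhds (hξ.prodMk_nhds (hξ.inv₀ hξ0))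

/-- The conjugates `A_c ∘ g ∘ A_{1/c}` map `K` into a neighbourhood of `K` for large `c`. -/
lemma eventually_conj_mem (hg : NormalizedAlong Ω g) (hc : Tendsto (fun i => ‖c i‖) atTop atTop)
    (hξ : Tendsto (fun i => c i / ‖c i‖) atTop (𝓝 ξ)) (hξ0 : ξ ≠ 0)
    {K U : Set (B × F)} (hK : IsCompact K) (hKΩ : K ⊆ Ω ×ˢ univ) (hU : IsOpen U) (hKU : K ⊆ U) :
    ∀ᶠ i in atTop, ∀ x ∈ K, fibreDil B F (c i)⁻¹ x ∈ g.source ∧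
      fibreDil B F (c i) (g (fibreDil B F (c i)⁻¹ x)) ∈ U := by
  obtain ⟨H, hH, hH0, hHe⟩ := exists_conj_family hg hc hξ0 hK hKΩ
  have h1 : ∀ᶠ θ in 𝓝 ((0, ξ, ξ⁻¹) : ℝ × ℂ × ℂ), ∀ x ∈ K, H (θ, x) ∈ U := by
    refine hK.eventually_forall_of_forall_eventually fun x hx => ?_
    refine hH.continuous.continuousAt.eventually_mem (hU.mem_nhds ?_)
    rw [hH0 x hx]
    exact hKU hx
  filter_upwards [hHe, (tendsto_dilParam hc hξ hξ0).eventually h1] with i h2 h3 x hx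
  exact ⟨(h2 x hx).1, (h2 x hx).2 ▸ h3 x hx⟩

lemma eventually_mem_of_conj_mem (hΩ : IsOpen Ω) (hg : NormalizedAlong Ω g)
    (hc : Tendsto (fun i => ‖c i‖) atTop atTop)
    (hξ : Tendsto (fun i => c i / ‖c i‖) atTop (𝓝 ξ)) (hξ0 : ξ ≠ 0)
    {K U : Set (B × F)} (hK : IsCompact K) (hKΩ : K ⊆ Ω ×ˢ univ) (hU : IsOpen U) (hKU : K ⊆ U) :
    ∀ᶠ i in atTop, ∀ x, fibreDil B F (c i)⁻¹ x ∈ g.source →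
      fibreDil B F (c i) (g (fibreDil B F (c i)⁻¹ x)) ∈ K → x ∈ U := by
  filter_upwards [eventually_conj_mem (hg.symm hΩ) hc hξ hξ0 hK hKΩ hU hKU,
    hc.eventually_gt_atTop 0] with i hi hci x hxs hx
  have hc0 : c i ≠ 0 := norm_pos_iff.1 hci
  have := (hi _ hx).2
  rw [fibreDil_inv_cancel hc0] at this
  rwa [show g.symm (g (fibreDil B F (c i)⁻¹ x)) = _ from g.left_inv hxs,
    fibreDil_cancel_inv hc0] at this

lemma isOpen_conj_dom (c : ℂ) : IsOpen {x : B × F | fibreDil B F c⁻¹ x ∈ g.source} :=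
  g.open_source.preimage (fibreDil B F c⁻¹).continuous

lemma contDiffOn_conj (c : ℂ) :
    ContDiffOn ℝ ∞ (fun x => fibreDil B F c (g (fibreDil B F c⁻¹ x)))
      {x : B × F | fibreDil B F c⁻¹ x ∈ g.source} :=
  (fibreDil B F c).contDiff.comp_contDiffOn
    (g.contDiffOn.comp (fibreDil B F c⁻¹).contDiff.contDiffOn fun _ h => h)

lemma conjPull_eq (c : ℂ) (f : B × F → (B × F) [⋀^Fin n]→L[ℝ] ℂ) :
    conjPull g c f = open Classical in fun x =>
      if x ∈ {x : B × F | fibreDil B F c⁻¹ x ∈ g.source} then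
        ContinuousAlternatingMap.compContinuousLinearMapCLM
          (fderiv ℝ (fun y => fibreDil B F c (g (fibreDil B F c⁻¹ y))) x)
          (f (fibreDil B F c (g (fibreDil B F c⁻¹ x)))) else 0 := rfl

/-- For large `c`, conjugated pull-back is continuous on test forms. -/
lemma eventually_conjPull_test (hΩ : IsOpen Ω) (hg : NormalizedAlong Ω g)
    (hc : Tendsto (fun i => ‖c i‖) atTop atTop)
    (hξ : Tendsto (fun i => c i / ‖c i‖) atTop (𝓝 ξ)) (hξ0 : ξ ≠ 0)
    {K K' : Set (B × F)} (hK : IsCompact K) (hK' : IsCompact K') (hKΩ' : K' ⊆ Ω ×ˢ univ)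
    (hKK : K ⊆ interior K') :
    ∀ᶠ i in atTop,
      (∀ f : B × F → (B × F) [⋀^Fin n]→L[ℝ] ℂ, IsTest K f → IsTest K' (conjPull g (c i) f)) ∧
      ∀ f : ℕ → B × F → (B × F) [⋀^Fin n]→L[ℝ] ℂ, NullSeq K f →
        NullSeq K' fun j => conjPull g (c i) (f j) := by
  have hKΩ := (hKK.trans interior_subset).trans hKΩ'
  filter_upwards [eventually_mem_of_conj_mem hΩ hg hc hξ hξ0 hK hKΩ isOpen_interior hKK,
    eventually_conj_mem hg hc hξ hξ0 hK' hKΩ' isOpen_univ (subset_univ _)] with i h1 h2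
  have hs := contDiffOn_conj (g := g) (c i)
  have hM := ContDiffOn.altPullCLM (n := n) (hs.fderiv_of_isOpen (isOpen_conj_dom (c i))
    (m := ∞) (by simp))
  simp only [conjPull_eq]
  exact ⟨fun f hf => hf.pull (isOpen_conj_dom _) hs hM hK'.isClosed (fun x hx => (h2 x hx).1)
      fun z hz hzK => interior_subset (h1 z hz hzK),
    fun f hf => hf.pull (isOpen_conj_dom _) hs hM hK' (fun x hx => (h2 x hx).1)
      fun z hz hzK => interior_subset (h1 z hz hzK)⟩

/-- Conjugated pull-backs tend to the identity. -/
lemma nullSeq_conjPull_sub (hΩ : IsOpen Ω) (hg : NormalizedAlong Ω g)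
    (hc : Tendsto (fun i => ‖c i‖) atTop atTop)
    (hξ : Tendsto (fun i => c i / ‖c i‖) atTop (𝓝 ξ)) (hξ0 : ξ ≠ 0)
    {K K' : Set (B × F)} (hK : IsCompact K) (hK' : IsCompact K') (hKΩ' : K' ⊆ Ω ×ˢ univ)
    (hKK : K ⊆ interior K') {f : ℕ → B × F → (B × F) [⋀^Fin n]→L[ℝ] ℂ}
    {f₀ : B × F → (B × F) [⋀^Fin n]→L[ℝ] ℂ} (hf₀ : IsTest K f₀)
    (hf : NullSeq K fun i => f i - f₀) (hft : ∀ᶠ i in atTop, IsTest K (f i)) :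
    NullSeq K' (fun i => conjPull g (c i) (f i) - f₀) := by
  obtain ⟨L, hL, hKL, hLΩ⟩ : ∃ L, IsCompact L ∧ K' ⊆ interior L ∧ L ⊆ Ω ×ˢ univ :=
    exists_compact_between hK' (hΩ.prod isOpen_univ) hKΩ'
  obtain ⟨H, hH, hH0, hHe⟩ := exists_conj_family hg hc hξ0 hL hLΩ
  have hD : ContDiff ℝ ∞ fun p : (ℝ × ℂ × ℂ) × (B × F) =>
      (fderiv ℝ H p).comp (ContinuousLinearMap.inr ℝ (ℝ × ℂ × ℂ) (B × F)) :=
    (hH.fderiv_right (m := ∞) (by simp)).clm_comp contDiff_const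
  have hDe : ∀ θ x, (fderiv ℝ H (θ, x)).comp (ContinuousLinearMap.inr ℝ (ℝ × ℂ × ℂ) (B × F)) =
      fderiv ℝ (fun y => H (θ, y)) x := fun θ x =>
    ((hH.differentiable (by simp) (θ, x)).hasFDerivAt.comp x
      (hasFDerivAt_prodMk_right θ x)).fderiv.symm
  refine nullSeq_pull_family hH (contDiffOn_univ.1 (ContDiffOn.altPullCLM (n := n) hD.contDiffOn))
    (tendsto_dilParam hc hξ hξ0) hK' hf₀ hf (hf₀.mono (hKK.trans interior_subset)) ?_
    isOpen_interior hKL ?_ ?_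
  · filter_upwards [hft, eventually_conjPull_test (n := n) hΩ hg hc hξ hξ0 hK hK' hKΩ' hKK]
      with i h1 h2 using h2.1 _ h1
  · filter_upwards [hHe] with i hi x hx
    have h1 := hi x (interior_subset hx)
    simp only [conjPull, if_pos h1.1]
    rw [h1.2, hDe]
    have : (fun y => fibreDil B F (c i) (g (fibreDil B F (c i)⁻¹ y))) =ᶠ[𝓝 x]
        fun y => H (dilParam (c i), y) := by
      filter_upwards [isOpen_interior.mem_nhds hx] with y hy using (hi y (interior_subset hy)).2
    rw [this.fderiv_eq]
    rfl
  · intro x hx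
    have : (fun y => H ((0, ξ, ξ⁻¹), y)) =ᶠ[𝓝 x] id := by
      filter_upwards [isOpen_interior.mem_nhds hx] with y hy using hH0 y (interior_subset hy)
    rw [hDe, this.fderiv_eq, fderiv_id, hH0 x (interior_subset hx)]
    ext v
    rfl

lemma eventually_conjPull_symm (hg : NormalizedAlong Ω g)
    (hc : Tendsto (fun i => ‖c i‖) atTop atTop)
    (hξ : Tendsto (fun i => c i / ‖c i‖) atTop (𝓝 ξ)) (hξ0 : ξ ≠ 0)
    {K : Set (B × F)} (hK : IsCompact K) (hKΩ : K ⊆ Ω ×ˢ univ) :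
    ∀ᶠ i in atTop, ∀ f : B × F → (B × F) [⋀^Fin n]→L[ℝ] ℂ, IsTest K f →
      conjPull g (c i) (conjPull g.symm (c i) f) = f := by
  filter_upwards [eventually_conj_mem hg hc hξ hξ0 hK hKΩ isOpen_univ (subset_univ _),
    hc.eventually_gt_atTop 0] with i h1 hci f hf
  have hc0 : c i ≠ 0 := norm_pos_iff.1 hci
  funext x
  by_cases hx : fibreDil B F (c i)⁻¹ x ∈ g.source
  · have ht : fibreDil B F (c i)⁻¹ (fibreDil B F (c i) (g (fibreDil B F (c i)⁻¹ x))) ∈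
        g.symm.source := by
      rw [fibreDil_inv_cancel hc0]
      exact g.map_source hx
    have hcomp : ∀ y, fibreDil B F (c i)⁻¹ y ∈ g.source →
        fibreDil B F (c i) (g.symm (fibreDil B F (c i)⁻¹
          (fibreDil B F (c i) (g (fibreDil B F (c i)⁻¹ y))))) = y := fun y hy => by
      rw [fibreDil_inv_cancel hc0, show g.symm (g (fibreDil B F (c i)⁻¹ y)) = _ from g.left_inv hy,
        fibreDil_cancel_inv hc0]
    have hd : (fderiv ℝ (fun y => fibreDil B F (c i) (g.symm (fibreDil B F (c i)⁻¹ y)))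
        (fibreDil B F (c i) (g (fibreDil B F (c i)⁻¹ x)))).comp
        (fderiv ℝ (fun y => fibreDil B F (c i) (g (fibreDil B F (c i)⁻¹ y))) x) =
        ContinuousLinearMap.id ℝ (B × F) := by
      have d1 := ((contDiffOn_conj (g := g) (c i)).contDiffAt
        ((isOpen_conj_dom (c i)).mem_nhds hx)).differentiableAt (by simp)
      have d2 := ((contDiffOn_conj (g := g.symm) (c i)).contDiffAt
        ((isOpen_conj_dom (c i)).mem_nhds ht)).differentiableAt (by simp)
      rw [← fderiv_comp x d2 d1, ← fderiv_id (x := x)]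
      refine Filter.EventuallyEq.fderiv_eq ?_
      filter_upwards [(isOpen_conj_dom (c i)).mem_nhds hx] with y hy using hcomp y hy
    rw [conjPull, if_pos hx, conjPull, if_pos ht, hcomp x hx]
    ext v
    have := fun j => DFunLike.congr_fun hd (v j)
    simp only [ContinuousLinearMap.comp_apply, ContinuousLinearMap.id_apply] at this
    simp only [ContinuousAlternatingMap.compContinuousLinearMap_apply, Function.comp_def, this]
  · rw [conjPull, if_neg hx, hf.eq_zero x fun h => hx (h1 x h).1]

end ConjugationLimits

/-! ## The linear model of a transverse intersection -/

/-- Linear data describing, near a point of `V`, the position of a submanifold (the image of `m`)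
relative to an embedding `δ` with `δ⁻¹ (range m) = ker pr`. -/
structure TransverseModel (B F P : Type) [NormedAddCommGroup B] [NormedSpace ℝ B] [NormedSpace ℂ B]
    [NormedAddCommGroup F] [NormedSpace ℝ F] [NormedSpace ℂ F]
    [NormedAddCommGroup P] [NormedSpace ℝ P] [NormedSpace ℂ P] where
  pr : B →L[ℝ] B
  δ : B →L[ℝ] F
  m : P →L[ℝ] F
  md : F →L[ℝ] P
  β : F →L[ℝ] B
  pr_smul : ∀ (c : ℂ) b, pr (c • b) = c • pr b
  δ_smul : ∀ (c : ℂ) b, δ (c • b) = c • δ b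
  m_smul : ∀ (c : ℂ) u, m (c • u) = c • m u
  pr_pr : ∀ b, pr (pr b) = pr b
  md_m : ∀ u, md (m u) = u
  β_m : ∀ u b, β (m u - δ (pr b)) = pr b
  m_md : ∀ w, m (md (w + δ (β w))) = w + δ (β w)
  m_md_δ : ∀ b, m (md (δ (b - pr b))) = δ (b - pr b)
  pr_β : ∀ w, pr (β w) = β w

namespace TransverseModel

variable {B F P : Type} [NormedAddCommGroup B] [NormedSpace ℝ B] [NormedSpace ℂ B]
  [IsScalarTower ℝ ℂ B] [FiniteDimensional ℝ B]
  [NormedAddCommGroup F] [NormedSpace ℝ F] [NormedSpace ℂ F] [IsScalarTower ℝ ℂ F]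
  [FiniteDimensional ℝ F]
  [NormedAddCommGroup P] [NormedSpace ℝ P] [NormedSpace ℂ P] [IsScalarTower ℝ ℂ P]
  [FiniteDimensional ℝ P] [MeasurableSpace P] [BorelSpace P] {μ : Measure P} [μ.IsAddHaarMeasure]
  (M : TransverseModel B F P) {a b : ℕ} (bs : Module.Basis (Fin b) ℝ P)

/-- Multiplication by `c` on the range of `π`, the identity on the kernel. -/
def dil (c : ℂ) : B →L[ℝ] B := ContinuousLinearMap.id ℝ B - M.pr + c • M.pr

@[simp] lemma dil_apply (c : ℂ) (x : B) : M.dil c x = x - M.pr x + c • M.pr x := rfl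

lemma dil_dil (c c' : ℂ) (x : B) : M.dil c (M.dil c' x) = M.dil (c * c') x := by
  simp only [dil_apply, map_add, map_sub, M.pr_smul, M.pr_pr, smul_smul, sub_self, zero_add]
  abel

lemma dil_one (x : B) : M.dil 1 x = x := by simp

lemma sub_pr_dil (c : ℂ) (x : B) : M.dil c x - M.pr (M.dil c x) = x - M.pr x := by
  simp only [dil_apply, map_add, map_sub, M.pr_smul, M.pr_pr, sub_self, zero_add]
  abel

/-- The map `(b, u) ↦ ((1-π) b + t π b, m u - δ π b)`. -/
def fibreMap (t : ℂ) : B × P →L[ℝ] B × F :=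
  ((M.dil t).comp (ContinuousLinearMap.fst ℝ B P)).prod
    (M.m.comp (ContinuousLinearMap.snd ℝ B P) -
      (M.δ.comp M.pr).comp (ContinuousLinearMap.fst ℝ B P))

@[simp] lemma fibreMap_apply (t : ℂ) (z : B × P) :
    M.fibreMap t z = (M.dil t z.1, M.m z.2 - M.δ (M.pr z.1)) := rfl

/-- A common left inverse of the maps `fibreMap t`. -/
def fibreInv : B × F →L[ℝ] B × P :=
  ((ContinuousLinearMap.id ℝ B - M.pr).comp (ContinuousLinearMap.fst ℝ B F) +
      M.β.comp (ContinuousLinearMap.snd ℝ B F)).prod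
    ((M.md.comp (ContinuousLinearMap.id ℝ F + M.δ.comp M.β)).comp (ContinuousLinearMap.snd ℝ B F))

@[simp] lemma fibreInv_apply (z : B × F) :
    M.fibreInv z = (z.1 - M.pr z.1 + M.β z.2, M.md (z.2 + M.δ (M.β z.2))) := rfl

lemma fibreInv_fibreMap (t : ℂ) (z : B × P) : M.fibreInv (M.fibreMap t z) = z := by
  simp only [fibreInv_apply, fibreMap_apply, M.β_m, sub_pr_dil, sub_add_cancel, M.md_m]

/-- The integration of forms along the fibres of `fst ∘ fibreInv`. -/
def fibreForm (μ : Measure P) (t : ℂ) (f : B × F → (B × F) [⋀^Fin (a + b)]→L[ℝ] ℂ) :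
    B → B [⋀^Fin a]→L[ℝ] ℂ := fun x =>
  ∫ u, sliceAlt bs ((f (M.fibreMap t (x, u))).compContinuousLinearMap (M.fibreMap t)) ∂μ

/-- The pull-back of forms by `dil c`. -/
def dilForm (c : ℂ) (ψ : B → B [⋀^Fin a]→L[ℝ] ℂ) : B → B [⋀^Fin a]→L[ℝ] ℂ := fun x =>
  (ψ (M.dil c x)).compContinuousLinearMap (M.dil c)

lemma isTest_fibreIntegrand {t : ℂ} {K : Set (B × F)}
    {f : B × F → (B × F) [⋀^Fin (a + b)]→L[ℝ] ℂ} (hf : IsTest K f) :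
    IsTest (M.fibreInv '' K) (fun z : B × P =>
      sliceAlt bs ((f (M.fibreMap t z)).compContinuousLinearMap (M.fibreMap t))) := by
  have h1 : ContDiff ℝ ∞ fun z : B × P =>
      (f (M.fibreMap t z)).compContinuousLinearMap (M.fibreMap t) :=
    contDiffOn_univ.1 (ContDiffOn.alt_comp
      (hf.smooth.comp (M.fibreMap t).contDiff).contDiffOn contDiffOn_const)
  refine ⟨(sliceAlt (B := B) (a := a) bs).contDiff.comp h1, fun z hz => ?_⟩
  rw [hf.eq_zero]
  · exact map_zero (sliceAlt bs)
  · intro h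
    exact hz ⟨_, h, M.fibreInv_fibreMap t z⟩

lemma isTest_fibreForm {t : ℂ} {K : Set (B × F)} (hK : IsCompact K)
    {f : B × F → (B × F) [⋀^Fin (a + b)]→L[ℝ] ℂ} (hf : IsTest K f) :
    IsTest (Prod.fst '' (M.fibreInv '' K)) (M.fibreForm bs μ t f) :=
  (M.isTest_fibreIntegrand bs hf).integral (hK.image M.fibreInv.continuous)

lemma integrable_fibreIntegrand {t : ℂ} {K : Set (B × F)} (hK : IsCompact K)
    {f : B × F → (B × F) [⋀^Fin (a + b)]→L[ℝ] ℂ} (hf : IsTest K f) (x : B) :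
    Integrable (fun u => sliceAlt bs ((f (M.fibreMap t (x, u))).compContinuousLinearMap
      (M.fibreMap t))) μ := by
  have h := M.isTest_fibreIntegrand bs (t := t) hf
  refine (h.smooth.continuous.comp (Continuous.prodMk_right x)).integrable_of_hasCompactSupport ?_
  refine HasCompactSupport.intro ((hK.image M.fibreInv.continuous).image continuous_snd)
    fun u hu => h.eq_zero _ fun h' => hu ⟨_, h', rfl⟩

lemma contDiff_fibreMap : ContDiff ℝ ∞ fun p : ℂ × (B × P) => M.fibreMap p.1 := by
  rw [contDiff_clm_apply_iff]
  intro y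
  simp only [fibreMap_apply, dil_apply]
  exact (contDiff_const.add (contDiff_fst.smul contDiff_const)).prodMk contDiff_const

lemma nullSeq_fibreForm {t : ℕ → ℂ} {t₀ : ℂ} (ht : Tendsto t atTop (𝓝 t₀)) {K : Set (B × F)}
    (hK : IsCompact K) {f : ℕ → B × F → (B × F) [⋀^Fin (a + b)]→L[ℝ] ℂ}
    {f₀ : B × F → (B × F) [⋀^Fin (a + b)]→L[ℝ] ℂ} (hf₀ : IsTest K f₀)
    (hf : NullSeq K fun i => f i - f₀) (hft : ∀ᶠ i in atTop, IsTest K (f i)) :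
    NullSeq (Prod.fst '' (M.fibreInv '' K))
      (fun i => M.fibreForm bs μ (t i) (f i) - M.fibreForm bs μ t₀ f₀) := by
  have hG := M.contDiff_fibreMap
  have hH : ContDiff ℝ ∞ fun p : ℂ × (B × P) => M.fibreMap p.1 p.2 := hG.clm_apply contDiff_snd
  have hM : ContDiff ℝ ∞ fun p : ℂ × (B × P) => (sliceAlt (B := B) (a := a) bs).comp
      (ContinuousAlternatingMap.compContinuousLinearMapCLM (M.fibreMap p.1) :
        ((B × F) [⋀^Fin (a + b)]→L[ℝ] ℂ) →L[ℝ] ((B × P) [⋀^Fin (a + b)]→L[ℝ] ℂ)) :=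
    contDiff_const.clm_comp (contDiffOn_univ.1 (ContDiffOn.altPullCLM hG.contDiffOn))
  have h : NullSeq (M.fibreInv '' K) (fun i => (fun z : B × P => sliceAlt (a := a) bs
      ((f i (M.fibreMap (t i) z)).compContinuousLinearMap (M.fibreMap (t i)))) -
      fun z => sliceAlt bs ((f₀ (M.fibreMap t₀ z)).compContinuousLinearMap (M.fibreMap t₀))) :=
    nullSeq_pull_family hH hM ht (hK.image M.fibreInv.continuous) hf₀ hf
    (M.isTest_fibreIntegrand bs (t := t₀) hf₀)
    (hft.mono fun i hi => M.isTest_fibreIntegrand bs (t := t i) hi) isOpen_univ (subset_univ _)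
    (Eventually.of_forall fun i x _ => rfl) (fun x _ => rfl)
  refine (h.integral (μ := μ) (hK.image M.fibreInv.continuous)).congr ?_
  filter_upwards [hft] with i hi
  funext x
  exact integral_sub (M.integrable_fibreIntegrand bs hK hi x)
    (M.integrable_fibreIntegrand bs hK hf₀ x)

lemma fibreForm_add {t : ℂ} {K : Set (B × F)} (hK : IsCompact K)
    {f g : B × F → (B × F) [⋀^Fin (a + b)]→L[ℝ] ℂ} (hf : IsTest K f) (hg : IsTest K g) :
    M.fibreForm bs μ t (f + g) = M.fibreForm bs μ t f + M.fibreForm bs μ t g := by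
  funext x
  exact integral_add (M.integrable_fibreIntegrand bs hK hf x)
    (M.integrable_fibreIntegrand bs hK hg x)

lemma fibreForm_smul {t : ℂ} (c : ℂ) (f : B × F → (B × F) [⋀^Fin (a + b)]→L[ℝ] ℂ) :
    M.fibreForm bs μ t (fun x => c • f x) = fun x => c • M.fibreForm bs μ t f x := by
  funext x
  exact integral_smul c (fun u => sliceAlt (a := a) bs
    ((f (M.fibreMap t (x, u))).compContinuousLinearMap (M.fibreMap t)))

lemma fibreForm_zero {t : ℂ} : M.fibreForm (a := a) bs μ t 0 = 0 := by
  funext x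
  have h : ∀ u, sliceAlt (a := a) bs (((0 : B × F → (B × F) [⋀^Fin (a + b)]→L[ℝ] ℂ)
      (M.fibreMap t (x, u))).compContinuousLinearMap (M.fibreMap t)) = 0 := fun u =>
    map_zero (sliceAlt (a := a) bs)
  rw [fibreForm, integral_congr_ae (Eventually.of_forall h), integral_zero, Pi.zero_apply]

lemma eventually_dil_inv_mem {Ω : Set B} (hΩ : IsOpen Ω) {C : Set B} (hC : IsCompact C)
    (hCΩ : ∀ x ∈ C, x - M.pr x ∈ Ω) : ∀ᶠ t in 𝓝 (0 : ℂ), ∀ x ∈ C, M.dil t x ∈ Ω := by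
  refine hC.eventually_forall_of_forall_eventually fun x hx => ?_
  have hcont : Continuous fun z : ℂ × B => M.dil z.1 z.2 := by
    simp only [dil_apply]; fun_prop
  refine hcont.continuousAt.eventually_mem (hΩ.mem_nhds ?_)
  simpa using hCΩ x hx

lemma tendsto_inv_zero_of_norm {c : ℕ → ℂ} (hc : Tendsto (fun i => ‖c i‖) atTop atTop) :
    Tendsto (fun i => (c i)⁻¹) atTop (𝓝 0) :=
  tendsto_inv₀_cobounded.comp (tendsto_norm_atTop_iff_cobounded.1 hc)

/-- A functional on forms that is continuous on test forms supported in a compact subset of `Ω`. -/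
def IsLocalFunctional {V E : Type} [NormedAddCommGroup E] [NormedSpace ℝ E] [NormedAddCommGroup V]
    [NormedSpace ℝ V] [SMul ℂ V] (Ω : Set E) (L : (E → V) → ℂ) : Prop :=
  ∀ C : Set E, IsCompact C → C ⊆ Ω → IsTestFunctional C L

lemma eventually_dil_functional {Ω : Set B} (hΩ : IsOpen Ω)
    {T₀ : (B → B [⋀^Fin a]→L[ℝ] ℂ) → ℂ} (hT₀ : IsLocalFunctional Ω T₀)
    {c : ℕ → ℂ} (hc : Tendsto (fun i => ‖c i‖) atTop atTop)
    {C : Set B} (hC : IsCompact C) (hCΩ : ∀ x ∈ C, x - M.pr x ∈ Ω) :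
    ∀ᶠ i in atTop, IsTestFunctional C (fun ψ => T₀ (M.dilForm (c i) ψ)) := by
  filter_upwards [(tendsto_inv_zero_of_norm hc).eventually (M.eventually_dil_inv_mem hΩ hC hCΩ),
    hc.eventually_gt_atTop 0] with i hi hci
  have hc0 : c i ≠ 0 := norm_pos_iff.1 hci
  have hK : IsCompact (M.dil (c i)⁻¹ '' C) := hC.image (M.dil _).continuous
  have hT := hT₀ _ hK (by rintro _ ⟨x, hx, rfl⟩; exact hi x hx)
  have hgK : ∀ z ∈ (univ : Set B), M.dil (c i) z ∈ C → z ∈ M.dil (c i)⁻¹ '' C := fun z _ hz =>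
    ⟨_, hz, by rw [dil_dil, inv_mul_cancel₀ hc0, dil_one]⟩
  have hM : ContDiffOn ℝ ∞ (fun _ : B => (ContinuousAlternatingMap.compContinuousLinearMapCLM
    (M.dil (c i)) : (B [⋀^Fin a]→L[ℝ] ℂ) →L[ℝ] (B [⋀^Fin a]→L[ℝ] ℂ))) univ := contDiffOn_const
  have ht : ∀ ψ : B → B [⋀^Fin a]→L[ℝ] ℂ, IsTest C ψ →
      IsTest (M.dil (c i)⁻¹ '' C) (M.dilForm (c i) ψ) := fun ψ hψ => by
    have := hψ.pull isOpen_univ (M.dil (c i)).contDiff.contDiffOn hM hK.isClosed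
      (subset_univ _) hgK
    simp only [mem_univ, if_true] at this
    exact this
  refine ⟨fun f g hf hg => ?_, fun z f hf => ?_, fun x hx => ?_⟩
  · exact hT.map_add _ _ (ht f hf) (ht g hg)
  · exact hT.map_smul z _ (ht f hf)
  · have := hx.pull isOpen_univ (M.dil (c i)).contDiff.contDiffOn hM hK (subset_univ _) hgK
    simp only [mem_univ, if_true] at this
    exact hT.tendsto _ this

/-- The functional induced by `T₀` on forms on `B × F`. -/
def functional (μ : Measure P) (T₀ : (B → B [⋀^Fin a]→L[ℝ] ℂ) → ℂ) (c : ℂ)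
    (f : B × F → (B × F) [⋀^Fin (a + b)]→L[ℝ] ℂ) : ℂ :=
  T₀ (M.dilForm c (M.fibreForm bs μ c⁻¹ f))

lemma isCompact_fibreBase {K : Set (B × F)} (hK : IsCompact K) :
    IsCompact (Prod.fst '' (M.fibreInv '' K)) :=
  (hK.image M.fibreInv.continuous).image continuous_fst

lemma fibreBase_subset {Ω : Set B} (hΩpr : ∀ x ∈ Ω, x - M.pr x ∈ Ω) {K : Set (B × F)}
    (hKΩ : K ⊆ Ω ×ˢ univ) : ∀ x ∈ Prod.fst '' (M.fibreInv '' K), x - M.pr x ∈ Ω := by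
  rintro _ ⟨_, ⟨z, hz, rfl⟩, rfl⟩
  have := hΩpr _ (hKΩ hz).1
  simpa [M.pr_pr, M.pr_β] using this

lemma eventually_functional {Ω : Set B} (hΩ : IsOpen Ω) (hΩpr : ∀ x ∈ Ω, x - M.pr x ∈ Ω)
    {T₀ : (B → B [⋀^Fin a]→L[ℝ] ℂ) → ℂ} (hT₀ : IsLocalFunctional Ω T₀)
    {c : ℕ → ℂ} (hc : Tendsto (fun i => ‖c i‖) atTop atTop)
    {K : Set (B × F)} (hK : IsCompact K) (hKΩ : K ⊆ Ω ×ˢ univ) :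
    ∀ᶠ i in atTop, IsTestFunctional K (M.functional bs μ T₀ (c i)) := by
  filter_upwards [M.eventually_dil_functional hΩ hT₀ hc (M.isCompact_fibreBase hK)
    (M.fibreBase_subset hΩpr hKΩ)] with i hi
  have ht : ∀ {f : B × F → (B × F) [⋀^Fin (a + b)]→L[ℝ] ℂ}, IsTest K f →
      IsTest (Prod.fst '' (M.fibreInv '' K)) (M.fibreForm bs μ (c i)⁻¹ f) := fun hf =>
    M.isTest_fibreForm bs hK hf
  refine ⟨fun f g hf hg => ?_, fun z f hf => ?_, fun x hx => ?_⟩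
  · simp only [functional]
    rw [M.fibreForm_add bs hK hf hg]
    exact hi.map_add _ _ (ht hf) (ht hg)
  · simp only [functional]
    rw [M.fibreForm_smul bs]
    exact hi.map_smul z _ (ht hf)
  · refine hi.tendsto _ ?_
    have := M.nullSeq_fibreForm bs (μ := μ) (tendsto_const_nhds (x := (c i)⁻¹)) hK (f₀ := 0)
      (IsTest.zero K) (by simpa using hx) hx.test
    simpa [M.fibreForm_zero] using this

end TransverseModel

lemma contDiff_smul_clm {X V V' : Type*} [NormedAddCommGroup X] [NormedSpace ℝ X]
    [NormedAddCommGroup V] [NormedSpace ℝ V] [NormedAddCommGroup V'] [NormedSpace ℝ V']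
    {φ : X → ℝ} (hφ : ContDiff ℝ ∞ φ) (A : V →L[ℝ] V') : ContDiff ℝ ∞ fun x => φ x • A :=
  hφ.smul contDiff_const

namespace TransverseModel

variable {B F P : Type} [NormedAddCommGroup B] [NormedSpace ℝ B] [NormedSpace ℂ B]
  [IsScalarTower ℝ ℂ B] [FiniteDimensional ℝ B]
  [NormedAddCommGroup F] [NormedSpace ℝ F] [NormedSpace ℂ F] [IsScalarTower ℝ ℂ F]
  [FiniteDimensional ℝ F]
  [NormedAddCommGroup P] [NormedSpace ℝ P] [NormedSpace ℂ P] [IsScalarTower ℝ ℂ P]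
  [FiniteDimensional ℝ P] [MeasurableSpace P] [BorelSpace P] {μ : Measure P} [μ.IsAddHaarMeasure]
  (M : TransverseModel B F P) {a b : ℕ} (bs : Module.Basis (Fin b) ℝ P)

lemma m_md_add (z : B × F) {x : B} (hx : x = z.1 - M.pr z.1 + M.β z.2) :
    z.2 = M.m (M.md (z.2 + M.δ (M.β z.2))) - M.δ (x - z.1 + M.pr z.1) := by
  rw [M.m_md, hx, show z.1 - M.pr z.1 + M.β z.2 - z.1 + M.pr z.1 = M.β z.2 by abel]
  simp

/-- Every form on `B` is a fibre integral. -/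
lemma exists_fibreForm_rightInverse (μ : Measure P) [μ.IsAddHaarMeasure] {Ω : Set B}
    (hΩ : IsOpen Ω) {C : Set B} (hC : IsCompact C) (hCΩ : ∀ x ∈ C, x - M.pr x ∈ Ω) :
    ∃ K : Set (B × F), IsCompact K ∧ K ⊆ Ω ×ˢ univ ∧
      ∃ Q : (B → B [⋀^Fin a]→L[ℝ] ℂ) → (B × F → (B × F) [⋀^Fin (a + b)]→L[ℝ] ℂ),
        (∀ ψ, IsTest C ψ → IsTest K (Q ψ)) ∧
        (∀ ψ : ℕ → B → B [⋀^Fin a]→L[ℝ] ℂ, NullSeq C ψ → NullSeq K fun i => Q (ψ i)) ∧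
        ∀ᶠ t in 𝓝 (0 : ℂ), ∀ ψ, IsTest C ψ → M.fibreForm bs μ t (Q ψ) = ψ := by
  obtain ⟨χ, L, hχ, hL, hLΩ, N, hN, hCN, hNL, hN1⟩ := exists_cutoff
    (hC.image (f := fun x => x - M.pr x) (by fun_prop)) hΩ
    (by rintro _ ⟨x, hx, rfl⟩; exact hCΩ x hx)
  obtain ⟨E, hE⟩ := exists_sliceAlt_rightInverse (B := B) (a := a) bs
  let ρ : ContDiffBump (0 : P) := ⟨1, 2, one_pos, one_lt_two⟩
  have hρ : ∀ u, u ∉ Metric.closedBall (0 : P) 2 → ρ.normed μ u = 0 := fun u hu => by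
    by_contra h
    exact hu ((ρ.tsupport_normed_eq (μ := μ)).subset (subset_tsupport _ h))
  let q : B × F →L[ℝ] B := (ContinuousLinearMap.fst ℝ B P).comp M.fibreInv
  let r : B × F →L[ℝ] P := (ContinuousLinearMap.snd ℝ B P).comp M.fibreInv
  let A : B × F → (B [⋀^Fin a]→L[ℝ] ℂ) →L[ℝ] ((B × F) [⋀^Fin (a + b)]→L[ℝ] ℂ) := fun z =>
    (χ z.1 * ρ.normed μ (r z)) • (ContinuousAlternatingMap.compContinuousLinearMapCLM M.fibreInv :
      ((B × P) [⋀^Fin (a + b)]→L[ℝ] ℂ) →L[ℝ] ((B × F) [⋀^Fin (a + b)]→L[ℝ] ℂ)).comp E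
  have hA : ContDiff ℝ ∞ A :=
    contDiff_smul_clm
      ((hχ.smooth.comp contDiff_fst).mul (ρ.contDiff_normed.comp r.contDiff)) _
  have hAv : ∀ z v, A z v = (χ z.1 * ρ.normed μ (r z)) •
      (E v).compContinuousLinearMap M.fibreInv := fun _ _ => rfl
  let Q : (B → B [⋀^Fin a]→L[ℝ] ℂ) → (B × F → (B × F) [⋀^Fin (a + b)]→L[ℝ] ℂ) := fun ψ z =>
    A z (ψ (q z))
  let K : Set (B × F) := (fun x : B × B × P => (x.1, M.m x.2.2 - M.δ (x.2.1 - x.1 + M.pr x.1))) ''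
    (L ×ˢ C ×ˢ Metric.closedBall 0 2)
  have hK : IsCompact K :=
    (hL.prod (hC.prod (isCompact_closedBall _ _))).image (by fun_prop)
  have hQ0 : ∀ ψ, (∀ x, x ∉ C → ψ x = 0) → ∀ z, z ∉ K → Q ψ z = 0 := by
    intro ψ hψ z hz
    change A z (ψ (q z)) = 0
    by_cases h1 : z.1 ∈ L
    · by_cases h2 : q z ∈ C
      · by_cases h3 : r z ∈ Metric.closedBall (0 : P) 2
        · exact absurd ⟨(z.1, q z, r z), ⟨h1, h2, h3⟩,
            Prod.ext rfl (M.m_md_add z rfl).symm⟩ hz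
        · rw [hAv, hρ _ h3, mul_zero]; exact zero_smul ℝ ((E (ψ (q z))).compContinuousLinearMap M.fibreInv)
      · rw [hψ _ h2, map_zero]
    · rw [hAv, hχ.eq_zero _ h1, zero_mul]; exact zero_smul ℝ ((E (ψ (q z))).compContinuousLinearMap M.fibreInv)
  have hQt : ∀ ψ, IsTest C ψ → IsTest K (Q ψ) := fun ψ hψ =>
    ⟨hA.clm_apply (hψ.smooth.comp q.contDiff), hQ0 ψ hψ.eq_zero⟩
  refine ⟨K, hK, ?_, Q, hQt, fun ψ hψ => ?_, ?_⟩
  · rintro _ ⟨x, hx, rfl⟩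
    exact ⟨hLΩ hx.1, mem_univ _⟩
  · have h0 : Q 0 = 0 := by
      funext z
      exact map_zero (A z)
    have := nullSeq_pull_family (T := ℝ) (H := fun p => q p.2) (M := fun p => A p.2)
      (q.contDiff.comp contDiff_snd) (hA.comp contDiff_snd)
      (tendsto_const_nhds (x := (0 : ℝ)) (f := atTop (α := ℕ))) hK (f := ψ) (f₀ := 0)
      (IsTest.zero C) (by simpa using hψ) (y := fun i => Q (ψ i)) (y₀ := Q 0)
      (by rw [h0]; exact IsTest.zero K) (hψ.test.mono fun i hi => hQt _ hi) isOpen_univ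
      (subset_univ _) (Eventually.of_forall fun i x _ => rfl) (fun x _ => rfl)
    simpa [h0] using this
  · filter_upwards [M.eventually_dil_inv_mem hN hC fun x hx => hCN ⟨x, hx, rfl⟩] with t ht ψ hψ
    funext x
    have hqr : ∀ u, M.fibreInv (M.fibreMap t (x, u)) = (x, u) := fun u => M.fibreInv_fibreMap t _
    have hcomp : M.fibreInv.comp (M.fibreMap t) = ContinuousLinearMap.id ℝ (B × P) :=
      ContinuousLinearMap.ext fun z => M.fibreInv_fibreMap t z
    have h1 : ∀ u, sliceAlt bs ((Q ψ (M.fibreMap t (x, u))).compContinuousLinearMap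
        (M.fibreMap t)) = ρ.normed μ u • (χ (M.dil t x) • ψ x) := by
      intro u
      have hq : q (M.fibreMap t (x, u)) = x := congrArg Prod.fst (hqr u)
      have hr : r (M.fibreMap t (x, u)) = u := congrArg Prod.snd (hqr u)
      have h2 : (Q ψ (M.fibreMap t (x, u))).compContinuousLinearMap (M.fibreMap t) =
          (χ (M.dil t x) * ρ.normed μ u) • E (ψ x) := by
        change (A (M.fibreMap t (x, u)) (ψ (q (M.fibreMap t (x, u))))).compContinuousLinearMap
          (M.fibreMap t) = _
        ext v
        rw [hAv, hq, hr]
        change (χ (M.dil t x) * ρ.normed μ u) • E (ψ x) (fun j => M.fibreInv (M.fibreMap t (v j))) = _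
        simp only [M.fibreInv_fibreMap]
        rfl
      rw [h2, map_smul, hE, smul_smul, mul_comm]
    have hfin : M.fibreForm bs μ t (Q ψ) x = χ (M.dil t x) • ψ x := by
      rw [fibreForm]
      simp only [h1]
      rw [integral_smul_const, ρ.integral_normed, one_smul]
    rw [hfin]
    by_cases hx : x ∈ C
    · rw [hN1 _ (ht x hx), one_smul]
    · rw [hψ.eq_zero x hx, smul_zero]

variable {Ω : Set B} {g : PartialDiffeomorph 𝓘(ℝ, B × F) 𝓘(ℝ, B × F) (B × F) (B × F) ∞}
  {c : ℕ → ℂ} {ξ : ℂ}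

lemma eventually_functional_conjPull (hΩ : IsOpen Ω) (hΩpr : ∀ x ∈ Ω, x - M.pr x ∈ Ω)
    {T₀ : (B → B [⋀^Fin a]→L[ℝ] ℂ) → ℂ} (hT₀ : IsLocalFunctional Ω T₀)
    (hg : NormalizedAlong Ω g) (hc : Tendsto (fun i => ‖c i‖) atTop atTop)
    (hξ : Tendsto (fun i => c i / ‖c i‖) atTop (𝓝 ξ)) (hξ0 : ξ ≠ 0)
    {K : Set (B × F)} (hK : IsCompact K) (hKΩ : K ⊆ Ω ×ˢ univ) :
    ∀ᶠ i in atTop, IsTestFunctional K fun f => M.functional bs μ T₀ (c i) (conjPull g (c i) f) := by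
  obtain ⟨K', hK', hKK, hKΩ'⟩ : ∃ L, IsCompact L ∧ K ⊆ interior L ∧ L ⊆ Ω ×ˢ univ :=
    exists_compact_between hK (hΩ.prod isOpen_univ) hKΩ
  filter_upwards [M.eventually_functional bs (μ := μ) hΩ hΩpr hT₀ hc hK' hKΩ',
    eventually_conjPull_test (n := a + b) hΩ hg hc hξ hξ0 hK hK' hKΩ' hKK] with i h1 h2
  have hadd : ∀ f f' : B × F → (B × F) [⋀^Fin (a + b)]→L[ℝ] ℂ,
      conjPull g (c i) (f + f') = conjPull g (c i) f + conjPull g (c i) f' := fun f f' => by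
    funext x
    simp only [conjPull, Pi.add_apply]
    split_ifs
    · rfl
    · simp
  have hsmul : ∀ (z : ℂ) (f : B × F → (B × F) [⋀^Fin (a + b)]→L[ℝ] ℂ),
      conjPull g (c i) (fun x => z • f x) = fun x => z • conjPull g (c i) f x := fun z f => by
    funext x
    simp only [conjPull]
    split_ifs
    · rfl
    · exact (smul_zero (A := (B × F) [⋀^Fin (a + b)]→L[ℝ] ℂ) z).symm
  refine ⟨fun f f' hf hf' => ?_, fun z f hf => ?_, fun x hx => h1.tendsto _ (h2.2 x hx)⟩
  · rw [hadd]; exact h1.map_add _ _ (h2.1 f hf) (h2.1 f' hf')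
  · rw [hsmul]; exact h1.map_smul z _ (h2.1 f hf)

/-- Convergence of the functionals on `B × F` implies convergence of the functionals on `B`. -/
theorem exists_limit (hΩ : IsOpen Ω) (hΩpr : ∀ x ∈ Ω, x - M.pr x ∈ Ω)
    {T₀ : (B → B [⋀^Fin a]→L[ℝ] ℂ) → ℂ} (hT₀ : IsLocalFunctional Ω T₀)
    (hg : NormalizedAlong Ω g) (hc : Tendsto (fun i => ‖c i‖) atTop atTop)
    (hξ : Tendsto (fun i => c i / ‖c i‖) atTop (𝓝 ξ)) (hξ0 : ξ ≠ 0)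
    {R₀ : (B × F → (B × F) [⋀^Fin (a + b)]→L[ℝ] ℂ) → ℂ}
    (hR₀ : IsLocalFunctional (Ω ×ˢ univ) R₀)
    (hlim : ∀ K : Set (B × F), IsCompact K → K ⊆ Ω ×ˢ univ → ∀ f, IsTest K f →
      Tendsto (fun i => M.functional bs μ T₀ (c i) (conjPull g (c i) f)) atTop (𝓝 (R₀ f))) :
    ∃ L : (B → B [⋀^Fin a]→L[ℝ] ℂ) → ℂ, IsLocalFunctional {x | x - M.pr x ∈ Ω} L ∧
      (∀ C : Set B, IsCompact C → (∀ x ∈ C, x - M.pr x ∈ Ω) → ∀ ψ, IsTest C ψ →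
        Tendsto (fun i => T₀ (M.dilForm (c i) ψ)) atTop (𝓝 (L ψ))) ∧
      ((∀ f, R₀ f = 0) → ∀ C : Set B, IsCompact C → (∀ x ∈ C, x - M.pr x ∈ Ω) → ∀ ψ, IsTest C ψ →
        L ψ = 0) := by
  have key : ∀ C : Set B, IsCompact C → (∀ x ∈ C, x - M.pr x ∈ Ω) →
      ∃ K : Set (B × F), IsCompact K ∧ K ⊆ Ω ×ˢ univ ∧
      ∃ Q : (B → B [⋀^Fin a]→L[ℝ] ℂ) → (B × F → (B × F) [⋀^Fin (a + b)]→L[ℝ] ℂ),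
        (∀ ψ : ℕ → B → B [⋀^Fin a]→L[ℝ] ℂ, NullSeq C ψ → NullSeq K fun i => Q (ψ i)) ∧
        ∀ ψ, IsTest C ψ → IsTest K (Q ψ) ∧
          Tendsto (fun i => T₀ (M.dilForm (c i) ψ)) atTop (𝓝 (R₀ (Q ψ))) := by
    intro C hC hCΩ
    obtain ⟨K, hK, hKΩ, Q, hQt, hQn, hQ⟩ :=
      M.exists_fibreForm_rightInverse (a := a) bs μ hΩ hC hCΩ
    refine ⟨K, hK, hKΩ, Q, hQn, fun ψ hψ => ⟨hQt ψ hψ, ?_⟩⟩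
    obtain ⟨K', hK', hKK, hKΩ'⟩ : ∃ L, IsCompact L ∧ K ⊆ interior L ∧ L ⊆ Ω ×ˢ univ :=
      exists_compact_between hK (hΩ.prod isOpen_univ) hKΩ
    have h1 := nullSeq_conjPull_sub hΩ (hg.symm hΩ) hc hξ hξ0 hK hK' hKΩ' hKK
      (f := fun _ => Q ψ) (hQt ψ hψ) (by
        simp only [sub_self]
        exact ⟨Eventually.of_forall fun _ => IsTest.zero K, fun j ε hε =>
          Eventually.of_forall fun _ x => by
            simpa [Pi.zero_def, iteratedFDeriv_fun_zero] using hε.le⟩)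
      (Eventually.of_forall fun _ => hQt ψ hψ)
    have h2 := tendsto_apply_of_tendsto
      (M.eventually_functional_conjPull bs (μ := μ) hΩ hΩpr hT₀ hg hc hξ hξ0 hK' hKΩ')
      (hR₀ K' hK' hKΩ') (hlim K' hK' hKΩ') ((hQt ψ hψ).mono (hKK.trans interior_subset)) h1
    refine h2.congr' ?_
    filter_upwards [eventually_conjPull_symm (n := a + b) hg hc hξ hξ0 hK hKΩ,
      (tendsto_inv_zero_of_norm hc).eventually hQ] with i h3 h4
    rw [h3 _ (hQt ψ hψ), functional, h4 ψ hψ]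
  have hL : ∀ C : Set B, IsCompact C → (∀ x ∈ C, x - M.pr x ∈ Ω) → ∀ ψ, IsTest C ψ →
      Tendsto (fun i => T₀ (M.dilForm (c i) ψ)) atTop
        (𝓝 (limUnder atTop fun i => T₀ (M.dilForm (c i) ψ))) := by
    intro C hC hCΩ ψ hψ
    obtain ⟨K, hK, hKΩ, Q, hQn, hQ⟩ := key C hC hCΩ
    exact tendsto_nhds_limUnder ⟨_, (hQ ψ hψ).2⟩
  refine ⟨fun ψ => limUnder atTop fun i => T₀ (M.dilForm (c i) ψ), fun C hC hCΩ => ?_, hL,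
    fun hR C hC hCΩ ψ hψ => ?_⟩
  · have hev := M.eventually_dil_functional hΩ hT₀ hc hC hCΩ
    refine ⟨fun f f' hf hf' => ?_, fun z f hf => ?_, fun x hx => ?_⟩
    · refine tendsto_nhds_unique (hL C hC hCΩ _ (hf.add hf')) ?_
      refine ((hL C hC hCΩ f hf).add (hL C hC hCΩ f' hf')).congr' ?_
      filter_upwards [hev] with i hi using (hi.map_add f f' hf hf').symm
    · refine tendsto_nhds_unique (hL C hC hCΩ _
        ⟨hf.smooth.const_smul z, fun x hx => by simp [hf.eq_zero x hx]⟩) ?_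
      refine ((hL C hC hCΩ f hf).const_mul z).congr' ?_
      filter_upwards [hev] with i hi using (hi.map_smul z f hf).symm
    · obtain ⟨K, hK, hKΩ, Q, hQn, hQ⟩ := key C hC hCΩ
      refine ((hR₀ K hK hKΩ).tendsto _ (hQn x hx)).congr' ?_
      filter_upwards [hx.test] with i hi
      exact tendsto_nhds_unique (hQ _ hi).2 (hL C hC hCΩ _ hi)
  · obtain ⟨K, hK, hKΩ, Q, hQn, hQ⟩ := key C hC hCΩ
    have := (hQ ψ hψ).2
    rw [hR] at this
    exact tendsto_nhds_unique (hL C hC hCΩ ψ hψ) this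

/-- Convergence of the functionals on `B` implies convergence of the functionals on `B × F`. -/
theorem tendsto_functional (hΩ : IsOpen Ω) (hΩpr : ∀ x ∈ Ω, x - M.pr x ∈ Ω)
    {T₀ : (B → B [⋀^Fin a]→L[ℝ] ℂ) → ℂ} (hT₀ : IsLocalFunctional Ω T₀)
    (hg : NormalizedAlong Ω g) (hc : Tendsto (fun i => ‖c i‖) atTop atTop)
    (hξ : Tendsto (fun i => c i / ‖c i‖) atTop (𝓝 ξ)) (hξ0 : ξ ≠ 0)
    {L : (B → B [⋀^Fin a]→L[ℝ] ℂ) → ℂ} (hL : IsLocalFunctional {x | x - M.pr x ∈ Ω} L)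
    (hlim : ∀ C : Set B, IsCompact C → (∀ x ∈ C, x - M.pr x ∈ Ω) → ∀ ψ, IsTest C ψ →
        Tendsto (fun i => T₀ (M.dilForm (c i) ψ)) atTop (𝓝 (L ψ)))
    {K : Set (B × F)} (hK : IsCompact K) (hKΩ : K ⊆ Ω ×ˢ univ) {χ : B × F → ℝ}
    (hχ : ContDiff ℝ ∞ χ) {f : B × F → (B × F) [⋀^Fin (a + b)]→L[ℝ] ℂ} (hf : IsTest K f) :
    Tendsto (fun i => M.functional bs μ T₀ (c i) fun x => χ x • conjPull g (c i) f x) atTop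
      (𝓝 (L (M.fibreForm bs μ 0 fun x => χ x • f x))) := by
  obtain ⟨K', hK', hKK, hKΩ'⟩ : ∃ L, IsCompact L ∧ K ⊆ interior L ∧ L ⊆ Ω ×ˢ univ :=
    exists_compact_between hK (hΩ.prod isOpen_univ) hKΩ
  have h1 := nullSeq_conjPull_sub hΩ hg hc hξ hξ0 hK hK' hKΩ' hKK (f := fun _ => f) hf (by
      simp only [sub_self]
      exact ⟨Eventually.of_forall fun _ => IsTest.zero K, fun j ε hε =>
        Eventually.of_forall fun _ x => by
          simpa [Pi.zero_def, iteratedFDeriv_fun_zero] using hε.le⟩)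
    (Eventually.of_forall fun _ => hf)
  have ht := eventually_conjPull_test (n := a + b) hΩ hg hc hξ hξ0 hK hK' hKΩ' hKK
  have hf' := hf.mono (hKK.trans interior_subset)
  have h2 : NullSeq K' (fun i => (fun x => χ x • conjPull g (c i) f x) - fun x => χ x • f x) :=
    nullSeq_pull_family (T := ℝ) (H := fun p => p.2)
      (M := fun p => χ p.2 • ContinuousLinearMap.id ℝ ((B × F) [⋀^Fin (a + b)]→L[ℝ] ℂ))
      contDiff_snd ((hχ.comp contDiff_snd).smul contDiff_const)
      (tendsto_const_nhds (x := (0 : ℝ)) (f := atTop (α := ℕ))) hK' hf' h1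
      (hf'.smul_left hχ) (ht.mono fun i hi => (hi.1 f hf).smul_left hχ) isOpen_univ
      (subset_univ _) (Eventually.of_forall fun i x _ => rfl) (fun x _ => rfl)
  have h3 := M.nullSeq_fibreForm bs (μ := μ) (tendsto_inv_zero_of_norm hc) hK'
    (hf'.smul_left hχ) h2 (ht.mono fun i hi => (hi.1 f hf).smul_left hχ)
  have hC := M.isCompact_fibreBase hK'
  have hCΩ := M.fibreBase_subset hΩpr hKΩ'
  exact tendsto_apply_of_tendsto (M.eventually_dil_functional hΩ hT₀ hc hC hCΩ)
    (hL _ hC hCΩ) (hlim _ hC hCΩ) (M.isTest_fibreForm bs hK' (hf'.smul_left hχ)) h3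

end TransverseModel

namespace TransverseModel

variable {B F P : Type} [NormedAddCommGroup B] [NormedSpace ℝ B] [NormedSpace ℂ B]
  [IsScalarTower ℝ ℂ B] [FiniteDimensional ℝ B]
  [NormedAddCommGroup F] [NormedSpace ℝ F] [NormedSpace ℂ F] [IsScalarTower ℝ ℂ F]
  [FiniteDimensional ℝ F]
  [NormedAddCommGroup P] [NormedSpace ℝ P] [NormedSpace ℂ P] [IsScalarTower ℝ ℂ P]
  [FiniteDimensional ℝ P] [MeasurableSpace P] [BorelSpace P] {μ : Measure P} [μ.IsAddHaarMeasure]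
  (M : TransverseModel B F P) {a b : ℕ} (bs : Module.Basis (Fin b) ℝ P)

lemma det_complex_linear_nonneg {P : Type*} [AddCommGroup P] [Module ℝ P] [Module ℂ P]
    [IsScalarTower ℝ ℂ P] (C : P →ₗ[ℂ] P) : 0 ≤ LinearMap.det (C.restrictScalars ℝ) := by
  have := LinearMap.det_restrictScalars (R := ℝ) (f := C)
  rw [Algebra.norm_complex_apply] at this
  exact this ▸ Complex.normSq_nonneg _

/-- Multiplication by `c ≠ 0`, as a real linear map. -/
def smulEquiv (P : Type*) [AddCommGroup P] [Module ℝ P] [Module ℂ P] [IsScalarTower ℝ ℂ P]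
    {c : ℂ} (hc : c ≠ 0) : P ≃ₗ[ℝ] P :=
  DistribMulAction.toLinearEquiv ℝ P (Units.mk0 c hc)

lemma integral_det_comp {V : Type*} [NormedAddCommGroup V] [NormedSpace ℝ V] {c : ℂ} (hc : c ≠ 0)
    (φ : P → V) (ζ₀ : P) :
    ∫ ζ, LinearMap.det (smulEquiv P hc : P →ₗ[ℝ] P) • φ (c • (ζ - ζ₀)) ∂μ = ∫ u, φ u ∂μ := by
  set d := LinearMap.det (smulEquiv P hc : P →ₗ[ℝ] P) with hd
  have hd0 : d ≠ 0 := (LinearEquiv.isUnit_det' (smulEquiv P hc)).ne_zero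
  have hdp : 0 ≤ d := by
    have h : (smulEquiv P hc : P →ₗ[ℝ] P) =
        (c • LinearMap.id : P →ₗ[ℂ] P).restrictScalars ℝ := LinearMap.ext fun _ => rfl
    rw [hd, h]
    exact det_complex_linear_nonneg _
  have h1 := Measure.map_linearMap_addHaar_eq_smul_addHaar μ (f := (smulEquiv P hc : P →ₗ[ℝ] P)) hd0
  have h2 := ((smulEquiv P hc).toContinuousLinearEquiv.toHomeomorph.measurableEmbedding).integral_map
    (μ := μ) φ
  have h3 : ∫ ζ, φ (c • ζ) ∂μ = d⁻¹ • ∫ u, φ u ∂μ := by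
    refine h2.symm.trans ?_
    change ∫ y, φ y ∂(Measure.map (smulEquiv P hc : P →ₗ[ℝ] P) μ) = _
    rw [h1, integral_smul_measure, abs_of_nonneg (inv_nonneg.2 hdp),
      ENNReal.toReal_ofReal (inv_nonneg.2 hdp)]
  rw [integral_smul, integral_sub_right_eq_self (fun ζ => φ (c • ζ)), h3, smul_smul,
    mul_inv_cancel₀ hd0, one_smul]

/-- The map `(x, ζ) ↦ (x, c (m ζ - δ x))`. -/
def normalMap (c : ℂ) : B × P →L[ℝ] B × F :=
  (ContinuousLinearMap.fst ℝ B P).prod (c • (M.m.comp (ContinuousLinearMap.snd ℝ B P) -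
    M.δ.comp (ContinuousLinearMap.fst ℝ B P)))

lemma normalMap_apply (c : ℂ) (z : B × P) : M.normalMap c z = (z.1, c • (M.m z.2 - M.δ z.1)) := rfl

lemma fibreMap_shear {c : ℂ} (hc : c ≠ 0) (x : B) (ζ : P) :
    M.fibreMap c⁻¹ (M.dil c x, c • (ζ - M.md (M.δ (x - M.pr x)))) = M.normalMap c (x, ζ) := by
  have h1 : M.pr (M.dil c x) = c • M.pr x := by
    simp only [dil_apply, map_add, map_sub, M.pr_smul, M.pr_pr, sub_self, zero_add]
  rw [fibreMap_apply, normalMap_apply]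
  simp only [dil_dil, inv_mul_cancel₀ hc, dil_one, h1, M.m_smul, M.δ_smul, map_sub, smul_sub]
  have h2 := M.m_md_δ x
  simp only [map_sub] at h2
  rw [← smul_sub c (M.m (M.md (M.δ x))), h2, smul_sub]
  abel_nf

/-- Integration over the range of `m`, in terms of `fibreForm`. -/
lemma integral_normalMap {c : ℂ} (hc : c ≠ 0) {K : Set (B × F)} (hK : IsCompact K)
    {f : B × F → (B × F) [⋀^Fin (a + b)]→L[ℝ] ℂ} (hf : IsTest K f) (x : B) :
    ∫ ζ, sliceAlt bs ((f (M.normalMap c (x, ζ))).compContinuousLinearMap (M.normalMap c)) ∂μ =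
      M.dilForm c (M.fibreForm bs μ c⁻¹ f) x := by
  let φ : P → B [⋀^Fin a]→L[ℝ] ℂ := fun u =>
    (sliceAlt bs ((f (M.fibreMap c⁻¹ (M.dil c x, u))).compContinuousLinearMap
      (M.fibreMap c⁻¹))).compContinuousLinearMap (M.dil c)
  have h1 : ∀ ζ, sliceAlt bs ((f (M.normalMap c (x, ζ))).compContinuousLinearMap
      (M.normalMap c)) = LinearMap.det (smulEquiv P hc : P →ₗ[ℝ] P) •
        φ (c • (ζ - M.md (M.δ (x - M.pr x)))) := by
    intro ζ
    ext v
    have h2 : ∀ t, M.normalMap c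
        ((Fin.append (fun i => (v i, (0 : P))) fun j => ((0 : B), bs j)) t) =
        M.fibreMap c⁻¹ ((Fin.append
          (fun i => (M.dil c (v i), c • (0 - M.md (M.δ (v i - M.pr (v i)))))) fun j =>
            ((0 : B), smulEquiv P hc (bs j))) t) := by
      intro t
      refine Fin.addCases (fun i => ?_) (fun j => ?_) t
      · simp only [Fin.append_left]
        rw [M.fibreMap_shear hc]
      · simp only [Fin.append_right]
        rw [← M.fibreMap_shear hc]
        simp [smulEquiv, dil_apply]
    have h3 := alt_append_shear_det bs ((f (M.normalMap c (x, ζ))).compContinuousLinearMap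
      (M.fibreMap c⁻¹)) (fun i => M.dil c (v i))
      (fun i => c • (0 - M.md (M.δ (v i - M.pr (v i))))) (smulEquiv P hc)
    change f (M.normalMap c (x, ζ)) (fun t => M.normalMap c
        ((Fin.append (fun i => (v i, (0 : P))) fun j => ((0 : B), bs j)) t)) = _
    simp only [h2]
    refine h3.trans ?_
    change _ = LinearMap.det (smulEquiv P hc : P →ₗ[ℝ] P) •
      f (M.fibreMap c⁻¹ (M.dil c x, c • (ζ - M.md (M.δ (x - M.pr x))))) _
    rw [M.fibreMap_shear hc]
    rfl
  rw [integral_congr_ae (Eventually.of_forall h1), integral_det_comp hc]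
  exact ContinuousLinearMap.integral_comp_comm
    (ContinuousAlternatingMap.compContinuousLinearMapCLM (M.dil c) :
      (B [⋀^Fin a]→L[ℝ] ℂ) →L[ℝ] (B [⋀^Fin a]→L[ℝ] ℂ))
    (M.integrable_fibreIntegrand bs hK hf (M.dil c x))

end TransverseModel

/-! ## Partial pairings in product charts -/

section PartialDiffeo

variable {E₁ : Type*} [NormedAddCommGroup E₁] [NormedSpace ℝ E₁]
  {E₂ : Type*} [NormedAddCommGroup E₂] [NormedSpace ℝ E₂]
  {E₃ : Type*} [NormedAddCommGroup E₃] [NormedSpace ℝ E₃]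
  {H₁ : Type*} [TopologicalSpace H₁] {I₁ : ModelWithCorners ℝ E₁ H₁}
  {H₂ : Type*} [TopologicalSpace H₂] {I₂ : ModelWithCorners ℝ E₂ H₂}
  {H₃ : Type*} [TopologicalSpace H₃] {I₃ : ModelWithCorners ℝ E₃ H₃}
  {M₁ : Type*} [TopologicalSpace M₁] [ChartedSpace H₁ M₁]
  {M₂ : Type*} [TopologicalSpace M₂] [ChartedSpace H₂ M₂]
  {M₃ : Type*} [TopologicalSpace M₃] [ChartedSpace H₃ M₃]

/-- The differential of a chart, as a map between the model spaces. -/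
def chartDeriv (Φ : PartialDiffeomorph I₁ 𝓘(ℝ, E₂) M₁ E₂ ∞) (x : M₁) : E₁ →L[ℝ] E₂ :=
  mfderiv I₁ 𝓘(ℝ, E₂) Φ x

lemma PartialDiffeomorph.mem_trans_source {Φ : PartialDiffeomorph I₁ I₂ M₁ M₂ ∞}
    {Ψ : PartialDiffeomorph I₂ I₃ M₂ M₃ ∞} {x : M₁} :
    x ∈ (Φ.trans Ψ).source ↔ x ∈ Φ.source ∧ Φ x ∈ Ψ.source := by
  change x ∈ (Φ.toOpenPartialHomeomorph.trans Ψ.toOpenPartialHomeomorph).source ↔ _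
  rw [OpenPartialHomeomorph.trans_source]
  rfl

lemma PartialDiffeomorph.trans_apply {Φ : PartialDiffeomorph I₁ I₂ M₁ M₂ ∞}
    {Ψ : PartialDiffeomorph I₂ I₃ M₂ M₃ ∞} {x : M₁} : (Φ.trans Ψ) x = Ψ (Φ x) := rfl

lemma PartialDiffeomorph.mfderiv_symm_comp (Φ : PartialDiffeomorph I₁ I₂ M₁ M₂ ∞) {x : M₁}
    (hx : x ∈ Φ.source) (v : TangentSpace I₁ x) :
    mfderiv I₂ I₁ Φ.symm (Φ x) (mfderiv I₁ I₂ Φ x v) = v := by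
  have h1 : MDifferentiableAt I₂ I₁ Φ.symm (Φ x) :=
    Φ.symm.mdifferentiableAt (by simp) (Φ.map_source hx)
  have h2 : MDifferentiableAt I₁ I₂ Φ x := Φ.mdifferentiableAt (by simp) hx
  have h3 : mfderiv I₁ I₁ (Φ.symm ∘ Φ) x = ContinuousLinearMap.id ℝ (TangentSpace I₁ x) := by
    rw [← mfderiv_id]
    refine Filter.EventuallyEq.mfderiv_eq ?_
    filter_upwards [Φ.open_source.mem_nhds hx] with y hy using Φ.left_inv hy
  rw [mfderiv_comp x h1 h2] at h3
  exact DFunLike.congr_fun h3 v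

end PartialDiffeo

section ProductChart

variable {B F P : Type} [NormedAddCommGroup B] [NormedSpace ℝ B] [NormedSpace ℂ B]
  [IsScalarTower ℝ ℂ B] [FiniteDimensional ℝ B]
  [NormedAddCommGroup F] [NormedSpace ℝ F] [NormedSpace ℂ F] [IsScalarTower ℝ ℂ F]
  [FiniteDimensional ℝ F]
  [NormedAddCommGroup P] [NormedSpace ℝ P] [NormedSpace ℂ P] [IsScalarTower ℝ ℂ P]
  [FiniteDimensional ℝ P] [MeasurableSpace P] [BorelSpace P] {μ : Measure P} [μ.IsAddHaarMeasure]
  {Y : Type*} [TopologicalSpace Y] [ChartedSpace B Y]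
  {HN : Type*} [TopologicalSpace HN] {J : ModelWithCorners ℝ F HN}
  {N : Type*} [TopologicalSpace N] [ChartedSpace HN N]

/-- The chart `(y, z) ↦ (e y, eN z - δ (e y))` of `Y × N`. -/
def prodChart (e : PartialDiffeomorph 𝓘(ℝ, B) 𝓘(ℝ, B) Y B ∞)
    (eN : PartialDiffeomorph J 𝓘(ℝ, F) N F ∞) (δ : B →L[ℝ] F) :
    PartialDiffeomorph (𝓘(ℝ, B).prod J) 𝓘(ℝ, B × F) (Y × N) (B × F) ∞ where
  toFun x := (e x.1, eN x.2 - δ (e x.1))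
  invFun z := (e.symm z.1, eN.symm (z.2 + δ z.1))
  source := e.source ×ˢ eN.source
  target := {z | z.1 ∈ e.target ∧ z.2 + δ z.1 ∈ eN.target}
  map_source' x hx := ⟨e.map_source hx.1, by simpa using eN.map_source hx.2⟩
  map_target' z hz := ⟨e.map_target hz.1, eN.map_target hz.2⟩
  left_inv' x hx := Prod.ext (e.left_inv hx.1) (by simpa using eN.left_inv hx.2)
  right_inv' z hz := Prod.ext (e.right_inv hz.1) (by
    have h1 : e (e.symm z.1) = z.1 := e.right_inv hz.1
    have h2 : eN (eN.symm (z.2 + δ z.1)) = z.2 + δ z.1 := eN.right_inv hz.2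
    change eN (eN.symm (z.2 + δ z.1)) - δ (e (e.symm z.1)) = z.2
    rw [h1, h2, add_sub_cancel_right])
  open_source := e.open_source.prod eN.open_source
  open_target := (e.open_target.preimage continuous_fst).inter
    (eN.open_target.preimage (continuous_snd.add (δ.continuous.comp continuous_fst)))
  contMDiffOn_toFun := by
    have h1 : ContMDiffOn (𝓘(ℝ, B).prod J) 𝓘(ℝ, B) ∞ (fun x : Y × N => e x.1)
        (e.source ×ˢ eN.source) :=
      e.contMDiffOn_toFun.comp contMDiff_fst.contMDiffOn fun x hx => hx.1
    have h2 : ContMDiffOn (𝓘(ℝ, B).prod J) 𝓘(ℝ, F) ∞ (fun x : Y × N => eN x.2)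
        (e.source ×ˢ eN.source) :=
      eN.contMDiffOn_toFun.comp contMDiff_snd.contMDiffOn fun x hx => hx.2
    have h3 : ContDiff ℝ ∞ fun p : B × F => (p.1, p.2 - δ p.1) := by fun_prop
    exact h3.contMDiff.comp_contMDiffOn (h1.prodMk_space h2)
  contMDiffOn_invFun := by
    have h1 : ContDiff ℝ ∞ fun p : B × F => p.1 := contDiff_fst
    have h2 : ContDiff ℝ ∞ fun p : B × F => p.2 + δ p.1 := by fun_prop
    exact ContMDiffOn.prodMk (e.symm.contMDiffOn_toFun.comp h1.contMDiff.contMDiffOn fun z hz => hz.1)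
      (eN.symm.contMDiffOn_toFun.comp h2.contMDiff.contMDiffOn fun z hz => hz.2)

lemma prodChart_apply (e : PartialDiffeomorph 𝓘(ℝ, B) 𝓘(ℝ, B) Y B ∞)
    (eN : PartialDiffeomorph J 𝓘(ℝ, F) N F ∞) (δ : B →L[ℝ] F) (x : Y × N) :
    prodChart e eN δ x = (e x.1, eN x.2 - δ (e x.1)) := rfl

lemma mfderiv_prodChart (e : PartialDiffeomorph 𝓘(ℝ, B) 𝓘(ℝ, B) Y B ∞)
    (eN : PartialDiffeomorph J 𝓘(ℝ, F) N F ∞) (δ : B →L[ℝ] F) {x : Y × N}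
    (hx1 : x.1 ∈ e.source) (hx2 : x.2 ∈ eN.source) (v : B × F) :
    chartDeriv (prodChart e eN δ) x v =
      (chartDeriv e x.1 v.1, chartDeriv eN x.2 v.2 - δ (chartDeriv e x.1 v.1)) := by
  have hX := ((prodChart e eN δ).mdifferentiableAt (by simp) (x := x) ⟨hx1, hx2⟩).hasMFDerivAt
  have he := ((e.mdifferentiableAt (by simp) hx1).hasMFDerivAt).comp x (hasMFDerivAt_fst (I := 𝓘(ℝ, B)) (I' := J) x)
  have heN := ((eN.mdifferentiableAt (by simp) hx2).hasMFDerivAt).comp x (hasMFDerivAt_snd (I := 𝓘(ℝ, B)) (I' := J) x)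
  let A : B × F →L[ℝ] F := ContinuousLinearMap.snd ℝ B F + δ.comp (ContinuousLinearMap.fst ℝ B F)
  have h1 := ((ContinuousLinearMap.fst ℝ B F).hasFDerivAt
    (x := prodChart e eN δ x)).hasMFDerivAt.comp x hX
  have h2 := (A.hasFDerivAt (x := prodChart e eN δ x)).hasMFDerivAt.comp x hX
  have e2 : A ∘ prodChart e eN δ = eN ∘ Prod.snd := by
    funext z
    simp [A, prodChart_apply]
  rw [e2] at h2
  have k1 := DFunLike.congr_fun (hasMFDerivAt_unique h1 he) v
  have k2 := DFunLike.congr_fun (hasMFDerivAt_unique h2 heN) v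
  have k1' : (chartDeriv (prodChart e eN δ) x v).1 =
    chartDeriv e x.1 v.1 := k1
  have k2' : (chartDeriv (prodChart e eN δ) x v).2 +
    δ (chartDeriv (prodChart e eN δ) x v).1 = chartDeriv eN x.2 v.2 := k2
  refine Prod.ext k1' ?_
  rw [k1'] at k2'
  exact eq_sub_of_add_eq k2'

/-- The linear map `(x, z) ↦ (x, z - δ x)`. -/
def shearMap (δ : B →L[ℝ] F) : B × F →L[ℝ] B × F :=
  (ContinuousLinearMap.fst ℝ B F).prod
    (ContinuousLinearMap.snd ℝ B F - δ.comp (ContinuousLinearMap.fst ℝ B F))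

variable {a b : ℕ}

lemma sliceForm_chartPull_prodChart (e : PartialDiffeomorph 𝓘(ℝ, B) 𝓘(ℝ, B) Y B ∞)
    (eN : PartialDiffeomorph J 𝓘(ℝ, F) N F ∞) (δ : B →L[ℝ] F)
    (υ : B × F → (B × F) [⋀^Fin (a + b)]→L[ℝ] ℂ) {y : Y} (hy : y ∈ e.source)
    (u : Fin a → TangentSpace 𝓘(ℝ, B) y) :
    sliceForm (J := J) (chartPull (prodChart e eN δ) υ) y u =
      chartPull eN fun z => partialForm
        ((υ (e y, z - δ (e y))).compContinuousLinearMap (shearMap δ))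
        fun i => chartDeriv e y (u i) := by
  funext z
  by_cases hz : z ∈ eN.source
  · have hx : (y, z) ∈ (prodChart e eN δ).source := ⟨hy, hz⟩
    simp only [sliceForm, chartPull, if_pos hz, if_pos hx]
    ext w
    change υ (e y, eN z - δ (e y)) (fun t => chartDeriv (prodChart e eN δ) (y, z)
        ((Fin.append (fun i => ((u i, 0) : B × F))
          fun j => ((0, w j) : B × F)) t)) = υ (e y, eN z - δ (e y)) (fun t => shearMap δ
        ((Fin.append (fun i => ((chartDeriv e y (u i), 0) : B × F))
          fun j => ((0, chartDeriv eN z (w j)) : B × F)) t))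
    congr 1
    funext t
    refine (mfderiv_prodChart e eN δ (x := (y, z)) hy hz _).trans ?_
    refine Fin.addCases (fun i => ?_) (fun j => ?_) t
    · simp only [Fin.append_left, shearMap, ContinuousLinearMap.prod_apply]
      refine Prod.ext rfl ?_
      change chartDeriv eN z 0 - _ = 0 - _
      rw [map_zero]
      rfl
    · simp only [Fin.append_right, shearMap, ContinuousLinearMap.prod_apply]
      have h0 : chartDeriv e y 0 = 0 := map_zero _
      refine Prod.ext h0 ?_
      change chartDeriv eN z (w j) - δ (chartDeriv e y 0) =
        chartDeriv eN z (w j) - δ 0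
      rw [h0]
  · have hx : (y, z) ∉ (prodChart e eN δ).source := fun h => hz h.2
    simp only [sliceForm, chartPull, if_neg hz, if_neg hx]
    rfl

lemma sliceForm_chartPull_prodChart_of_notMem (e : PartialDiffeomorph 𝓘(ℝ, B) 𝓘(ℝ, B) Y B ∞)
    (eN : PartialDiffeomorph J 𝓘(ℝ, F) N F ∞) (δ : B →L[ℝ] F)
    (υ : B × F → (B × F) [⋀^Fin (a + b)]→L[ℝ] ℂ) {y : Y} (hy : y ∉ e.source)
    (u : Fin a → TangentSpace 𝓘(ℝ, B) y) :
    sliceForm (J := J) (chartPull (prodChart e eN δ) υ) y u = 0 := by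
  funext z
  have hx : (y, z) ∉ (prodChart e eN δ).source := fun h => hy h.1
  simp only [sliceForm, chartPull, if_neg hx]
  rfl

lemma partialPairing_eq {S : DForm J N b → ℂ} {φ : DForm (𝓘(ℝ, B).prod J) (Y × N) (a + b)} {y : Y}
    {A : TangentSpace 𝓘(ℝ, B) y [⋀^Fin a]→L[ℝ] ℂ} (hA : ∀ u, A u = S (sliceForm φ y u)) :
    partialPairing S φ y = A := by
  have h := Classical.epsilon_spec (p := fun A : TangentSpace 𝓘(ℝ, B) y [⋀^Fin a]→L[ℝ] ℂ =>
    ∀ u, A u = S (sliceForm φ y u)) ⟨A, hA⟩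
  ext u
  exact (h u).trans (hA u).symm

lemma isTest_slice {K : Set (B × F)} {υ : B × F → (B × F) [⋀^Fin (a + b)]→L[ℝ] ℂ}
    (hυ : IsTest K υ) (δ : B →L[ℝ] F) (x : B) (u : Fin a → B) :
    IsTest {z | (x, z - δ x) ∈ K} fun z =>
      partialForm ((υ (x, z - δ x)).compContinuousLinearMap (shearMap δ)) u := by
  refine ⟨contDiffOn_univ.1 (contDiffOn_alt_of_apply fun v => ?_), fun z hz => ?_⟩
  · refine ContDiffOn.alt_apply (f := fun z => (υ (x, z - δ x)).compContinuousLinearMap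
      (shearMap δ)) (ContDiffOn.alt_comp ?_ contDiffOn_const) fun i => contDiffOn_const
    exact (hυ.smooth.comp (by fun_prop : ContDiff ℝ ∞ fun z : F => ((x, z - δ x) : B × F))).contDiffOn
  · rw [hυ.eq_zero _ hz]
    rfl

/-- The map `(x, ζ) ↦ (x, m ζ - δ x)`. -/
def graphMap (m : P →L[ℝ] F) (δ : B →L[ℝ] F) : B × P →L[ℝ] B × F :=
  (ContinuousLinearMap.fst ℝ B P).prod (m.comp (ContinuousLinearMap.snd ℝ B P) -
    δ.comp (ContinuousLinearMap.fst ℝ B P))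

lemma graphMap_apply (m : P →L[ℝ] F) (δ : B →L[ℝ] F) (z : B × P) :
    graphMap m δ z = (z.1, m z.2 - δ z.1) := rfl

lemma partialPairing_chartPull {S : DForm J N b → ℂ} {m : P →L[ℝ] F} {md : F →L[ℝ] P}
    (hmd : ∀ u, md (m u) = u) (δ : B →L[ℝ] F) (fr : Fin b → P)
    (e : PartialDiffeomorph 𝓘(ℝ, B) 𝓘(ℝ, B) Y B ∞) (eN : PartialDiffeomorph J 𝓘(ℝ, F) N F ∞)
    (hS : ∀ (K : Set F) (f : F → F [⋀^Fin b]→L[ℝ] ℂ), IsCompact K → K ⊆ eN.target → IsTest K f →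
      S (chartPull eN f) = ∫ ζ, f (m ζ) (fun j => m (fr j)) ∂μ)
    {K : Set (B × F)} (hK : IsCompact K) (hKt : K ⊆ (prodChart e eN δ).target)
    {υ : B × F → (B × F) [⋀^Fin (a + b)]→L[ℝ] ℂ} (hυ : IsTest K υ) :
    partialPairing S (chartPull (prodChart e eN δ) υ) = chartPull e fun x =>
      ∫ ζ, sliceAlt fr ((υ (graphMap m δ (x, ζ))).compContinuousLinearMap (graphMap m δ)) ∂μ := by
  funext y
  refine partialPairing_eq fun u => ?_
  by_cases hy : y ∈ e.source
  · rw [sliceForm_chartPull_prodChart e eN δ υ hy, hS {z | (e y, z - δ (e y)) ∈ K}]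
    rotate_left
    · have : {z | (e y, z - δ (e y)) ∈ K} ⊆ (fun p : B × F => p.2 + δ p.1) '' K :=
        fun z hz => ⟨_, hz, by simp⟩
      refine (hK.image (by fun_prop)).of_isClosed_subset ?_ this
      exact hK.isClosed.preimage (by fun_prop)
    · intro z hz
      simpa using (hKt hz).2
    · exact isTest_slice hυ δ _ _
    have hint : Integrable (fun ζ => sliceAlt (a := a) fr ((υ (graphMap m δ
        (e y, ζ))).compContinuousLinearMap (graphMap m δ))) μ := by
      have hc : Continuous fun ζ : P => (υ (graphMap m δ (e y, ζ))).compContinuousLinearMap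
          (graphMap m δ) := by
        have := ContDiffOn.alt_comp (g := fun _ : P => graphMap m δ)
          (hυ.smooth.comp ((graphMap m δ).contDiff.comp
          (contDiff_const.prodMk contDiff_id : ContDiff ℝ ∞ fun ζ : P => (e y, ζ)))).contDiffOn
          (s := univ) contDiffOn_const
        exact (contDiffOn_univ.1 this).continuous
      refine Continuous.integrable_of_hasCompactSupport
        ((sliceAlt (B := B) (a := a) fr).continuous.comp hc) ?_
      refine HasCompactSupport.intro (hK.image
        (by fun_prop : Continuous fun p : B × F => md (p.2 + δ p.1))) fun ζ hζ => ?_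
      rw [hυ.eq_zero]
      · exact map_zero (sliceAlt (a := a) fr)
      · intro h
        refine hζ ⟨_, h, ?_⟩
        simp [graphMap_apply, hmd]
    simp only [chartPull, if_pos hy]
    have h2 := ContinuousLinearMap.integral_comp_comm
      (LinearMap.toContinuousLinearMap
        ({ toFun := fun A => A fun i => chartDeriv e y (u i)
           map_add' := fun _ _ => rfl
           map_smul' := fun _ _ => rfl } : (B [⋀^Fin a]→L[ℝ] ℂ) →ₗ[ℝ] ℂ)) hint
    refine h2.symm.trans (integral_congr_ae (Eventually.of_forall fun ζ => ?_))
    change υ (graphMap m δ (e y, ζ)) (fun t => graphMap m δ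
        ((Fin.append (fun i => ((chartDeriv e y (u i), 0) : B × P))
          fun j => ((0, fr j) : B × P)) t)) =
      υ (e y, m ζ - δ (e y)) (fun t => shearMap δ
        ((Fin.append (fun i => ((chartDeriv e y (u i), 0) : B × F))
          fun j => ((0, m (fr j)) : B × F)) t))
    have h3 : graphMap m δ (e y, ζ) = (e y, m ζ - δ (e y)) := by
      simp [graphMap_apply]
    rw [h3]
    congr 1
    funext t
    refine Fin.addCases (fun i => ?_) (fun j => ?_) t
    · simp [shearMap, graphMap_apply]
    · simp [shearMap, graphMap_apply]
  · rw [sliceForm_chartPull_prodChart_of_notMem e eN δ υ hy]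
    have h0 : (0 : DForm J N b) = chartPull eN 0 := by
      funext z
      simp only [chartPull]
      split_ifs <;> rfl
    rw [h0, hS ∅ 0 isCompact_empty (empty_subset _) (IsTest.zero _)]
    simp [chartPull, hy]

end ProductChart

/-! ## Tangent currents near a point of the intersection -/

section LocalModels

variable {B F P : Type} [NormedAddCommGroup B] [NormedSpace ℝ B] [NormedSpace ℂ B]
  [IsScalarTower ℝ ℂ B] [FiniteDimensional ℝ B]
  [NormedAddCommGroup F] [NormedSpace ℝ F] [NormedSpace ℂ F] [IsScalarTower ℝ ℂ F]
  [FiniteDimensional ℝ F]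
  [NormedAddCommGroup P] [NormedSpace ℝ P] [NormedSpace ℂ P] [IsScalarTower ℝ ℂ P]
  [FiniteDimensional ℝ P] [MeasurableSpace P] [BorelSpace P] {μ : Measure P} [μ.IsAddHaarMeasure]
  {Y : Type*} [TopologicalSpace Y] [ChartedSpace B Y]
  {HN : Type*} [TopologicalSpace HN] {J : ModelWithCorners ℝ F HN}
  {N : Type*} [TopologicalSpace N] [ChartedSpace HN N]
  {Z : Y → Type*} [TopologicalSpace (TotalSpace F Z)] [∀ y, TopologicalSpace (Z y)]
  [FiberBundle F Z] [∀ y, AddCommGroup (Z y)] [∀ y, Module ℝ (Z y)] [∀ y, Module ℂ (Z y)]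
  [∀ y, IsScalarTower ℝ ℂ (Z y)] {a b : ℕ}

/-- Charts `Θ` of the total space that are equivariant for dilations and lie over charts `e` of the
base. -/
structure BundleChart (e : PartialDiffeomorph 𝓘(ℝ, B) 𝓘(ℝ, B) Y B ∞)
    (Θ : PartialDiffeomorph (𝓘(ℝ, B).prod 𝓘(ℝ, F)) 𝓘(ℝ, B × F) (TotalSpace F Z) (B × F) ∞) :
    Prop where
  bundle_source : ∀ p, p ∈ Θ.source ↔ p.proj ∈ e.source
  bundle_fst : ∀ p ∈ Θ.source, (Θ p).1 = e p.proj
  bundle_dilation : ∀ p ∈ Θ.source, ∀ c : ℂ, (Θ (dilation F c p)).2 = c • (Θ p).2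

/-- Charts in which the embedding `y ↦ (y, δN y)`, the functional `S` and the normal bundle are
given by a linear model. -/
structure LocalModel (δN : Y → N)
    (quot : ∀ y : Y, TangentSpace (𝓘(ℝ, B).prod J) ((y, δN y) : Y × N) → Z y)
    (S : DForm J N b → ℂ) (M : TransverseModel B F P) (bs : Module.Basis (Fin b) ℝ P)
    (μ : Measure P) (e : PartialDiffeomorph 𝓘(ℝ, B) 𝓘(ℝ, B) Y B ∞)
    (eN : PartialDiffeomorph J 𝓘(ℝ, F) N F ∞)
    (Θ : PartialDiffeomorph (𝓘(ℝ, B).prod 𝓘(ℝ, F)) 𝓘(ℝ, B × F) (TotalSpace F Z) (B × F) ∞) :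
    Prop extends BundleChart e Θ where
  sub_pr_mem : ∀ x ∈ e.target, x - M.pr x ∈ e.target
  mem_source : ∀ y ∈ e.source, δN y ∈ eN.source
  map_δN : ∀ y ∈ e.source, eN (δN y) = M.δ (e y)
  bundle_target : Θ.target = e.target ×ˢ univ
  bundle_quot : ∀ y ∈ e.source, ∀ w : B × F,
    (Θ ⟨y, quot y w⟩).2 = chartDeriv eN (δN y) w.2 - M.δ (chartDeriv e y w.1)
  integral : ∀ (K : Set F) (f : F → F [⋀^Fin b]→L[ℝ] ℂ), IsCompact K → K ⊆ eN.target →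
    IsTest K f → S (chartPull eN f) = ∫ ζ, f (M.m ζ) (fun j => M.m (bs j)) ∂μ

variable {δN : Y → N} {quot : ∀ y : Y, TangentSpace (𝓘(ℝ, B).prod J) ((y, δN y) : Y × N) → Z y}
  {S : DForm J N b → ℂ} {M : TransverseModel B F P} {bs : Module.Basis (Fin b) ℝ P}
  {e : PartialDiffeomorph 𝓘(ℝ, B) 𝓘(ℝ, B) Y B ∞} {eN : PartialDiffeomorph J 𝓘(ℝ, F) N F ∞}
  {Θ : PartialDiffeomorph (𝓘(ℝ, B).prod 𝓘(ℝ, F)) 𝓘(ℝ, B × F) (TotalSpace F Z) (B × F) ∞}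
  {τ : PartialDiffeomorph (𝓘(ℝ, B).prod J) (𝓘(ℝ, B).prod 𝓘(ℝ, F)) (Y × N) (TotalSpace F Z) ∞}

/-- An admissible map in the charts of a local model. -/
def chartConj (M : TransverseModel B F P) (e : PartialDiffeomorph 𝓘(ℝ, B) 𝓘(ℝ, B) Y B ∞)
    (eN : PartialDiffeomorph J 𝓘(ℝ, F) N F ∞)
    (τ : PartialDiffeomorph (𝓘(ℝ, B).prod J) (𝓘(ℝ, B).prod 𝓘(ℝ, F)) (Y × N) (TotalSpace F Z) ∞)
    (Θ : PartialDiffeomorph (𝓘(ℝ, B).prod 𝓘(ℝ, F)) 𝓘(ℝ, B × F) (TotalSpace F Z) (B × F) ∞) :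
    PartialDiffeomorph 𝓘(ℝ, B × F) 𝓘(ℝ, B × F) (B × F) (B × F) ∞ :=
  ((prodChart e eN M.δ).symm.trans τ).trans Θ

lemma mem_chartConj_source {x : B × F} : x ∈ (chartConj M e eN τ Θ).source ↔
    x ∈ (prodChart e eN M.δ).target ∧ (prodChart e eN M.δ).symm x ∈ τ.source ∧
      τ ((prodChart e eN M.δ).symm x) ∈ Θ.source := by
  rw [chartConj, PartialDiffeomorph.mem_trans_source, PartialDiffeomorph.mem_trans_source, and_assoc]
  rfl

lemma chartConj_apply {x : B × F} : chartConj M e eN τ Θ x =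
    Θ (τ ((prodChart e eN M.δ).symm x)) := rfl

lemma chartConj_apply_prodChart {x : Y × N} (hx : x ∈ (prodChart e eN M.δ).source) :
    chartConj M e eN τ Θ (prodChart e eN M.δ x) = Θ (τ x) := by
  rw [chartConj_apply]
  exact congrArg (fun x => Θ (τ x)) ((prodChart e eN M.δ).left_inv hx)

lemma prodChart_mem_source_iff {x : Y × N} (hx : x ∈ (prodChart e eN M.δ).source) :
    prodChart e eN M.δ x ∈ (chartConj M e eN τ Θ).source ↔ x ∈ τ.source ∧ τ x ∈ Θ.source := by
  have hl : (prodChart e eN M.δ).symm (prodChart e eN M.δ x) = x :=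
    (prodChart e eN M.δ).left_inv hx
  rw [mem_chartConj_source, hl]
  exact and_iff_right ((prodChart e eN M.δ).map_source hx)

namespace BundleChart

variable (h : BundleChart (F := F) (Z := Z) e Θ)
include h

lemma bundle_zero {y : Y} (hy : y ∈ e.source) : Θ (⟨y, 0⟩ : TotalSpace F Z) = (e y, 0) := by
  have hs : (⟨y, 0⟩ : TotalSpace F Z) ∈ Θ.source := (h.bundle_source _).2 hy
  refine Prod.ext (h.bundle_fst _ hs) ?_
  have := h.bundle_dilation _ hs 0
  rw [zero_smul] at this
  rw [← this, dilation, smul_zero]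

lemma map_dilation {p : TotalSpace F Z} (hp : p ∈ Θ.source) (c : ℂ) :
    Θ (dilation F c p) = fibreDil B F c (Θ p) := by
  refine Prod.ext ?_ (h.bundle_dilation p hp c)
  have hs : dilation F c p ∈ Θ.source := by
    rw [h.bundle_source]
    exact (h.bundle_source p).1 hp
  exact (h.bundle_fst _ hs).trans (h.bundle_fst _ hp).symm

lemma chartDeriv_verticalVector {y : Y} (hy : y ∈ e.source) (z : Z y) :
    chartDeriv Θ (⟨y, 0⟩ : TotalSpace F Z) (verticalVector 𝓘(ℝ, B) F y z) =
      (0, (Θ (⟨y, z⟩ : TotalSpace F Z)).2) := by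
  set ζ := (Θ (⟨y, z⟩ : TotalSpace F Z)).2 with hζ
  have hs : ∀ z : Z y, (⟨y, z⟩ : TotalSpace F Z) ∈ Θ.source := fun z => (h.bundle_source _).2 hy
  have h1 : ∀ t : ℝ, Θ (⟨y, t • z⟩ : TotalSpace F Z) = (e y, t • ζ) := fun t => by
    refine Prod.ext (h.bundle_fst _ (hs _)) ?_
    have := h.bundle_dilation _ (hs z) (algebraMap ℝ ℂ t)
    rw [dilation, algebraMap_smul, algebraMap_smul] at this
    exact this
  have hsm : ContDiff ℝ ∞ fun t : ℝ => ((e y, t • ζ) : B × F) := by fun_prop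
  have hγ : MDifferentiableAt 𝓘(ℝ, ℝ) (𝓘(ℝ, B).prod 𝓘(ℝ, F))
      (fun t : ℝ => (⟨y, t • z⟩ : TotalSpace F Z)) 0 := by
    have h2 : (fun t : ℝ => (⟨y, t • z⟩ : TotalSpace F Z)) =
        Θ.symm ∘ fun t : ℝ => ((e y, t • ζ) : B × F) := by
      funext t
      rw [Function.comp_apply, ← h1 t]
      exact (Θ.left_inv (hs _)).symm
    rw [h2]
    refine MDifferentiableAt.comp (I' := 𝓘(ℝ, B × F)) _ (Θ.symm.mdifferentiableAt (by simp) ?_)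
      (hsm.contMDiff.contMDiffAt.mdifferentiableAt (by simp))
    rw [← h1 0]
    exact Θ.map_source (hs _)
  have hΘ : MDifferentiableAt (𝓘(ℝ, B).prod 𝓘(ℝ, F)) 𝓘(ℝ, B × F) Θ
      (⟨y, (0 : ℝ) • z⟩ : TotalSpace F Z) := Θ.mdifferentiableAt (by simp) (hs _)
  have h3 := mfderiv_comp (0 : ℝ) hΘ hγ
  have h4 : Θ ∘ (fun t : ℝ => (⟨y, t • z⟩ : TotalSpace F Z)) = fun t : ℝ => (e y, t • ζ) :=
    funext h1
  rw [h4, mfderiv_eq_fderiv] at h3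
  have h5 := DFunLike.congr_fun h3 (1 : ℝ)
  have h6 : fderiv ℝ (fun t : ℝ => ((e y, t • ζ) : B × F)) 0 1 = (0, ζ) := by
    have : HasFDerivAt (fun t : ℝ => ((e y, t • ζ) : B × F))
        ((0 : ℝ →L[ℝ] B).prod ((ContinuousLinearMap.id ℝ ℝ).smulRight ζ)) 0 :=
      (hasFDerivAt_const _ _).prodMk ((hasFDerivAt_id (0 : ℝ)).smul_const ζ)
    rw [this.fderiv]
    simp
  have h7 : chartDeriv Θ (⟨y, (0 : ℝ) • z⟩ : TotalSpace F Z) (verticalVector 𝓘(ℝ, B) F y z) =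
      fderiv ℝ (fun t : ℝ => ((e y, t • ζ) : B × F)) 0 1 := h5.symm
  rw [zero_smul] at h7
  rw [h7, h6]

lemma chartDeriv_horizontalVector {y : Y} (hy : y ∈ e.source) (u : TangentSpace 𝓘(ℝ, B) y) :
    chartDeriv Θ (⟨y, 0⟩ : TotalSpace F Z) (horizontalVector 𝓘(ℝ, B) F (Z := Z) y u) =
      (chartDeriv e y u, 0) := by
  have hs : ∀ y' ∈ e.source, (⟨y', 0⟩ : TotalSpace F Z) ∈ Θ.source :=
    fun y' hy' => (h.bundle_source _).2 hy'
  have hΘ : MDifferentiableAt (𝓘(ℝ, B).prod 𝓘(ℝ, F)) 𝓘(ℝ, B × F) Θ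
    (⟨y, 0⟩ : TotalSpace F Z) := Θ.mdifferentiableAt (by simp) (hs y hy)
  have he : HasMFDerivAt 𝓘(ℝ, B) 𝓘(ℝ, B) e y (mfderiv 𝓘(ℝ, B) 𝓘(ℝ, B) e y) :=
    (e.mdifferentiableAt (by simp) hy).hasMFDerivAt
  have hin : HasMFDerivAt 𝓘(ℝ, B) 𝓘(ℝ, B × F) (fun b : B => (b, (0 : F))) (e y)
      (ContinuousLinearMap.inl ℝ B F) := by
    have := (ContinuousLinearMap.inl ℝ B F).hasFDerivAt (x := e y)
    exact this.hasMFDerivAt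
  have h1 := hin.comp y he
  have hd : MDifferentiableAt 𝓘(ℝ, B) (𝓘(ℝ, B).prod 𝓘(ℝ, F))
      (fun y' => (⟨y', 0⟩ : TotalSpace F Z)) y := by
    have h2 : MDifferentiableAt 𝓘(ℝ, B × F) (𝓘(ℝ, B).prod 𝓘(ℝ, F)) Θ.symm (e y, 0) := by
      rw [← h.bundle_zero hy]
      exact Θ.symm.mdifferentiableAt (by simp) (Θ.map_source (hs y hy))
    refine (h2.comp y h1.mdifferentiableAt).congr_of_eventuallyEq ?_
    filter_upwards [e.open_source.mem_nhds hy] with y' hy'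
    simp only [Function.comp_apply]
    rw [← h.bundle_zero hy']
    exact (Θ.left_inv (hs y' hy')).symm
  have h3 : (Θ ∘ fun y' => (⟨y', 0⟩ : TotalSpace F Z)) =ᶠ[𝓝 y]
      (fun b : B => (b, (0 : F))) ∘ e := by
    filter_upwards [e.open_source.mem_nhds hy] with y' hy' using h.bundle_zero hy'
  exact DFunLike.congr_fun (hasMFDerivAt_unique (hΘ.hasMFDerivAt.comp y hd.hasMFDerivAt)
    (h1.congr_of_eventuallyEq h3)) u

end BundleChart

namespace LocalModel

variable (h : LocalModel δN quot S M bs μ e eN Θ)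
include h

lemma prodChart_δN {y : Y} (hy : y ∈ e.source) : prodChart e eN M.δ (y, δN y) = (e y, 0) := by
  rw [prodChart_apply]
  simp only [h.map_δN y hy, sub_self]

lemma normalizedAlong (hτ : IsAdmissible F (fun y => ((y, δN y) : Y × N)) quot τ) :
    NormalizedAlong e.target (chartConj M e eN τ Θ) := by
  have hy : ∀ p ∈ e.target, ∃ y ∈ e.source, e y = p := fun p hp =>
    ⟨_, e.map_target hp, e.right_inv hp⟩
  have hX : ∀ y ∈ e.source, ((y, δN y) : Y × N) ∈ (prodChart e eN M.δ).source := fun y hy =>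
    ⟨hy, h.mem_source y hy⟩
  have hms : ∀ p ∈ e.target, (p, (0 : F)) ∈ (chartConj M e eN τ Θ).source := by
    intro p hp
    obtain ⟨y, hy, rfl⟩ := hy p hp
    rw [← h.prodChart_δN hy, prodChart_mem_source_iff (hX y hy)]
    refine ⟨hτ.mem_source y, ?_⟩
    rw [hτ.map_base y]
    exact (h.bundle_source _).2 hy
  refine ⟨hms, fun p hp => ?_, fun p hp w => ?_⟩
  · obtain ⟨y, hy, rfl⟩ := hy p hp
    rw [← h.prodChart_δN hy, chartConj_apply_prodChart (hX y hy), hτ.map_base y, h.bundle_zero hy,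
      h.prodChart_δN hy]
  · obtain ⟨y, hy, rfl⟩ := hy p hp
    have hxs := hX y hy
    have hinj : Function.Injective (chartDeriv (prodChart e eN M.δ) (y, δN y)) :=
      fun v v' hv => by
        rw [← (prodChart e eN M.δ).mfderiv_symm_comp hxs v,
          ← (prodChart e eN M.δ).mfderiv_symm_comp hxs v']
        exact congrArg _ hv
    obtain ⟨v, hv⟩ := (LinearMap.injective_iff_surjective
      (f := (chartDeriv (prodChart e eN M.δ) (y, δN y)).toLinearMap)).1 hinj (0, w)
    have hv' : chartDeriv (prodChart e eN M.δ) (y, δN y) v = (0, w) := hv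
    have hm := hms _ hp
    rw [← h.prodChart_δN hy] at hm
    have d1 := ((prodChart e eN M.δ).mdifferentiableAt (by simp) hxs).hasMFDerivAt
    have d2 := ((chartConj M e eN τ Θ).differentiableAt hm).hasFDerivAt.hasMFDerivAt
    have d3 := (τ.mdifferentiableAt (by simp) (hτ.mem_source y)).hasMFDerivAt
    have hΘs : τ (y, δN y) ∈ Θ.source := by
      rw [show τ (y, δN y) = _ from hτ.map_base y]
      exact (h.bundle_source _).2 hy
    have d4 := (Θ.mdifferentiableAt (by simp) hΘs).hasMFDerivAt
    have heq : (chartConj M e eN τ Θ ∘ prodChart e eN M.δ) =ᶠ[𝓝 (y, δN y)] Θ ∘ τ := by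
      filter_upwards [(prodChart e eN M.δ).open_source.mem_nhds hxs] with x hx
      exact chartConj_apply_prodChart hx
    have h1 := DFunLike.congr_fun (hasMFDerivAt_unique (d2.comp _ d1)
      ((d4.comp _ d3).congr_of_eventuallyEq heq)) v
    have h2 : fderiv ℝ (chartConj M e eN τ Θ) (prodChart e eN M.δ (y, δN y))
        (chartDeriv (prodChart e eN M.δ) (y, δN y) v) = chartDeriv Θ (τ (y, δN y))
          (mfderiv (𝓘(ℝ, B).prod J) (𝓘(ℝ, B).prod 𝓘(ℝ, F)) τ (y, δN y) v) := h1
    obtain ⟨u, hu⟩ := hτ.deriv_normal y v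
    have h3 : chartDeriv Θ (τ (y, δN y))
          (mfderiv (𝓘(ℝ, B).prod J) (𝓘(ℝ, B).prod 𝓘(ℝ, F)) τ (y, δN y) v) =
        chartDeriv Θ (⟨y, 0⟩ : TotalSpace F Z) (horizontalVector 𝓘(ℝ, B) F (Z := Z) y u +
          verticalVector 𝓘(ℝ, B) F y (quot y v)) := by
      rw [show τ (y, δN y) = _ from hτ.map_base y]
      exact congrArg _ hu
    rw [h.prodChart_δN hy, hv', h3, map_add, h.chartDeriv_verticalVector hy] at h2
    rw [h2, h.chartDeriv_horizontalVector hy, Prod.snd_add, zero_add, h.bundle_quot y hy v]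
    have h4 := mfderiv_prodChart e eN M.δ (x := (y, δN y)) hy (h.mem_source y hy) v
    rw [hv'] at h4
    exact (congrArg Prod.snd h4).symm

variable {c : ℕ → ℂ} {ξ : ℂ}

lemma eventually_dilatedPullback_chartPull
    (hτ : IsAdmissible F (fun y => ((y, δN y) : Y × N)) quot τ)
    (hc : Tendsto (fun i => ‖c i‖) atTop atTop)
    (hξ : Tendsto (fun i => c i / ‖c i‖) atTop (𝓝 ξ)) (hξ0 : ξ ≠ 0) {K : Set (B × F)}
    (hK : IsCompact K) (hKΩ : K ⊆ e.target ×ˢ univ) :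
    ∀ᶠ i in atTop, ∀ f : B × F → (B × F) [⋀^Fin (a + b)]→L[ℝ] ℂ, IsTest K f →
      dilatedPullback F τ (c i) (chartPull Θ f) = chartPull (prodChart e eN M.δ) fun x =>
        (conjPull (chartConj M e eN τ Θ) (c i) f (fibreDil B F (c i) x)).compContinuousLinearMap
          (fibreDil B F (c i)) := by
  have hg := h.normalizedAlong hτ
  filter_upwards [eventually_conj_mem (hg.symm e.open_target) hc hξ hξ0 hK hKΩ isOpen_univ
    (subset_univ _), hc.eventually_gt_atTop 0] with i hi hci f hf
  have hc0 : c i ≠ 0 := norm_pos_iff.1 hci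
  set A := fibreDil B F (c i) with hA
  have hAi : ∀ x, fibreDil B F (c i)⁻¹ (A x) = x := fibreDil_inv_cancel hc0
  have hds : ∀ p : TotalSpace F Z, dilation F (c i) p ∈ Θ.source ↔ p ∈ Θ.source := fun p => by
    rw [h.bundle_source, h.bundle_source]
    rfl
  funext x
  by_cases hx : x ∈ τ.source ∧ τ x ∈ Θ.source
  · by_cases hxs : x ∈ (prodChart e eN M.δ).source
    · have hgs := (prodChart_mem_source_iff (τ := τ) (Θ := Θ) hxs).2 hx
      have hgs' : fibreDil B F (c i)⁻¹ (A (prodChart e eN M.δ x)) ∈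
          (chartConj M e eN τ Θ).source := by rwa [hAi]
      have hds' := (hds (τ x)).2 hx.2
      simp only [dilatedPullback, if_pos hx.1, chartPull, if_pos hxs, if_pos hds', conjPull,
        if_pos hgs']
      have hval : A (chartConj M e eN τ Θ (fibreDil B F (c i)⁻¹ (A (prodChart e eN M.δ x)))) =
          Θ (dilation F (c i) (τ x)) := by
        rw [hAi, chartConj_apply_prodChart hxs, h.map_dilation hx.2]
      rw [hval]
      have dX := ((prodChart e eN M.δ).mdifferentiableAt (by simp) hxs).hasMFDerivAt
      have dτ := (τ.mdifferentiableAt (by simp) hx.1).hasMFDerivAt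
      have dΘ := (Θ.mdifferentiableAt (by simp) hx.2).hasMFDerivAt
      have dΘ' := (Θ.mdifferentiableAt (by simp) hds').hasMFDerivAt
      have dg := (((contDiffOn_conj (g := chartConj M e eN τ Θ) (c i)).contDiffAt
        ((isOpen_conj_dom (c i)).mem_nhds hgs')).differentiableAt
          (by simp)).hasFDerivAt.hasMFDerivAt
      have dA := (A.hasFDerivAt (x := prodChart e eN M.δ x)).hasMFDerivAt
      have hopen : {x | x ∈ τ.source ∧ τ x ∈ Θ.source} ∈ 𝓝 x :=
        (τ.contMDiffOn_toFun.continuousOn.isOpen_inter_preimage τ.open_source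
          Θ.open_source).mem_nhds hx
      have ddil : MDifferentiableAt (𝓘(ℝ, B).prod J) (𝓘(ℝ, B).prod 𝓘(ℝ, F))
          (fun x' => dilation F (c i) (τ x')) x := by
        have hloc : (fun x' => dilation F (c i) (τ x')) =ᶠ[𝓝 x]
            Θ.symm ∘ A ∘ Θ ∘ τ := by
          filter_upwards [hopen] with y hy
          simp only [Function.comp_apply]
          rw [hA, ← h.map_dilation hy.2]
          exact (Θ.left_inv ((hds _).2 hy.2)).symm
        refine MDifferentiableAt.congr_of_eventuallyEq ?_ hloc
        have dA' := (A.hasFDerivAt (x := Θ (τ x))).hasMFDerivAt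
        refine MDifferentiableAt.comp (I' := 𝓘(ℝ, B × F)) x (Θ.symm.mdifferentiableAt (by simp) ?_)
          (dA'.comp x (dΘ.comp x dτ)).mdifferentiableAt
        change A (Θ (τ x)) ∈ Θ.target
        rw [hA, ← h.map_dilation hx.2]
        exact Θ.map_source hds'
      have k1 := dΘ'.comp x ddil.hasMFDerivAt
      have k2 := dg.comp x (dA.comp x dX)
      have hloc : (Θ ∘ fun x' => dilation F (c i) (τ x')) =ᶠ[𝓝 x]
          ((fun y => A (chartConj M e eN τ Θ (fibreDil B F (c i)⁻¹ y))) ∘ A ∘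
            prodChart e eN M.δ) := by
        filter_upwards [hopen, (prodChart e eN M.δ).open_source.mem_nhds hxs] with y hy hys
        simp only [Function.comp_apply]
        rw [hAi, chartConj_apply_prodChart hys, h.map_dilation hy.2]
      have k3 := hasMFDerivAt_unique k1 (k2.congr_of_eventuallyEq hloc)
      ext v
      change f (Θ (dilation F (c i) (τ x))) _ = f (Θ (dilation F (c i) (τ x))) _
      congr 1
      funext t
      exact DFunLike.congr_fun k3 (v t)
    · have h2 : Θ (dilation F (c i) (τ x)) ∉ K := by
        intro hmem
        have hgt := (hi _ hmem).1
        rw [h.map_dilation hx.2, fibreDil_inv_cancel hc0] at hgt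
        have hgt' : Θ (τ x) ∈ (chartConj M e eN τ Θ).target := hgt
        have h3 := (chartConj M e eN τ Θ).map_target hgt'
        have h4 : Θ (τ ((prodChart e eN M.δ).symm ((chartConj M e eN τ Θ).symm (Θ (τ x))))) =
            Θ (τ x) := (chartConj M e eN τ Θ).right_inv hgt'
        obtain ⟨s1, s2, s3⟩ := mem_chartConj_source.1 h3
        have h5 := Θ.injOn s3 hx.2 h4
        have h6 := τ.injOn s2 hx.1 h5
        exact hxs (h6 ▸ (prodChart e eN M.δ).map_target s1)
      simp only [dilatedPullback, if_pos hx.1, chartPull, if_neg hxs, if_pos ((hds (τ x)).2 hx.2)]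
      rw [hf.eq_zero _ h2]
      rfl
  · have hR : chartPull (prodChart e eN M.δ) (fun x =>
        (conjPull (chartConj M e eN τ Θ) (c i) f (A x)).compContinuousLinearMap A) x = 0 := by
      unfold chartPull
      split_ifs with hxs
      · have hgs : fibreDil B F (c i)⁻¹ (A (prodChart e eN M.δ x)) ∉
            (chartConj M e eN τ Θ).source := by
          rw [hAi]
          exact fun hh => hx ((prodChart_mem_source_iff hxs).1 hh)
        have h0 : conjPull (chartConj M e eN τ Θ) (c i) f (A (prodChart e eN M.δ x)) = 0 := by
          unfold conjPull
          exact if_neg hgs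
        simp only [h0]
        rfl
      · rfl
    rw [hR, dilatedPullback]
    split_ifs with hxτ
    · have : dilation F (c i) (τ x) ∉ Θ.source := fun hh => hx ⟨hxτ, (hds _).1 hh⟩
      simp only [chartPull, if_neg this]
      rfl
    · rfl

/-- For large dilation factors, the partial pairing is given by the linear model. -/
theorem eventually_partialPairing
    (hτ : IsAdmissible F (fun y => ((y, δN y) : Y × N)) quot τ)
    (hc : Tendsto (fun i => ‖c i‖) atTop atTop)
    (hξ : Tendsto (fun i => c i / ‖c i‖) atTop (𝓝 ξ)) (hξ0 : ξ ≠ 0) {K : Set (B × F)}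
    (hK : IsCompact K) (hKΩ : K ⊆ e.target ×ˢ univ) :
    ∀ᶠ i in atTop, ∀ f : B × F → (B × F) [⋀^Fin (a + b)]→L[ℝ] ℂ, IsTest K f →
      partialPairing S (dilatedPullback F τ (c i) (chartPull Θ f)) = chartPull e
        (M.dilForm (c i) (M.fibreForm bs μ (c i)⁻¹
          (conjPull (chartConj M e eN τ Θ) (c i) f))) := by
  have hg := h.normalizedAlong hτ
  obtain ⟨K', hK', hKK, hKΩ'⟩ : ∃ L, IsCompact L ∧ K ⊆ interior L ∧ L ⊆ e.target ×ˢ univ :=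
    exists_compact_between hK (e.open_target.prod isOpen_univ) hKΩ
  filter_upwards [h.eventually_dilatedPullback_chartPull (a := a) hτ hc hξ hξ0 hK hKΩ,
    eventually_conjPull_test (n := a + b) e.open_target hg hc hξ hξ0 hK hK' hKΩ' hKK,
    eventually_conj_mem hg hc hξ hξ0 hK' hKΩ' isOpen_univ (subset_univ _),
    hc.eventually_gt_atTop 0] with i h1 h2 h3 hci f hf
  have hc0 : c i ≠ 0 := norm_pos_iff.1 hci
  have hK'' : IsCompact (fibreDil B F (c i)⁻¹ '' K') := hK'.image (fibreDil B F _).continuous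
  have hft := h2.1 f hf
  have hυ : IsTest (fibreDil B F (c i)⁻¹ '' K') fun x =>
      (conjPull (chartConj M e eN τ Θ) (c i) f (fibreDil B F (c i) x)).compContinuousLinearMap
        (fibreDil B F (c i)) := by
    refine ⟨contDiffOn_univ.1 (ContDiffOn.alt_comp
      (hft.smooth.comp (fibreDil B F (c i)).contDiff).contDiffOn contDiffOn_const), fun x hx => ?_⟩
    rw [hft.eq_zero]
    · rfl
    · exact fun hh => hx ⟨_, hh, fibreDil_inv_cancel hc0 x⟩
  rw [h1 f hf, partialPairing_chartPull M.md_m M.δ bs e eN h.integral hK'' ?_ hυ]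
  · congr 1
    funext x
    rw [← M.integral_normalMap bs hc0 hK' hft x]
    have hn : ∀ z, fibreDil B F (c i) (graphMap M.m M.δ z) = M.normalMap (c i) z := fun _ => rfl
    refine integral_congr_ae (Eventually.of_forall fun ζ => ?_)
    change sliceAlt (a := a) bs ((conjPull (chartConj M e eN τ Θ) (c i) f (fibreDil B F (c i)
      (graphMap M.m M.δ (x, ζ)))).compContinuousLinearMap
        ((fibreDil B F (c i)).comp (graphMap M.m M.δ))) = _
    rw [hn, show (fibreDil B F (c i)).comp (graphMap M.m M.δ) = M.normalMap (c i) from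
      ContinuousLinearMap.ext hn]
  · rintro _ ⟨x, hx, rfl⟩
    exact (mem_chartConj_source.1 (h3 x hx).1).1

end LocalModel

end LocalModels

/-! ## From local to global convergence -/

section Globalize

open TransverseModel (IsLocalFunctional)

variable {B F P : Type} [NormedAddCommGroup B] [NormedSpace ℝ B] [NormedSpace ℂ B]
  [IsScalarTower ℝ ℂ B] [FiniteDimensional ℝ B]
  [NormedAddCommGroup F] [NormedSpace ℝ F] [NormedSpace ℂ F] [IsScalarTower ℝ ℂ F]
  [FiniteDimensional ℝ F]
  [NormedAddCommGroup P] [NormedSpace ℝ P] [NormedSpace ℂ P] [IsScalarTower ℝ ℂ P]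
  [FiniteDimensional ℝ P] [MeasurableSpace P] [BorelSpace P] {μ : Measure P} [μ.IsAddHaarMeasure]
  {Y : Type*} [TopologicalSpace Y] [ChartedSpace B Y]
  {HN : Type*} [TopologicalSpace HN] {J : ModelWithCorners ℝ F HN}
  {N : Type*} [TopologicalSpace N] [ChartedSpace HN N]
  {Z : Y → Type*} [TopologicalSpace (TotalSpace F Z)] [∀ y, TopologicalSpace (Z y)]
  [FiberBundle F Z] [∀ y, AddCommGroup (Z y)] [∀ y, Module ℝ (Z y)] [∀ y, Module ℂ (Z y)]
  [∀ y, IsScalarTower ℝ ℂ (Z y)] {a b : ℕ}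
  {δN : Y → N} {quot : ∀ y : Y, TangentSpace (𝓘(ℝ, B).prod J) ((y, δN y) : Y × N) → Z y}
  {S : DForm J N b → ℂ} {M : TransverseModel B F P} {bs : Module.Basis (Fin b) ℝ P}
  {e : PartialDiffeomorph 𝓘(ℝ, B) 𝓘(ℝ, B) Y B ∞} {eN : PartialDiffeomorph J 𝓘(ℝ, F) N F ∞}
  {Θ : PartialDiffeomorph (𝓘(ℝ, B).prod 𝓘(ℝ, F)) 𝓘(ℝ, B × F) (TotalSpace F Z) (B × F) ∞}
  {τ : PartialDiffeomorph (𝓘(ℝ, B).prod J) (𝓘(ℝ, B).prod 𝓘(ℝ, F)) (Y × N) (TotalSpace F Z) ∞}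
  {c : ℕ → ℂ} {ξ : ℂ}
  [IsManifold 𝓘(ℝ, B) ∞ Y] [T2Space Y]
  [IsManifold (𝓘(ℝ, B).prod 𝓘(ℝ, F)) ∞ (TotalSpace F Z)] [T2Space (TotalSpace F Z)]

lemma Current.isLocalFunctional (T : Current 𝓘(ℝ, B) Y a)
    (e : PartialDiffeomorph 𝓘(ℝ, B) 𝓘(ℝ, B) Y B ∞) :
    IsLocalFunctional e.target fun h => T.eval (chartPull e h) :=
  fun _ hC hCe => T.isTestFunctional e hC hCe

lemma Current.eval_zero_current {E : Type*} [NormedAddCommGroup E] [NormedSpace ℝ E]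
    {H : Type*} [TopologicalSpace H] {I : ModelWithCorners ℝ E H}
    {X : Type*} [TopologicalSpace X] [ChartedSpace H X] {n : ℕ} (φ : DForm I X n) :
    (0 : Current I X n).eval φ = 0 := by
  unfold Current.eval
  split_ifs
  · rfl
  · rfl

/-- Weak convergence on the normal bundle implies convergence in the linear model. -/
theorem LocalModel.exists_limit (h : LocalModel δN quot S M bs μ e eN Θ)
    (T : Current 𝓘(ℝ, B) Y a) (R : Current (𝓘(ℝ, B).prod 𝓘(ℝ, F)) (TotalSpace F Z) (a + b))
    (hτ : IsAdmissible F (fun y => ((y, δN y) : Y × N)) quot τ)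
    (hc : Tendsto (fun i => ‖c i‖) atTop atTop)
    (hξ : Tendsto (fun i => c i / ‖c i‖) atTop (𝓝 ξ)) (hξ0 : ξ ≠ 0)
    (hlim : ∀ Φ ∈ testForms (𝓘(ℝ, B).prod 𝓘(ℝ, F)) (TotalSpace F Z) (a + b),
      Tendsto (fun i => tensor T.eval S (dilatedPullback F τ (c i) Φ)) atTop (𝓝 (R.eval Φ))) :
    ∃ L : (B → B [⋀^Fin a]→L[ℝ] ℂ) → ℂ,
      IsLocalFunctional {x | x - M.pr x ∈ e.target} L ∧
      (∀ C : Set B, IsCompact C → (∀ x ∈ C, x - M.pr x ∈ e.target) → ∀ ψ, IsTest C ψ →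
        Tendsto (fun i => T.eval (chartPull e (M.dilForm (c i) ψ))) atTop (𝓝 (L ψ))) ∧
      (R = 0 → ∀ C : Set B, IsCompact C → (∀ x ∈ C, x - M.pr x ∈ e.target) →
        ∀ ψ, IsTest C ψ → L ψ = 0) := by
  have hR : IsLocalFunctional (e.target ×ˢ univ) fun f => R.eval (chartPull Θ f) := by
    intro K hK hKe
    rw [← h.bundle_target] at hKe
    exact R.isTestFunctional Θ hK hKe
  obtain ⟨L, h1, h2, h3⟩ := M.exists_limit bs (μ := μ) e.open_target h.sub_pr_mem
    (T.isLocalFunctional e) (h.normalizedAlong hτ) hc hξ hξ0 hR (by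
      intro K hK hKe f hf
      have hmem : chartPull Θ f ∈ testForms (𝓘(ℝ, B).prod 𝓘(ℝ, F)) (TotalSpace F Z) (a + b) :=
        chartPull_mem_testForms Θ hK (by rwa [h.bundle_target]) hf
      refine (hlim _ hmem).congr' ?_
      filter_upwards [h.eventually_partialPairing (a := a) hτ hc hξ hξ0 hK hKe] with i hi
      simp only [tensor, hi f hf]
      rfl)
  refine ⟨L, h1, h2, fun h0 => h3 fun f => ?_⟩
  rw [h0]
  exact Current.eval_zero_current _

/-- The supports of dilated pull-backs shrink to the image of the zero section. -/
lemma eventually_dilatedPullback_support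
    (hdil : Continuous fun p : ℂ × TotalSpace F Z => dilation F p.1 p.2)
    (hτ : IsAdmissible F (fun y => ((y, δN y) : Y × N)) quot τ)
    (hc : Tendsto (fun i => ‖c i‖) atTop atTop) {O : Set (Y × N)} (hO : IsOpen O)
    (hδO : ∀ y, (y, δN y) ∈ O) {n : ℕ}
    {Φ : DForm (𝓘(ℝ, B).prod 𝓘(ℝ, F)) (TotalSpace F Z) n}
    (hΦ : IsCompact (closure {p | Φ p ≠ 0})) :
    ∀ᶠ i in atTop, ∀ x, dilatedPullback F τ (c i) Φ x ≠ 0 → x ∈ O := by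
  set U : Set (TotalSpace F Z) := τ.target ∩ τ.symm ⁻¹' O with hU
  have hUo : IsOpen U := τ.contMDiffOn_invFun.continuousOn.isOpen_inter_preimage τ.open_target hO
  have h0 : ∀ y, (⟨y, 0⟩ : TotalSpace F Z) ∈ U := fun y => by
    rw [← hτ.map_base y]
    refine ⟨τ.map_source (hτ.mem_source y), ?_⟩
    change τ.symm (τ (y, δN y)) ∈ O
    rw [show τ.symm (τ (y, δN y)) = (y, δN y) from τ.left_inv (hτ.mem_source y)]
    exact hδO y
  have h1 : ∀ᶠ t in 𝓝 (0 : ℂ), ∀ p ∈ closure {p | Φ p ≠ 0}, dilation F t p ∈ U := by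
    refine hΦ.eventually_forall_of_forall_eventually fun p _ => ?_
    refine hdil.continuousAt.eventually_mem (hUo.mem_nhds ?_)
    simp only [dilation, zero_smul]
    exact h0 _
  filter_upwards [(TransverseModel.tendsto_inv_zero_of_norm hc).eventually h1,
    hc.eventually_gt_atTop 0] with i hi hci x hx
  have hc0 : c i ≠ 0 := norm_pos_iff.1 hci
  rw [dilatedPullback] at hx
  split_ifs at hx with hxs
  · have hp : Φ (dilation F (c i) (τ x)) ≠ 0 := by
      intro hp
      rw [hp] at hx
      exact hx rfl
    have h2 := hi _ (subset_closure hp)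
    have h3 : dilation F (c i)⁻¹ (dilation F (c i) (τ x)) = τ x :=
      congrArg (TotalSpace.mk (τ x).proj) (inv_smul_smul₀ hc0 (τ x).snd)
    rw [h3] at h2
    have h4 : τ.symm (τ x) ∈ O := h2.2
    rwa [show τ.symm (τ x) = x from τ.left_inv hxs] at h4
  · exact absurd rfl hx

lemma partialPairing_congr {Φ Φ' : DForm (𝓘(ℝ, B).prod J) (Y × N) (a + b)} {y : Y}
    (h : ∀ z, Φ (y, z) = Φ' (y, z)) : partialPairing S Φ y = partialPairing S Φ' y := by
  have : ∀ u : Fin a → TangentSpace 𝓘(ℝ, B) y, sliceForm Φ y u = sliceForm Φ' y u := fun u => by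
    funext z
    simp only [sliceForm, h]
    rfl
  simp only [partialPairing, this]

lemma partialPairing_eq_zero {Φ : DForm (𝓘(ℝ, B).prod J) (Y × N) (a + b)} {y : Y}
    {W : Set N} (hS : ∀ φ : DForm J N b, (∀ z ∈ W, φ z = 0) → S φ = 0)
    (h : ∀ z ∈ W, Φ (y, z) = 0) : partialPairing S Φ y = 0 := by
  refine partialPairing_eq fun u => ?_
  rw [hS]
  · rfl
  · intro z hz
    simp only [sliceForm, h z hz]
    rfl

/-- The expression of a function in a chart, extended by zero. -/
def chartFun (e : PartialDiffeomorph 𝓘(ℝ, B) 𝓘(ℝ, B) Y B ∞) (χ : Y → ℝ) (p : B) : ℝ :=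
  open Classical in if p ∈ e.target then χ (e.symm p) else 0

lemma isTest_chartFun [CompactSpace Y] (e : PartialDiffeomorph 𝓘(ℝ, B) 𝓘(ℝ, B) Y B ∞) {χ : Y → ℝ}
    (hχ : ContMDiff 𝓘(ℝ, B) 𝓘(ℝ, ℝ) ∞ χ) (hχe : tsupport χ ⊆ e.source) :
    IsTest (e '' tsupport χ) (chartFun e χ) ∧ IsCompact (e '' tsupport χ) := by
  have hC : IsCompact (e '' tsupport χ) :=
    (isClosed_tsupport χ).isCompact.image_of_continuousOn
      (e.contMDiffOn_toFun.continuousOn.mono hχe)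
  have h0 : ∀ p, p ∉ e '' tsupport χ → chartFun e χ p = 0 := fun p hp => by
    rw [chartFun]
    split_ifs with hpe
    · by_contra hne
      exact hp ⟨e.symm p, subset_tsupport χ hne, e.right_inv hpe⟩
    · rfl
  refine ⟨⟨contDiff_iff_contDiffAt.2 fun p => ?_, h0⟩, hC⟩
  by_cases hp : p ∈ e '' tsupport χ
  · have hpe : p ∈ e.target := by
      obtain ⟨y, hy, rfl⟩ := hp
      exact e.map_source (hχe hy)
    have h1 : ContMDiffAt 𝓘(ℝ, B) 𝓘(ℝ, ℝ) ∞ (χ ∘ e.symm) p :=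
      (hχ _).comp p (e.contMDiffOn_invFun.contMDiffAt (e.open_target.mem_nhds hpe))
    refine h1.contDiffAt.congr_of_eventuallyEq ?_
    filter_upwards [e.open_target.mem_nhds hpe] with q hq
    exact if_pos hq
  · refine (contDiffAt_const (c := (0 : ℝ))).congr_of_eventuallyEq ?_
    filter_upwards [hC.isClosed.isOpen_compl.mem_nhds hp] with q hq
    exact h0 q hq

namespace TransverseModel

lemma fibreForm_smul_base (M : TransverseModel B F P) (bs : Module.Basis (Fin b) ℝ P) (t : ℂ)
    (χ : B → ℝ) (f : B × F → (B × F) [⋀^Fin (a + b)]→L[ℝ] ℂ) (x : B) :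
    M.fibreForm bs μ t (fun z => χ z.1 • f z) x = χ (M.dil t x) • M.fibreForm bs μ t f x := by
  have h : ∀ u, sliceAlt (a := a) bs ((χ (M.fibreMap t (x, u)).1 •
      f (M.fibreMap t (x, u))).compContinuousLinearMap (M.fibreMap t)) =
      χ (M.dil t x) • sliceAlt (a := a) bs
        ((f (M.fibreMap t (x, u))).compContinuousLinearMap (M.fibreMap t)) := fun u =>
    (sliceAlt (B := B) (a := a) bs).map_smul (χ (M.dil t x))
      ((f (M.fibreMap t (x, u))).compContinuousLinearMap (M.fibreMap t))
  rw [fibreForm, integral_congr_ae (Eventually.of_forall h), integral_smul]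
  rfl

lemma isTestFunctional_fibreForm (M : TransverseModel B F P) (bs : Module.Basis (Fin b) ℝ P)
    {Ω : Set B} (hΩpr : ∀ x ∈ Ω, x - M.pr x ∈ Ω) {L : (B → B [⋀^Fin a]→L[ℝ] ℂ) → ℂ}
    (hL : IsLocalFunctional {x | x - M.pr x ∈ Ω} L) (t : ℂ) {K : Set (B × F)} (hK : IsCompact K)
    (hKΩ : K ⊆ Ω ×ˢ univ) {χ : B × F → ℝ} (hχ : ContDiff ℝ ∞ χ) :
    IsTestFunctional K fun f : B × F → (B × F) [⋀^Fin (a + b)]→L[ℝ] ℂ =>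
      L (M.fibreForm bs μ t fun x => χ x • f x) := by
  have hi := hL _ (M.isCompact_fibreBase hK) (M.fibreBase_subset hΩpr hKΩ)
  have ht : ∀ {f : B × F → (B × F) [⋀^Fin (a + b)]→L[ℝ] ℂ}, IsTest K f →
      IsTest (Prod.fst '' (M.fibreInv '' K)) (M.fibreForm bs μ t fun x => χ x • f x) := fun hf =>
    M.isTest_fibreForm bs hK (hf.smul_left hχ)
  refine ⟨fun f g hf hg => ?_, fun z f hf => ?_, fun x hx => hi.tendsto _ ?_⟩
  · have h1 : (fun x => χ x • (f + g) x) = (fun x => χ x • f x) + fun x => χ x • g x := by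
      funext x
      exact smul_add _ _ _
    rw [h1, M.fibreForm_add bs hK (hf.smul_left hχ) (hg.smul_left hχ)]
    exact hi.map_add _ _ (ht hf) (ht hg)
  · have h1 : (fun x => χ x • z • f x) = fun x => z • χ x • f x := by
      funext x
      exact smul_comm _ _ _
    rw [h1, M.fibreForm_smul bs]
    exact hi.map_smul z _ (ht hf)
  · have h2 : NullSeq K fun i y => χ y • x i y := by
      have := hx.pull (K' := K) isOpen_univ (contDiffOn_id (E := B × F))
        (M := fun y => χ y • ContinuousLinearMap.id ℝ ((B × F) [⋀^Fin (a + b)]→L[ℝ] ℂ))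
        (hχ.smul contDiff_const).contDiffOn hK (subset_univ _) (fun z _ hz => hz)
      simpa using this
    have := M.nullSeq_fibreForm bs (μ := μ) (tendsto_const_nhds (x := t)) hK (f₀ := 0)
      (IsTest.zero K) (by simpa using h2) h2.test
    simpa [M.fibreForm_zero] using this

end TransverseModel

end Globalize

/-! ## Global convergence -/

section Globalize

open TransverseModel (IsLocalFunctional)

variable {B F P : Type} [NormedAddCommGroup B] [NormedSpace ℝ B] [NormedSpace ℂ B]
  [IsScalarTower ℝ ℂ B] [FiniteDimensional ℝ B]
  [NormedAddCommGroup F] [NormedSpace ℝ F] [NormedSpace ℂ F] [IsScalarTower ℝ ℂ F]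
  [FiniteDimensional ℝ F]
  [NormedAddCommGroup P] [NormedSpace ℝ P] [NormedSpace ℂ P] [IsScalarTower ℝ ℂ P]
  [FiniteDimensional ℝ P] [MeasurableSpace P] [BorelSpace P] {μ : Measure P} [μ.IsAddHaarMeasure]
  {Y : Type*} [TopologicalSpace Y] [ChartedSpace B Y]
  {HN : Type*} [TopologicalSpace HN] {J : ModelWithCorners ℝ F HN}
  {N : Type*} [TopologicalSpace N] [ChartedSpace HN N]
  {Z : Y → Type*} [TopologicalSpace (TotalSpace F Z)] [∀ y, TopologicalSpace (Z y)]
  [FiberBundle F Z] [∀ y, AddCommGroup (Z y)] [∀ y, Module ℝ (Z y)] [∀ y, Module ℂ (Z y)]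
  [∀ y, IsScalarTower ℝ ℂ (Z y)] {a b : ℕ}
  {δN : Y → N} {quot : ∀ y : Y, TangentSpace (𝓘(ℝ, B).prod J) ((y, δN y) : Y × N) → Z y}
  {S : DForm J N b → ℂ} {M : TransverseModel B F P} {bs : Module.Basis (Fin b) ℝ P}
  {e : PartialDiffeomorph 𝓘(ℝ, B) 𝓘(ℝ, B) Y B ∞} {eN : PartialDiffeomorph J 𝓘(ℝ, F) N F ∞}
  {Θ : PartialDiffeomorph (𝓘(ℝ, B).prod 𝓘(ℝ, F)) 𝓘(ℝ, B × F) (TotalSpace F Z) (B × F) ∞}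
  {τ : PartialDiffeomorph (𝓘(ℝ, B).prod J) (𝓘(ℝ, B).prod 𝓘(ℝ, F)) (Y × N) (TotalSpace F Z) ∞}
  {c : ℕ → ℂ} {ξ : ℂ}
  [IsManifold 𝓘(ℝ, B) ∞ Y] [T2Space Y]
  [IsManifold (𝓘(ℝ, B).prod 𝓘(ℝ, F)) ∞ (TotalSpace F Z)] [T2Space (TotalSpace F Z)]

lemma Current.eval_apply {E : Type*} [NormedAddCommGroup E] [NormedSpace ℝ E]
    {H : Type*} [TopologicalSpace H] {I : ModelWithCorners ℝ E H}
    {X : Type*} [TopologicalSpace X] [ChartedSpace H X] {n : ℕ} (R : Current I X n)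
    {φ : DForm I X n} (h : φ ∈ testForms I X n) : R.eval φ = R.toLinearMap ⟨φ, h⟩ :=
  dif_pos h

/-- A sequentially continuous linear functional on test forms is a current. -/
lemma Current.exists_of_functional {E : Type*} [NormedAddCommGroup E] [NormedSpace ℝ E]
    {H : Type*} [TopologicalSpace H] {I : ModelWithCorners ℝ E H}
    {X : Type*} [TopologicalSpace X] [ChartedSpace H X] {n : ℕ} {G : DForm I X n → ℂ}
    (hadd : ∀ φ ∈ testForms I X n, ∀ ψ ∈ testForms I X n, G (φ + ψ) = G φ + G ψ)
    (hsmul : ∀ (t : ℂ), ∀ φ ∈ testForms I X n, G (t • φ) = t * G φ)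
    (hG : ∀ φ : ℕ → DForm I X n, (∀ i, φ i ∈ testForms I X n) → TendsToZero φ →
      Tendsto (fun i => G (φ i)) atTop (𝓝 0)) :
    ∃ R : Current I X n, (∀ φ ∈ testForms I X n, R.eval φ = G φ) ∧
      ((∀ φ ∈ testForms I X n, G φ = 0) → R = 0) := by
  refine ⟨⟨⟨⟨fun φ => G φ.1, fun φ ψ => hadd _ φ.2 _ ψ.2⟩, fun t φ => hsmul t _ φ.2⟩,
    fun φ hφ => hG _ (fun i => (φ i).2) hφ⟩, fun φ hφ => Current.eval_apply _ hφ, fun h => ?_⟩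
  congr 1
  exact LinearMap.ext fun φ => h _ φ.2

open Classical in
/-- A finite sum of currents. -/
lemma Current.exists_sum {E : Type*} [NormedAddCommGroup E] [NormedSpace ℝ E]
    {H : Type*} [TopologicalSpace H] {I : ModelWithCorners ℝ E H}
    {X : Type*} [TopologicalSpace X] [ChartedSpace H X] {n : ℕ} {ι : Type*} (s : Finset ι)
    (A : ι → Current I X n) : ∃ R : Current I X n,
      (∀ φ ∈ testForms I X n, R.eval φ = ∑ i ∈ s, (A i).eval φ) ∧
      ((∀ i ∈ s, A i = 0) → R = 0) := by
  refine ⟨⟨∑ i ∈ s, (A i).toLinearMap, fun φ hφ => ?_⟩, fun φ hφ => ?_, fun h => ?_⟩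
  · simp only [LinearMap.coe_sum, Finset.sum_apply]
    have := tendsto_finsetSum s fun i _ => (A i).continuous' φ hφ
    simpa using this
  · rw [Current.eval_apply _ hφ]
    simp only [LinearMap.coe_sum, Finset.sum_apply]
    exact Finset.sum_congr rfl fun i _ => ((A i).eval_apply hφ).symm
  · have h1 : ∑ i ∈ s, (A i).toLinearMap = 0 := Finset.sum_eq_zero fun i hi => by rw [h i hi]; rfl
    simp only [h1]
    rfl

lemma chartPush_add (Φ Φ' : DForm (𝓘(ℝ, B).prod 𝓘(ℝ, F)) (TotalSpace F Z) (a + b)) :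
    chartPush Θ (Φ + Φ') = chartPush Θ Φ + chartPush Θ Φ' := by
  funext z
  simp only [chartPush, Pi.add_apply]
  split_ifs
  · rfl
  · simp

lemma chartPush_smul (t : ℂ) (Φ : DForm (𝓘(ℝ, B).prod 𝓘(ℝ, F)) (TotalSpace F Z) (a + b)) :
    chartPush Θ (t • Φ) = t • chartPush Θ Φ := by
  funext z
  simp only [chartPush, Pi.smul_apply]
  split_ifs
  · rfl
  · exact (smul_zero (A := (B × F) [⋀^Fin (a + b)]→L[ℝ] ℂ) t).symm

/-- The limit of a localized tensor product near a point of the intersection. -/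
lemma LocalModel.exists_piece [CompactSpace Y] (h : LocalModel δN quot S M bs μ e eN Θ)
    (hdil : Continuous fun p : ℂ × TotalSpace F Z => dilation F p.1 p.2)
    (T : Current 𝓘(ℝ, B) Y a)
    (hτ : IsAdmissible F (fun y => ((y, δN y) : Y × N)) quot τ)
    (hc : Tendsto (fun i => ‖c i‖) atTop atTop)
    (hξ : Tendsto (fun i => c i / ‖c i‖) atTop (𝓝 ξ)) (hξ0 : ξ ≠ 0)
    {L : (B → B [⋀^Fin a]→L[ℝ] ℂ) → ℂ}
    (hL : IsLocalFunctional {x | x - M.pr x ∈ e.target} L)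
    (hlim : ∀ C : Set B, IsCompact C → (∀ x ∈ C, x - M.pr x ∈ e.target) → ∀ ψ, IsTest C ψ →
        Tendsto (fun i => T.eval (chartPull e (M.dilForm (c i) ψ))) atTop (𝓝 (L ψ)))
    {χ : Y → ℝ} (hχ : ContMDiff 𝓘(ℝ, B) 𝓘(ℝ, ℝ) ∞ χ) (hχe : tsupport χ ⊆ e.source) :
    ∃ A : Current (𝓘(ℝ, B).prod 𝓘(ℝ, F)) (TotalSpace F Z) (a + b),
      (∀ Φ ∈ testForms (𝓘(ℝ, B).prod 𝓘(ℝ, F)) (TotalSpace F Z) (a + b),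
        (∀ᶠ i in atTop, (fun y => χ y • partialPairing S (dilatedPullback F τ (c i) Φ) y) ∈
          testForms 𝓘(ℝ, B) Y a) ∧
        Tendsto (fun i => T.eval fun y => χ y • partialPairing S (dilatedPullback F τ (c i) Φ) y)
          atTop (𝓝 (A.eval Φ))) ∧
      ((∀ C : Set B, IsCompact C → (∀ x ∈ C, x - M.pr x ∈ e.target) →
        ∀ ψ, IsTest C ψ → L ψ = 0) → A = 0) := by
  obtain ⟨hχt, hC⟩ := isTest_chartFun e hχ hχe
  set C := e '' tsupport χ with hCdef
  have hCe : C ⊆ e.target := by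
    rintro _ ⟨y, hy, rfl⟩
    exact e.map_source (hχe hy)
  obtain ⟨χ', L', hχ't, hL', hL'e, N', hN', hCN, hNL, hχ'1⟩ := exists_cutoff hC e.open_target hCe
  set D : Set Y := e.symm '' L' with hD
  have hDc : _root_.IsClosed D := (hL'.image_of_continuousOn
    (e.contMDiffOn_invFun.continuousOn.mono hL'e)).isClosed
  have hDs : D ⊆ e.source := by
    rintro _ ⟨p, hp, rfl⟩
    exact e.map_target (hL'e hp)
  set KQ : Set (TotalSpace F Z) → Set (B × F) := fun Q =>
    Θ '' (Q ∩ TotalSpace.proj ⁻¹' D) with hKQ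
  have hKQs : ∀ Q : Set (TotalSpace F Z), Q ∩ TotalSpace.proj ⁻¹' D ⊆ Θ.source := fun Q p hp =>
    (h.bundle_source p).2 (hDs hp.2)
  have hKQc : ∀ Q, IsCompact Q → IsCompact (KQ Q) := fun Q hQ =>
    (hQ.inter_right (hDc.preimage (FiberBundle.continuous_proj F Z))).image_of_continuousOn
      (Θ.contMDiffOn_toFun.continuousOn.mono (hKQs Q))
  have hKQt : ∀ Q, KQ Q ⊆ Θ.target := by
    rintro Q _ ⟨p, hp, rfl⟩
    exact Θ.map_source (hKQs Q hp)
  have hKQe : ∀ Q, KQ Q ⊆ e.target ×ˢ univ := fun Q => h.bundle_target ▸ hKQt Q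
  have hχ'c : ContDiff ℝ ∞ fun z : B × F => χ' z.1 := hχ't.smooth.comp contDiff_fst
  have hKQ0 : ∀ (Q : Set (TotalSpace F Z))
      (Φ : DForm (𝓘(ℝ, B).prod 𝓘(ℝ, F)) (TotalSpace F Z) (a + b)), (∀ p, Φ p ≠ 0 → p ∈ Q) →
      ∀ z, z ∉ KQ Q → χ' z.1 • chartPush Θ Φ z = 0 := by
    intro Q Φ hΦQ z hz
    by_cases hzt : z ∈ Θ.target
    · by_cases hz1 : z.1 ∈ L'
      · have hp : Θ.symm z ∈ Θ.source := Θ.map_target hzt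
        have hΘz : Θ (Θ.symm z) = z := Θ.right_inv hzt
        have h1 : (Θ.symm z).proj = e.symm z.1 := by
          have h2 := h.bundle_fst _ hp
          rw [hΘz] at h2
          rw [h2]
          exact (e.left_inv ((h.bundle_source _).1 hp)).symm
        have h3 : Φ (Θ.symm z) = 0 := by
          by_contra hne
          refine hz ⟨Θ.symm z, ⟨hΦQ _ hne, ?_⟩, hΘz⟩
          rw [mem_preimage, h1]
          exact ⟨z.1, hz1, rfl⟩
        have h4 : chartPush Θ Φ z = 0 := by
          rw [chartPush, if_pos hzt, h3]
          rfl
        rw [h4]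
        exact smul_zero (A := (B × F) [⋀^Fin (a + b)]→L[ℝ] ℂ) (χ' z.1)
      · rw [hχ't.eq_zero _ hz1]
        exact zero_smul ℝ (chartPush Θ Φ z : (B × F) [⋀^Fin (a + b)]→L[ℝ] ℂ)
    · have h4 : chartPush Θ Φ z = 0 := by rw [chartPush, if_neg hzt]
      rw [h4]
      exact smul_zero (A := (B × F) [⋀^Fin (a + b)]→L[ℝ] ℂ) (χ' z.1)
  have hft : ∀ Q, IsCompact Q → ∀ Φ : DForm (𝓘(ℝ, B).prod 𝓘(ℝ, F)) (TotalSpace F Z) (a + b),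
      SmoothForm Φ → (∀ p, Φ p ≠ 0 → p ∈ Q) →
      IsTest (KQ Q) fun z => χ' z.1 • chartPush Θ Φ z := fun Q hQ Φ hΦ hΦQ =>
    isTest_smul_chartPush Θ (hKQc Q hQ) (hKQt Q) hχ'c.contDiffOn hΦ (hKQ0 Q Φ hΦQ)
  have hχc : ContDiff ℝ ∞ fun z : B × F => chartFun e χ z.1 := hχt.smooth.comp contDiff_fst
  have hfun : ∀ K : Set (B × F), IsCompact K → K ⊆ e.target ×ˢ univ →
      IsTestFunctional K fun f : B × F → (B × F) [⋀^Fin (a + b)]→L[ℝ] ℂ =>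
        L (M.fibreForm bs μ 0 fun x => chartFun e χ x.1 • f x) := fun K hK hKe =>
    M.isTestFunctional_fibreForm bs h.sub_pr_mem hL 0 hK hKe hχc
  set G : DForm (𝓘(ℝ, B).prod 𝓘(ℝ, F)) (TotalSpace F Z) (a + b) → ℂ := fun Φ =>
    L (M.fibreForm bs μ 0 fun x => chartFun e χ x.1 • χ' x.1 • chartPush Θ Φ x) with hG
  have hsupp : ∀ Φ : DForm (𝓘(ℝ, B).prod 𝓘(ℝ, F)) (TotalSpace F Z) (a + b), ∀ p, Φ p ≠ 0 →
      p ∈ closure {p | Φ p ≠ 0} := fun Φ p hp => subset_closure hp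
  have hadd : ∀ Φ ∈ testForms (𝓘(ℝ, B).prod 𝓘(ℝ, F)) (TotalSpace F Z) (a + b),
      ∀ Φ' ∈ testForms (𝓘(ℝ, B).prod 𝓘(ℝ, F)) (TotalSpace F Z) (a + b),
      G (Φ + Φ') = G Φ + G Φ' := by
    intro Φ hΦ Φ' hΦ'
    have hQ : IsCompact (closure {p | Φ p ≠ 0} ∪ closure {p | Φ' p ≠ 0}) := hΦ.2.union hΦ'.2
    refine Eq.trans ?_ ((hfun _ (hKQc _ hQ) (hKQe _)).map_add _ _
      (hft _ hQ Φ hΦ.1 fun p hp => Or.inl (hsupp _ p hp))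
      (hft _ hQ Φ' hΦ'.1 fun p hp => Or.inr (hsupp _ p hp)))
    refine congrArg (fun f => L (M.fibreForm bs μ 0 f)) (funext fun x => ?_)
    rw [chartPush_add]
    exact congrArg _ (smul_add (A := (B × F) [⋀^Fin (a + b)]→L[ℝ] ℂ) _ _ _)
  have hsmul : ∀ (t : ℂ), ∀ Φ ∈ testForms (𝓘(ℝ, B).prod 𝓘(ℝ, F)) (TotalSpace F Z) (a + b),
      G (t • Φ) = t * G Φ := by
    intro t Φ hΦ
    refine Eq.trans ?_ ((hfun _ (hKQc _ hΦ.2) (hKQe _)).map_smul t _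
      (hft _ hΦ.2 Φ hΦ.1 (hsupp _)))
    refine congrArg (fun f => L (M.fibreForm bs μ 0 f)) (funext fun x => ?_)
    rw [chartPush_smul]
    exact congrArg _ (smul_comm (α := (B × F) [⋀^Fin (a + b)]→L[ℝ] ℂ) (χ' x.1) t _)
  have hseq : ∀ φ : ℕ → DForm (𝓘(ℝ, B).prod 𝓘(ℝ, F)) (TotalSpace F Z) (a + b),
      (∀ i, φ i ∈ testForms (𝓘(ℝ, B).prod 𝓘(ℝ, F)) (TotalSpace F Z) (a + b)) → TendsToZero φ →
      Tendsto (fun i => G (φ i)) atTop (𝓝 0) := by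
    rintro φ hφt ⟨⟨Q, hQ, hφQ⟩, hφ'⟩
    exact (hfun _ (hKQc _ hQ) (hKQe _)).tendsto _
      (nullSeq_smul_chartPush Θ (hKQc Q hQ) (hKQt Q) hχ'c.contDiffOn (fun i => (hφt i).1)
        ⟨⟨Q, hQ, hφQ⟩, hφ'⟩ fun i => hKQ0 Q (φ i) (hφQ i))
  obtain ⟨A, hA, hA0⟩ := Current.exists_of_functional hadd hsmul hseq
  refine ⟨A, fun Φ hΦ => ?_, fun h0 => hA0 fun Φ hΦ => h0 _ (M.isCompact_fibreBase (hKQc _ hΦ.2))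
    (M.fibreBase_subset h.sub_pr_mem (hKQe _)) _
    (M.isTest_fibreForm bs (hKQc _ hΦ.2) ((hft _ hΦ.2 Φ hΦ.1 (hsupp _)).smul_left hχc))⟩
  set f : B × F → (B × F) [⋀^Fin (a + b)]→L[ℝ] ℂ := fun z => χ' z.1 • chartPush Θ Φ z with hf
  set K := KQ (closure {p | Φ p ≠ 0}) with hK
  have hKc : IsCompact K := hKQc _ hΦ.2
  have hfK : IsTest K f := hft _ hΦ.2 Φ hΦ.1 (hsupp Φ)
  set N'' : Set Y := e.source ∩ e ⁻¹' N' with hN''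
  have hN''o : IsOpen N'' :=
    e.contMDiffOn_toFun.continuousOn.isOpen_inter_preimage e.open_source hN'
  have hχN : tsupport χ ⊆ N'' := fun y hy => ⟨hχe hy, hCN ⟨y, hy, rfl⟩⟩
  set O : Set (Y × N) := (Prod.fst ⁻¹' (tsupport χ)ᶜ) ∪
    (τ.source ∩ τ ⁻¹' (TotalSpace.proj ⁻¹' N'')) with hO
  have hOo : IsOpen O := ((isClosed_tsupport χ).isOpen_compl.preimage continuous_fst).union
    (τ.contMDiffOn_toFun.continuousOn.isOpen_inter_preimage τ.open_source
      (hN''o.preimage (FiberBundle.continuous_proj F Z)))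
  have hδO : ∀ y, (y, δN y) ∈ O := fun y => by
    by_cases hy : y ∈ tsupport χ
    · refine Or.inr ⟨hτ.mem_source y, ?_⟩
      change (τ (y, δN y)).proj ∈ N''
      rw [show τ (y, δN y) = _ from hτ.map_base y]
      exact hχN hy
    · exact Or.inl hy
  have hcut : ∀ p : TotalSpace F Z, ∃ s : ℝ, chartPull Θ f p = s • Φ p ∧
      (p.proj ∈ N'' → s = 1) := by
    intro p
    by_cases hp : p ∈ Θ.source
    · refine ⟨χ' (e p.proj), ?_, fun hpN => hχ'1 _ hpN.2⟩
      have h1 := chartPull_chartPush Θ Φ hp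
      rw [chartPull, if_pos hp] at h1
      rw [chartPull, if_pos hp, hf, ← h1, ← h.bundle_fst p hp]
      rfl
    · refine ⟨0, ?_, fun hpN => absurd ((h.bundle_source p).2 hpN.1) hp⟩
      rw [chartPull, if_neg hp]
      exact (zero_smul ℝ (Φ p : (B × F) [⋀^Fin (a + b)]→L[ℝ] ℂ)).symm
  have hev : ∀ᶠ i in atTop, (fun y => χ y • partialPairing S (dilatedPullback F τ (c i) Φ) y) =
      chartPull e (M.dilForm (c i) (M.fibreForm bs μ (c i)⁻¹ fun z => chartFun e χ z.1 •
        conjPull (chartConj M e eN τ Θ) (c i) f z)) := by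
    filter_upwards [eventually_dilatedPullback_support hdil hτ hc hOo hδO hΦ.2,
      h.eventually_partialPairing (a := a) hτ hc hξ hξ0 hKc (hKQe _),
      hc.eventually_gt_atTop 0] with i h1 h2 hci
    have hc0 : c i ≠ 0 := norm_pos_iff.1 hci
    have h3 : ∀ y ∈ tsupport χ, ∀ z, dilatedPullback F τ (c i) Φ (y, z) =
        dilatedPullback F τ (c i) (chartPull Θ f) (y, z) := by
      intro y hy z
      by_cases hx : (y, z) ∈ τ.source
      · obtain ⟨s, hs, hs1⟩ := hcut (dilation F (c i) (τ (y, z)))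
        have h4 : dilatedPullback F τ (c i) (chartPull Θ f) (y, z) =
            s • dilatedPullback F τ (c i) Φ (y, z) := by
          simp only [dilatedPullback, if_pos hx, hs]
          rfl
        rw [h4]
        by_cases h5 : dilatedPullback F τ (c i) Φ (y, z) = 0
        · rw [h5]
          exact (smul_zero (A := (B × F) [⋀^Fin (a + b)]→L[ℝ] ℂ) s).symm
        · obtain h6 | h6 := h1 _ h5
          · exact absurd hy h6
          · rw [hs1 h6.2, one_smul]
      · simp only [dilatedPullback, if_neg hx]
    funext y
    by_cases hy : y ∈ tsupport χ
    · rw [partialPairing_congr (h3 y hy), h2 f hfK]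
      have hye := hχe hy
      simp only [chartPull, if_pos hye, TransverseModel.dilForm, M.fibreForm_smul_base,
        M.dil_dil, inv_mul_cancel₀ hc0, M.dil_one]
      have h7 : chartFun e χ (e y) = χ y := by
        rw [chartFun, if_pos (e.map_source hye)]
        exact congrArg χ (e.left_inv hye)
      rw [h7]
      rfl
    · rw [image_eq_zero_of_notMem_tsupport hy]
      refine (zero_smul ℝ (partialPairing S (dilatedPullback F τ (c i) Φ) y :
        B [⋀^Fin a]→L[ℝ] ℂ)).trans ?_
      simp only [chartPull, TransverseModel.dilForm, M.fibreForm_smul_base,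
        M.dil_dil, inv_mul_cancel₀ hc0, M.dil_one]
      split_ifs with hye
      · have h7 : chartFun e χ (e y) = 0 := by
          rw [chartFun, if_pos (e.map_source hye)]
          exact (congrArg χ (e.left_inv hye)).trans (image_eq_zero_of_notMem_tsupport hy)
        rw [h7]
        exact congrArg (fun η : B [⋀^Fin a]→L[ℝ] ℂ => (η.compContinuousLinearMap
          (M.dil (c i))).compContinuousLinearMap (chartDeriv e y)) (zero_smul ℝ _).symm
      · rfl
  refine ⟨?_, ?_⟩
  · obtain ⟨K', hK', hKK, hKΩ'⟩ : ∃ L, IsCompact L ∧ K ⊆ interior L ∧ L ⊆ e.target ×ˢ univ :=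
      exists_compact_between hKc (e.open_target.prod isOpen_univ) (hKQe _)
    filter_upwards [hev, eventually_conjPull_test (n := a + b) e.open_target
      (h.normalizedAlong hτ) hc hξ hξ0 hKc hK' hKΩ' hKK,
      hc.eventually_gt_atTop 0] with i h1 h2 hci
    have hc0 : c i ≠ 0 := norm_pos_iff.1 hci
    rw [h1]
    refine chartPull_mem_testForms e hC hCe ⟨?_, fun x hx => ?_⟩
    · have h3 := M.isTest_fibreForm bs (μ := μ) (t := (c i)⁻¹) hK' ((h2.1 f hfK).smul_left hχc)
      exact contDiffOn_univ.1 (ContDiffOn.alt_comp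
        (h3.smooth.comp (M.dil (c i)).contDiff).contDiffOn contDiffOn_const)
    · simp only [TransverseModel.dilForm, M.fibreForm_smul_base, M.dil_dil,
        inv_mul_cancel₀ hc0, M.dil_one]
      rw [hχt.eq_zero x hx]
      exact congrArg (fun η : B [⋀^Fin a]→L[ℝ] ℂ => η.compContinuousLinearMap (M.dil (c i)))
        (zero_smul ℝ _)
  · rw [hA Φ hΦ]
    refine (M.tendsto_functional bs (μ := μ) e.open_target h.sub_pr_mem (T.isLocalFunctional e)
      (h.normalizedAlong hτ) hc hξ hξ0 hL hlim hKc (hKQe _) hχc hfK).congr' ?_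
    filter_upwards [hev] with i hi
    rw [hi]
    rfl

/-- A localized tensor product vanishes eventually away from the intersection. -/
lemma eventually_smul_partialPairing_eq_zero
    (hdil : Continuous fun p : ℂ × TotalSpace F Z => dilation F p.1 p.2)
    (hτ : IsAdmissible F (fun y => ((y, δN y) : Y × N)) quot τ)
    (hc : Tendsto (fun i => ‖c i‖) atTop atTop) {W : Set N} (hW : _root_.IsClosed W)
    (hS : ∀ φ : DForm J N b, (∀ z ∈ W, φ z = 0) → S φ = 0) {χ : Y → ℝ}
    (hχ : ∀ y ∈ tsupport χ, δN y ∉ W)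
    {Φ : DForm (𝓘(ℝ, B).prod 𝓘(ℝ, F)) (TotalSpace F Z) (a + b)}
    (hΦ : IsCompact (closure {p | Φ p ≠ 0})) :
    ∀ᶠ i in atTop, (fun y => χ y • partialPairing S (dilatedPullback F τ (c i) Φ) y) = 0 := by
  have hO : IsOpen ((tsupport χ) ×ˢ W)ᶜ := ((isClosed_tsupport χ).prod hW).isOpen_compl
  filter_upwards [eventually_dilatedPullback_support hdil hτ hc hO
    (fun y hy => hχ y hy.1 hy.2) hΦ] with i hi
  funext y
  by_cases hy : y ∈ tsupport χ
  · rw [partialPairing_eq_zero hS]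
    · exact smul_zero (A := B [⋀^Fin a]→L[ℝ] ℂ) (χ y)
    · intro z hz
      by_contra hne
      exact hi _ hne ⟨hy, hz⟩
  · rw [image_eq_zero_of_notMem_tsupport hy]
    exact zero_smul ℝ (partialPairing S (dilatedPullback F τ (c i) Φ) y : B [⋀^Fin a]→L[ℝ] ℂ)

/-- Convergence in the linear models implies weak convergence on the normal bundle. -/
theorem exists_tendsto_of_localModels [CompactSpace Y]
    (hdil : Continuous fun p : ℂ × TotalSpace F Z => dilation F p.1 p.2)
    (T : Current 𝓘(ℝ, B) Y a)
    (hτ : IsAdmissible F (fun y => ((y, δN y) : Y × N)) quot τ)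
    (hc : Tendsto (fun i => ‖c i‖) atTop atTop)
    (hξ : Tendsto (fun i => c i / ‖c i‖) atTop (𝓝 ξ)) (hξ0 : ξ ≠ 0)
    {V : Set Y} (hV : _root_.IsClosed V) {W : Set N} (hW : _root_.IsClosed W)
    (hVW : ∀ y, δN y ∈ W → y ∈ V)
    (hS : ∀ φ : DForm J N b, (∀ z ∈ W, φ z = 0) → S φ = 0) {vanish : Prop}
    (hloc : ∀ x ∈ V, ∃ (M : TransverseModel B F P)
      (e : PartialDiffeomorph 𝓘(ℝ, B) 𝓘(ℝ, B) Y B ∞)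
      (eN : PartialDiffeomorph J 𝓘(ℝ, F) N F ∞)
      (Θ : PartialDiffeomorph (𝓘(ℝ, B).prod 𝓘(ℝ, F)) 𝓘(ℝ, B × F) (TotalSpace F Z) (B × F) ∞)
      (L : (B → B [⋀^Fin a]→L[ℝ] ℂ) → ℂ),
      x ∈ e.source ∧ LocalModel δN quot S M bs μ e eN Θ ∧
      IsLocalFunctional {x | x - M.pr x ∈ e.target} L ∧
      (∀ C : Set B, IsCompact C → (∀ x ∈ C, x - M.pr x ∈ e.target) → ∀ ψ, IsTest C ψ →
        Tendsto (fun i => T.eval (chartPull e (M.dilForm (c i) ψ))) atTop (𝓝 (L ψ))) ∧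
      (vanish → ∀ C : Set B, IsCompact C → (∀ x ∈ C, x - M.pr x ∈ e.target) →
        ∀ ψ, IsTest C ψ → L ψ = 0)) :
    ∃ R : Current (𝓘(ℝ, B).prod 𝓘(ℝ, F)) (TotalSpace F Z) (a + b),
      (∀ Φ ∈ testForms (𝓘(ℝ, B).prod 𝓘(ℝ, F)) (TotalSpace F Z) (a + b),
        Tendsto (fun i => tensor T.eval S (dilatedPullback F τ (c i) Φ)) atTop (𝓝 (R.eval Φ))) ∧
      (vanish → R = 0) := by
  classical
  choose M e eN Θ L hxe hM hL hlim hvan using hloc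
  set U : Option V → Set Y := fun o => o.elim Vᶜ fun x => (e x.1 x.2).source with hU
  have hUo : ∀ o, IsOpen (U o) := by
    rintro (_ | x)
    · exact hV.isOpen_compl
    · exact (e x.1 x.2).open_source
  have hUc : (univ : Set Y) ⊆ ⋃ o, U o := fun y _ => by
    by_cases hy : y ∈ V
    · exact mem_iUnion_of_mem (some ⟨y, hy⟩) (hxe y hy)
    · exact mem_iUnion_of_mem none hy
  obtain ⟨ρ, hρ⟩ := SmoothPartitionOfUnity.exists_isSubordinate 𝓘(ℝ, B)
    (isClosed_univ (X := Y)) U hUo hUc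
  have hfin : {o | (Function.support (ρ o)).Nonempty}.Finite :=
    ρ.locallyFinite.finite_nonempty_of_compact
  have hpiece : ∀ o : Option V, ∃ A : Current (𝓘(ℝ, B).prod 𝓘(ℝ, F)) (TotalSpace F Z) (a + b),
      (∀ Φ ∈ testForms (𝓘(ℝ, B).prod 𝓘(ℝ, F)) (TotalSpace F Z) (a + b),
        (∀ᶠ i in atTop, (fun y => ρ o y • partialPairing S (dilatedPullback F τ (c i) Φ) y) ∈
          testForms 𝓘(ℝ, B) Y a) ∧
        Tendsto (fun i => T.eval fun y => ρ o y • partialPairing S (dilatedPullback F τ (c i) Φ) y)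
          atTop (𝓝 (A.eval Φ))) ∧ (vanish → A = 0) := by
    rintro (_ | x)
    · refine ⟨0, fun Φ hΦ => ?_, fun _ => rfl⟩
      have h1 := eventually_smul_partialPairing_eq_zero (a := a) hdil hτ hc hW hS (χ := ρ none)
        (fun y hy hyW => hρ none hy (hVW y hyW)) hΦ.2
      refine ⟨h1.mono fun i hi => hi ▸ Submodule.zero_mem _, ?_⟩
      rw [Current.eval_zero_current]
      refine tendsto_const_nhds.congr' (h1.mono fun i hi => ?_)
      beta_reduce
      rw [hi, Current.eval_of_mem _ (Submodule.zero_mem _)]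
      exact (map_zero T.toLinearMap).symm
    · obtain ⟨A, h1, h2⟩ := (hM x.1 x.2).exists_piece hdil T hτ hc hξ hξ0 (hL x.1 x.2)
        (hlim x.1 x.2) (ρ (some x)).contMDiff (hρ (some x))
      exact ⟨A, h1, fun hv => h2 (hvan x.1 x.2 hv)⟩
  choose A hA hA0 using hpiece
  obtain ⟨R, hR, hR0⟩ := Current.exists_sum hfin.toFinset A
  refine ⟨R, fun Φ hΦ => ?_, fun hv => hR0 fun o _ => hA0 o hv⟩
  rw [hR Φ hΦ]
  refine (tendsto_finsetSum hfin.toFinset fun o _ => (hA o Φ hΦ).2).congr' ?_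
  filter_upwards [(Finset.eventually_all hfin.toFinset).2 fun o _ => (hA o Φ hΦ).1] with i hi
  have hsum : partialPairing S (dilatedPullback F τ (c i) Φ) = ∑ o ∈ hfin.toFinset,
      fun y => ρ o y • partialPairing S (dilatedPullback F τ (c i) Φ) y := by
    funext y
    rw [Finset.sum_apply, ← Finset.sum_smul]
    have h1 := ρ.sum_eq_one (mem_univ y)
    rw [finsum_eq_sum_of_support_subset (s := hfin.toFinset)] at h1
    · rw [h1, one_smul]
    · intro o ho
      exact hfin.mem_toFinset.2 ⟨y, ho⟩
  have key : ∀ s : Finset (Option V), s ⊆ hfin.toFinset →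
      (∑ o ∈ s, fun y => ρ o y • partialPairing S (dilatedPullback F τ (c i) Φ) y) ∈
        testForms 𝓘(ℝ, B) Y a ∧
      T.eval (∑ o ∈ s, fun y => ρ o y • partialPairing S (dilatedPullback F τ (c i) Φ) y) =
        ∑ o ∈ s, T.eval fun y => ρ o y • partialPairing S (dilatedPullback F τ (c i) Φ) y := by
    intro s hs
    have hmem := fun o (ho : o ∈ s) => hi o (hs ho)
    have hsm := Submodule.sum_mem (testForms 𝓘(ℝ, B) Y a) hmem
    refine ⟨hsm, ?_⟩
    rw [Current.eval_of_mem _ hsm]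
    have h2 : (⟨_, hsm⟩ : testForms 𝓘(ℝ, B) Y a) = ∑ o ∈ s.attach, ⟨_, hmem o.1 o.2⟩ := by
      apply Subtype.ext
      rw [AddSubmonoidClass.coe_finsetSum]
      exact (Finset.sum_attach s fun o => (fun y => ρ o y • partialPairing S
        (dilatedPullback F τ (c i) Φ) y : DForm 𝓘(ℝ, B) Y a)).symm
    rw [h2, map_sum, ← Finset.sum_attach s]
    exact Finset.sum_congr rfl fun o _ => (T.eval_of_mem (hmem o.1 o.2)).symm
  rw [tensor]
  conv_rhs => rw [hsum]
  exact (key _ subset_rfl).2.symm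

end Globalize

/-! ## Holomorphic charts and charts of the tangent bundle -/

section BundleTopology

lemma FiberBundle.t2Space_totalSpace {B F : Type*} [TopologicalSpace B] [TopologicalSpace F]
    [T2Space B] [T2Space F] {Z : B → Type*} [TopologicalSpace (TotalSpace F Z)]
    [∀ b, TopologicalSpace (Z b)] [FiberBundle F Z] : T2Space (TotalSpace F Z) := by
  refine ⟨fun p q hpq => ?_⟩
  by_cases hpr : p.proj = q.proj
  · set t := trivializationAt F Z p.proj
    have hp : p ∈ t.source := t.mem_source.2 (mem_baseSet_trivializationAt F Z _)
    have hq : q ∈ t.source := t.mem_source.2 (hpr ▸ mem_baseSet_trivializationAt F Z _)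
    obtain ⟨U, U', hU, hU', hpU, hqU, hd⟩ := t2_separation fun h => hpq (t.injOn hp hq h)
    exact ⟨_, _, t.continuousOn.isOpen_inter_preimage t.open_source hU,
      t.continuousOn.isOpen_inter_preimage t.open_source hU', ⟨hp, hpU⟩, ⟨hq, hqU⟩,
      (hd.preimage _).mono inter_subset_right inter_subset_right⟩
  · obtain ⟨U, U', hU, hU', hpU, hqU, hd⟩ := t2_separation hpr
    exact ⟨_, _, hU.preimage (FiberBundle.continuous_proj F Z),
      hU'.preimage (FiberBundle.continuous_proj F Z), hpU, hqU, hd.preimage _⟩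

variable {EB : Type*} [NormedAddCommGroup EB] [NormedSpace ℝ EB] {HB : Type*} [TopologicalSpace HB]
  {IB : ModelWithCorners ℝ EB HB} {B : Type*} [TopologicalSpace B] [ChartedSpace HB B]
  {EM : Type*} [NormedAddCommGroup EM] [NormedSpace ℝ EM] {HM : Type*} [TopologicalSpace HM]
  {IM : ModelWithCorners ℝ EM HM} {M : Type*} [TopologicalSpace M] [ChartedSpace HM M]
  {F₁ F₂ : Type*} [NormedAddCommGroup F₁] [NormedSpace ℝ F₁]
  [NormedAddCommGroup F₂] [NormedSpace ℝ F₂] {E₁ E₂ : B → Type*}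
  [TopologicalSpace (TotalSpace F₁ E₁)] [∀ b, TopologicalSpace (E₁ b)] [FiberBundle F₁ E₁]
  [TopologicalSpace (TotalSpace F₂ E₂)] [∀ b, TopologicalSpace (E₂ b)] [FiberBundle F₂ E₂]
  [∀ b, Zero (E₁ b)] [∀ b, Zero (E₂ b)]
  {n : ℕ∞ω}

lemma contMDiffAt_prod_totalSpace {f : M → TotalSpace (F₁ × F₂) (E₁ ×ᵇ E₂)} {x : M} :
    ContMDiffAt IM (IB.prod 𝓘(ℝ, F₁ × F₂)) n f x ↔
      ContMDiffAt IM (IB.prod 𝓘(ℝ, F₁)) n (fun y => (⟨(f y).1, (f y).2.1⟩ : TotalSpace F₁ E₁)) x ∧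
      ContMDiffAt IM (IB.prod 𝓘(ℝ, F₂)) n (fun y => (⟨(f y).1, (f y).2.2⟩ : TotalSpace F₂ E₂)) x := by
  rw [contMDiffAt_totalSpace, contMDiffAt_totalSpace, contMDiffAt_totalSpace]
  constructor
  · rintro ⟨h1, h2⟩
    have h3 : ContDiff ℝ n (Prod.fst : F₁ × F₂ → F₁) := contDiff_fst
    have h4 : ContDiff ℝ n (Prod.snd : F₁ × F₂ → F₂) := contDiff_snd
    exact ⟨⟨h1, h3.contMDiff.contMDiffAt.comp x h2⟩, h1, h4.contMDiff.contMDiffAt.comp x h2⟩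
  · rintro ⟨⟨h1, h2⟩, _, h3⟩
    exact ⟨h1, h2.prodMk_space h3⟩

lemma contMDiff_prod_totalSpace_fst : ContMDiff (IB.prod 𝓘(ℝ, F₁ × F₂)) (IB.prod 𝓘(ℝ, F₁)) n
    fun p : TotalSpace (F₁ × F₂) (E₁ ×ᵇ E₂) => (⟨p.1, p.2.1⟩ : TotalSpace F₁ E₁) := fun _ =>
  (contMDiffAt_prod_totalSpace.1 contMDiffAt_id).1

lemma contMDiff_prod_totalSpace_snd : ContMDiff (IB.prod 𝓘(ℝ, F₁ × F₂)) (IB.prod 𝓘(ℝ, F₂)) n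
    fun p : TotalSpace (F₁ × F₂) (E₁ ×ᵇ E₂) => (⟨p.1, p.2.2⟩ : TotalSpace F₂ E₂) := fun _ =>
  (contMDiffAt_prod_totalSpace.1 contMDiffAt_id).2

end BundleTopology

section TangentCharts

variable {k : ℕ} {Y : Type*} [TopologicalSpace Y] [ChartedSpace (Cn k) Y]
  [IsManifold 𝓘(ℝ, Cn k) ∞ Y]

instance (y : Y) : IsScalarTower ℝ ℂ (TangentSpace 𝓘(ℝ, Cn k) y) :=
  inferInstanceAs (IsScalarTower ℝ ℂ (Cn k))

lemma PartialDiffeomorph.comp_mfderiv_symm {E : Type*} [NormedAddCommGroup E] [NormedSpace ℝ E]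
    {E' : Type*} [NormedAddCommGroup E'] [NormedSpace ℝ E']
    {H : Type*} [TopologicalSpace H] {I : ModelWithCorners ℝ E H} {X : Type*} [TopologicalSpace X]
    [ChartedSpace H X] (Φ : PartialDiffeomorph I 𝓘(ℝ, E') X E' ∞) {z : E'}
    (hz : z ∈ Φ.target) (w : E') :
    mfderiv I 𝓘(ℝ, E') Φ (Φ.symm z) (mfderiv 𝓘(ℝ, E') I Φ.symm z w) = w :=
  Φ.symm.mfderiv_symm_comp hz w

lemma contMDiffAt_tangentBundle_model {E : Type*} [NormedAddCommGroup E] [NormedSpace ℝ E]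
    {EM : Type*} [NormedAddCommGroup EM] [NormedSpace ℝ EM] {HM : Type*} [TopologicalSpace HM]
    {IM : ModelWithCorners ℝ EM HM} {M : Type*} [TopologicalSpace M] [ChartedSpace HM M]
    {f : M → TangentBundle 𝓘(ℝ, E) E} {x : M} {n : ℕ∞ω} :
    ContMDiffAt IM (𝓘(ℝ, E).prod 𝓘(ℝ, E)) n f x ↔
      ContMDiffAt IM 𝓘(ℝ, E) n (fun y => (f y).1) x ∧
      ContMDiffAt IM 𝓘(ℝ, E) n (fun y => ((f y).2 : E)) x := by
  rw [contMDiffAt_totalSpace]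
  have h : (fun y => (trivializationAt E (TangentSpace 𝓘(ℝ, E)) (f x).proj (f y)).2) =
      fun y => ((f y).2 : E) := by
    funext y
    rw [TangentBundle.trivializationAt_apply]
    have : (chartAt E (f x).proj).extend 𝓘(ℝ, E) ∘ ((chartAt E (f y).proj).extend 𝓘(ℝ, E)).symm =
        (id : E → E) := by
      funext z
      simp
      rfl
    rw [this]
    simp
    rfl
  rw [h]

/-- The derivative of a chart is a smooth map from the tangent bundle. -/
lemma contMDiffOn_tangentChart (e : PartialDiffeomorph 𝓘(ℝ, Cn k) 𝓘(ℝ, Cn k) Y (Cn k) ∞) :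
    ContMDiffOn (𝓘(ℝ, Cn k).prod 𝓘(ℝ, Cn k)) 𝓘(ℝ, Cn k) ∞
      (fun p : TotalSpace (Cn k) (TangentSpace 𝓘(ℝ, Cn k) : Y → Type) =>
        (chartDeriv e p.proj p.2 : Cn k)) (TotalSpace.proj ⁻¹' e.source) := by
  have : IsManifold 𝓘(ℝ, Cn k) 1 Y := IsManifold.of_le (n := ∞) (by simp)
  have h1 := e.contMDiffOn_toFun.contMDiffOn_tangentMapWithin (m := ∞) (by simp)
    e.open_source.uniqueMDiffOn
  intro p hp
  have hs : TotalSpace.proj ⁻¹' e.source ∈ 𝓝 p :=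
    (e.open_source.preimage (FiberBundle.continuous_proj _ _)).mem_nhds hp
  have h2 := (contMDiffAt_tangentBundle_model.1 (h1.contMDiffAt hs)).2
  refine (h2.congr_of_eventuallyEq ?_).contMDiffWithinAt
  filter_upwards [hs] with q hq
  have h3 := mfderivWithin_of_isOpen (I := 𝓘(ℝ, Cn k)) (I' := 𝓘(ℝ, Cn k)) (f := e) e.open_source hq
  exact (DFunLike.congr_fun h3 q.2).symm

lemma contMDiffOn_tangentChart_symm (e : PartialDiffeomorph 𝓘(ℝ, Cn k) 𝓘(ℝ, Cn k) Y (Cn k) ∞) :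
    ContMDiffOn (𝓘(ℝ, Cn k × Cn k)) (𝓘(ℝ, Cn k).prod 𝓘(ℝ, Cn k)) ∞
      (fun z : Cn k × Cn k => (⟨e.symm z.1, mfderiv 𝓘(ℝ, Cn k) 𝓘(ℝ, Cn k) e.symm z.1 z.2⟩ :
        TotalSpace (Cn k) (TangentSpace 𝓘(ℝ, Cn k) : Y → Type))) (e.target ×ˢ univ) := by
  have : IsManifold 𝓘(ℝ, Cn k) 1 Y := IsManifold.of_le (n := ∞) (by simp)
  have h1 := e.contMDiffOn_invFun.contMDiffOn_tangentMapWithin (m := ∞) (by simp)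
    e.open_target.uniqueMDiffOn
  have h2 : ContMDiff 𝓘(ℝ, Cn k × Cn k) (𝓘(ℝ, Cn k).prod 𝓘(ℝ, Cn k)) ∞
      fun z : Cn k × Cn k => (⟨z.1, z.2⟩ : TangentBundle 𝓘(ℝ, Cn k) (Cn k)) := fun z =>
    contMDiffAt_tangentBundle_model.2 ⟨contDiff_fst.contMDiff.contMDiffAt,
      contDiff_snd.contMDiff.contMDiffAt⟩
  refine ContMDiffOn.congr (h1.comp h2.contMDiffOn (s := e.target ×ˢ univ) fun z hz => hz.1)
    fun z hz => ?_
  have h4 := mfderivWithin_of_isOpen (I := 𝓘(ℝ, Cn k)) (I' := 𝓘(ℝ, Cn k)) (f := e.symm)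
    e.open_target hz.1
  exact congrArg (TotalSpace.mk _) (DFunLike.congr_fun h4 z.2).symm

/-- The chart of the tangent bundle induced by a chart. -/
def tangentChart (e : PartialDiffeomorph 𝓘(ℝ, Cn k) 𝓘(ℝ, Cn k) Y (Cn k) ∞) :
    PartialDiffeomorph (𝓘(ℝ, Cn k).prod 𝓘(ℝ, Cn k)) 𝓘(ℝ, Cn k × Cn k)
      (TotalSpace (Cn k) (TangentSpace 𝓘(ℝ, Cn k) : Y → Type)) (Cn k × Cn k) ∞ where
  toFun p := (e p.proj, chartDeriv e p.proj p.2)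
  invFun z := ⟨e.symm z.1, mfderiv 𝓘(ℝ, Cn k) 𝓘(ℝ, Cn k) e.symm z.1 z.2⟩
  source := TotalSpace.proj ⁻¹' e.source
  target := e.target ×ˢ univ
  map_source' p hp := ⟨e.map_source hp, mem_univ _⟩
  map_target' z hz := e.map_target hz.1
  left_inv' := by
    rintro ⟨y, v⟩ hp
    have h1 : e.symm (e y) = y := e.left_inv hp
    have h2 : mfderiv 𝓘(ℝ, Cn k) 𝓘(ℝ, Cn k) e.symm (e y) (chartDeriv e y v) = v :=
      e.mfderiv_symm_comp hp v
    change (⟨e.symm (e y), mfderiv 𝓘(ℝ, Cn k) 𝓘(ℝ, Cn k) e.symm (e y) (chartDeriv e y v)⟩ :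
      TotalSpace (Cn k) (TangentSpace 𝓘(ℝ, Cn k) : Y → Type)) = ⟨y, v⟩
    exact TotalSpace.ext h1 (heq_of_eq h2)
  right_inv' z hz := Prod.ext (e.right_inv hz.1) (e.comp_mfderiv_symm hz.1 z.2)
  open_source := e.open_source.preimage (FiberBundle.continuous_proj _ _)
  open_target := e.open_target.prod isOpen_univ
  contMDiffOn_toFun := by
    have h1 : ContMDiffOn (𝓘(ℝ, Cn k).prod 𝓘(ℝ, Cn k)) 𝓘(ℝ, Cn k) ∞
        (fun p : TotalSpace (Cn k) (TangentSpace 𝓘(ℝ, Cn k) : Y → Type) => e p.proj)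
        (TotalSpace.proj ⁻¹' e.source) :=
      e.contMDiffOn_toFun.comp (contMDiff_proj _).contMDiffOn fun p hp => hp
    exact h1.prodMk_space (contMDiffOn_tangentChart e)
  contMDiffOn_invFun := contMDiffOn_tangentChart_symm e

/-- The chart of `TY ⊕ TY` induced by a chart. -/
def tangentChart₂ (e : PartialDiffeomorph 𝓘(ℝ, Cn k) 𝓘(ℝ, Cn k) Y (Cn k) ∞) :
    PartialDiffeomorph (𝓘(ℝ, Cn k).prod 𝓘(ℝ, Cn k × Cn k)) 𝓘(ℝ, Cn k × (Cn k × Cn k))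
      (TotalSpace (Cn k × Cn k) ((TangentSpace 𝓘(ℝ, Cn k) : Y → Type) ×ᵇ
        (TangentSpace 𝓘(ℝ, Cn k) : Y → Type))) (Cn k × (Cn k × Cn k)) ∞ where
  toFun p := (e p.proj, chartDeriv e p.proj p.2.1, chartDeriv e p.proj p.2.2)
  invFun z := ⟨e.symm z.1, mfderiv 𝓘(ℝ, Cn k) 𝓘(ℝ, Cn k) e.symm z.1 z.2.1,
    mfderiv 𝓘(ℝ, Cn k) 𝓘(ℝ, Cn k) e.symm z.1 z.2.2⟩
  source := TotalSpace.proj ⁻¹' e.source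
  target := e.target ×ˢ univ
  map_source' p hp := ⟨e.map_source hp, mem_univ _⟩
  map_target' z hz := e.map_target hz.1
  left_inv' := by
    rintro ⟨y, v, w⟩ hp
    have h1 : e.symm (e y) = y := e.left_inv hp
    have h2 : ∀ v : TangentSpace 𝓘(ℝ, Cn k) y,
        mfderiv 𝓘(ℝ, Cn k) 𝓘(ℝ, Cn k) e.symm (e y) (chartDeriv e y v) = v :=
      e.mfderiv_symm_comp hp
    refine TotalSpace.ext h1 ?_
    exact heq_of_eq (Prod.ext (h2 v) (h2 w) : ((_, _) :
      TangentSpace 𝓘(ℝ, Cn k) y × TangentSpace 𝓘(ℝ, Cn k) y) = (v, w))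
  right_inv' z hz := Prod.ext (e.right_inv hz.1)
    (Prod.ext (e.comp_mfderiv_symm hz.1 z.2.1) (e.comp_mfderiv_symm hz.1 z.2.2))
  open_source := e.open_source.preimage (FiberBundle.continuous_proj _ _)
  open_target := e.open_target.prod isOpen_univ
  contMDiffOn_toFun := by
    have h1 : ContMDiffOn (𝓘(ℝ, Cn k).prod 𝓘(ℝ, Cn k × Cn k)) 𝓘(ℝ, Cn k) ∞
        (fun p : TotalSpace (Cn k × Cn k) ((TangentSpace 𝓘(ℝ, Cn k) : Y → Type) ×ᵇ
          (TangentSpace 𝓘(ℝ, Cn k) : Y → Type)) => e p.proj)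
        (TotalSpace.proj ⁻¹' e.source) :=
      e.contMDiffOn_toFun.comp (contMDiff_proj _).contMDiffOn fun p hp => hp
    exact h1.prodMk_space (((contMDiffOn_tangentChart e).comp
      contMDiff_prod_totalSpace_fst.contMDiffOn fun p hp => hp).prodMk_space
      ((contMDiffOn_tangentChart e).comp contMDiff_prod_totalSpace_snd.contMDiffOn fun p hp => hp))
  contMDiffOn_invFun := by
    intro z hz
    have hs : e.target ×ˢ univ ∈ 𝓝 z := (e.open_target.prod isOpen_univ).mem_nhds hz
    have h0 := contMDiffOn_tangentChart_symm e
    have h1 : ContDiff ℝ ∞ fun z : Cn k × (Cn k × Cn k) => (z.1, z.2.1) := by fun_prop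
    have h2 : ContDiff ℝ ∞ fun z : Cn k × (Cn k × Cn k) => (z.1, z.2.2) := by fun_prop
    refine (contMDiffAt_prod_totalSpace.2 ⟨?_, ?_⟩).contMDiffWithinAt
    · exact (h0.comp h1.contMDiff.contMDiffOn (fun z hz => ⟨hz.1, mem_univ _⟩)).contMDiffAt hs
    · exact (h0.comp h2.contMDiff.contMDiffOn (fun z hz => ⟨hz.1, mem_univ _⟩)).contMDiffAt hs

end TangentCharts

/-! ## Local models in holomorphic charts -/

section HolomorphicCharts

lemma HasMFDerivAt.restrictScalars_complex {E E' : Type*} [NormedAddCommGroup E] [NormedSpace ℂ E]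
    [NormedAddCommGroup E'] [NormedSpace ℂ E'] {X X' : Type*} [TopologicalSpace X]
    [ChartedSpace E X] [TopologicalSpace X'] [ChartedSpace E' X'] {f : X → X'} {x : X}
    {f' : E →L[ℂ] E'} (h : HasMFDerivAt 𝓘(ℂ, E) 𝓘(ℂ, E') f x f') :
    HasMFDerivAt 𝓘(ℝ, E) 𝓘(ℝ, E') f x (f'.restrictScalars ℝ) :=
  ⟨h.1, h.2.restrictScalars ℝ⟩

lemma ContMDiffOn.restrictScalars_complex {E E' : Type*} [NormedAddCommGroup E] [NormedSpace ℂ E]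
    [NormedAddCommGroup E'] [NormedSpace ℂ E'] {X X' : Type*} [TopologicalSpace X]
    [ChartedSpace E X] [TopologicalSpace X'] [ChartedSpace E' X'] {f : X → X'} {s : Set X}
    {n : ℕ∞ω} (h : ContMDiffOn 𝓘(ℂ, E) 𝓘(ℂ, E') n f s) : ContMDiffOn 𝓘(ℝ, E) 𝓘(ℝ, E') n f s :=
  fun x hx => ⟨(h x hx).1, ContDiffWithinAt.restrict_scalars ℝ (h x hx).2⟩

variable {k : ℕ} {Y : Type*} [TopologicalSpace Y] [ChartedSpace (Cn k) Y]
  [IsManifold 𝓘(ℂ, Cn k) ω Y]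

/-- A holomorphic chart, as a smooth partial diffeomorphism. -/
def holChart (e : OpenPartialHomeomorph Y (Cn k))
    (he : e ∈ IsManifold.maximalAtlas 𝓘(ℂ, Cn k) ω Y) :
    PartialDiffeomorph 𝓘(ℝ, Cn k) 𝓘(ℝ, Cn k) Y (Cn k) ∞ where
  toPartialEquiv := e.toPartialEquiv
  open_source := e.open_source
  open_target := e.open_target
  contMDiffOn_toFun := (contMDiffOn_of_mem_maximalAtlas he).restrictScalars_complex.of_le (by simp)
  contMDiffOn_invFun :=
    (contMDiffOn_symm_of_mem_maximalAtlas he).restrictScalars_complex.of_le (by simp)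

variable {e : OpenPartialHomeomorph Y (Cn k)} {he : e ∈ IsManifold.maximalAtlas 𝓘(ℂ, Cn k) ω Y}

lemma chartDeriv_holChart_smul {y : Y} (hy : y ∈ e.source) (c : ℂ) (v : Cn k) :
    chartDeriv (holChart e he) y (c • v) = c • chartDeriv (holChart e he) y v := by
  have h1 := ((contMDiffOn_of_mem_maximalAtlas he).contMDiffAt
    (e.open_source.mem_nhds hy)).mdifferentiableAt (by simp)
  have h2 := h1.hasMFDerivAt.restrictScalars_complex.mfderiv
  have h3 : ∀ w : Cn k, chartDeriv (holChart e he) y w =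
    (mfderiv 𝓘(ℂ, Cn k) 𝓘(ℂ, Cn k) e y : Cn k →L[ℂ] Cn k) w := fun w => DFunLike.congr_fun h2 w
  rw [h3, h3]
  exact (mfderiv 𝓘(ℂ, Cn k) 𝓘(ℂ, Cn k) e y : Cn k →L[ℂ] Cn k).map_smul c v

instance isManifold_real_smooth : IsManifold 𝓘(ℝ, Cn k) ∞ Y :=
  IsManifold.of_le (n := ω) (by simp)

lemma exists_holChart (y : Y) : ∃ (e : OpenPartialHomeomorph Y (Cn k)),
    e ∈ IsManifold.maximalAtlas 𝓘(ℂ, Cn k) ω Y ∧ y ∈ e.source :=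
  ⟨chartAt (Cn k) y, IsManifold.chart_mem_maximalAtlas y, mem_chart_source _ y⟩

lemma continuous_dilation_of_charts {B F : Type} [NormedAddCommGroup B] [NormedSpace ℝ B]
    [NormedAddCommGroup F] [NormedSpace ℝ F] [NormedSpace ℂ F] [IsScalarTower ℝ ℂ F]
    {X : Type*} [TopologicalSpace X] [ChartedSpace B X] {Z : X → Type*}
    [TopologicalSpace (TotalSpace F Z)] [∀ y, TopologicalSpace (Z y)]
    [FiberBundle F Z] [∀ y, AddCommGroup (Z y)] [∀ y, Module ℝ (Z y)] [∀ y, Module ℂ (Z y)]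
    (h : ∀ p₀ : TotalSpace F Z, ∃ Θ : PartialDiffeomorph (𝓘(ℝ, B).prod 𝓘(ℝ, F)) 𝓘(ℝ, B × F)
      (TotalSpace F Z) (B × F) ∞, p₀ ∈ Θ.source ∧ ∀ p ∈ Θ.source, ∀ c : ℂ,
        dilation F c p ∈ Θ.source ∧ Θ (dilation F c p) = ((Θ p).1, c • (Θ p).2)) :
    Continuous fun p : ℂ × TotalSpace F Z => dilation F p.1 p.2 := by
  refine continuous_iff_continuousAt.2 fun ⟨c, p⟩ => ?_
  obtain ⟨Θ, hp, hΘ⟩ := h p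
  have h1 : ContinuousAt (fun q : ℂ × TotalSpace F Z => Θ q.2) (c, p) :=
    (Θ.contMDiffOn_toFun.continuousOn.continuousAt (Θ.open_source.mem_nhds hp)).comp
      (f := Prod.snd) continuousAt_snd
  have h2 : ContinuousAt (fun q : ℂ × TotalSpace F Z => ((Θ q.2).1, q.1 • (Θ q.2).2)) (c, p) :=
    h1.fst.prodMk (continuousAt_fst.smul h1.snd)
  have h3 : ((Θ p).1, c • (Θ p).2) ∈ Θ.target := by
    rw [← (hΘ p hp c).2]
    exact Θ.map_source (hΘ p hp c).1
  have h4 : ContinuousAt (fun q : ℂ × TotalSpace F Z => Θ.symm ((Θ q.2).1, q.1 • (Θ q.2).2))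
      (c, p) := ContinuousAt.comp (g := Θ.symm)
        (f := fun q : ℂ × TotalSpace F Z => ((Θ q.2).1, q.1 • (Θ q.2).2))
        (Θ.contMDiffOn_invFun.continuousOn.continuousAt (Θ.open_target.mem_nhds h3)) h2
  refine h4.congr ?_
  filter_upwards [(Θ.open_source.preimage continuous_snd).mem_nhds hp] with q hq
  rw [← (hΘ q.2 hq q.1).2]
  exact Θ.left_inv (hΘ q.2 hq q.1).1

lemma continuous_dilation_tangentBundle :
    Continuous fun p : ℂ × TotalSpace (Cn k) (TangentSpace 𝓘(ℝ, Cn k) : Y → Type) =>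
      dilation (Cn k) p.1 p.2 := by
  refine continuous_dilation_of_charts (B := Cn k) fun p₀ => ?_
  obtain ⟨e, he, hp⟩ := exists_holChart (k := k) p₀.proj
  exact ⟨tangentChart (holChart e he), hp, fun p hp c =>
    ⟨hp, Prod.ext rfl (chartDeriv_holChart_smul hp c p.2)⟩⟩

lemma continuous_dilation_tangentBundle₂ :
    Continuous fun p : ℂ × TotalSpace (Cn k × Cn k) ((TangentSpace 𝓘(ℝ, Cn k) : Y → Type) ×ᵇ
        (TangentSpace 𝓘(ℝ, Cn k) : Y → Type)) => dilation (Cn k × Cn k) p.1 p.2 := by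
  refine continuous_dilation_of_charts (B := Cn k) fun p₀ => ?_
  obtain ⟨e, he, hp⟩ := exists_holChart (k := k) p₀.proj
  exact ⟨tangentChart₂ (holChart e he), hp, fun p hp c =>
    ⟨hp, Prod.ext rfl (Prod.ext (chartDeriv_holChart_smul hp c p.2.1)
      (chartDeriv_holChart_smul hp c p.2.2))⟩⟩

variable {P : Type} [NormedAddCommGroup P] [NormedSpace ℝ P] [NormedSpace ℂ P] [IsScalarTower ℝ ℂ P]
  [FiniteDimensional ℝ P] [MeasurableSpace P] [BorelSpace P] {μ : Measure P} [μ.IsAddHaarMeasure]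
  {b : ℕ} {bs : Module.Basis (Fin b) ℝ P}

lemma bundleChart_tangentChart (e : OpenPartialHomeomorph Y (Cn k))
    (he : e ∈ IsManifold.maximalAtlas 𝓘(ℂ, Cn k) ω Y) :
    BundleChart (Z := (TangentSpace 𝓘(ℝ, Cn k) : Y → Type)) (holChart e he)
      (tangentChart (holChart e he)) where
  bundle_source _ := Iff.rfl
  bundle_fst _ _ := rfl
  bundle_dilation p hp c := chartDeriv_holChart_smul hp c p.2

lemma bundleChart_tangentChart₂ (e : OpenPartialHomeomorph Y (Cn k))
    (he : e ∈ IsManifold.maximalAtlas 𝓘(ℂ, Cn k) ω Y) :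
    BundleChart (Z := (TangentSpace 𝓘(ℝ, Cn k) : Y → Type) ×ᵇ
      (TangentSpace 𝓘(ℝ, Cn k) : Y → Type)) (holChart e he) (tangentChart₂ (holChart e he)) where
  bundle_source _ := Iff.rfl
  bundle_fst _ _ := rfl
  bundle_dilation p hp c := Prod.ext (chartDeriv_holChart_smul hp c p.2.1)
    (chartDeriv_holChart_smul hp c p.2.2)

lemma localModel_tangentChart {M : TransverseModel (Cn k) (Cn k) P} (hδ : ∀ x, M.δ x = x)
    (hpr : ∀ x ∈ e.target, x - M.pr x ∈ e.target) {S : DForm 𝓘(ℝ, Cn k) Y b → ℂ}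
    (hS : ∀ (K : Set (Cn k)) (f : Cn k → Cn k [⋀^Fin b]→L[ℝ] ℂ), IsCompact K → K ⊆ e.target →
      IsTest K f → S (chartPull (holChart e he) f) = ∫ ζ, f (M.m ζ) (fun j => M.m (bs j)) ∂μ) :
    LocalModel (Z := (TangentSpace 𝓘(ℝ, Cn k) : Y → Type)) (fun y => y)
      (fun y (w : Cn k × Cn k) => (w.2 - w.1 : TangentSpace 𝓘(ℝ, Cn k) y)) S M bs μ
      (holChart e he) (holChart e he) (tangentChart (holChart e he)) where
  sub_pr_mem := hpr
  mem_source _ hy := hy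
  map_δN y _ := (hδ _).symm
  toBundleChart := bundleChart_tangentChart e he
  bundle_target := rfl
  bundle_quot y _ w := by
    rw [hδ, ← map_sub]
    rfl
  integral := hS

lemma localModel_tangentChart₂ {M : TransverseModel (Cn k) (Cn k × Cn k) P}
    (hδ : ∀ x, M.δ x = (x, x))
    (hpr : ∀ x ∈ e.target, x - M.pr x ∈ e.target)
    {S : DForm (𝓘(ℝ, Cn k).prod 𝓘(ℝ, Cn k)) (Y × Y) b → ℂ}
    (hS : ∀ (K : Set (Cn k × Cn k)) (f : Cn k × Cn k → (Cn k × Cn k) [⋀^Fin b]→L[ℝ] ℂ),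
      IsCompact K → K ⊆ e.target ×ˢ e.target → IsTest K f →
      S (chartPull (prodChart (holChart e he) (holChart e he) 0) f) =
        ∫ ζ, f (M.m ζ) (fun j => M.m (bs j)) ∂μ) :
    LocalModel (N := Y × Y) (J := 𝓘(ℝ, Cn k).prod 𝓘(ℝ, Cn k))
      (Z := (TangentSpace 𝓘(ℝ, Cn k) : Y → Type) ×ᵇ (TangentSpace 𝓘(ℝ, Cn k) : Y → Type))
      (fun y => (y, y))
      (fun y (w : Cn k × (Cn k × Cn k)) => ((w.2.1 - w.1, w.2.2 - w.1) :
        TangentSpace 𝓘(ℝ, Cn k) y × TangentSpace 𝓘(ℝ, Cn k) y)) S M bs μ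
      (holChart e he) (prodChart (holChart e he) (holChart e he) 0)
      (tangentChart₂ (holChart e he)) where
  sub_pr_mem := hpr
  mem_source _ hy := ⟨hy, hy⟩
  map_δN y _ := by
    rw [hδ, prodChart_apply]
    simp
  toBundleChart := bundleChart_tangentChart₂ e he
  bundle_target := rfl
  bundle_quot y hy w := by
    have h1 := mfderiv_prodChart (holChart e he) (holChart e he) 0 (x := (y, y)) hy hy w.2
    rw [hδ]
    refine Eq.trans ?_ (congrArg (fun z : Cn k × Cn k => z - _) h1.symm)
    simp only [zero_apply, sub_zero]
    exact Prod.ext (map_sub (chartDeriv (holChart e he) y) w.2.1 w.1)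
      (map_sub (chartDeriv (holChart e he) y) w.2.2 w.1)
  integral K f hK hKt hf := hS K f hK (fun z hz => by
    obtain ⟨h1, h2⟩ := hKt hz
    have h3 : z.2 + (0 : Cn k →L[ℝ] Cn k) z.1 ∈ e.target := h2
    exact ⟨h1, by simpa using h3⟩) hf

end HolomorphicCharts

/-! ## Currents of integration in charts -/

section IntegrationCurrents

lemma span_realFrame (ℓ : ℕ) : ⊤ ≤ Submodule.span ℝ (range (realFrame ℓ)) := by
  intro w _
  have h1 : w = ∑ j, Pi.single j (w j) := (Finset.univ_sum_single w).symm
  rw [h1]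
  refine Submodule.sum_mem _ fun j _ => ?_
  have h2 : (Pi.single j (w j) : Cn ℓ) = (w j).re • realFrame ℓ ⟨2 * j.val, by omega⟩ +
      (w j).im • realFrame ℓ ⟨2 * j.val + 1, by omega⟩ := by
    have e1 : (⟨2 * j.val / 2, by omega⟩ : Fin ℓ) = j := Fin.ext (by simp)
    have e2 : (⟨(2 * j.val + 1) / 2, by omega⟩ : Fin ℓ) = j := Fin.ext (by simp; omega)
    have e3 : 2 * j.val % 2 = 0 := by omega
    have e4 : ¬ (2 * j.val + 1) % 2 = 0 := by omega
    simp only [realFrame, e1, e2, if_pos e3, if_neg e4]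
    rw [← Pi.single_smul, ← Pi.single_smul, ← Pi.single_add]
    congr 1
    apply Complex.ext <;> simp
  rw [h2]
  exact Submodule.add_mem _ (Submodule.smul_mem _ _ (Submodule.subset_span ⟨_, rfl⟩))
    (Submodule.smul_mem _ _ (Submodule.subset_span ⟨_, rfl⟩))

/-- The real basis `(e₁, i e₁, …, e_ℓ, i e_ℓ)` of `ℂ^ℓ`. -/
def realFrameBasis (ℓ : ℕ) : Module.Basis (Fin (2 * ℓ)) ℝ (Cn ℓ) :=
  basisOfTopLeSpanOfCardEqFinrank (realFrame ℓ) (span_realFrame ℓ) (by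
    rw [Module.finrank_pi_fintype]
    simp [Complex.finrank_real_complex, mul_comm])

lemma realFrameBasis_apply (ℓ : ℕ) (j : Fin (2 * ℓ)) : realFrameBasis ℓ j = realFrame ℓ j := by
  rw [realFrameBasis, coe_basisOfTopLeSpanOfCardEqFinrank]

variable {k : ℕ} {Y : Type*} [TopologicalSpace Y] [ChartedSpace (Cn k) Y]
  [IsManifold 𝓘(ℂ, Cn k) ω Y]

/-- The projection to the first `ℓ` coordinates (for `ℓ ≤ k`). -/
def sliceProj {ℓ k : ℕ} (h : ℓ ≤ k) : Cn k →L[ℂ] Cn ℓ :=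
  ContinuousLinearMap.pi fun j => ContinuousLinearMap.proj (Fin.castLE h j)

lemma sliceProj_sliceIncl {ℓ k : ℕ} (h : ℓ ≤ k) (w : Cn ℓ) : sliceProj h (sliceIncl ℓ k w) = w := by
  funext j
  simp [sliceProj, sliceIncl]

lemma sliceIncl_sliceProj {ℓ k : ℕ} (h : ℓ ≤ k) {z : Cn k}
    (hz : ∀ j : Fin k, ℓ ≤ j.val → z j = 0) : sliceIncl ℓ k (sliceProj h z) = z := by
  funext j
  simp only [sliceProj, sliceIncl]
  split_ifs with hj
  · rfl
  · exact (hz j (not_lt.1 hj)).symm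

lemma contDiff_sliceIncl (ℓ k : ℕ) {𝕜 : Type*} [RCLike 𝕜] [NormedSpace 𝕜 ℂ] {n : ℕ∞ω} :
    ContDiff 𝕜 n (sliceIncl ℓ k) := by
  refine contDiff_pi.2 fun j => ?_
  simp only [sliceIncl]
  split_ifs
  · exact contDiff_apply _ _ _
  · exact contDiff_const

variable {V : Set Y} {ℓ : ℕ} {E : OpenPartialHomeomorph Y (Cn k)}

lemma IsSliceChart.symm_mem (hE : IsSliceChart V ℓ E) {w : Cn ℓ} (hw : sliceIncl ℓ k w ∈ E.target) :
    E.symm (sliceIncl ℓ k w) ∈ V := by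
  rw [hE.mem_iff _ (E.map_target hw), E.right_inv hw]
  intro j hj
  simp [sliceIncl, not_lt.2 hj]

lemma chartIntegral_eq_zero (hE : IsSliceChart V ℓ E) (χ : Y → ℝ)
    {φ : DForm 𝓘(ℝ, Cn k) Y (2 * ℓ)} (hφ : ∀ z ∈ V, φ z = 0) : chartIntegral ℓ E χ φ = 0 := by
  have hm : MeasurableSet {w : Cn ℓ | sliceIncl ℓ k w ∈ E.target} :=
    (E.open_target.preimage (contDiff_sliceIncl ℓ k (𝕜 := ℝ) (n := 0)).continuous).measurableSet
  rw [chartIntegral]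
  refine (setIntegral_congr_fun hm fun w hw => ?_).trans (integral_zero _ _)
  rw [hφ _ (hE.symm_mem hw)]
  exact mul_zero _

lemma integrationCurrent_eq_zero [T2Space Y] [CompactSpace Y] (hV : IsComplexSubmanifold k V ℓ)
    {φ : DForm 𝓘(ℝ, Cn k) Y (2 * ℓ)} (hφ : ∀ z ∈ V, φ z = 0) : integrationCurrent hV φ = 0 := by
  rw [integrationCurrent]
  refine (finsum_congr fun p => ?_).trans finsum_zero
  exact chartIntegral_eq_zero (hV.exists_chart p.1 p.2).choose_spec.2 _ hφ

variable {e : OpenPartialHomeomorph Y (Cn k)} {he : e ∈ IsManifold.maximalAtlas 𝓘(ℂ, Cn k) ω Y}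

/-- Change of variables between slice charts. -/
lemma chartIntegral_chartPull (hE : IsSliceChart V ℓ E) (hℓ : ℓ ≤ k) {m : Cn ℓ →L[ℂ] Cn k}
    {md : Cn k →L[ℂ] Cn ℓ} (hmd : ∀ u, md (m u) = u)
    (hVm : ∀ y ∈ e.source, y ∈ V ↔ m (md (e y)) = e y) {χ : Y → ℝ}
    (hχ : ∀ y, χ y ≠ 0 → y ∈ E.source) (f : Cn k → Cn k [⋀^Fin (2 * ℓ)]→L[ℝ] ℂ) :
    chartIntegral ℓ E χ (chartPull (holChart e he) f) =
      ∫ ζ, (chartFun (holChart e he) χ (m ζ) : ℂ) * f (m ζ) fun j => m (realFrame ℓ j) := by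
  set G : Cn ℓ → Y := fun w => E.symm (sliceIncl ℓ k w) with hG
  set U : Set (Cn ℓ) := {w | sliceIncl ℓ k w ∈ E.target} with hU
  have hincl : Continuous (sliceIncl ℓ k) := (contDiff_sliceIncl ℓ k (𝕜 := ℝ) (n := 0)).continuous
  have hUo : IsOpen U := E.open_target.preimage hincl
  have hGc : ContinuousOn G U := E.continuousOn_symm.comp hincl.continuousOn fun w hw => hw
  set U' : Set (Cn ℓ) := U ∩ G ⁻¹' e.source with hU'
  have hU'o : IsOpen U' := hGc.isOpen_inter_preimage hUo e.open_source
  have hGV : ∀ w ∈ U, G w ∈ V := fun w hw => hE.symm_mem hw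
  set g : Cn ℓ → Cn ℓ := fun w => md (e (G w)) with hg
  have hmg : ∀ w ∈ U', m (g w) = e (G w) := fun w hw => (hVm _ hw.2).1 (hGV w hw.1)
  have hGd : ∀ w ∈ U, MDifferentiableAt 𝓘(ℂ, Cn ℓ) 𝓘(ℂ, Cn k) G w := fun w hw => by
    have h1 := ((contMDiffOn_symm_of_mem_maximalAtlas hE.mem_maximalAtlas).contMDiffAt
      (E.open_target.mem_nhds hw)).mdifferentiableAt (by simp)
    have h2 : MDifferentiableAt 𝓘(ℂ, Cn ℓ) 𝓘(ℂ, Cn k) (sliceIncl ℓ k) w :=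
      ((contDiff_sliceIncl ℓ k (𝕜 := ℂ) (n := 1)).contMDiff w).mdifferentiableAt (by simp)
    exact h1.comp w h2
  have hed : ∀ y ∈ e.source, MDifferentiableAt 𝓘(ℂ, Cn k) 𝓘(ℂ, Cn k) e y := fun y hy =>
    ((contMDiffOn_of_mem_maximalAtlas he).contMDiffAt
      (e.open_source.mem_nhds hy)).mdifferentiableAt (by simp)
  have hegd : ∀ w ∈ U', DifferentiableAt ℂ (fun w => e (G w)) w := fun w hw =>
    mdifferentiableAt_iff_differentiableAt.1 ((hed _ hw.2).comp w (hGd w hw.1))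
  have hgd : ∀ w ∈ U', DifferentiableAt ℂ g w := fun w hw =>
    md.differentiableAt.comp w (hegd w hw)
  set g' : Cn ℓ → Cn ℓ →L[ℝ] Cn ℓ := fun w => (fderiv ℂ g w).restrictScalars ℝ with hg'
  have hdet : ∀ w, 0 ≤ (g' w).det := fun w =>
    TransverseModel.det_complex_linear_nonneg (fderiv ℂ g w).toLinearMap
  have hderiv : ∀ w ∈ U', ∀ v : Cn ℓ, chartDeriv (holChart e he) (G w)
      (mfderiv 𝓘(ℝ, Cn ℓ) 𝓘(ℝ, Cn k) G w v) = m (g' w v) := by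
    intro w hw v
    have h1 := (hed _ hw.2).hasMFDerivAt.restrictScalars_complex
    have h2 := (hGd w hw.1).hasMFDerivAt.restrictScalars_complex
    have h3 := h1.comp w h2
    have h4 : HasFDerivAt (fun w => m (g w)) ((m.restrictScalars ℝ).comp (g' w)) w :=
      (m.restrictScalars ℝ).hasFDerivAt.comp w ((hgd w hw).hasFDerivAt.restrictScalars ℝ)
    have h5 : (e ∘ G) =ᶠ[𝓝 w] fun w => m (g w) := by
      filter_upwards [hU'o.mem_nhds hw] with w' hw' using (hmg w' hw').symm
    have h6 := hasMFDerivAt_unique h3 (h4.hasMFDerivAt.congr_of_eventuallyEq h5)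
    have h7 := h1.mfderiv
    have h8 := h2.mfderiv
    refine Eq.trans ?_ (DFunLike.congr_fun h6 v)
    change (mfderiv 𝓘(ℝ, Cn k) 𝓘(ℝ, Cn k) e (G w)) (mfderiv 𝓘(ℝ, Cn ℓ) 𝓘(ℝ, Cn k) G w v) = _
    rw [h7, h8]
    rfl
  set Fn : Cn ℓ → ℂ := fun ζ =>
    (chartFun (holChart e he) χ (m ζ) : ℂ) * f (m ζ) fun j => m (realFrame ℓ j) with hFn
  have hval : ∀ w ∈ U', (χ (G w) : ℂ) * chartPull (holChart e he) f (G w)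
      (fun a => mfderiv 𝓘(ℝ, Cn ℓ) 𝓘(ℝ, Cn k) G w (realFrame ℓ a)) =
      |(g' w).det| • Fn (g w) := by
    intro w hw
    have h1 : chartFun (holChart e he) χ (m (g w)) = χ (G w) := by
      rw [hmg w hw]
      exact (if_pos (e.map_source hw.2)).trans (congrArg χ (e.left_inv hw.2))
    have h2 : chartPull (holChart e he) f (G w)
        (fun a => mfderiv 𝓘(ℝ, Cn ℓ) 𝓘(ℝ, Cn k) G w (realFrame ℓ a)) =
        f (m (g w)) fun a => m (g' w (realFrame ℓ a)) := by
      have h0 : chartPull (holChart e he) f (G w) = _ := if_pos hw.2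
      rw [h0]
      change f (e (G w)) (fun a => chartDeriv (holChart e he) (G w)
        (mfderiv 𝓘(ℝ, Cn ℓ) 𝓘(ℝ, Cn k) G w (realFrame ℓ a))) = _
      rw [hmg w hw]
      congr 1
      funext a
      exact hderiv w hw _
    have h3 := topForm_comp (realFrameBasis ℓ)
      ((f (m (g w))).compContinuousLinearMap (m.restrictScalars ℝ)) (g' w).toLinearMap
    rw [show ⇑(realFrameBasis ℓ) = realFrame ℓ from funext (realFrameBasis_apply ℓ)] at h3
    have h4 : f (m (g w)) (fun a => m (g' w (realFrame ℓ a))) =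
        (g' w).det • f (m (g w)) fun a => m (realFrame ℓ a) := by
      exact h3
    rw [h2, h4, abs_of_nonneg (hdet w), hFn]
    dsimp only
    rw [h1, mul_smul_comm]
  have hinj : InjOn g U' := by
    intro w hw w' hw' hww
    have h1 : e (G w) = e (G w') := by rw [← hmg w hw, ← hmg w' hw', hww]
    have h2 := e.injOn hw.2 hw'.2 h1
    have h3 := E.symm.injOn hw.1 hw'.1 h2
    rw [← sliceProj_sliceIncl hℓ w, h3, sliceProj_sliceIncl]
  have himg : g '' U' = {ζ | m ζ ∈ e.target ∧ e.symm (m ζ) ∈ E.source} := by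
    ext ζ
    constructor
    · rintro ⟨w, hw, rfl⟩
      refine ⟨?_, ?_⟩
      · rw [hmg w hw]
        exact e.map_source hw.2
      · rw [hmg w hw, e.left_inv hw.2]
        exact E.map_target hw.1
    · rintro ⟨h1, h2⟩
      have hes := e.map_target h1
      have hyV : e.symm (m ζ) ∈ V := by
        rw [hVm _ hes, e.right_inv h1, hmd]
      have h3 := sliceIncl_sliceProj hℓ ((hE.mem_iff _ h2).1 hyV)
      have h4 : G (sliceProj hℓ (E (e.symm (m ζ)))) = e.symm (m ζ) := by
        rw [hG]
        dsimp only
        rw [h3, E.left_inv h2]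
      refine ⟨sliceProj hℓ (E (e.symm (m ζ))), ⟨?_, ?_⟩, ?_⟩
      · change sliceIncl ℓ k _ ∈ E.target
        rw [h3]
        exact E.map_source h2
      · rw [mem_preimage, h4]
        exact hes
      · rw [hg]
        dsimp only
        rw [h4, e.right_inv h1, hmd]
  have hout : ∀ ζ, ζ ∉ g '' U' → Fn ζ = 0 := by
    intro ζ hζ
    have h0 : chartFun (holChart e he) χ (m ζ) = 0 := by
      rw [chartFun]
      split_ifs with h1
      · by_contra hne
        rw [himg] at hζ
        exact hζ ⟨h1, hχ _ hne⟩
      · rfl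
    rw [hFn]
    dsimp only
    rw [h0]
    simp
  rw [chartIntegral]
  have hsub : ∫ w in U, (χ (G w) : ℂ) * chartPull (holChart e he) f (G w)
      (fun a => mfderiv 𝓘(ℝ, Cn ℓ) 𝓘(ℝ, Cn k) G w (realFrame ℓ a)) =
      ∫ w in U', (χ (G w) : ℂ) * chartPull (holChart e he) f (G w)
      (fun a => mfderiv 𝓘(ℝ, Cn ℓ) 𝓘(ℝ, Cn k) G w (realFrame ℓ a)) := by
    refine setIntegral_eq_of_subset_of_forall_sdiff_eq_zero hUo.measurableSet inter_subset_left
      fun w hw => ?_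
    have hn : G w ∉ e.source := fun h => hw.2 ⟨hw.1, h⟩
    have : chartPull (holChart e he) f (G w) = 0 := if_neg hn
    rw [this]
    exact mul_zero _
  refine hsub.trans ?_
  rw [setIntegral_congr_fun hU'o.measurableSet hval,
    ← integral_image_eq_integral_abs_det_fderiv_smul volume hU'o.measurableSet
      (fun w hw => ((hgd w hw).hasFDerivAt.restrictScalars ℝ).hasFDerivWithinAt) hinj]
  exact setIntegral_eq_integral_of_forall_compl_eq_zero hout

lemma continuous_chartFun_mul {χ : Y → ℝ} (hχ : Continuous χ) {K : Set (Cn k)} (hK : IsCompact K)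
    (hKe : K ⊆ e.target) {b : ℕ} {f : Cn k → Cn k [⋀^Fin b]→L[ℝ] ℂ} (hf : IsTest K f)
    (v : Fin b → Cn k) :
    Continuous fun z => (chartFun (holChart e he) χ z : ℂ) * f z v := by
  have hfc : Continuous fun z => f z v :=
    ((ContinuousAlternatingMap.apply ℝ (Cn k) ℂ v).continuous).comp hf.smooth.continuous
  refine continuous_iff_continuousAt.2 fun z => ?_
  by_cases hz : z ∈ e.target
  · have h1 : ContinuousAt (fun z => (χ (e.symm z) : ℂ) * f z v) z :=
      (Complex.continuous_ofReal.continuousAt.comp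
        (hχ.continuousAt.comp (e.continuousAt_symm hz))).mul hfc.continuousAt
    refine h1.congr ?_
    filter_upwards [e.open_target.mem_nhds hz] with z' hz'
    have : chartFun (holChart e he) χ z' = χ (e.symm z') := if_pos hz'
    rw [this]
  · have h1 : ContinuousAt (fun _ : Cn k => (0 : ℂ)) z := continuousAt_const
    refine h1.congr ?_
    filter_upwards [hK.isClosed.isOpen_compl.mem_nhds fun h => hz (hKe h)] with z' hz'
    rw [hf.eq_zero z' hz']
    exact (mul_zero _).symm

/-- The current of integration in a chart in which the submanifold is linear. -/
theorem integrationCurrent_chartPull [T2Space Y] [CompactSpace Y] (hV : IsComplexSubmanifold k V ℓ)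
    {m : Cn ℓ →L[ℂ] Cn k} {md : Cn k →L[ℂ] Cn ℓ} (hmd : ∀ u, md (m u) = u)
    (hVm : ∀ y ∈ e.source, y ∈ V ↔ m (md (e y)) = e y) {K : Set (Cn k)} (hK : IsCompact K)
    (hKe : K ⊆ e.target) {f : Cn k → Cn k [⋀^Fin (2 * ℓ)]→L[ℝ] ℂ} (hf : IsTest K f) :
    integrationCurrent hV (chartPull (holChart e he) f) =
      ∫ ζ, f (m ζ) fun j => m (realFrame ℓ j) := by
  set ρ := hV.exists_partition.choose with hρdef
  have hρ : ρ.IsSubordinate fun p => (hV.exists_chart p.1 p.2).choose.source :=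
    hV.exists_partition.choose_spec
  have hfin : {p | (Function.support (ρ p)).Nonempty}.Finite :=
    ρ.locallyFinite.finite_nonempty_of_compact
  have hterm : ∀ p : V, chartIntegral ℓ (hV.exists_chart p.1 p.2).choose (ρ p)
      (chartPull (holChart e he) f) =
      ∫ ζ, (chartFun (holChart e he) (ρ p) (m ζ) : ℂ) * f (m ζ) fun j => m (realFrame ℓ j) :=
    fun p => chartIntegral_chartPull (hV.exists_chart p.1 p.2).choose_spec.2 hV.dim_le hmd hVm
      (fun y hy => hρ p (subset_tsupport _ hy)) f
  have hzero : ∀ p : V, p ∉ hfin.toFinset → ∀ z, chartFun (holChart e he) (ρ p) z = 0 := by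
    intro p hp z
    rw [chartFun]
    split_ifs
    · by_contra hne
      exact hp (hfin.mem_toFinset.2 ⟨_, hne⟩)
    · rfl
  have hint : ∀ p ∈ hfin.toFinset, Integrable fun ζ =>
      (chartFun (holChart e he) (ρ p) (m ζ) : ℂ) * f (m ζ) fun j => m (realFrame ℓ j) := by
    intro p _
    refine ((continuous_chartFun_mul (ρ p).contMDiff.continuous hK hKe hf _).comp
      m.continuous).integrable_of_hasCompactSupport ?_
    refine HasCompactSupport.intro (hK.image md.continuous) fun ζ hζ => ?_
    have h0 : f (m ζ) = 0 := hf.eq_zero _ fun h => hζ ⟨_, h, hmd ζ⟩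
    simp only [Function.comp_apply, h0]
    exact mul_zero _
  rw [integrationCurrent]
  simp only [← hρdef, hterm]
  rw [finsum_eq_sum_of_support_subset (s := hfin.toFinset), ← integral_finsetSum _ hint]
  · refine integral_congr_ae (Eventually.of_forall fun ζ => ?_)
    dsimp only
    rw [← Finset.sum_mul]
    by_cases hζ : m ζ ∈ e.target
    · have hs : ∑ p ∈ hfin.toFinset, (chartFun (holChart e he) (ρ p) (m ζ) : ℂ) = 1 := by
        have hyV : e.symm (m ζ) ∈ V := by
          rw [hVm _ (e.map_target hζ), e.right_inv hζ, hmd]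
        have h1 := ρ.sum_eq_one hyV
        rw [finsum_eq_sum_of_support_subset (s := hfin.toFinset)] at h1
        · rw [← Complex.ofReal_sum, ← Complex.ofReal_one, ← h1]
          congr 1
          exact Finset.sum_congr rfl fun p _ => if_pos hζ
        · intro p hp
          exact hfin.mem_toFinset.2 ⟨_, hp⟩
      rw [hs, one_mul]
    · have h0 : f (m ζ) = 0 := hf.eq_zero _ fun h => hζ (hKe h)
      rw [h0]
      exact mul_zero _
  · intro p hp
    by_contra hp'
    refine hp ?_
    have : ∀ ζ, (chartFun (holChart e he) (ρ p) (m ζ) : ℂ) *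
        (f (m ζ) fun j => m (realFrame ℓ j)) = 0 := fun ζ => by
      rw [hzero p hp']
      simp
    simp only [this, integral_zero]

end IntegrationCurrents

/-! ## Tensor products of currents of integration -/

section TensorIntegration

/-- The union of the bases `realFrameBasis` of the two factors. -/
def realFrameBasisProd (ℓ₁ ℓ₂ : ℕ) : Module.Basis (Fin (2 * ℓ₁ + 2 * ℓ₂)) ℝ (Cn ℓ₁ × Cn ℓ₂) :=
  ((realFrameBasis ℓ₁).prod (realFrameBasis ℓ₂)).reindex finSumFinEquiv

lemma realFrameBasisProd_apply (ℓ₁ ℓ₂ : ℕ) (j : Fin (2 * ℓ₁ + 2 * ℓ₂)) :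
    realFrameBasisProd ℓ₁ ℓ₂ j = Fin.append (fun i => (realFrame ℓ₁ i, (0 : Cn ℓ₂)))
      (fun i => ((0 : Cn ℓ₁), realFrame ℓ₂ i)) j := by
  refine Fin.addCases (fun i => ?_) (fun i => ?_) j
  · rw [realFrameBasisProd, Module.Basis.reindex_apply, finSumFinEquiv_symm_apply_castAdd,
      Fin.append_left, Module.Basis.prod_apply]
    simp [realFrameBasis_apply]
  · rw [realFrameBasisProd, Module.Basis.reindex_apply, finSumFinEquiv_symm_apply_natAdd,
      Fin.append_right, Module.Basis.prod_apply]
    simp [realFrameBasis_apply]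

variable {k : ℕ} {Y : Type*} [TopologicalSpace Y] [ChartedSpace (Cn k) Y]
  [IsManifold 𝓘(ℂ, Cn k) ω Y] [T2Space Y] [CompactSpace Y] {V₁ V₂ : Set Y} {ℓ₁ ℓ₂ : ℕ}
  {e : OpenPartialHomeomorph Y (Cn k)} {he : e ∈ IsManifold.maximalAtlas 𝓘(ℂ, Cn k) ω Y}

lemma tensor_integrationCurrent_eq_zero (hV₁ : IsComplexSubmanifold k V₁ ℓ₁)
    (hV₂ : IsComplexSubmanifold k V₂ ℓ₂)
    {φ : DForm (𝓘(ℝ, Cn k).prod 𝓘(ℝ, Cn k)) (Y × Y) (2 * ℓ₁ + 2 * ℓ₂)}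
    (hφ : ∀ z ∈ V₁ ×ˢ V₂, φ z = 0) :
    tensor (integrationCurrent hV₁) (integrationCurrent hV₂) φ = 0 :=
  integrationCurrent_eq_zero hV₁ fun _ hy =>
    partialPairing_eq_zero (W := V₂) (fun _ h => integrationCurrent_eq_zero hV₂ h)
      fun _ hz => hφ _ ⟨hy, hz⟩

/-- The tensor product of currents of integration in a product chart in which the submanifolds are
linear. -/
theorem tensor_integrationCurrent_chartPull (hV₁ : IsComplexSubmanifold k V₁ ℓ₁)
    (hV₂ : IsComplexSubmanifold k V₂ ℓ₂) {m₁ : Cn ℓ₁ →L[ℂ] Cn k} {md₁ : Cn k →L[ℂ] Cn ℓ₁}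
    {m₂ : Cn ℓ₂ →L[ℂ] Cn k} {md₂ : Cn k →L[ℂ] Cn ℓ₂} (hmd₁ : ∀ u, md₁ (m₁ u) = u)
    (hmd₂ : ∀ u, md₂ (m₂ u) = u) (hVm₁ : ∀ y ∈ e.source, y ∈ V₁ ↔ m₁ (md₁ (e y)) = e y)
    (hVm₂ : ∀ y ∈ e.source, y ∈ V₂ ↔ m₂ (md₂ (e y)) = e y) {K : Set (Cn k × Cn k)}
    (hK : IsCompact K) (hKe : K ⊆ e.target ×ˢ e.target)
    {f : Cn k × Cn k → (Cn k × Cn k) [⋀^Fin (2 * ℓ₁ + 2 * ℓ₂)]→L[ℝ] ℂ} (hf : IsTest K f) :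
    tensor (integrationCurrent hV₁) (integrationCurrent hV₂)
      (chartPull (prodChart (holChart e he) (holChart e he) 0) f) =
      ∫ ζ : Cn ℓ₁ × Cn ℓ₂, f (m₁ ζ.1, m₂ ζ.2) fun j =>
        (m₁ (realFrameBasisProd ℓ₁ ℓ₂ j).1, m₂ (realFrameBasisProd ℓ₁ ℓ₂ j).2) := by
  have hKt : K ⊆ (prodChart (holChart e he) (holChart e he) 0).target := fun z hz =>
    ⟨(hKe hz).1, by
      change z.2 + (0 : Cn k →L[ℝ] Cn k) z.1 ∈ e.target
      simpa using (hKe hz).2⟩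
  set G : Cn k × Cn ℓ₂ →L[ℝ] Cn k × Cn k := graphMap (m₂.restrictScalars ℝ) 0 with hG
  have hGa : ∀ z, G z = (z.1, m₂ z.2) := fun z => by
    rw [hG, graphMap_apply]
    simp
  set h : Cn k × Cn ℓ₂ → Cn k [⋀^Fin (2 * ℓ₁)]→L[ℝ] ℂ := fun z =>
    sliceAlt (realFrame ℓ₂) ((f (G z)).compContinuousLinearMap G) with hh
  set Q : Cn k × Cn k →L[ℝ] Cn k × Cn ℓ₂ :=
    (ContinuousLinearMap.fst ℝ _ _).prod
      ((md₂.restrictScalars ℝ).comp (ContinuousLinearMap.snd ℝ _ _)) with hQ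
  have hQG : ∀ z, Q (G z) = z := fun z => by
    rw [hGa]
    exact Prod.ext rfl (hmd₂ _)
  have hQK : IsCompact (Q '' K) := hK.image Q.continuous
  have hht : IsTest (Q '' K) h := by
    have h1 : ContDiff ℝ ∞ fun z => (f (G z)).compContinuousLinearMap G :=
      contDiffOn_univ.1 (ContDiffOn.alt_comp (hf.smooth.comp G.contDiff).contDiffOn
        contDiffOn_const)
    refine ⟨(sliceAlt (B := Cn k) (a := 2 * ℓ₁) (realFrame ℓ₂)).contDiff.comp h1, fun z hz => ?_⟩
    have h0 : f (G z) = 0 := hf.eq_zero _ fun h => hz ⟨_, h, hQG z⟩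
    rw [hh]
    dsimp only
    rw [h0]
    exact map_zero (sliceAlt _)
  have hpp : partialPairing (integrationCurrent hV₂)
      (chartPull (prodChart (holChart e he) (holChart e he) 0) f) =
      chartPull (holChart e he) fun x => ∫ ζ, h (x, ζ) :=
    partialPairing_chartPull (m := m₂.restrictScalars ℝ) (md := md₂.restrictScalars ℝ) hmd₂ 0
      (realFrame ℓ₂) (holChart e he) (holChart e he)
      (fun K' f' hK' hKt' hf' => integrationCurrent_chartPull hV₂ hmd₂ hVm₂ hK' hKt' hf') hK hKt hf
  rw [tensor, hpp, integrationCurrent_chartPull hV₁ hmd₁ hVm₁ (hQK.image continuous_fst)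
    (by
      rintro _ ⟨_, ⟨z, hz, rfl⟩, rfl⟩
      exact (hKe hz).1) (hht.integral hQK)]
  set w : Fin (2 * ℓ₁) → Cn k := fun j => m₁ (realFrame ℓ₁ j) with hw
  have happ : ∀ x, (∫ ζ, h (x, ζ)) w = ∫ ζ, h (x, ζ) w := fun x => by
    have hint : Integrable fun ζ => h (x, ζ) := by
      refine (hht.smooth.continuous.comp
        (Continuous.prodMk_right x)).integrable_of_hasCompactSupport ?_
      exact HasCompactSupport.intro (hQK.image continuous_snd)
        fun u hu => hht.eq_zero _ fun h' => hu ⟨_, h', rfl⟩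
    exact (ContinuousLinearMap.integral_comp_comm
      (ContinuousAlternatingMap.apply ℝ (Cn k) ℂ w) hint).symm
  simp only [happ]
  have hc : Continuous fun ζ : Cn ℓ₁ × Cn ℓ₂ => h (m₁ ζ.1, ζ.2) w :=
    (ContinuousAlternatingMap.apply ℝ (Cn k) ℂ w).continuous.comp
      (hht.smooth.continuous.comp (by fun_prop))
  have hi : Integrable (fun ζ : Cn ℓ₁ × Cn ℓ₂ => h (m₁ ζ.1, ζ.2) w)
      ((volume : Measure (Cn ℓ₁)).prod (volume : Measure (Cn ℓ₂))) := by
    refine hc.integrable_of_hasCompactSupport ?_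
    refine HasCompactSupport.intro (hQK.image
      (by fun_prop : Continuous fun z : Cn k × Cn ℓ₂ => (md₁ z.1, z.2))) fun ζ hζ => ?_
    have h0 : h (m₁ ζ.1, ζ.2) = 0 := hht.eq_zero _ fun h' => hζ ⟨_, h', by simp [hmd₁]⟩
    rw [h0]
    rfl
  rw [← integral_prod (fun ζ : Cn ℓ₁ × Cn ℓ₂ => h (m₁ ζ.1, ζ.2) w) hi]
  refine integral_congr_ae (Eventually.of_forall fun ζ => ?_)
  dsimp only
  rw [hh]
  dsimp only
  rw [sliceAlt_apply, hGa]
  change f (m₁ ζ.1, m₂ ζ.2) (fun t => G _) = _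
  congr 1
  funext t
  rw [realFrameBasisProd_apply]
  refine Fin.addCases (fun i => ?_) (fun i => ?_) t
  · rw [Fin.append_left, Fin.append_left, hGa]
  · rw [Fin.append_right, Fin.append_right, hGa]
    simp

end TensorIntegration

/-! ## Charts adapted to two transverse submanifolds -/

section AdaptedCharts

/-- The inverse function theorem, with smoothness of the inverse on the whole target. -/
lemma ContDiffOn.exists_openPartialHomeomorph {𝕂 E F : Type*} [RCLike 𝕂] [NormedAddCommGroup E]
    [NormedSpace 𝕂 E] [CompleteSpace E] [NormedAddCommGroup F] [NormedSpace 𝕂 F] {n : ℕ∞ω}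
    (hn : n ≠ 0) {Ω : Set E} (hΩ : IsOpen Ω) {f : E → F} (hf : ContDiffOn 𝕂 n f Ω) {a : E}
    (ha : a ∈ Ω) {f' : E ≃L[𝕂] F} (hf' : HasFDerivAt f (f' : E →L[𝕂] F) a) :
    ∃ Ψ : OpenPartialHomeomorph E F, ⇑Ψ = f ∧ a ∈ Ψ.source ∧ Ψ.source ⊆ Ω ∧
      ContDiffOn 𝕂 n Ψ.symm Ψ.target := by
  have hfa : ContDiffAt 𝕂 n f a := hf.contDiffAt (hΩ.mem_nhds ha)
  have h1 : ContinuousAt (fderiv 𝕂 f) a := by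
    have h1n : 1 ≤ n := ENat.one_le_iff_ne_zero_withTop.2 hn
    exact ((hfa.of_le h1n).fderiv_right (m := 0) (by simp)).continuousAt
  have h2 : ∀ᶠ x in 𝓝 a, fderiv 𝕂 f x ∈ range ((↑) : (E ≃L[𝕂] F) → E →L[𝕂] F) := by
    refine h1 ?_
    rw [hf'.fderiv]
    exact ContinuousLinearEquiv.nhds f'
  obtain ⟨O, hO, hOo, haO⟩ := mem_nhds_iff.1 (inter_mem h2 (hΩ.mem_nhds ha))
  set Ψ₀ := hfa.toOpenPartialHomeomorph f hf' hn with hΨ₀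
  refine ⟨Ψ₀.restrOpen O hOo, rfl, ⟨hfa.mem_toOpenPartialHomeomorph_source hf' hn, haO⟩,
    fun x hx => (hO hx.2).2, fun z hz => ?_⟩
  set x := (Ψ₀.restrOpen O hOo).symm z with hx
  have hxs : x ∈ Ψ₀.source ∩ O := (Ψ₀.restrOpen O hOo).map_target hz
  obtain ⟨A, hA⟩ := (hO hxs.2).1
  have hfx : ContDiffAt 𝕂 n f x := hf.contDiffAt (hΩ.mem_nhds (hO hxs.2).2)
  have hd : HasFDerivAt f (A : E →L[𝕂] F) x := by
    rw [hA]
    exact (hfx.differentiableAt hn).hasFDerivAt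
  exact ((Ψ₀.restrOpen O hOo).contDiffAt_symm hz hd hfx).contDiffWithinAt

lemma LinearIndependent.exists_basis_extension {K V ι : Type*} [Field K] [AddCommGroup V]
    [Module K V] {v : ι → V} (hv : LinearIndependent K v) {n : ℕ} (c : Module.Basis (Fin n) K V) :
    ∃ (b : Module.Basis (Fin n) K V) (σ : ι → Fin n), Function.Injective σ ∧ ∀ i, b (σ i) = v i := by
  set b₀ := Module.Basis.extend hv.linearIndepOn_id with hb₀
  set E := b₀.indexEquiv c with hE
  have hmem : ∀ i, v i ∈ hv.linearIndepOn_id.extend (subset_univ (range v)) := fun i =>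
    Module.Basis.subset_extend hv.linearIndepOn_id ⟨i, rfl⟩
  refine ⟨b₀.reindex E, fun i => E ⟨v i, hmem i⟩, fun i j hij => ?_, fun i => ?_⟩
  · exact hv.injective (congrArg Subtype.val (E.injective hij))
  · rw [Module.Basis.reindex_apply, E.symm_apply_apply, hb₀, Module.Basis.extend_apply_self]

lemma card_eq_of_mem_iff_forall_ne {k ℓ : ℕ} (hℓ : ℓ ≤ k)
    {e : {j : Fin k // ℓ ≤ j.val} → Fin k} (he : Function.Injective e) {s : Finset (Fin k)}
    (hs : ∀ i, i ∈ s ↔ ∀ j, e j ≠ i) : s.card = ℓ := by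
  classical
  have h1 : s = (Finset.univ.image e)ᶜ := by
    ext i
    simp [hs]
  have h2 : Fintype.card {j : Fin k // ℓ ≤ j.val} = k - ℓ := by
    have h3 := Fintype.card_subtype_compl (fun j : Fin k => j.val < ℓ)
    simp only [not_lt] at h3
    rw [h3, Fintype.card_fin]
    congr 1
    rw [Fintype.card_subtype, Fin.card_filter_val_lt]
    omega
  rw [h1, Finset.card_compl, Finset.card_image_of_injective _ he, Finset.card_univ, h2,
    Fintype.card_fin]
  omega

variable {k : ℕ} {Y : Type*} [TopologicalSpace Y] [ChartedSpace (Cn k) Y]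
  [IsManifold 𝓘(ℂ, Cn k) ω Y]

lemma trans_mem_maximalAtlas {e : OpenPartialHomeomorph Y (Cn k)}
    (he : e ∈ IsManifold.maximalAtlas 𝓘(ℂ, Cn k) ω Y) {Ψ : OpenPartialHomeomorph (Cn k) (Cn k)}
    (h1 : ContDiffOn ℂ ω Ψ Ψ.source) (h2 : ContDiffOn ℂ ω Ψ.symm Ψ.target) :
    e ≫ₕ Ψ ∈ IsManifold.maximalAtlas 𝓘(ℂ, Cn k) ω Y := by
  have hΨ : Ψ ∈ contDiffGroupoid ω 𝓘(ℂ, Cn k) := by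
    rw [contDiffGroupoid, mem_groupoid_of_pregroupoid]
    simpa [contDiffPregroupoid] using And.intro h1 h2
  intro e' he'
  have h3 := he e' he'
  refine ⟨?_, ?_⟩
  · rw [OpenPartialHomeomorph.trans_symm_eq_symm_trans_symm, OpenPartialHomeomorph.trans_assoc]
    exact StructureGroupoid.trans _ (StructureGroupoid.symm _ hΨ) h3.1
  · rw [← OpenPartialHomeomorph.trans_assoc]
    exact StructureGroupoid.trans _ h3.2 hΨ

variable {V₁ V₂ : Set Y} {ℓ₁ ℓ₂ : ℕ}

/-- The linear algebra behind adapted charts. -/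
lemma linearIndependent_of_transverse {p₁ p₂ : Fin k → Prop} (A : Cn k →ₗ[ℂ] Cn k)
    (hA : Function.Surjective A)
    (h : ∀ w : Cn k, ∃ v₁ v₂ : Cn k, (∀ j, p₁ j → v₁ j = 0) ∧ (∀ j, p₂ j → A v₂ j = 0) ∧
      w = v₁ + v₂) :
    LinearIndependent ℂ (Sum.elim (fun j : {j // p₁ j} => (LinearMap.proj j.1 : Cn k →ₗ[ℂ] ℂ))
      fun j : {j // p₂ j} => (LinearMap.proj j.1 : Cn k →ₗ[ℂ] ℂ) ∘ₗ A) := by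
  classical
  rw [Fintype.linearIndependent_iff]
  intro g hg
  have h0 : ∀ w : Cn k, ∑ j : {j // p₁ j}, g (Sum.inl j) * w j.1 +
      ∑ j : {j // p₂ j}, g (Sum.inr j) * A w j.1 = 0 := fun w => by
    have := LinearMap.congr_fun hg w
    simpa [Fintype.sum_sum_type] using this
  have h1 : ∀ w : Cn k, ∑ j : {j // p₁ j}, g (Sum.inl j) * w j.1 = 0 := fun w => by
    obtain ⟨v₁, v₂, hv₁, hv₂, rfl⟩ := h w
    have e1 : ∑ j : {j // p₁ j}, g (Sum.inl j) * v₁ j.1 = 0 :=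
      Finset.sum_eq_zero fun j _ => by rw [hv₁ _ j.2, mul_zero]
    have e2 : ∑ j : {j // p₂ j}, g (Sum.inr j) * A v₂ j.1 = 0 :=
      Finset.sum_eq_zero fun j _ => by rw [hv₂ _ j.2, mul_zero]
    have e3 := h0 v₂
    rw [e2, add_zero] at e3
    simp only [Pi.add_apply, mul_add, Finset.sum_add_distrib, e1, e3, add_zero]
  have h2 : ∀ w : Cn k, ∑ j : {j // p₂ j}, g (Sum.inr j) * w j.1 = 0 := fun w => by
    obtain ⟨v, rfl⟩ := hA w
    simpa [h1 v] using h0 v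
  rintro (i | i)
  · simpa [Pi.single_apply, Subtype.val_inj] using h1 (Pi.single i.1 1)
  · simpa [Pi.single_apply, Subtype.val_inj] using h2 (Pi.single i.1 1)

/-- A holomorphic chart, onto a ball, in which both submanifolds are coordinate subspaces. -/
theorem exists_adapted_chart (hV₁ : IsComplexSubmanifold k V₁ ℓ₁)
    (hV₂ : IsComplexSubmanifold k V₂ ℓ₂) (htrans : Transverse k V₁ ℓ₁ V₂ ℓ₂) {x : Y}
    (hx : x ∈ V₁ ∩ V₂) :
    ∃ (e : OpenPartialHomeomorph Y (Cn k)) (s₁ s₂ : Finset (Fin k)) (r : ℝ),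
      e ∈ IsManifold.maximalAtlas 𝓘(ℂ, Cn k) ω Y ∧ x ∈ e.source ∧ e.target = Metric.ball 0 r ∧
      s₁.card = ℓ₁ ∧ s₂.card = ℓ₂ ∧ s₁ ∪ s₂ = Finset.univ ∧
      (∀ y ∈ e.source, y ∈ V₁ ↔ ∀ i, i ∉ s₁ → e y i = 0) ∧
      (∀ y ∈ e.source, y ∈ V₂ ↔ ∀ i, i ∉ s₂ → e y i = 0) := by
  classical
  obtain ⟨e₁, hx₁, he₁⟩ := hV₁.exists_chart x hx.1
  obtain ⟨e₂, hx₂, he₂⟩ := hV₂.exists_chart x hx.2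
  set θ := e₁.symm ≫ₕ e₂ with hθ
  have hθs : ∀ z, z ∈ θ.source ↔ z ∈ e₁.target ∧ e₁.symm z ∈ e₂.source := fun z => by
    rw [hθ, OpenPartialHomeomorph.trans_source]
    rfl
  have hθd : ContDiffOn ℂ ω θ θ.source := by
    have h := StructureGroupoid.compatible_of_mem_maximalAtlas he₁.mem_maximalAtlas
      he₂.mem_maximalAtlas
    rw [contDiffGroupoid, mem_groupoid_of_pregroupoid] at h
    rw [hθ]
    simpa [contDiffPregroupoid] using h.1
  have hz₀ : e₁ x ∈ θ.source := (hθs _).2 ⟨e₁.map_source hx₁, by rwa [e₁.left_inv hx₁]⟩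
  have hθx : θ (e₁ x) = e₂ x := congrArg e₂ (e₁.left_inv hx₁)
  set A : Cn k →L[ℂ] Cn k := fderiv ℂ θ (e₁ x) with hA
  have hAd : HasFDerivAt θ A (e₁ x) :=
    ((hθd.contDiffAt (θ.open_source.mem_nhds hz₀)).differentiableAt (by simp)).hasFDerivAt
  set c₁ := holChart e₁ he₁.mem_maximalAtlas with hc₁
  set c₂ := holChart e₂ he₂.mem_maximalAtlas with hc₂
  have hchain : ∀ v : Cn k, chartDeriv c₂ x v = A (chartDeriv c₁ x v) := by
    intro v
    have h1 : HasMFDerivAt 𝓘(ℝ, Cn k) 𝓘(ℝ, Cn k) c₁ x (chartDeriv c₁ x) :=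
      (c₁.mdifferentiableAt (by simp) hx₁).hasMFDerivAt
    have h2 : HasMFDerivAt 𝓘(ℝ, Cn k) 𝓘(ℝ, Cn k) θ (c₁ x) (A.restrictScalars ℝ) :=
      (hAd.restrictScalars ℝ).hasMFDerivAt
    have h3 := h2.comp x h1
    have h4 : c₂ =ᶠ[𝓝 x] θ ∘ c₁ := by
      filter_upwards [e₁.open_source.mem_nhds hx₁] with y hy
      exact congrArg e₂ (e₁.left_inv hy).symm
    exact DFunLike.congr_fun (h3.congr_of_eventuallyEq h4).mfderiv v
  have hsurj : ∀ (c : PartialDiffeomorph 𝓘(ℝ, Cn k) 𝓘(ℝ, Cn k) Y (Cn k) ∞), x ∈ c.source →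
      ∀ w : Cn k, ∃ v : Cn k, chartDeriv c x v = w := fun c hc w => by
    have h1 := c.comp_mfderiv_symm (c.map_source hc) w
    have h2 : c.symm (c x) = x := c.left_inv hc
    rw [h2] at h1
    exact ⟨_, h1⟩
  have hLI := linearIndependent_of_transverse (p₁ := fun j : Fin k => ℓ₁ ≤ j.val)
    (p₂ := fun j : Fin k => ℓ₂ ≤ j.val) A.toLinearMap (fun w => by
      obtain ⟨v, hv⟩ := hsurj c₂ hx₂ w
      exact ⟨chartDeriv c₁ x v, (hchain v).symm.trans hv⟩) (fun w => by
      obtain ⟨v, hv⟩ := hsurj c₁ hx₁ w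
      obtain ⟨v₁, v₂, h1, h2, h3⟩ := htrans x hx e₁ e₂ he₁ hx₁ he₂ hx₂ v
      refine ⟨chartDeriv c₁ x v₁, chartDeriv c₁ x v₂, h1, fun j hj => ?_, ?_⟩
      · exact (congrFun (hchain v₂) j).symm.trans (h2 j hj)
      · rw [← hv, h3]
        exact map_add (chartDeriv c₁ x) v₁ v₂)
  obtain ⟨b, σ, hσ, hbσ⟩ := hLI.exists_basis_extension (Pi.basisFun ℂ (Fin k)).dualBasis
  set φ : {j : Fin k // ℓ₁ ≤ j.val} ⊕ {j : Fin k // ℓ₂ ≤ j.val} → Cn k → ℂ :=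
    Sum.elim (fun j z => z j.1) (fun j z => θ z j.1) with hφ
  set g : Cn k → Cn k := fun z i =>
    if h : ∃ t, σ t = i then φ h.choose z else b i (z - e₁ x) with hg
  have hgσ : ∀ t z, g z (σ t) = φ t z := by
    intro t z
    have h : ∃ t', σ t' = σ t := ⟨t, rfl⟩
    rw [hg]
    dsimp only
    rw [dif_pos h, hσ h.choose_spec]
  have hgn : ∀ i, (¬ ∃ t, σ t = i) → ∀ z, g z i = b i (z - e₁ x) := fun i h z => dif_neg h
  have hcd : ContDiffOn ℂ ω g θ.source := by
    refine contDiffOn_pi.2 fun i => ?_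
    by_cases h : ∃ t, σ t = i
    · obtain ⟨t, rfl⟩ := h
      simp only [hgσ]
      rcases t with t | t
      · exact (contDiff_apply ℂ ℂ t.1).contDiffOn
      · exact (contDiff_apply ℂ ℂ t.1).comp_contDiffOn hθd
    · simp only [hgn i h]
      exact ((LinearMap.toContinuousLinearMap (b i)).contDiff.comp
        (contDiff_id.sub contDiff_const)).contDiffOn
  set G : Cn k →ₗ[ℂ] Cn k := LinearMap.pi fun i => b i with hG
  have hGinj : Function.Injective G := by
    rw [← LinearMap.ker_eq_bot, LinearMap.ker_eq_bot']
    intro v hv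
    have h1 : ∀ f : Module.Dual ℂ (Cn k), f v = 0 := fun f => by
      rw [← b.sum_repr f]
      simp only [LinearMap.sum_apply, LinearMap.smul_apply]
      exact Finset.sum_eq_zero fun i _ => by rw [show b i v = 0 from congrFun hv i, smul_zero]
    exact funext fun i => h1 (LinearMap.proj i)
  set G' : Cn k ≃L[ℂ] Cn k :=
    (LinearEquiv.ofInjectiveEndo G hGinj).toContinuousLinearEquiv with hG'
  have hgd : HasFDerivAt g (G' : Cn k →L[ℂ] Cn k) (e₁ x) := by
    rw [hasFDerivAt_pi']
    intro i
    by_cases h : ∃ t, σ t = i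
    · obtain ⟨t, rfl⟩ := h
      simp only [hgσ]
      have h2 : ∀ v, G' v (σ t) = b (σ t) v := fun v => rfl
      rcases t with t | t
      · refine ((ContinuousLinearMap.proj (R := ℂ) (φ := fun _ : Fin k => ℂ)
          t.1).hasFDerivAt).congr_fderiv ?_
        ext1 v
        refine Eq.trans ?_ (h2 v).symm
        rw [hbσ]
        rfl
      · refine ((ContinuousLinearMap.proj (R := ℂ) (φ := fun _ : Fin k => ℂ)
          t.1).hasFDerivAt.comp (e₁ x) hAd).congr_fderiv ?_
        ext1 v
        refine Eq.trans ?_ (h2 v).symm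
        rw [hbσ]
        rfl
    · simp only [hgn i h]
      exact ((LinearMap.toContinuousLinearMap (b i)).hasFDerivAt.comp (e₁ x)
        ((hasFDerivAt_id _).sub_const _)).congr_fderiv (by ext1 v; rfl)
  obtain ⟨Ψ, hΨg, hxΨ, hΨs, hΨi⟩ := hcd.exists_openPartialHomeomorph (by simp) θ.open_source hz₀ hgd
  have hg0 : g (e₁ x) = 0 := by
    funext i
    by_cases h : ∃ t, σ t = i
    · obtain ⟨t, rfl⟩ := h
      rw [hgσ]
      rcases t with t | t
      · exact (he₁.mem_iff x hx₁).1 hx.1 t.1 t.2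
      · change θ (e₁ x) t.1 = 0
        rw [hθx]
        exact (he₂.mem_iff x hx₂).1 hx.2 t.1 t.2
    · rw [hgn i h, sub_self, map_zero]
      rfl
  obtain ⟨r, hr, hball⟩ := Metric.isOpen_iff.1 Ψ.open_target 0
    (by rw [← hg0, ← hΨg]; exact Ψ.map_source hxΨ)
  set Ψ' := (Ψ.symm.restrOpen (Metric.ball 0 r) Metric.isOpen_ball).symm with hΨ'
  have hΨ's : ∀ z, z ∈ Ψ'.source → z ∈ Ψ.source := fun z hz => by
    have := Ψ'.map_source hz
    have h2 := Ψ.map_target this.1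
    rwa [show Ψ.symm (Ψ' z) = z from Ψ'.left_inv hz] at h2
  have hΨ't : Ψ'.target = Metric.ball 0 r := by
    change Ψ.target ∩ Metric.ball 0 r = _
    exact inter_eq_right.2 hball
  have hΨ'g : ∀ z, Ψ' z = g z := fun z => by
    rw [← hΨg]
    rfl
  have hΨ'x : e₁ x ∈ Ψ'.source := by
    have h1 : (0 : Cn k) ∈ Ψ'.target := by
      rw [hΨ't]
      exact Metric.mem_ball_self hr
    have h2 := Ψ'.map_target h1
    rw [← hg0, ← hΨg] at h2
    rwa [show Ψ'.symm (Ψ (e₁ x)) = e₁ x from Ψ.left_inv hxΨ] at h2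
  have hsrc : ∀ y, y ∈ (e₁ ≫ₕ Ψ').source → y ∈ e₁.source ∧ e₁ y ∈ Ψ'.source ∧ y ∈ e₂.source := by
    intro y hy
    rw [OpenPartialHomeomorph.trans_source] at hy
    refine ⟨hy.1, hy.2, ?_⟩
    have := ((hθs _).1 (hΨs (hΨ's _ hy.2))).2
    rwa [e₁.left_inv hy.1] at this
  have hval : ∀ y, (e₁ ≫ₕ Ψ') y = g (e₁ y) := fun y => hΨ'g _
  refine ⟨e₁ ≫ₕ Ψ', Finset.univ.filter fun i => ∀ j, σ (Sum.inl j) ≠ i,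
    Finset.univ.filter fun i => ∀ j, σ (Sum.inr j) ≠ i, r, ?_, ?_, ?_, ?_, ?_, ?_, ?_, ?_⟩
  · refine trans_mem_maximalAtlas he₁.mem_maximalAtlas ?_ ?_
    · refine (hcd.mono fun z hz => hΨs (hΨ's z hz)).congr fun z _ => hΨ'g z
    · refine hΨi.mono ?_
      rw [hΨ't]
      exact hball
  · rw [OpenPartialHomeomorph.trans_source]
    exact ⟨hx₁, hΨ'x⟩
  · rw [OpenPartialHomeomorph.trans_target, hΨ't]
    refine inter_eq_left.2 fun z hz => ?_
    rw [← hΨ't] at hz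
    exact ((hθs _).1 (hΨs (hΨ's _ (Ψ'.map_target hz)))).1
  · exact card_eq_of_mem_iff_forall_ne hV₁.dim_le (hσ.comp Sum.inl_injective) fun i => by simp
  · exact card_eq_of_mem_iff_forall_ne hV₂.dim_le (hσ.comp Sum.inr_injective) fun i => by simp
  · ext i
    simp only [Finset.mem_union, Finset.mem_filter, Finset.mem_univ, true_and, iff_true]
    by_contra! hcon
    obtain ⟨⟨j, hj⟩, j', hj'⟩ := hcon
    exact absurd (hσ (hj.trans hj'.symm)) (by simp)
  · intro y hy
    obtain ⟨h1, -, -⟩ := hsrc y hy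
    rw [he₁.mem_iff y h1, hval]
    constructor
    · intro h i hi
      simp only [Finset.mem_filter, Finset.mem_univ, true_and, not_forall, not_not] at hi
      obtain ⟨j, rfl⟩ := hi
      rw [hgσ]
      exact h j.1 j.2
    · intro h j hj
      have h2 := h (σ (Sum.inl ⟨j, hj⟩)) fun hm => (Finset.mem_filter.1 hm).2 ⟨j, hj⟩ rfl
      rwa [hgσ] at h2
  · intro y hy
    obtain ⟨h1, -, h3⟩ := hsrc y hy
    have hθy : θ (e₁ y) = e₂ y := congrArg e₂ (e₁.left_inv h1)
    rw [he₂.mem_iff y h3, hval, ← hθy]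
    constructor
    · intro h i hi
      simp only [Finset.mem_filter, Finset.mem_univ, true_and, not_forall, not_not] at hi
      obtain ⟨j, rfl⟩ := hi
      rw [hgσ]
      exact h j.1 j.2
    · intro h j hj
      have h2 := h (σ (Sum.inr ⟨j, hj⟩)) fun hm => (Finset.mem_filter.1 hm).2 ⟨j, hj⟩ rfl
      rwa [hgσ] at h2

end AdaptedCharts

/-! ## The linear models of a pair and of a triple of currents -/

section CoordinateModels

variable {k ℓ ℓ₁ ℓ₂ : ℕ}

/-- The inclusion of the coordinate subspace indexed by `s`. -/
def coordIncl (s : Finset (Fin k)) (h : s.card = ℓ) : Cn ℓ →L[ℂ] Cn k :=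
  ContinuousLinearMap.pi fun i => if hi : i ∈ s then
    ContinuousLinearMap.proj ((s.orderIsoOfFin h).symm ⟨i, hi⟩) else 0

/-- The projection to the coordinates indexed by `s`. -/
def coordProj (s : Finset (Fin k)) (h : s.card = ℓ) : Cn k →L[ℂ] Cn ℓ :=
  ContinuousLinearMap.pi fun j => ContinuousLinearMap.proj (s.orderIsoOfFin h j).1

/-- The projection to the complementary coordinate subspace. -/
def coordKill (s : Finset (Fin k)) : Cn k →L[ℂ] Cn k :=
  ContinuousLinearMap.pi fun i => if i ∈ s then 0 else ContinuousLinearMap.proj i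

variable {s : Finset (Fin k)} {h : s.card = ℓ}

lemma coordIncl_apply_of_notMem {i : Fin k} (hi : i ∉ s) (u : Cn ℓ) : coordIncl s h u i = 0 := by
  simp [coordIncl, hi]

lemma coordKill_apply (z : Cn k) (i : Fin k) : coordKill s z i = if i ∈ s then 0 else z i := by
  simp only [coordKill, ContinuousLinearMap.coe_pi']
  split_ifs <;> rfl

lemma coordProj_coordIncl (u : Cn ℓ) : coordProj s h (coordIncl s h u) = u := by
  funext j
  change coordIncl s h u (s.orderIsoOfFin h j).1 = u j
  simp only [coordIncl, ContinuousLinearMap.coe_pi']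
  rw [dif_pos (s.orderIsoOfFin h j).2]
  exact congrArg u ((s.orderIsoOfFin h).symm_apply_apply j)

lemma coordIncl_coordProj {z : Cn k} : coordIncl s h (coordProj s h z) = z ↔ ∀ i, i ∉ s → z i = 0 := by
  refine ⟨fun hz i hi => by rw [← hz, coordIncl_apply_of_notMem hi], fun hz => funext fun i => ?_⟩
  by_cases hi : i ∈ s
  · simp only [coordIncl, ContinuousLinearMap.coe_pi']
    rw [dif_pos hi]
    exact congrArg (fun t => z t.1) ((s.orderIsoOfFin h).apply_symm_apply ⟨i, hi⟩)
  · rw [coordIncl_apply_of_notMem hi, hz i hi]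

lemma norm_sub_coordKill_le (z : Cn k) : ‖z - coordKill s z‖ ≤ ‖z‖ := by
  refine (pi_norm_le_iff_of_nonneg (norm_nonneg z)).2 fun i => ?_
  rw [Pi.sub_apply, coordKill_apply]
  split_ifs
  · rw [sub_zero]
    exact norm_le_pi_norm z i
  · rw [sub_self, norm_zero]
    exact norm_nonneg z

/-- The linear model of the tangent currents to `T ⊗ [V]`. -/
def pairModel (s : Finset (Fin k)) (h : s.card = ℓ) : TransverseModel (Cn k) (Cn k) (Cn ℓ) where
  pr := (coordKill s).restrictScalars ℝ
  δ := ContinuousLinearMap.id ℝ _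
  m := (coordIncl s h).restrictScalars ℝ
  md := (coordProj s h).restrictScalars ℝ
  β := -(coordKill s).restrictScalars ℝ
  pr_smul c b := (coordKill s).map_smul c b
  δ_smul _ _ := rfl
  m_smul c u := (coordIncl s h).map_smul c u
  pr_pr b := by
    funext i
    simp only [ContinuousLinearMap.coe_restrictScalars', coordKill_apply]
    split_ifs <;> rfl
  md_m := coordProj_coordIncl
  β_m u b := by
    funext i
    simp only [neg_apply, ContinuousLinearMap.coe_restrictScalars',
      ContinuousLinearMap.id_apply, Pi.neg_apply, coordKill_apply, Pi.sub_apply]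
    split_ifs with hi
    · exact neg_zero
    · rw [coordIncl_apply_of_notMem hi, zero_sub, neg_neg]
  m_md w := coordIncl_coordProj.2 fun i hi => by
    simp [coordKill_apply, hi]
  m_md_δ b := coordIncl_coordProj.2 fun i hi => by
    simp [coordKill_apply, hi]
  pr_β w := by
    funext i
    simp only [neg_apply, ContinuousLinearMap.coe_restrictScalars',
      Pi.neg_apply, coordKill_apply]
    split_ifs
    · exact neg_zero.symm
    · rfl

variable {s₁ s₂ : Finset (Fin k)}

/-- The map `β` of `tripleModel`. -/
def tripleBeta (s₁ s₂ : Finset (Fin k)) : Cn k × Cn k →L[ℝ] Cn k :=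
  ContinuousLinearMap.pi fun i =>
    if i ∈ s₁ then if i ∈ s₂ then 0 else
      -(ContinuousLinearMap.proj i).comp (ContinuousLinearMap.snd ℝ (Cn k) (Cn k))
    else -(ContinuousLinearMap.proj i).comp (ContinuousLinearMap.fst ℝ (Cn k) (Cn k))

lemma tripleBeta_apply (w : Cn k × Cn k) (i : Fin k) : tripleBeta s₁ s₂ w i =
    if i ∈ s₁ then if i ∈ s₂ then 0 else -w.2 i else -w.1 i := by
  simp only [tripleBeta, ContinuousLinearMap.coe_pi']
  split_ifs <;> rfl

/-- The linear model of the tangent currents to `T ⊗ [V₁] ⊗ [V₂]`. -/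
def tripleModel (s₁ s₂ : Finset (Fin k)) (h₁ : s₁.card = ℓ₁) (h₂ : s₂.card = ℓ₂)
    (hs : s₁ ∪ s₂ = Finset.univ) :
    TransverseModel (Cn k) (Cn k × Cn k) (Cn ℓ₁ × Cn ℓ₂) where
  pr := (coordKill (s₁ ∩ s₂)).restrictScalars ℝ
  δ := (ContinuousLinearMap.id ℝ _).prod (ContinuousLinearMap.id ℝ _)
  m := ((coordIncl s₁ h₁).prodMap (coordIncl s₂ h₂)).restrictScalars ℝ
  md := ((coordProj s₁ h₁).prodMap (coordProj s₂ h₂)).restrictScalars ℝ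
  β := tripleBeta s₁ s₂
  pr_smul c b := (coordKill _).map_smul c b
  δ_smul _ _ := rfl
  m_smul c u := ((coordIncl s₁ h₁).prodMap (coordIncl s₂ h₂)).map_smul c u
  pr_pr b := by
    funext i
    simp only [ContinuousLinearMap.coe_restrictScalars', coordKill_apply]
    split_ifs <;> rfl
  md_m u := Prod.ext (coordProj_coordIncl u.1) (coordProj_coordIncl u.2)
  β_m u b := by
    funext i
    simp only [ContinuousLinearMap.coe_restrictScalars', tripleBeta_apply, coordKill_apply,
      ContinuousLinearMap.coe_prodMap', Prod.map_apply', Prod.fst_sub, Prod.snd_sub, Pi.sub_apply,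
      ContinuousLinearMap.prod_apply, ContinuousLinearMap.id_apply, Finset.mem_inter]
    by_cases h1 : i ∈ s₁ <;> by_cases h2 : i ∈ s₂ <;>
      simp [h1, h2, coordIncl_apply_of_notMem]
  m_md w := Prod.ext
    ((coordIncl_coordProj (z := w.1 + tripleBeta s₁ s₂ w)).2 fun i hi => by
      simp [tripleBeta_apply, hi])
    ((coordIncl_coordProj (z := w.2 + tripleBeta s₁ s₂ w)).2 fun i hi => by
      have h1 : i ∈ s₁ := by
        have := Finset.mem_univ i
        rw [← hs, Finset.mem_union] at this
        exact this.resolve_right hi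
      simp [tripleBeta_apply, hi, h1])
  m_md_δ b := Prod.ext
    ((coordIncl_coordProj (z := b - coordKill (s₁ ∩ s₂) b)).2 fun i hi => by
      simp [coordKill_apply, hi])
    ((coordIncl_coordProj (z := b - coordKill (s₁ ∩ s₂) b)).2 fun i hi => by
      simp [coordKill_apply, hi])
  pr_β w := by
    funext i
    simp only [ContinuousLinearMap.coe_restrictScalars', coordKill_apply, tripleBeta_apply,
      Finset.mem_inter]
    by_cases h1 : i ∈ s₁ <;> by_cases h2 : i ∈ s₂ <;> simp [h1, h2]

lemma card_inter_of_union_eq_univ (h₁ : s₁.card = ℓ₁) (h₂ : s₂.card = ℓ₂)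
    (hs : s₁ ∪ s₂ = Finset.univ) : (s₁ ∩ s₂).card = ℓ₁ + ℓ₂ - k := by
  have := Finset.card_union_add_card_inter s₁ s₂
  rw [hs, Finset.card_univ, Fintype.card_fin, h₁, h₂] at this
  omega

variable {Y : Type*} [TopologicalSpace Y] [ChartedSpace (Cn k) Y]
  [IsManifold 𝓘(ℂ, Cn k) ω Y] {V V₁ V₂ : Set Y}

/-- A chart in which `V` is a coordinate subspace gives a slice chart. -/
lemma exists_isSliceChart {e : OpenPartialHomeomorph Y (Cn k)}
    (he : e ∈ IsManifold.maximalAtlas 𝓘(ℂ, Cn k) ω Y) (h : s.card = ℓ)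
    (hV : ∀ y ∈ e.source, y ∈ V ↔ ∀ i, i ∉ s → e y i = 0) :
    ∃ e' : OpenPartialHomeomorph Y (Cn k), e'.source = e.source ∧ IsSliceChart V ℓ e' := by
  have hℓ : ℓ ≤ k := by
    rw [← h]
    simpa using s.card_le_univ
  have hcard : Fintype.card {i // i ∈ s} = Fintype.card {i : Fin k // i.val < ℓ} := by
    rw [Fintype.card_coe, h, Fintype.card_subtype, Fin.card_filter_val_lt]
    omega
  set p : Equiv.Perm (Fin k) := (Fintype.equivOfCardEq hcard).extendSubtype with hp
  have hps : ∀ i, i ∈ s ↔ (p i).val < ℓ := fun i =>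
    ⟨fun hi => (Fintype.equivOfCardEq hcard).extendSubtype_mem i hi, fun hi => by
      by_contra hn
      exact (Fintype.equivOfCardEq hcard).extendSubtype_not_mem i hn hi⟩
  set A : Cn k ≃L[ℂ] Cn k := ContinuousLinearEquiv.piCongrLeft ℂ (fun _ => ℂ) p with hA
  have hAi : ∀ z i, A z (p i) = z i := fun z i =>
    Equiv.piCongrLeft_apply_apply (fun _ => ℂ) p z i
  refine ⟨e ≫ₕ A.toHomeomorph.toOpenPartialHomeomorph, ?_, ?_, ?_⟩
  · rw [OpenPartialHomeomorph.trans_source]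
    exact inter_univ _
  · exact trans_mem_maximalAtlas he A.contDiff.contDiffOn A.symm.contDiff.contDiffOn
  · intro y hy
    rw [OpenPartialHomeomorph.trans_source] at hy
    rw [hV y hy.1]
    constructor
    · intro hz j hj
      have h1 := hAi (e y) (p.symm j)
      rw [p.apply_symm_apply] at h1
      refine h1.trans (hz _ fun hs => ?_)
      have := (hps _).1 hs
      rw [p.apply_symm_apply] at this
      omega
    · intro hz i hi
      rw [← hAi (e y) i]
      exact hz _ (not_lt.1 fun hlt => hi ((hps i).2 hlt))

theorem isComplexSubmanifold_inter (hV₁ : IsComplexSubmanifold k V₁ ℓ₁)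
    (hV₂ : IsComplexSubmanifold k V₂ ℓ₂) (htrans : Transverse k V₁ ℓ₁ V₂ ℓ₂) :
    IsComplexSubmanifold k (V₁ ∩ V₂) (ℓ₁ + ℓ₂ - k) where
  isClosed := hV₁.isClosed.inter hV₂.isClosed
  dim_le := by
    have h1 := hV₁.dim_le
    have h2 := hV₂.dim_le
    omega
  exists_chart x hx := by
    obtain ⟨e, s₁, s₂, r, he, hxe, -, h₁, h₂, hs, hm₁, hm₂⟩ :=
      exists_adapted_chart hV₁ hV₂ htrans hx
    obtain ⟨e', h1, h2⟩ := exists_isSliceChart (V := V₁ ∩ V₂) he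
      (card_inter_of_union_eq_univ h₁ h₂ hs) fun y hy => by
        rw [mem_inter_iff, hm₁ y hy, hm₂ y hy]
        simp only [Finset.mem_inter]
        constructor
        · rintro ⟨h1, h2⟩ i hi
          by_cases hi1 : i ∈ s₁
          · exact h2 i fun hi2 => hi ⟨hi1, hi2⟩
          · exact h1 i hi1
        · exact fun h => ⟨fun i hi => h i fun h' => hi h'.1, fun i hi => h i fun h' => hi h'.2⟩
    exact ⟨e', h1 ▸ hxe, h2⟩

end CoordinateModels

/-! ## Comparison of the density currents of the pair and of the triple -/

section Comparison

lemma TransverseModel.dilForm_congr {B F P F' P' : Type}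
    [NormedAddCommGroup B] [NormedSpace ℝ B] [NormedSpace ℂ B] [IsScalarTower ℝ ℂ B]
    [FiniteDimensional ℝ B]
    [NormedAddCommGroup F] [NormedSpace ℝ F] [NormedSpace ℂ F]
    [NormedAddCommGroup P] [NormedSpace ℝ P] [NormedSpace ℂ P]
    [NormedAddCommGroup F'] [NormedSpace ℝ F'] [NormedSpace ℂ F']
    [NormedAddCommGroup P'] [NormedSpace ℝ P'] [NormedSpace ℂ P']
    {M : TransverseModel B F P} {M' : TransverseModel B F' P'} (h : M.pr = M'.pr) {a : ℕ} (c : ℂ)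
    (ψ : B → B [⋀^Fin a]→L[ℝ] ℂ) : M.dilForm c ψ = M'.dilForm c ψ := by
  have h1 : M.dil c = M'.dil c := by rw [dil, dil, h]
  funext x
  rw [dilForm, dilForm, h1]

variable {k ℓ₁ ℓ₂ : ℕ} {Y : Type*} [TopologicalSpace Y] [ChartedSpace (Cn k) Y]
  [IsManifold 𝓘(ℂ, Cn k) ω Y] [T2Space Y] [CompactSpace Y] {V₁ V₂ : Set Y}

instance isAddHaarMeasure_prod_Cn : (volume : Measure (Cn ℓ₁ × Cn ℓ₂)).IsAddHaarMeasure :=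
  Measure.prod.instIsAddHaarMeasure (volume : Measure (Cn ℓ₁)) (volume : Measure (Cn ℓ₂))

instance t2Space_tangentBundle :
    T2Space (TotalSpace (Cn k) (TangentSpace 𝓘(ℝ, Cn k) : Y → Type)) :=
  FiberBundle.t2Space_totalSpace

instance t2Space_tangentBundle₂ :
    T2Space (TotalSpace (Cn k × Cn k) ((TangentSpace 𝓘(ℝ, Cn k) : Y → Type) ×ᵇ
      (TangentSpace 𝓘(ℝ, Cn k) : Y → Type))) := FiberBundle.t2Space_totalSpace

/-- The identification of the normal bundle of the diagonal of `Y²` with `TY`. -/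
abbrev normalQuot₂ (y : Y) (w : Cn k × Cn k) : TangentSpace 𝓘(ℝ, Cn k) y :=
  (w.2 - w.1 : TangentSpace 𝓘(ℝ, Cn k) y)

/-- The identification of the normal bundle of the diagonal of `Y³` with `TY ⊕ TY`. -/
abbrev normalQuot₃ (y : Y) (w : Cn k × (Cn k × Cn k)) :
    TangentSpace 𝓘(ℝ, Cn k) y × TangentSpace 𝓘(ℝ, Cn k) y :=
  ((w.2.1 - w.1, w.2.2 - w.1) : TangentSpace 𝓘(ℝ, Cn k) y × TangentSpace 𝓘(ℝ, Cn k) y)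

theorem exists_localModels (hV₁ : IsComplexSubmanifold k V₁ ℓ₁)
    (hV₂ : IsComplexSubmanifold k V₂ ℓ₂) (htrans : Transverse k V₁ ℓ₁ V₂ ℓ₂)
    (hV : IsComplexSubmanifold k (V₁ ∩ V₂) (ℓ₁ + ℓ₂ - k)) {x : Y} (hx : x ∈ V₁ ∩ V₂) :
    ∃ (M₂ : TransverseModel (Cn k) (Cn k) (Cn (ℓ₁ + ℓ₂ - k)))
      (M₃ : TransverseModel (Cn k) (Cn k × Cn k) (Cn ℓ₁ × Cn ℓ₂))
      (e : PartialDiffeomorph 𝓘(ℝ, Cn k) 𝓘(ℝ, Cn k) Y (Cn k) ∞)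
      (eN : PartialDiffeomorph (𝓘(ℝ, Cn k).prod 𝓘(ℝ, Cn k)) 𝓘(ℝ, Cn k × Cn k) (Y × Y)
        (Cn k × Cn k) ∞)
      (Θ₂ : PartialDiffeomorph (𝓘(ℝ, Cn k).prod 𝓘(ℝ, Cn k)) 𝓘(ℝ, Cn k × Cn k)
        (TotalSpace (Cn k) (TangentSpace 𝓘(ℝ, Cn k) : Y → Type)) (Cn k × Cn k) ∞)
      (Θ₃ : PartialDiffeomorph (𝓘(ℝ, Cn k).prod 𝓘(ℝ, Cn k × Cn k)) 𝓘(ℝ, Cn k × (Cn k × Cn k))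
        (TotalSpace (Cn k × Cn k) ((TangentSpace 𝓘(ℝ, Cn k) : Y → Type) ×ᵇ
          (TangentSpace 𝓘(ℝ, Cn k) : Y → Type))) (Cn k × (Cn k × Cn k)) ∞),
      x ∈ e.source ∧ M₂.pr = M₃.pr ∧
      LocalModel (Z := (TangentSpace 𝓘(ℝ, Cn k) : Y → Type)) (fun y => y) normalQuot₂
        (integrationCurrent hV) M₂ (realFrameBasis _) volume e e Θ₂ ∧
      LocalModel (N := Y × Y) (J := 𝓘(ℝ, Cn k).prod 𝓘(ℝ, Cn k))
        (Z := (TangentSpace 𝓘(ℝ, Cn k) : Y → Type) ×ᵇ (TangentSpace 𝓘(ℝ, Cn k) : Y → Type))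
        (fun y => (y, y)) normalQuot₃ (tensor (integrationCurrent hV₁) (integrationCurrent hV₂))
        M₃ (realFrameBasisProd ℓ₁ ℓ₂) volume e eN Θ₃ := by
  obtain ⟨e, s₁, s₂, r, he, hxe, hball, h₁, h₂, hs, hm₁, hm₂⟩ :=
    exists_adapted_chart hV₁ hV₂ htrans hx
  have h₀ := card_inter_of_union_eq_univ h₁ h₂ hs
  have hpr : ∀ z ∈ e.target, z - coordKill (s₁ ∩ s₂) z ∈ e.target := fun z hz => by
    rw [hball, mem_ball_zero_iff] at hz ⊢
    exact (norm_sub_coordKill_le z).trans_lt hz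
  have hm₁' : ∀ y ∈ e.source, y ∈ V₁ ↔ coordIncl s₁ h₁ (coordProj s₁ h₁ (e y)) = e y :=
    fun y hy => (hm₁ y hy).trans coordIncl_coordProj.symm
  have hm₂' : ∀ y ∈ e.source, y ∈ V₂ ↔ coordIncl s₂ h₂ (coordProj s₂ h₂ (e y)) = e y :=
    fun y hy => (hm₂ y hy).trans coordIncl_coordProj.symm
  have hm₀ : ∀ y ∈ e.source, y ∈ V₁ ∩ V₂ ↔
      coordIncl (s₁ ∩ s₂) h₀ (coordProj (s₁ ∩ s₂) h₀ (e y)) = e y := fun y hy => by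
    rw [coordIncl_coordProj, mem_inter_iff, hm₁ y hy, hm₂ y hy]
    simp only [Finset.mem_inter]
    constructor
    · rintro ⟨h1, h2⟩ i hi
      by_cases hi1 : i ∈ s₁
      · exact h2 i fun hi2 => hi ⟨hi1, hi2⟩
      · exact h1 i hi1
    · exact fun h => ⟨fun i hi => h i fun h' => hi h'.1, fun i hi => h i fun h' => hi h'.2⟩
  refine ⟨pairModel (s₁ ∩ s₂) h₀, tripleModel s₁ s₂ h₁ h₂ hs, holChart e he,
    prodChart (holChart e he) (holChart e he) 0, tangentChart (holChart e he),
    tangentChart₂ (holChart e he), hxe, rfl, ?_, ?_⟩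
  · refine localModel_tangentChart (fun _ => rfl) hpr fun K f hK hKe hf => ?_
    simp only [realFrameBasis_apply]
    exact integrationCurrent_chartPull hV coordProj_coordIncl hm₀ hK hKe hf
  · refine localModel_tangentChart₂ (fun _ => rfl) hpr fun K f hK hKe hf => ?_
    exact tensor_integrationCurrent_chartPull hV₁ hV₂ coordProj_coordIncl coordProj_coordIncl
      hm₁' hm₂' hK hKe hf

variable {q : ℕ} {T : Current 𝓘(ℝ, Cn k) Y q} {c : ℕ → ℂ} {ξ : ℂ}
  {τ₂ : PartialDiffeomorph (𝓘(ℝ, Cn k).prod 𝓘(ℝ, Cn k)) (𝓘(ℝ, Cn k).prod 𝓘(ℝ, Cn k)) (Y × Y)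
    (TotalSpace (Cn k) (TangentSpace 𝓘(ℝ, Cn k) : Y → Type)) ∞}
  {τ₃ : PartialDiffeomorph (𝓘(ℝ, Cn k).prod (𝓘(ℝ, Cn k).prod 𝓘(ℝ, Cn k)))
    (𝓘(ℝ, Cn k).prod 𝓘(ℝ, Cn k × Cn k)) (Y × (Y × Y))
    (TotalSpace (Cn k × Cn k) ((TangentSpace 𝓘(ℝ, Cn k) : Y → Type) ×ᵇ
      (TangentSpace 𝓘(ℝ, Cn k) : Y → Type))) ∞}

theorem exists_tendsto_pair (hV₁ : IsComplexSubmanifold k V₁ ℓ₁)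
    (hV₂ : IsComplexSubmanifold k V₂ ℓ₂) (htrans : Transverse k V₁ ℓ₁ V₂ ℓ₂)
    (hV : IsComplexSubmanifold k (V₁ ∩ V₂) (ℓ₁ + ℓ₂ - k))
    (hτ₂ : IsAdmissible (Cn k) (Z := (TangentSpace 𝓘(ℝ, Cn k) : Y → Type)) (fun y => (y, y))
      normalQuot₂ τ₂)
    (hτ₃ : IsAdmissible (Cn k × Cn k) (Z := (TangentSpace 𝓘(ℝ, Cn k) : Y → Type) ×ᵇ
      (TangentSpace 𝓘(ℝ, Cn k) : Y → Type)) (fun y => (y, (y, y))) normalQuot₃ τ₃)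
    (hc : Tendsto (fun i => ‖c i‖) atTop atTop)
    (hξ : Tendsto (fun i => c i / ‖c i‖) atTop (𝓝 ξ)) (hξ0 : ξ ≠ 0)
    (R₃ : Current (𝓘(ℝ, Cn k).prod 𝓘(ℝ, Cn k × Cn k))
      (TotalSpace (Cn k × Cn k) ((TangentSpace 𝓘(ℝ, Cn k) : Y → Type) ×ᵇ
        (TangentSpace 𝓘(ℝ, Cn k) : Y → Type))) (q + (2 * ℓ₁ + 2 * ℓ₂)))
    (hR₃ : ∀ Φ ∈ testForms (𝓘(ℝ, Cn k).prod 𝓘(ℝ, Cn k × Cn k))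
      (TotalSpace (Cn k × Cn k) ((TangentSpace 𝓘(ℝ, Cn k) : Y → Type) ×ᵇ
        (TangentSpace 𝓘(ℝ, Cn k) : Y → Type))) (q + (2 * ℓ₁ + 2 * ℓ₂)),
      Tendsto (fun i => tensor T.eval (tensor (integrationCurrent hV₁) (integrationCurrent hV₂))
        (dilatedPullback (Cn k × Cn k) τ₃ (c i) Φ)) atTop (𝓝 (R₃.eval Φ))) :
    ∃ R₂ : Current (𝓘(ℝ, Cn k).prod 𝓘(ℝ, Cn k))
      (TotalSpace (Cn k) (TangentSpace 𝓘(ℝ, Cn k) : Y → Type)) (q + 2 * (ℓ₁ + ℓ₂ - k)),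
      (∀ Φ ∈ testForms (𝓘(ℝ, Cn k).prod 𝓘(ℝ, Cn k))
        (TotalSpace (Cn k) (TangentSpace 𝓘(ℝ, Cn k) : Y → Type)) (q + 2 * (ℓ₁ + ℓ₂ - k)),
        Tendsto (fun i => tensor T.eval (integrationCurrent hV)
          (dilatedPullback (Cn k) τ₂ (c i) Φ)) atTop (𝓝 (R₂.eval Φ))) ∧ (R₃ = 0 → R₂ = 0) := by
  refine exists_tendsto_of_localModels (bs := realFrameBasis (ℓ₁ + ℓ₂ - k)) (μ := volume)
    continuous_dilation_tangentBundle T hτ₂ hc hξ hξ0 hV.isClosed hV.isClosed (fun _ h => h)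
    (fun φ hφ => integrationCurrent_eq_zero hV hφ) fun x hx => ?_
  obtain ⟨M₂, M₃, e, eN, Θ₂, Θ₃, hxe, hpr, hM₂, hM₃⟩ :=
    exists_localModels hV₁ hV₂ htrans hV hx
  obtain ⟨L, hL, hlim, hL0⟩ := hM₃.exists_limit T R₃ hτ₃ hc hξ hξ0 hR₃
  refine ⟨M₂, e, e, Θ₂, L, hxe, hM₂, ?_, ?_, ?_⟩
  · rwa [hpr]
  · intro C hC hCe ψ hψ
    rw [hpr] at hCe
    simp only [TransverseModel.dilForm_congr hpr]
    exact hlim C hC hCe ψ hψ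
  · rwa [hpr]

theorem exists_tendsto_triple (hV₁ : IsComplexSubmanifold k V₁ ℓ₁)
    (hV₂ : IsComplexSubmanifold k V₂ ℓ₂) (htrans : Transverse k V₁ ℓ₁ V₂ ℓ₂)
    (hV : IsComplexSubmanifold k (V₁ ∩ V₂) (ℓ₁ + ℓ₂ - k))
    (hτ₂ : IsAdmissible (Cn k) (Z := (TangentSpace 𝓘(ℝ, Cn k) : Y → Type)) (fun y => (y, y))
      normalQuot₂ τ₂)
    (hτ₃ : IsAdmissible (Cn k × Cn k) (Z := (TangentSpace 𝓘(ℝ, Cn k) : Y → Type) ×ᵇ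
      (TangentSpace 𝓘(ℝ, Cn k) : Y → Type)) (fun y => (y, (y, y))) normalQuot₃ τ₃)
    (hc : Tendsto (fun i => ‖c i‖) atTop atTop)
    (hξ : Tendsto (fun i => c i / ‖c i‖) atTop (𝓝 ξ)) (hξ0 : ξ ≠ 0)
    (R₂ : Current (𝓘(ℝ, Cn k).prod 𝓘(ℝ, Cn k))
      (TotalSpace (Cn k) (TangentSpace 𝓘(ℝ, Cn k) : Y → Type)) (q + 2 * (ℓ₁ + ℓ₂ - k)))
    (hR₂ : ∀ Φ ∈ testForms (𝓘(ℝ, Cn k).prod 𝓘(ℝ, Cn k))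
      (TotalSpace (Cn k) (TangentSpace 𝓘(ℝ, Cn k) : Y → Type)) (q + 2 * (ℓ₁ + ℓ₂ - k)),
      Tendsto (fun i => tensor T.eval (integrationCurrent hV)
        (dilatedPullback (Cn k) τ₂ (c i) Φ)) atTop (𝓝 (R₂.eval Φ))) :
    ∃ R₃ : Current (𝓘(ℝ, Cn k).prod 𝓘(ℝ, Cn k × Cn k))
      (TotalSpace (Cn k × Cn k) ((TangentSpace 𝓘(ℝ, Cn k) : Y → Type) ×ᵇ
        (TangentSpace 𝓘(ℝ, Cn k) : Y → Type))) (q + (2 * ℓ₁ + 2 * ℓ₂)),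
      ∀ Φ ∈ testForms (𝓘(ℝ, Cn k).prod 𝓘(ℝ, Cn k × Cn k))
        (TotalSpace (Cn k × Cn k) ((TangentSpace 𝓘(ℝ, Cn k) : Y → Type) ×ᵇ
          (TangentSpace 𝓘(ℝ, Cn k) : Y → Type))) (q + (2 * ℓ₁ + 2 * ℓ₂)),
        Tendsto (fun i => tensor T.eval (tensor (integrationCurrent hV₁) (integrationCurrent hV₂))
          (dilatedPullback (Cn k × Cn k) τ₃ (c i) Φ)) atTop (𝓝 (R₃.eval Φ)) := by
  have h := exists_tendsto_of_localModels (bs := realFrameBasisProd ℓ₁ ℓ₂) (μ := volume)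
    (S := tensor (integrationCurrent hV₁) (integrationCurrent hV₂)) (vanish := False)
    (V := V₁ ∩ V₂) (W := V₁ ×ˢ V₂)
    continuous_dilation_tangentBundle₂ T hτ₃ hc hξ hξ0 hV.isClosed
    (hV₁.isClosed.prod hV₂.isClosed) (fun _ h => h)
    (fun φ hφ => tensor_integrationCurrent_eq_zero hV₁ hV₂ hφ) fun x hx => ?_
  · obtain ⟨R, hR, -⟩ := h
    exact ⟨R, hR⟩
  obtain ⟨M₂, M₃, e, eN, Θ₂, Θ₃, hxe, hpr, hM₂, hM₃⟩ :=
    exists_localModels hV₁ hV₂ htrans hV hx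
  obtain ⟨L, hL, hlim, hL0⟩ := hM₂.exists_limit T R₂ hτ₂ hc hξ hξ0 hR₂
  refine ⟨M₃, e, eN, Θ₃, L, hxe, hM₃, ?_, ?_, False.elim⟩
  · rwa [← hpr]
  · intro C hC hCe ψ hψ
    rw [← hpr] at hCe
    simp only [← TransverseModel.dilForm_congr hpr]
    exact hlim C hC hCe ψ hψ

end Comparison

/-! ## Admissible maps for pairs from admissible maps for triples -/

section LocalDiffeomorphisms

variable {E E₁ E₂ : Type*} [NormedAddCommGroup E] [NormedSpace ℝ E] [FiniteDimensional ℝ E]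
  [NormedAddCommGroup E₁] [NormedSpace ℝ E₁] [NormedAddCommGroup E₂] [NormedSpace ℝ E₂]
  {H₁ H₂ : Type*} [TopologicalSpace H₁] [TopologicalSpace H₂]
  {I : ModelWithCorners ℝ E₁ H₁} {J : ModelWithCorners ℝ E₂ H₂}
  {M N : Type*} [TopologicalSpace M] [ChartedSpace H₁ M] [TopologicalSpace N] [ChartedSpace H₂ N]

/-- The inverse function theorem for maps between manifolds, in given charts. -/
lemma isLocalDiffeomorphAt_of_injective (Φ : PartialDiffeomorph I 𝓘(ℝ, E) M E ∞)
    (Θ : PartialDiffeomorph J 𝓘(ℝ, E) N E ∞) {f : M → N} {O : Set M} (hO : IsOpen O)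
    (hf : ContMDiffOn I J ∞ f O) {x : M} (hxO : x ∈ O) (hxΦ : x ∈ Φ.source)
    (hxΘ : f x ∈ Θ.source)
    (hinj : ∀ v : TangentSpace I x, mfderiv J 𝓘(ℝ, E) Θ (f x) (mfderiv I J f x v) = 0 → v = 0) :
    IsLocalDiffeomorphAt I J ∞ f x := by
  obtain ⟨a, ha, rfl⟩ : ∃ a ∈ Φ.target, Φ.symm a = x :=
    ⟨Φ x, Φ.map_source hxΦ, Φ.left_inv hxΦ⟩
  set O' : Set M := O ∩ f ⁻¹' Θ.source with hO'
  have hO'o : IsOpen O' := hf.continuousOn.isOpen_inter_preimage hO Θ.open_source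
  set Ω : Set E := Φ.target ∩ Φ.symm ⁻¹' O' with hΩ
  have hΩo : IsOpen Ω :=
    Φ.contMDiffOn_invFun.continuousOn.isOpen_inter_preimage Φ.open_target hO'o
  have haΩ : a ∈ Ω := ⟨ha, hxO, hxΘ⟩
  have hψ : ContDiffOn ℝ ∞ (Θ ∘ f ∘ Φ.symm) Ω := by
    refine ContMDiffOn.contDiffOn ?_
    exact Θ.contMDiffOn_toFun.comp
      (hf.comp (Φ.contMDiffOn_invFun.mono inter_subset_left) fun z hz => hz.2.1) fun z hz => hz.2.2
  have h1 : HasMFDerivAt 𝓘(ℝ, E) I Φ.symm a (mfderiv 𝓘(ℝ, E) I Φ.symm a) :=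
    (Φ.symm.mdifferentiableAt (by simp) ha).hasMFDerivAt
  have h2 : HasMFDerivAt I J f (Φ.symm a) (mfderiv I J f (Φ.symm a)) :=
    ((hf.contMDiffAt (hO.mem_nhds hxO)).mdifferentiableAt (by simp)).hasMFDerivAt
  have h3 : HasMFDerivAt J 𝓘(ℝ, E) Θ (f (Φ.symm a)) (mfderiv J 𝓘(ℝ, E) Θ (f (Φ.symm a))) :=
    (Θ.mdifferentiableAt (by simp) hxΘ).hasMFDerivAt
  have h4 : HasFDerivAt (Θ ∘ f ∘ Φ.symm) (fderiv ℝ (Θ ∘ f ∘ Φ.symm) a) a :=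
    ((hψ.contDiffAt (hΩo.mem_nhds haΩ)).differentiableAt (by simp)).hasFDerivAt
  have h5 := hasMFDerivAt_unique h4.hasMFDerivAt (h3.comp a (h2.comp a h1))
  have hψinj : Function.Injective (fderiv ℝ (Θ ∘ f ∘ Φ.symm) a).toLinearMap := by
    rw [← LinearMap.ker_eq_bot, LinearMap.ker_eq_bot']
    intro w hw
    have h6 : mfderiv 𝓘(ℝ, E) I Φ.symm a w = 0 :=
      hinj _ ((DFunLike.congr_fun h5 w).symm.trans hw)
    have h7 := Φ.symm.mfderiv_symm_comp ha w
    rw [h6] at h7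
    exact h7.symm.trans (map_zero _)
  set A : E ≃L[ℝ] E := (LinearEquiv.ofInjectiveEndo _ hψinj).toContinuousLinearEquiv with hA
  have h8 : HasFDerivAt (Θ ∘ f ∘ Φ.symm) (A : E →L[ℝ] E) a := h4.congr_fderiv (by ext1 v; rfl)
  obtain ⟨Ψ, hΨ, haΨ, hΨΩ, hΨi⟩ :=
    hψ.exists_openPartialHomeomorph (by simp) hΩo haΩ h8
  set Ψp : PartialDiffeomorph 𝓘(ℝ, E) 𝓘(ℝ, E) E E ∞ :=
    { toPartialEquiv := Ψ.toPartialEquiv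
      open_source := Ψ.open_source
      open_target := Ψ.open_target
      contMDiffOn_toFun := by
        refine ContDiffOn.contMDiffOn ?_
        change ContDiffOn ℝ ∞ Ψ Ψ.source
        rw [hΨ]
        exact hψ.mono hΨΩ
      contMDiffOn_invFun := hΨi.contMDiffOn } with hΨp
  have hΨa : ∀ z, Ψp z = Θ (f (Φ.symm z)) := fun z => congrFun hΨ z
  have hl : ∀ y ∈ Φ.source, Φ.symm (Φ y) = y := fun y hy => Φ.left_inv hy
  refine ⟨(Φ.trans Ψp).trans Θ.symm, ?_, fun y hy => ?_⟩
  · have hr : Φ (Φ.symm a) = a := Φ.right_inv ha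
    rw [PartialDiffeomorph.mem_trans_source, PartialDiffeomorph.mem_trans_source,
      PartialDiffeomorph.trans_apply, hr, hΨa]
    exact ⟨⟨Φ.map_target ha, haΨ⟩, Θ.map_source hxΘ⟩
  · rw [PartialDiffeomorph.mem_trans_source, PartialDiffeomorph.mem_trans_source] at hy
    have h9 := (hΨΩ hy.1.2).2.2
    rw [mem_preimage, hl y hy.1.1] at h9
    rw [PartialDiffeomorph.trans_apply, PartialDiffeomorph.trans_apply, hΨa, hl y hy.1.1]
    exact (Θ.left_inv h9).symm

/-- An injective local diffeomorphism on an open set is a diffeomorphism onto its image. -/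
lemma exists_partialDiffeomorph {f : M → N} (g : N → M) {W : Set M} (hW : IsOpen W)
    (hinj : InjOn f W) (hf : IsLocalDiffeomorphOn I J ∞ f W) :
    ∃ Ψ : PartialDiffeomorph I J M N ∞, ⇑Ψ = f ∧ Ψ.source = W := by
  classical
  set inv : N → M := fun p => if h : ∃ x ∈ W, f x = p then h.choose else g p with hinv
  have hinvf : ∀ x ∈ W, inv (f x) = x := fun x hx => by
    have h : ∃ x' ∈ W, f x' = f x := ⟨x, hx, rfl⟩
    rw [hinv]
    dsimp only
    rw [dif_pos h]
    exact hinj h.choose_spec.1 hx h.choose_spec.2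
  have hloc : ∀ x ∈ W, ∃ Φ : PartialDiffeomorph I J M N ∞, x ∈ Φ.source ∧ EqOn f Φ Φ.source :=
    fun x hx => hf ⟨x, hx⟩
  have hnhd : ∀ x ∈ W, ∀ Φ : PartialDiffeomorph I J M N ∞, x ∈ Φ.source → EqOn f Φ Φ.source →
      ∀ᶠ p in 𝓝 (f x), p ∈ Φ.target ∧ Φ.symm p ∈ W ∧ f (Φ.symm p) = p := by
    intro x hx Φ hxΦ hΦ
    have hfx : f x = Φ x := hΦ hxΦ
    have hmt : Φ x ∈ Φ.target := Φ.map_source hxΦ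
    have hc : ContinuousAt Φ.symm (Φ x) :=
      Φ.contMDiffOn_invFun.continuousOn.continuousAt (Φ.open_target.mem_nhds hmt)
    have hs : Φ.symm (Φ x) = x := Φ.left_inv hxΦ
    rw [hfx]
    filter_upwards [Φ.open_target.mem_nhds hmt, hc (hW.mem_nhds (by rwa [hs]))] with p hp hpW
    exact ⟨hp, hpW, (hΦ (Φ.map_target hp)).trans (Φ.right_inv hp)⟩
  refine ⟨{
    toFun := f
    invFun := inv
    source := W
    target := f '' W
    map_source' := fun x hx => ⟨x, hx, rfl⟩
    map_target' := by
      rintro _ ⟨x, hx, rfl⟩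
      rwa [hinvf x hx]
    left_inv' := hinvf
    right_inv' := by
      rintro _ ⟨x, hx, rfl⟩
      rw [hinvf x hx]
    open_source := hW
    open_target := by
      refine isOpen_iff_mem_nhds.2 ?_
      rintro _ ⟨x, hx, rfl⟩
      obtain ⟨Φ, hxΦ, hΦ⟩ := hloc x hx
      filter_upwards [hnhd x hx Φ hxΦ hΦ] with p hp using ⟨_, hp.2⟩
    contMDiffOn_toFun := fun x hx => by
      obtain ⟨Φ, hxΦ, hΦ⟩ := hloc x hx
      refine ((Φ.contMDiffOn_toFun.contMDiffAt
        (Φ.open_source.mem_nhds hxΦ)).congr_of_eventuallyEq ?_).contMDiffWithinAt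
      filter_upwards [Φ.open_source.mem_nhds hxΦ] with y hy using hΦ hy
    contMDiffOn_invFun := by
      rintro _ ⟨x, hx, rfl⟩
      obtain ⟨Φ, hxΦ, hΦ⟩ := hloc x hx
      have h0 := hnhd x hx Φ hxΦ hΦ
      refine ((Φ.contMDiffOn_invFun.contMDiffAt
        (Φ.open_target.mem_nhds h0.self_of_nhds.1)).congr_of_eventuallyEq ?_).contMDiffWithinAt
      filter_upwards [h0] with p hp
      have := hinvf _ hp.2.1
      rw [hp.2.2] at this
      exact this }, rfl, rfl⟩

end LocalDiffeomorphisms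

section AdmissiblePairs

variable {k : ℕ} {Y : Type*} [TopologicalSpace Y] [ChartedSpace (Cn k) Y]
  [IsManifold 𝓘(ℂ, Cn k) ω Y] [T2Space Y] [CompactSpace Y]
  {τ₃ : PartialDiffeomorph (𝓘(ℝ, Cn k).prod (𝓘(ℝ, Cn k).prod 𝓘(ℝ, Cn k)))
    (𝓘(ℝ, Cn k).prod 𝓘(ℝ, Cn k × Cn k)) (Y × (Y × Y))
    (TotalSpace (Cn k × Cn k) ((TangentSpace 𝓘(ℝ, Cn k) : Y → Type) ×ᵇ
      (TangentSpace 𝓘(ℝ, Cn k) : Y → Type))) ∞}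

/-- The map `(a, b) ↦ pr₁ (τ (a, b, a))`. -/
def pairMap (τ₃ : PartialDiffeomorph (𝓘(ℝ, Cn k).prod (𝓘(ℝ, Cn k).prod 𝓘(ℝ, Cn k)))
    (𝓘(ℝ, Cn k).prod 𝓘(ℝ, Cn k × Cn k)) (Y × (Y × Y))
    (TotalSpace (Cn k × Cn k) ((TangentSpace 𝓘(ℝ, Cn k) : Y → Type) ×ᵇ
      (TangentSpace 𝓘(ℝ, Cn k) : Y → Type))) ∞) (x : Y × Y) :
    TotalSpace (Cn k) (TangentSpace 𝓘(ℝ, Cn k) : Y → Type) :=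
  ⟨(τ₃ (x.1, (x.2, x.1))).1, (τ₃ (x.1, (x.2, x.1))).2.1⟩

lemma contMDiff_pairEmbedding : ContMDiff (𝓘(ℝ, Cn k).prod 𝓘(ℝ, Cn k))
    (𝓘(ℝ, Cn k).prod (𝓘(ℝ, Cn k).prod 𝓘(ℝ, Cn k))) ∞
    fun x : Y × Y => ((x.1, (x.2, x.1)) : Y × (Y × Y)) :=
  contMDiff_fst.prodMk (contMDiff_snd.prodMk contMDiff_fst)

lemma contMDiffOn_pairMap : ContMDiffOn (𝓘(ℝ, Cn k).prod 𝓘(ℝ, Cn k))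
    (𝓘(ℝ, Cn k).prod 𝓘(ℝ, Cn k)) ∞ (pairMap τ₃) {x | (x.1, (x.2, x.1)) ∈ τ₃.source} :=
  contMDiff_prod_totalSpace_fst.comp_contMDiffOn
    (τ₃.contMDiffOn_toFun.comp contMDiff_pairEmbedding.contMDiffOn fun _ hx => hx)

lemma isOpen_pairMap_source : IsOpen {x : Y × Y | (x.1, (x.2, x.1)) ∈ τ₃.source} :=
  τ₃.open_source.preimage (contMDiff_pairEmbedding (k := k)).continuous

variable (hτ₃ : IsAdmissible (Cn k × Cn k) (Z := (TangentSpace 𝓘(ℝ, Cn k) : Y → Type) ×ᵇ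
  (TangentSpace 𝓘(ℝ, Cn k) : Y → Type)) (fun y => (y, (y, y))) normalQuot₃ τ₃)
include hτ₃

lemma pairMap_diagonal (y : Y) : pairMap τ₃ (y, y) = ⟨y, 0⟩ := by
  rw [pairMap, show τ₃ (y, (y, y)) = _ from hτ₃.map_base y]
  rfl

/-- The differential of `pairMap` along the diagonal, in charts. -/
lemma exists_mfderiv_pairMap {e : OpenPartialHomeomorph Y (Cn k)}
    (he : e ∈ IsManifold.maximalAtlas 𝓘(ℂ, Cn k) ω Y) {y : Y} (hy : y ∈ e.source)
    (w : Cn k × Cn k) : ∃ u : Cn k,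
    chartDeriv (tangentChart (holChart e he)) (pairMap τ₃ (y, y))
        (mfderiv (𝓘(ℝ, Cn k).prod 𝓘(ℝ, Cn k)) (𝓘(ℝ, Cn k).prod 𝓘(ℝ, Cn k)) (pairMap τ₃) (y, y) w) =
      (chartDeriv (holChart e he) y u, chartDeriv (holChart e he) y (w.2 - w.1)) ∧
    (u = 0 → w.2 - w.1 = 0 → w = 0) := by
  set c := holChart e he with hc
  have hb := bundleChart_tangentChart₂ e he
  have hxs : ((y, (y, y)) : Y × (Y × Y)) ∈ τ₃.source := hτ₃.mem_source y
  have hmb : τ₃ (y, (y, y)) = ⟨y, 0⟩ := hτ₃.map_base y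
  obtain ⟨u, hu⟩ := hτ₃.deriv_normal y (w.1, (w.2, w.1))
  have hΘs : τ₃ (y, (y, y)) ∈ (tangentChart₂ c).source := by
    rw [hmb]
    exact hy
  have h1 : chartDeriv (tangentChart₂ c) (τ₃ (y, (y, y)))
      (mfderiv (𝓘(ℝ, Cn k).prod (𝓘(ℝ, Cn k).prod 𝓘(ℝ, Cn k))) (𝓘(ℝ, Cn k).prod 𝓘(ℝ, Cn k × Cn k))
        τ₃ (y, (y, y)) (w.1, (w.2, w.1))) =
      (chartDeriv c y u, (chartDeriv c y (w.2 - w.1), 0)) := by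
    have h2 : chartDeriv (tangentChart₂ c) (τ₃ (y, (y, y)))
      (mfderiv (𝓘(ℝ, Cn k).prod (𝓘(ℝ, Cn k).prod 𝓘(ℝ, Cn k))) (𝓘(ℝ, Cn k).prod 𝓘(ℝ, Cn k × Cn k))
        τ₃ (y, (y, y)) (w.1, (w.2, w.1))) = chartDeriv (tangentChart₂ c) (⟨y, 0⟩ :
          TotalSpace (Cn k × Cn k) ((TangentSpace 𝓘(ℝ, Cn k) : Y → Type) ×ᵇ
            (TangentSpace 𝓘(ℝ, Cn k) : Y → Type))) (horizontalVector 𝓘(ℝ, Cn k) (Cn k × Cn k)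
              (Z := (TangentSpace 𝓘(ℝ, Cn k) : Y → Type) ×ᵇ
                (TangentSpace 𝓘(ℝ, Cn k) : Y → Type)) y u +
            verticalVector 𝓘(ℝ, Cn k) (Cn k × Cn k) (Z := (TangentSpace 𝓘(ℝ, Cn k) : Y → Type) ×ᵇ
                (TangentSpace 𝓘(ℝ, Cn k) : Y → Type)) y (normalQuot₃ y (w.1, (w.2, w.1)))) := by
      rw [hmb]
      exact congrArg _ hu
    refine h2.trans ((map_add _ _ _).trans ((congrArg₂ (· + ·)
      (hb.chartDeriv_horizontalVector hy u) (hb.chartDeriv_verticalVector hy _)).trans ?_))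
    refine Prod.ext (add_zero _) (Prod.ext (zero_add _) ?_)
    refine (zero_add _).trans ?_
    change chartDeriv c y (w.1 - w.1) = 0
    rw [sub_self, map_zero]
  refine ⟨u, ?_, fun hu0 hw0 => ?_⟩
  · set dup : Y × Y → Y × (Y × Y) := fun x => (x.1, (x.2, x.1)) with hdup
    have d1 : HasMFDerivAt (𝓘(ℝ, Cn k).prod 𝓘(ℝ, Cn k))
        (𝓘(ℝ, Cn k).prod (𝓘(ℝ, Cn k).prod 𝓘(ℝ, Cn k))) dup (y, y)
        ((ContinuousLinearMap.fst ℝ (Cn k) (Cn k)).prod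
          ((ContinuousLinearMap.snd ℝ (Cn k) (Cn k)).prod
            (ContinuousLinearMap.fst ℝ (Cn k) (Cn k)))) :=
      (hasMFDerivAt_fst _).prodMk ((hasMFDerivAt_snd _).prodMk (hasMFDerivAt_fst _))
    have d2 : HasMFDerivAt (𝓘(ℝ, Cn k).prod (𝓘(ℝ, Cn k).prod 𝓘(ℝ, Cn k)))
        (𝓘(ℝ, Cn k).prod 𝓘(ℝ, Cn k × Cn k)) τ₃ (dup (y, y))
        (mfderiv (𝓘(ℝ, Cn k).prod (𝓘(ℝ, Cn k).prod 𝓘(ℝ, Cn k)))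
          (𝓘(ℝ, Cn k).prod 𝓘(ℝ, Cn k × Cn k)) τ₃ (y, (y, y))) :=
      (τ₃.mdifferentiableAt (by simp) hxs).hasMFDerivAt
    have d12 := d2.comp (y, y) d1
    have d3 : HasMFDerivAt (𝓘(ℝ, Cn k).prod 𝓘(ℝ, Cn k × Cn k)) 𝓘(ℝ, Cn k × (Cn k × Cn k))
        (tangentChart₂ c) ((τ₃ ∘ dup) (y, y)) (chartDeriv (tangentChart₂ c) (τ₃ (y, (y, y)))) :=
      ((tangentChart₂ c).mdifferentiableAt (by simp) hΘs).hasMFDerivAt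
    set P : Cn k × (Cn k × Cn k) →L[ℝ] Cn k × Cn k :=
      (ContinuousLinearMap.fst ℝ (Cn k) (Cn k × Cn k)).prod
        ((ContinuousLinearMap.fst ℝ (Cn k) (Cn k)).comp
          (ContinuousLinearMap.snd ℝ (Cn k) (Cn k × Cn k))) with hP
    have d4 : HasMFDerivAt 𝓘(ℝ, Cn k × (Cn k × Cn k)) 𝓘(ℝ, Cn k × Cn k) P
        ((tangentChart₂ c ∘ τ₃ ∘ dup) (y, y)) P := P.hasFDerivAt.hasMFDerivAt
    have d5 := d4.comp (y, y) (d3.comp (y, y) d12)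
    have hps : pairMap τ₃ (y, y) ∈ (tangentChart c).source := by
      rw [pairMap_diagonal hτ₃]
      exact hy
    have d6 : HasMFDerivAt (𝓘(ℝ, Cn k).prod 𝓘(ℝ, Cn k)) 𝓘(ℝ, Cn k × Cn k) (tangentChart c)
        (pairMap τ₃ (y, y)) (chartDeriv (tangentChart c) (pairMap τ₃ (y, y))) :=
      ((tangentChart c).mdifferentiableAt (by simp) hps).hasMFDerivAt
    have d7 := (((contMDiffOn_pairMap (τ₃ := τ₃)).contMDiffAt
      (isOpen_pairMap_source.mem_nhds (show (y, y) ∈ _ from hxs))).mdifferentiableAt (by simp)).hasMFDerivAt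
    have h2 := DFunLike.congr_fun (hasMFDerivAt_unique (d6.comp (y, y) d7) d5) w
    refine h2.trans ?_
    exact congrArg P h1
  · rw [hu0, hw0, map_zero] at h1
    have h2 := (tangentChart₂ c).mfderiv_symm_comp hΘs
      (mfderiv (𝓘(ℝ, Cn k).prod (𝓘(ℝ, Cn k).prod 𝓘(ℝ, Cn k))) (𝓘(ℝ, Cn k).prod 𝓘(ℝ, Cn k × Cn k))
        τ₃ (y, (y, y)) (w.1, (w.2, w.1)))
    have h3 := τ₃.mfderiv_symm_comp hxs (w.1, (w.2, w.1))
    have h4 : mfderiv (𝓘(ℝ, Cn k).prod (𝓘(ℝ, Cn k).prod 𝓘(ℝ, Cn k)))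
        (𝓘(ℝ, Cn k).prod 𝓘(ℝ, Cn k × Cn k)) τ₃ (y, (y, y)) (w.1, (w.2, w.1)) = 0 := by
      refine h2.symm.trans ?_
      refine (congrArg _ (h1 : _ = (0 : Cn k × (Cn k × Cn k)))).trans (map_zero _)
    have h5 : ((w.1, (w.2, w.1)) : Cn k × (Cn k × Cn k)) = 0 := by
      refine h3.symm.trans ?_
      exact (congrArg _ h4).trans (map_zero _)
    exact Prod.ext (congrArg (fun z => z.1) h5) (congrArg (fun z => z.2.1) h5)

/-- An admissible map for triples induces one for pairs. -/
theorem exists_isAdmissible_pair : ∃ τ₂ : PartialDiffeomorph (𝓘(ℝ, Cn k).prod 𝓘(ℝ, Cn k))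
    (𝓘(ℝ, Cn k).prod 𝓘(ℝ, Cn k)) (Y × Y)
    (TotalSpace (Cn k) (TangentSpace 𝓘(ℝ, Cn k) : Y → Type)) ∞,
    IsAdmissible (Cn k) (Z := (TangentSpace 𝓘(ℝ, Cn k) : Y → Type)) (fun y => (y, y))
      normalQuot₂ τ₂ := by
  have hinjD : ∀ (e : OpenPartialHomeomorph Y (Cn k)), ∀ y ∈ e.source, ∀ (he : e ∈
      IsManifold.maximalAtlas 𝓘(ℂ, Cn k) ω Y) (u : Cn k),
      chartDeriv (holChart e he) y u = 0 → u = 0 := fun e y hy he u hu => by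
    refine ((holChart e he).mfderiv_symm_comp hy u).symm.trans ?_
    exact (congrArg _ hu).trans (map_zero _)
  have hloc : ∀ y, IsLocalDiffeomorphAt (𝓘(ℝ, Cn k).prod 𝓘(ℝ, Cn k)) (𝓘(ℝ, Cn k).prod 𝓘(ℝ, Cn k))
      ∞ (pairMap τ₃) (y, y) := by
    intro y
    obtain ⟨e, he, hy⟩ := exists_holChart (k := k) y
    refine isLocalDiffeomorphAt_of_injective (prodChart (holChart e he) (holChart e he) 0)
      (tangentChart (holChart e he)) isOpen_pairMap_source contMDiffOn_pairMap
      (hτ₃.mem_source y) ⟨hy, hy⟩ ?_ fun w hw => ?_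
    · rw [pairMap_diagonal hτ₃]
      exact hy
    · obtain ⟨u, h1, h2⟩ := exists_mfderiv_pairMap hτ₃ he hy w
      have h3 : ((chartDeriv (holChart e he) y u,
        chartDeriv (holChart e he) y (w.2 - w.1)) : Cn k × Cn k) = 0 := h1.symm.trans hw
      exact h2 (hinjD e y hy he _ (congrArg Prod.fst h3)) (hinjD e y hy he _ (congrArg Prod.snd h3))
  set D : Set (Y × Y) := range fun y => (y, y) with hD
  have hDc : IsCompact D := isCompact_range (by fun_prop)
  have hDinj : InjOn (pairMap τ₃) D := by
    rintro _ ⟨y, rfl⟩ _ ⟨y', rfl⟩ h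
    rw [pairMap_diagonal hτ₃, pairMap_diagonal hτ₃] at h
    have : y = y' := congrArg TotalSpace.proj h
    rw [this]
  obtain ⟨U, hUo, hDU, hUinj⟩ := hDinj.exists_isOpen_superset hDc
    (by
      rintro _ ⟨y, rfl⟩
      exact (hloc y).contMDiffAt.continuousAt)
    (by
      rintro _ ⟨y, rfl⟩
      obtain ⟨Φ, hyΦ, hΦ⟩ := hloc y
      exact ⟨Φ.source, Φ.open_source.mem_nhds hyΦ, Φ.injOn.congr hΦ.symm⟩)
  choose Φ hyΦ hΦ using hloc
  set W : Set (Y × Y) := U ∩ ⋃ y, (Φ y).source with hWd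
  have hWo : IsOpen W := hUo.inter (isOpen_iUnion fun y => (Φ y).open_source)
  have hmW : ∀ y, (y, y) ∈ W := fun y => ⟨hDU ⟨y, rfl⟩, mem_iUnion.2 ⟨y, hyΦ y⟩⟩
  obtain ⟨τ₂, hτ₂, hτ₂s⟩ := exists_partialDiffeomorph (I := 𝓘(ℝ, Cn k).prod 𝓘(ℝ, Cn k))
    (J := 𝓘(ℝ, Cn k).prod 𝓘(ℝ, Cn k)) (f := pairMap τ₃) (fun p => (p.proj, p.proj)) hWo
    (hUinj.mono inter_subset_left) (by
      rintro ⟨x, hx⟩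
      obtain ⟨y, hxy⟩ := mem_iUnion.1 hx.2
      exact ⟨Φ y, hxy, hΦ y⟩)
  refine ⟨τ₂, fun y => ?_, fun y => ?_, fun y w => ?_⟩
  · rw [hτ₂s]
    exact hmW y
  · rw [hτ₂]
    exact pairMap_diagonal hτ₃ y
  · obtain ⟨e, he, hy⟩ := exists_holChart (k := k) y
    obtain ⟨u, h1, -⟩ := exists_mfderiv_pairMap hτ₃ he hy w
    refine ⟨u, ?_⟩
    have hb := bundleChart_tangentChart e he
    have hs : (⟨y, 0⟩ : TotalSpace (Cn k) (TangentSpace 𝓘(ℝ, Cn k) : Y → Type)) ∈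
      (tangentChart (holChart e he)).source := hy
    rw [pairMap_diagonal hτ₃] at h1
    have h2 : chartDeriv (tangentChart (holChart e he))
        (⟨y, 0⟩ : TotalSpace (Cn k) (TangentSpace 𝓘(ℝ, Cn k) : Y → Type))
        (horizontalVector 𝓘(ℝ, Cn k) (Cn k) (Z := (TangentSpace 𝓘(ℝ, Cn k) : Y → Type)) y u +
          verticalVector 𝓘(ℝ, Cn k) (Cn k) y (normalQuot₂ y w)) =
        (chartDeriv (holChart e he) y u, chartDeriv (holChart e he) y (w.2 - w.1)) := by
      exact (map_add _ _ _).trans ((congrArg₂ (· + ·) (hb.chartDeriv_horizontalVector hy u)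
        (hb.chartDeriv_verticalVector hy _)).trans (Prod.ext (add_zero _) (zero_add _)))
    have h3 := h1.trans h2.symm
    rw [hτ₂]
    exact ((tangentChart (holChart e he)).mfderiv_symm_comp hs _).symm.trans
      ((congrArg _ h3).trans ((tangentChart (holChart e he)).mfderiv_symm_comp hs _))

end AdmissiblePairs

/-! ## The main theorem -/

lemma Current.eq_zero_of_eval {E : Type*} [NormedAddCommGroup E] [NormedSpace ℝ E]
    {H : Type*} [TopologicalSpace H] {I : ModelWithCorners ℝ E H}
    {X : Type*} [TopologicalSpace X] [ChartedSpace H X] {n : ℕ} {R : Current I X n}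
    (h : ∀ φ ∈ testForms I X n, R.eval φ = 0) : R = 0 := by
  obtain ⟨L, hL⟩ := R
  have h0 : L = 0 := by
    ext φ
    have := h φ.1 φ.2
    rwa [Current.eval, dif_pos φ.2] at this
  subst h0
  rfl

/-- Sequences in `ℂ^*` that tend to infinity have subsequences with convergent arguments. -/
lemma exists_subseq_tendsto_div_norm {c : ℕ → ℂ} (hc0 : ∀ i, c i ≠ 0) :
    ∃ (φ : ℕ → ℕ) (ξ : ℂ), StrictMono φ ∧ ξ ≠ 0 ∧
      Tendsto (fun i => c (φ i) / ‖c (φ i)‖) atTop (𝓝 ξ) := by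
  obtain ⟨ξ, hξ, φ, hφ, hlim⟩ := (isCompact_sphere (0 : ℂ) 1).tendsto_subseq
    (x := fun i => c i / ‖c i‖) fun i => by simp [hc0 i]
  exact ⟨φ, ξ, hφ, fun h => by simp [h] at hξ, hlim⟩

end

theorem mainTheorem5 (k : ℕ) (Y : Type*) [TopologicalSpace Y] [ChartedSpace (Cn k) Y]
    [IsManifold 𝓘(ℂ, Cn k) ω Y] [T2Space Y] [CompactSpace Y] (hY : IsKahler k Y)
    (q : ℕ) (T : Current 𝓘(ℝ, Cn k) Y (2 * q)) (hTpos : T.IsPositive) (hTclosed : T.IsClosed)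
    (ℓ₁ ℓ₂ : ℕ) (V₁ V₂ : Set Y)
    (hV₁ : IsComplexSubmanifold k V₁ ℓ₁) (hV₂ : IsComplexSubmanifold k V₂ ℓ₂)
    (htrans : Transverse k V₁ ℓ₁ V₂ ℓ₂)
    (hzero : DSProductEqZero₃ T.eval (integrationCurrent hV₁) (integrationCurrent hV₂)) :
    ∃ hV : IsComplexSubmanifold k (V₁ ∩ V₂) (ℓ₁ + ℓ₂ - k),
      DSProductEqZero₂ T.eval (integrationCurrent hV) := by
  have hV := isComplexSubmanifold_inter hV₁ hV₂ htrans
  obtain ⟨τ₃, hτ₃, c₀, hc₀, hc₀', hlim₀⟩ := (hzero 0).2 rfl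
  refine ⟨hV, fun R => ⟨?_, ?_⟩⟩
  · rintro ⟨τ₂, hτ₂, c, hc, hc', hlim⟩
    obtain ⟨φ, ξ, hφ, hξ0, hξ⟩ := exists_subseq_tendsto_div_norm hc
    have hcφ := hc'.comp hφ.tendsto_atTop
    have hlimφ := fun Φ hΦ => (hlim Φ hΦ).comp hφ.tendsto_atTop
    obtain ⟨R₃, hR₃⟩ := exists_tendsto_triple (c := c ∘ φ) hV₁ hV₂ htrans hV hτ₂ hτ₃ hcφ hξ hξ0
      R hlimφ
    have hR₃0 : R₃ = 0 := (hzero R₃).1 ⟨τ₃, hτ₃, c ∘ φ, fun i => hc _, hcφ, hR₃⟩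
    obtain ⟨R₂, hR₂, hR₂0⟩ := exists_tendsto_pair (c := c ∘ φ) hV₁ hV₂ htrans hV hτ₂ hτ₃ hcφ hξ
      hξ0 R₃ hR₃
    refine Current.eq_zero_of_eval fun Φ hΦ => ?_
    rw [tendsto_nhds_unique (hlimφ Φ hΦ) (hR₂ Φ hΦ), hR₂0 hR₃0]
    exact Current.eval_zero_current _
  · rintro rfl
    obtain ⟨τ₂, hτ₂⟩ := exists_isAdmissible_pair hτ₃
    obtain ⟨φ, ξ, hφ, hξ0, hξ⟩ := exists_subseq_tendsto_div_norm hc₀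
    have hcφ := hc₀'.comp hφ.tendsto_atTop
    obtain ⟨R₂, hR₂, hR₂0⟩ := exists_tendsto_pair (c := c₀ ∘ φ) hV₁ hV₂ htrans hV hτ₂ hτ₃ hcφ hξ
      hξ0 0 fun Φ hΦ => (hlim₀ Φ hΦ).comp hφ.tendsto_atTop
    rw [← hR₂0 rfl]
    exact ⟨τ₂, hτ₂, c₀ ∘ φ, fun i => hc₀ _, hcφ, hR₂⟩
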